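/- Let $\mathbb K$ be a field of characteristic zero and let $(\wedge V,d)$ be a Sullivan algebra over $\mathbb K$ with $\dim V<\infty$ and $V^1=0$. Fix a homogeneous basis $x_1,\dots,x_p,y_1,\dots,y_q$ of $V$ with all $|x_i|$ even and all $|y_j|$ odd. Let $\overline V^{\,n}=V^{n+1}$, with corresponding basis $\bar x_i,\bar y_j$. Let $I_V\subset\wedge V$ be the ideal generated by $x_1,\dots,x_p$, let $\bar I_V\subset\wedge V\otimes\wedge V\otimes\wedge\overline V$ be the ideal generated by all $x_k\otimes1\otimes 1$, $1\otimes x_k\otimes 1$, $\bar x_k$, and let $\bar I_{V,i}$ be the ideal generated by all $x_k\otimes1\otimes 1$, $1\otimes x_k\otimes 1$ and by the $\bar x_k$ with $k\neq i$. Assume that $(\wedge V,d)$ is semi-pure, i.e. $d(I_V)\subset I_V$. Let $\mu\colon(\wedge V,d)^{\otimes2}\to(\wedge V,d)$ be the multiplication, and let $m\colon(\wedge V^{\otimes2}\otimes\wedge\overline V,D)\xrightarrow{\simeq}(\wedge V,d)$ be a relative Sullivan model of $\mu$ (a quasi-isomorphism from a relative Sullivan algebra with base $(\wedge V,d)^{\otimes2}$,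 restricting to $\mu$ on the base) which is nice, i.e. (a) $D(\bar I_V)\subset\bar I_V$; (b) $D\bar x_i\in\bar I_{V,i}$ for $1\le i\le p$; (c) $m$ induces maps $(\bar I_V,D)\to(I_V,d)$ and $((\wedge V^{\otimes2}\otimes\wedge\overline V)/\bar I_V,D)\to(\wedge V/I_V,d)$, and both are quasi-isomorphisms. Let $J\subset\wedge V^{\otimes2}$ be the ideal generated by the elements $y_j\otimes y_j$, $1\le j\le q$. Say that a homogeneous element $f$ of the complex $\mathrm{Hom}_{\wedge V^{\otimes2}}(\wedge V^{\otimes2}\otimes\wedge\overline V,\wedge V^{\otimes2})$ satisfies $(\ast)$ if there is $u\in J$ with $$f(\bar x_1\cdots\bar x_p)=\pm\prod_{j=1}^q(1\otimes y_j-y_j\otimes1)+u .$$ Then: 1. There is a cocycle $f$ satisfying $(\ast)$. 2. If $f$ is any cocycle satisfying $(\ast)$, of degree $n$ say, then its class $[f]$ in $H^n(\mathrm{Hom}_{\wedge V^{\otimes2}}(\wedge V^{\otimes2}\otimes\wedge\overline V,\wedge V^{\otimes2}))=\mathrm{Ext}^n_{\wedge V^{\otimes2}}(\wedge V,\wedge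 V^{\otimes2})$ is non-zero. In particular $f$ represents the shriek map $\Delta_!$: $(\wedge V,d)$ is a Gorenstein algebra of dimension $n$ (that is, $\mathrm{Ext}^l_{\wedge V}(\mathbb K,\wedge V)$ has dimension $1$ for $l=n$ and is $0$ for $l\ne n$), the space $\mathrm{Ext}^n_{\wedge V^{\otimes2}}(\wedge V,\wedge V^{\otimes2})$ is one-dimensional, and $[f]$ is a generator of it. -/

import Mathlib

noncomputable section

namespace ShriekMap

/-! ### Signs, complexes, cohomology -/

section Complexes

variable (K : Type*) [Field K]

/-- The sign `(-1)^n`, as a scalar of `K`. -/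
def sgn (n : ℤ) : K := (((n.negOnePow : ℤˣ) : ℤ) : K)

lemma sgn_add (m n : ℤ) : sgn K (m + n) = sgn K m * sgn K n := by
  simp [sgn, Int.negOnePow_add]

lemma sgn_zero : sgn K 0 = 1 := by simp [sgn]

lemma sgn_even {n : ℤ} (h : Even n) : sgn K n = 1 := by
  simp [sgn, Int.negOnePow_even n h]

lemma sgn_odd {n : ℤ} (h : Odd n) : sgn K n = -1 := by
  simp [sgn, Int.negOnePow_odd n h]

variable {K}
variable {A A' : Type*} [AddCommGroup A] [Module K A] [AddCommGroup A'] [Module K A']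

/-- The quotient `Z / B` for submodules `B ⊆ Z` of a module. -/
def SubQuotient (Z B : Submodule K A) : Type _ := Z ⧸ B.submoduleOf Z

instance (Z B : Submodule K A) : AddCommGroup (SubQuotient Z B) :=
  inferInstanceAs (AddCommGroup (Z ⧸ B.submoduleOf Z))

instance (Z B : Submodule K A) : Module K (SubQuotient Z B) :=
  inferInstanceAs (Module K (Z ⧸ B.submoduleOf Z))

/-- The projection `Z → Z / B`. -/
def SubQuotient.mk (Z B : Submodule K A) : Z →ₗ[K] SubQuotient Z B :=
  (B.submoduleOf Z).mkQ

/-- The (total) cohomology `ker d / im d` of a module with a differential. -/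
abbrev Cohomology (d : A →ₗ[K] A) : Type _ :=
  LinearMap.ker d ⧸ (LinearMap.range d).submoduleOf (LinearMap.ker d)

/-- The map induced in cohomology by a map commuting with the differentials. -/
def cohomologyMap {d : A →ₗ[K] A} {d' : A' →ₗ[K] A'} (φ : A →ₗ[K] A')
    (h : ∀ x, φ (d x) = d' (φ x)) : Cohomology d →ₗ[K] Cohomology d' :=
  Submodule.mapQ _ _
    (φ.restrict (p := LinearMap.ker d) (q := LinearMap.ker d') (by
      intro x hx
      rw [LinearMap.mem_ker] at hx ⊢
      rw [← h, hx, map_zero]))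
    (by
      rintro ⟨x, hx⟩ ⟨y, hy⟩
      exact ⟨φ y, by rw [← h, hy]; rfl⟩)

/-- `φ : (A, d) → (A', d')` commutes with the differentials and is an isomorphism in cohomology. -/
def IsQuasiIso (d : A →ₗ[K] A) (d' : A' →ₗ[K] A') (φ : A →ₗ[K] A') : Prop :=
  ∃ h : ∀ x, φ (d x) = d' (φ x), Function.Bijective (cohomologyMap φ h)

end Complexes

/-! ### Free graded commutative algebras -/

/-- The relations `a b = (-1)^{|a||b|} b a` between generators. In characteristic zero they imply
`a ^ 2 = 0` for generators of odd degree. -/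
inductive FreeCGA.Rel (K : Type*) [Field K] {ι : Type*} (deg : ι → ℤ) :
    FreeAlgebra K ι → FreeAlgebra K ι → Prop
  | swap (i j : ι) : FreeCGA.Rel K deg (FreeAlgebra.ι K i * FreeAlgebra.ι K j)
      (sgn K (deg i * deg j) • (FreeAlgebra.ι K j * FreeAlgebra.ι K i))

/-- The free graded commutative algebra `∧V` over a field of characteristic zero, where `V` is the
graded vector space with homogeneous basis `ι`, the basis element `i` having degree `deg i`.
We identify `∧(V ⊕ W)` with `∧V ⊗ ∧W`, so the tensor product of the algebras on `ι` and on `κ` is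
the algebra on `ι ⊕ κ`. -/
def FreeCGA (K : Type*) [Field K] {ι : Type*} (deg : ι → ℤ) : Type _ :=
  RingQuot (FreeCGA.Rel K deg)

namespace FreeCGA

variable {K : Type*} [Field K] {ι κ : Type*}

instance (deg : ι → ℤ) : Ring (FreeCGA K deg) :=
  inferInstanceAs (Ring (RingQuot (FreeCGA.Rel K deg)))

instance (deg : ι → ℤ) : Algebra K (FreeCGA K deg) :=
  inferInstanceAs (Algebra K (RingQuot (FreeCGA.Rel K deg)))

variable (K) in
/-- The generator of `∧V` given by the basis element `i` of `V`. -/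
def gen (deg : ι → ℤ) (i : ι) : FreeCGA K deg :=
  RingQuot.mkAlgHom K (FreeCGA.Rel K deg) (FreeAlgebra.ι K i)

lemma gen_mul_gen (deg : ι → ℤ) (i j : ι) :
    gen K deg i * gen K deg j = sgn K (deg i * deg j) • (gen K deg j * gen K deg i) := by
  have h := RingQuot.mkAlgHom_rel K (Rel.swap (K := K) (deg := deg) i j)
  simp only [map_mul, map_smul] at h
  exact h

/-- The algebra homomorphism out of `∧V` with given values on the basis of `V`. -/
def lift (deg : ι → ℤ) {R : Type*} [Ring R] [Algebra K R] (g : ι → R)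
    (hg : ∀ i j, g i * g j = sgn K (deg i * deg j) • (g j * g i)) : FreeCGA K deg →ₐ[K] R :=
  RingQuot.liftAlgHom K ⟨FreeAlgebra.lift K g, by
    rintro _ _ ⟨i, j⟩
    simpa using hg i j⟩

lemma lift_gen (deg : ι → ℤ) {R : Type*} [Ring R] [Algebra K R] (g : ι → R)
    (hg : ∀ i j, g i * g j = sgn K (deg i * deg j) • (g j * g i)) (i : ι) :
    lift deg g hg (gen K deg i) = g i := by
  unfold lift gen
  erw [RingQuot.liftAlgHom_mkAlgHom_apply]
  simp

lemma induction {deg : ι → ℤ} {P : FreeCGA K deg → Prop}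
    (h0 : ∀ c : K, P (algebraMap K _ c)) (h1 : ∀ i, P (gen K deg i))
    (hm : ∀ x y, P x → P y → P (x * y)) (ha : ∀ x y, P x → P y → P (x + y)) (x) : P x := by
  obtain ⟨x, rfl⟩ := RingQuot.mkAlgHom_surjective K (Rel K deg) x
  induction x using FreeAlgebra.induction with
  | grade0 c => rw [AlgHom.commutes]; exact h0 c
  | grade1 i => exact h1 i
  | mul a b ha' hb' => rw [map_mul]; exact hm _ _ ha' hb'
  | add a b ha' hb' => rw [map_add]; exact ha _ _ ha' hb'

variable (K) in
/-- The homogeneous part `(∧V)^n`, spanned by the products of generators of total degree `n`. -/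
def part (deg : ι → ℤ) (n : ℤ) : Submodule K (FreeCGA K deg) :=
  Submodule.span K {x | ∃ l : List ι, (l.map deg).sum = n ∧ x = (l.map (gen K deg)).prod}

variable (K) in
/-- The subspace `V` of `∧V`. -/
def gens (deg : ι → ℤ) : Submodule K (FreeCGA K deg) :=
  Submodule.span K (Set.range (gen K deg))

lemma prod_mem_part (deg : ι → ℤ) (l : List ι) :
    (l.map (gen K deg)).prod ∈ part K deg (l.map deg).sum :=
  Submodule.subset_span ⟨l, rfl, rfl⟩

lemma gen_mem_part (deg : ι → ℤ) (i : ι) : gen K deg i ∈ part K deg (deg i) := by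
  simpa using prod_mem_part (K := K) deg [i]

lemma one_mem_part (deg : ι → ℤ) : (1 : FreeCGA K deg) ∈ part K deg 0 := by
  simpa using prod_mem_part (K := K) deg []

lemma mul_mem_part {deg : ι → ℤ} {m n : ℤ} {x y : FreeCGA K deg}
    (hx : x ∈ part K deg m) (hy : y ∈ part K deg n) : x * y ∈ part K deg (m + n) := by
  unfold part at hx
  induction hx using Submodule.span_induction with
  | mem x h =>
    obtain ⟨l, rfl, rfl⟩ := h
    unfold part at hy
    induction hy using Submodule.span_induction with
    | mem y h =>
      obtain ⟨l', rfl, rfl⟩ := h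
      simpa using prod_mem_part (K := K) deg (l ++ l')
    | zero => simp
    | add a b _ _ ha hb => rw [mul_add]; exact add_mem ha hb
    | smul c a _ ha => rw [mul_smul_comm]; exact Submodule.smul_mem _ _ ha
  | zero => simp
  | add a b _ _ ha hb => rw [add_mul]; exact add_mem ha hb
  | smul c a _ ha => rw [smul_mul_assoc]; exact Submodule.smul_mem _ _ ha

/-- A generator commutes, up to the Koszul sign, with every homogeneous element. -/
lemma gen_mul {deg : ι → ℤ} (i : ι) {n : ℤ} {x : FreeCGA K deg} (hx : x ∈ part K deg n) :
    gen K deg i * x = sgn K (deg i * n) • (x * gen K deg i) := by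
  unfold part at hx
  induction hx using Submodule.span_induction with
  | mem x h =>
    obtain ⟨l, rfl, rfl⟩ := h
    induction l with
    | nil => simp [sgn_zero]
    | cons j l ih =>
      simp only [List.map_cons, List.prod_cons, List.sum_cons]
      rw [← mul_assoc, gen_mul_gen, smul_mul_assoc, mul_assoc, ih, mul_smul_comm, smul_smul,
        mul_add, sgn_add, mul_assoc]
  | zero => simp
  | add a b _ _ ha hb => rw [mul_add, ha, hb, add_mul, smul_add]
  | smul c a _ ha => rw [mul_smul_comm, ha, smul_mul_assoc, smul_comm]

/-- Two homogeneous elements commute up to the Koszul sign. -/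
lemma graded_comm {deg : ι → ℤ} {m n : ℤ} {x y : FreeCGA K deg} (hx : x ∈ part K deg m)
    (hy : y ∈ part K deg n) : x * y = sgn K (m * n) • (y * x) := by
  unfold part at hx
  induction hx using Submodule.span_induction with
  | mem x h =>
    obtain ⟨l, rfl, rfl⟩ := h
    induction l with
    | nil => simp [sgn_zero]
    | cons j l ih =>
      simp only [List.map_cons, List.prod_cons, List.sum_cons]
      rw [mul_assoc, ih, mul_smul_comm, ← mul_assoc, gen_mul j hy, smul_mul_assoc, smul_smul,
        mul_assoc, add_mul, sgn_add, mul_comm (sgn K _)]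
  | zero => simp
  | add a b _ _ ha hb => rw [add_mul, ha, hb, mul_add, smul_add]
  | smul c a _ ha => rw [smul_mul_assoc, ha, mul_smul_comm, smul_comm]

/-- The algebra map `∧V → ∧W` induced by a degree preserving map between the bases. -/
def map {deg : ι → ℤ} {deg' : κ → ℤ} (e : ι → κ) (he : ∀ i, deg' (e i) = deg i) :
    FreeCGA K deg →ₐ[K] FreeCGA K deg' :=
  lift deg (fun i => gen K deg' (e i)) (fun i j => by rw [gen_mul_gen, he, he])

lemma map_gen {deg : ι → ℤ} {deg' : κ → ℤ} (e : ι → κ) (he : ∀ i, deg' (e i) = deg i) (i : ι) :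
    map (K := K) e he (gen K deg i) = gen K deg' (e i) := lift_gen _ _ _ _

lemma map_mem_part {deg : ι → ℤ} {deg' : κ → ℤ} (e : ι → κ) (he : ∀ i, deg' (e i) = deg i)
    {n : ℤ} {x : FreeCGA K deg} (hx : x ∈ part K deg n) : map e he x ∈ part K deg' n := by
  unfold part at hx
  induction hx using Submodule.span_induction with
  | mem x h =>
    obtain ⟨l, rfl, rfl⟩ := h
    have h := prod_mem_part (K := K) deg' (l.map e)
    have h1 : ((l.map e).map deg').sum = (l.map deg).sum := by
      congr 1; simp [Function.comp_def, he]
    have h2 : map e he ((l.map (gen K deg)).prod) = ((l.map e).map (gen K deg')).prod := by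
      rw [map_list_prod]; simp [Function.comp_def, map_gen]
    rw [h1] at h
    rwa [h2]
  | zero => simp
  | add a b _ _ ha hb => rw [map_add]; exact add_mem ha hb
  | smul c a _ ha => rw [map_smul]; exact Submodule.smul_mem _ _ ha

/-- The inclusion `∧V → ∧V ⊗ ∧W`, `a ↦ a ⊗ 1`. -/
def inl (deg : ι → ℤ) (deg' : κ → ℤ) :
    FreeCGA K deg →ₐ[K] FreeCGA K (Sum.elim deg deg') :=
  map Sum.inl (Sum.elim_inl deg deg')

/-- The inclusion `∧W → ∧V ⊗ ∧W`, `a ↦ 1 ⊗ a`. -/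
def inr (deg : ι → ℤ) (deg' : κ → ℤ) :
    FreeCGA K deg' →ₐ[K] FreeCGA K (Sum.elim deg deg') :=
  map Sum.inr (Sum.elim_inr deg deg')

variable (K) in
/-- The multiplication `∧V ⊗ ∧V → ∧V`. -/
def mult (deg : ι → ℤ) : FreeCGA K (Sum.elim deg deg) →ₐ[K] FreeCGA K deg :=
  map (Sum.elim id id) (by rintro (i | i) <;> rfl)

variable (K) in
/-- The augmentation `∧V → K`, which sends `V` to zero. -/
def aug (deg : ι → ℤ) : FreeCGA K deg →ₐ[K] K :=
  lift deg (fun _ => 0) (by simp)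

/-! #### Derivations -/

variable (K) in
/-- The automorphism of `∧V` that multiplies homogeneous elements of degree `n` by `(-1)^n`. -/
def signAut (deg : ι → ℤ) : FreeCGA K deg →ₐ[K] FreeCGA K deg :=
  lift deg (fun i => sgn K (deg i) • gen K deg i) (fun i j => by
    simp only [smul_mul_smul_comm]
    rw [gen_mul_gen, smul_comm, mul_comm (sgn K (deg i)) (sgn K (deg j))])

lemma signAut_part {deg : ι → ℤ} {n : ℤ} {x : FreeCGA K deg} (hx : x ∈ part K deg n) :
    signAut K deg x = sgn K n • x := by
  unfold part at hx
  induction hx using Submodule.span_induction with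
  | mem x h =>
    obtain ⟨l, rfl, rfl⟩ := h
    induction l with
    | nil => simp [sgn_zero]
    | cons j l ih =>
      simp only [List.map_cons, List.prod_cons, List.sum_cons, map_mul]
      rw [ih, signAut, lift_gen, smul_mul_smul_comm, sgn_add]
  | zero => simp
  | add a b _ _ ha hb => rw [map_add, ha, hb, smul_add]
  | smul c a _ ha => rw [map_smul, ha, smul_comm]

/-- The upper triangular matrices `(σ(x), θ(x); 0, x)`, where `σ` is the sign automorphism, encode
a derivation `θ` of odd degree. -/
def derivMat (deg : ι → ℤ) (δ : ι → FreeCGA K deg)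
    (hδ : ∀ i, δ i ∈ part K deg (deg i + 1)) :
    FreeCGA K deg →ₐ[K] Matrix (Fin 2) (Fin 2) (FreeCGA K deg) :=
  lift deg (fun i => !![sgn K (deg i) • gen K deg i, δ i; 0, gen K deg i]) (fun i j => by
    have e1 := gen_mul_gen (K := K) deg i j
    have e2 := gen_mul i (hδ j)
    have e3 := gen_mul j (hδ i)
    have hsq : sgn K (deg i * deg j) * sgn K (deg i * deg j) = 1 := by
      rw [← sgn_add]; exact sgn_even K ⟨_, rfl⟩
    have hsi : sgn K (deg i) * sgn K (deg i) = 1 := by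
      rw [← sgn_add]; exact sgn_even K ⟨_, rfl⟩
    have hsj : sgn K (deg j) * sgn K (deg j) = 1 := by
      rw [← sgn_add]; exact sgn_even K ⟨_, rfl⟩
    rw [mul_add, mul_one, sgn_add] at e2 e3
    rw [mul_comm (deg j)] at e3
    ext a b
    fin_cases a <;> fin_cases b
    · simp [e1, smul_smul]
      ring_nf
    · simp only [Matrix.mul_fin_two, Matrix.smul_apply]
      simp only [Matrix.of_apply, Matrix.cons_val', Matrix.cons_val_zero, Matrix.cons_val_one,
        Matrix.cons_val_fin_one, Fin.zero_eta, Fin.mk_one, smul_mul_assoc, e2, e3, smul_add,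
        smul_smul]
      rw [show sgn K (deg i) * (sgn K (deg i * deg j) * sgn K (deg i))
          = sgn K (deg i * deg j) * (sgn K (deg i) * sgn K (deg i)) by ring, hsi,
        show sgn K (deg i * deg j) * (sgn K (deg j) * (sgn K (deg i * deg j) * sgn K (deg j)))
          = (sgn K (deg i * deg j) * sgn K (deg i * deg j)) * (sgn K (deg j) * sgn K (deg j))
          by ring, hsq, hsj, mul_one, mul_one, one_smul, add_comm]
    · simp
    · simp [e1])

lemma derivMat_gen (deg : ι → ℤ) (δ : ι → FreeCGA K deg)
    (hδ : ∀ i, δ i ∈ part K deg (deg i + 1)) (i : ι) :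
    derivMat deg δ hδ (gen K deg i) = !![sgn K (deg i) • gen K deg i, δ i; 0, gen K deg i] :=
  lift_gen _ _ _ _

lemma derivMat_diag (deg : ι → ℤ) (δ : ι → FreeCGA K deg)
    (hδ : ∀ i, δ i ∈ part K deg (deg i + 1)) (x : FreeCGA K deg) :
    derivMat deg δ hδ x 0 0 = signAut K deg x ∧ derivMat deg δ hδ x 1 0 = 0 ∧
      derivMat deg δ hδ x 1 1 = x := by
  induction x using induction with
  | h0 c => simp [Matrix.algebraMap_matrix_apply]
  | h1 i => rw [derivMat_gen, signAut, lift_gen]; simp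
  | hm x y hx hy =>
    simp only [map_mul, Matrix.mul_apply, Fin.sum_univ_two, hx.1, hx.2.1, hx.2.2, hy.1, hy.2.1,
      hy.2.2]
    simp
  | ha x y hx hy =>
    simp only [map_add, Matrix.add_apply, hx.1, hx.2.1, hx.2.2, hy.1, hy.2.1, hy.2.2]
    simp

/-- The derivation of degree `1` of `∧V` with given values on the basis of `V`. -/
def deriv (deg : ι → ℤ) (δ : ι → FreeCGA K deg)
    (hδ : ∀ i, δ i ∈ part K deg (deg i + 1)) : FreeCGA K deg →ₗ[K] FreeCGA K deg :=
  Matrix.entryLinearMap K (FreeCGA K deg) 0 1 ∘ₗ (derivMat deg δ hδ).toLinearMap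

section

variable (deg : ι → ℤ) (δ : ι → FreeCGA K deg) (hδ : ∀ i, δ i ∈ part K deg (deg i + 1))

lemma deriv_gen (i : ι) : deriv deg δ hδ (gen K deg i) = δ i := by
  simp [deriv, derivMat_gen]

lemma deriv_mul (x y : FreeCGA K deg) :
    deriv deg δ hδ (x * y) = deriv deg δ hδ x * y + signAut K deg x * deriv deg δ hδ y := by
  have h1 := derivMat_diag deg δ hδ x
  have h2 := derivMat_diag deg δ hδ y
  simp [deriv, Matrix.mul_apply, Fin.sum_univ_two, h1.1, h2.2.2, add_comm]

lemma deriv_one : deriv deg δ hδ 1 = 0 := by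
  simp [deriv]

lemma deriv_part {n : ℤ} {x : FreeCGA K deg} (hx : x ∈ part K deg n) :
    deriv deg δ hδ x ∈ part K deg (n + 1) := by
  unfold part at hx
  induction hx using Submodule.span_induction with
  | mem x h =>
    obtain ⟨l, rfl, rfl⟩ := h
    induction l with
    | nil => simp [deriv_one]
    | cons j l ih =>
      simp only [List.map_cons, List.prod_cons, List.sum_cons, deriv_mul, deriv_gen]
      refine add_mem ?_ ?_
      · have := mul_mem_part (hδ j) (prod_mem_part (K := K) deg l)
        rwa [add_right_comm] at this
      · rw [signAut_part (gen_mem_part deg j), smul_mul_assoc, add_assoc]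
        exact Submodule.smul_mem _ _ (mul_mem_part (gen_mem_part deg j) ih)
  | zero => simp
  | add a b _ _ ha hb => rw [map_add]; exact add_mem ha hb
  | smul c a _ ha => rw [map_smul]; exact Submodule.smul_mem _ _ ha

lemma deriv_signAut (x : FreeCGA K deg) :
    deriv deg δ hδ (signAut K deg x) = - signAut K deg (deriv deg δ hδ x) := by
  induction x using induction with
  | h0 c => simp [Algebra.algebraMap_eq_smul_one, deriv_one]
  | h1 i =>
    rw [signAut_part (gen_mem_part deg i), map_smul, deriv_gen, signAut_part (hδ i), sgn_add,
      sgn_odd K odd_one]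
    simp
  | hm x y hx hy => simp only [map_mul, deriv_mul, map_add, hx, hy]; noncomm_ring
  | ha x y hx hy => simp only [map_add, hx, hy]; abel

end

/-! #### Differentials -/

/-- A differential on the graded algebra `∧V`: a derivation of degree `1` and of square zero. It
makes `∧V` into a commutative differential graded algebra. -/
structure Differential (K : Type*) [Field K] {ι : Type*} (deg : ι → ℤ) where
  /-- the underlying linear map -/
  toLin : FreeCGA K deg →ₗ[K] FreeCGA K deg
  map_part : ∀ (n : ℤ) (x : FreeCGA K deg), x ∈ part K deg n → toLin x ∈ part K deg (n + 1)
  leibniz : ∀ (n : ℤ) (x y : FreeCGA K deg), x ∈ part K deg n →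
    toLin (x * y) = toLin x * y + sgn K n • (x * toLin y)
  sq_zero : ∀ x, toLin (toLin x) = 0

instance {deg : ι → ℤ} : CoeFun (Differential K deg) (fun _ => FreeCGA K deg → FreeCGA K deg) :=
  ⟨fun d => d.toLin⟩

lemma Differential.map_one {deg : ι → ℤ} (d : Differential K deg) : d 1 = 0 := by
  have h := d.leibniz 0 1 1 (one_mem_part deg)
  simpa [sgn_zero] using h

lemma Differential.mul {deg : ι → ℤ} (d : Differential K deg) (x y : FreeCGA K deg) :
    d (x * y) = d x * y + signAut K deg x * d y := by
  induction x using induction generalizing y with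
  | h0 c => simp [Algebra.algebraMap_eq_smul_one, d.map_one]
  | h1 i =>
    rw [d.leibniz _ _ _ (gen_mem_part deg i), signAut_part (gen_mem_part deg i), smul_mul_assoc]
  | hm a b ha hb => rw [mul_assoc, ha, hb, ha, map_mul]; noncomm_ring
  | ha a b ha hb => rw [add_mul, map_add, ha, hb, map_add, map_add]; noncomm_ring

variable {deg : ι → ℤ} {deg' : κ → ℤ}

/-- The values on the basis of `V ⊕ W` of the differential of `(∧V, d) ⊗ (∧W, d')`. -/
def tensorGen (d : Differential K deg) (d' : Differential K deg') :
    ι ⊕ κ → FreeCGA K (Sum.elim deg deg')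
  | .inl i => inl deg deg' (d (gen K deg i))
  | .inr j => inr deg deg' (d' (gen K deg' j))

lemma tensorGen_mem (d : Differential K deg) (d' : Differential K deg') (k : ι ⊕ κ) :
    tensorGen d d' k ∈ part K (Sum.elim deg deg') (Sum.elim deg deg' k + 1) := by
  rcases k with i | j
  · exact map_mem_part _ _ (d.map_part _ _ (gen_mem_part deg i))
  · exact map_mem_part _ _ (d'.map_part _ _ (gen_mem_part deg' j))

lemma signAut_map (e : ι → κ) (he : ∀ i, deg' (e i) = deg i) (x : FreeCGA K deg) :
    signAut K deg' (map e he x) = map e he (signAut K deg x) := by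
  induction x using induction with
  | h0 c => simp
  | h1 i =>
    rw [map_gen, signAut_part (gen_mem_part _ _), signAut_part (gen_mem_part _ _), map_smul,
      map_gen, he]
  | hm x y hx hy => simp only [map_mul, hx, hy]
  | ha x y hx hy => simp only [map_add, hx, hy]

lemma tensor_inl (d : Differential K deg) (d' : Differential K deg') (x : FreeCGA K deg) :
    deriv _ (tensorGen d d') (tensorGen_mem d d') (inl deg deg' x) = inl deg deg' (d x) := by
  induction x using induction with
  | h0 c => simp [Algebra.algebraMap_eq_smul_one, deriv_one, d.map_one]
  | h1 i => rw [inl, map_gen, deriv_gen]; rfl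
  | hm x y hx hy =>
    rw [map_mul, deriv_mul, hx, hy, d.mul, map_add, map_mul, map_mul]
    simp only [inl, signAut_map]
  | ha x y hx hy => simp only [map_add, hx, hy]

lemma tensor_inr (d : Differential K deg) (d' : Differential K deg') (x : FreeCGA K deg') :
    deriv _ (tensorGen d d') (tensorGen_mem d d') (inr deg deg' x) = inr deg deg' (d' x) := by
  induction x using induction with
  | h0 c => simp [Algebra.algebraMap_eq_smul_one, deriv_one, d'.map_one]
  | h1 i => rw [inr, map_gen, deriv_gen]; rfl
  | hm x y hx hy =>
    rw [map_mul, deriv_mul, hx, hy, d'.mul, map_add, map_mul, map_mul]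
    simp only [inr, signAut_map]
  | ha x y hx hy => simp only [map_add, hx, hy]

/-- The differential `d ⊗ 1 ± 1 ⊗ d'` of the tensor product `(∧V, d) ⊗ (∧W, d')`. -/
def Differential.tensor (d : Differential K deg) (d' : Differential K deg') :
    Differential K (Sum.elim deg deg') where
  toLin := deriv _ (tensorGen d d') (tensorGen_mem d d')
  map_part _ _ hx := deriv_part _ _ _ hx
  leibniz n x y hx := by rw [deriv_mul, signAut_part hx, smul_mul_assoc]
  sq_zero x := by
    induction x using induction with
    | h0 c => simp [Algebra.algebraMap_eq_smul_one, deriv_one]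
    | h1 k =>
      rw [deriv_gen]
      rcases k with i | j
      · rw [tensorGen, tensor_inl, d.sq_zero, map_zero]
      · rw [tensorGen, tensor_inr, d'.sq_zero, map_zero]
    | hm x y hx hy => simp only [deriv_mul, map_add, hx, hy, deriv_signAut]; noncomm_ring
    | ha x y hx hy => simp only [map_add, hx, hy, add_zero]

end FreeCGA

open FreeCGA

/-! ### Sullivan algebras -/

section Sullivan

variable {K : Type*} [Field K] {ι κ υ : Type*}

/-- A graded subspace of `∧V`: the sum of its homogeneous components. -/
def IsGradedSubspace {deg : ι → ℤ} (F : Submodule K (FreeCGA K deg)) : Prop :=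
  F = ⨆ n : ℤ, F ⊓ part K deg n

/-- `(∧V, d)` is a Sullivan algebra. Here `F k` is the term `V(k - 1)` of the filtration. -/
def IsSullivan {deg : ι → ℤ} (d : Differential K deg) : Prop :=
  (∀ i, 1 ≤ deg i) ∧
  ∃ F : ℕ → Submodule K (FreeCGA K deg),
    (∀ k, IsGradedSubspace (F k)) ∧ F 0 = ⊥ ∧ Monotone F ∧ (⨆ k, F k) = gens K deg ∧
    ∀ k, ∀ v ∈ F (k + 1), d v ∈ Algebra.adjoin K (F k : Set (FreeCGA K deg))

/-- `(B ⊗ ∧U, D)` is a relative Sullivan algebra with base `(B, dB)`, where `B` is the free graded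
commutative algebra on generators of positive degree (so that `H⁰(B) = K`). Here `F k` is the term
`U(k - 1)` of the filtration. -/
def IsRelSullivan {degB : κ → ℤ} {degU : υ → ℤ} (dB : Differential K degB)
    (D : Differential K (Sum.elim degB degU)) : Prop :=
  (∀ k, 1 ≤ degB k) ∧ (∀ u, 1 ≤ degU u) ∧
  (∀ b, D (inl degB degU b) = inl degB degU (dB b)) ∧
  ∃ F : ℕ → Submodule K (FreeCGA K (Sum.elim degB degU)),
    (∀ k, IsGradedSubspace (F k)) ∧ F 0 = ⊥ ∧ Monotone F ∧
    (⨆ k, F k) = (gens K degU).map (inr degB degU).toLinearMap ∧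
    ∀ k, ∀ u ∈ F (k + 1), D u ∈ Algebra.adjoin K
      (Set.range (inl degB degU) ∪ (F k : Set (FreeCGA K (Sum.elim degB degU))))

/-- `m : (B ⊗ ∧U, D) → (C, dC)` is a relative Sullivan model for the homomorphism
`φ : (B, dB) → (C, dC)` of differential graded algebras, the grading of `C` being `partC`. -/
structure IsRelSullivanModel {degB : κ → ℤ} {degU : υ → ℤ} (dB : Differential K degB)
    (D : Differential K (Sum.elim degB degU)) {C : Type*} [Ring C] [Algebra K C]
    (partC : ℤ → Submodule K C) (dC : C →ₗ[K] C) (φ : FreeCGA K degB →ₐ[K] C)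
    (m : FreeCGA K (Sum.elim degB degU) →ₐ[K] C) : Prop where
  isRelSullivan : IsRelSullivan dB D
  map_part : ∀ n x, x ∈ part K (Sum.elim degB degU) n → m x ∈ partC n
  restrict : m.comp (inl degB degU) = φ
  quasiIso : IsQuasiIso D.toLin dC m.toLinearMap

/-! ### Hom complexes, Ext, Gorenstein algebras -/

/-- `Hom_B^n(B ⊗ ∧U, B)`: the linear maps `f` of degree `n` with
`f (b x) = (-1)^{n |b|} b f(x)`. -/
def homDeg (degB : κ → ℤ) (degU : υ → ℤ) (n : ℤ) :
    Submodule K (FreeCGA K (Sum.elim degB degU) →ₗ[K] FreeCGA K degB) where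
  carrier := {f | (∀ k x, x ∈ part K (Sum.elim degB degU) k → f x ∈ part K degB (k + n)) ∧
    ∀ k b, b ∈ part K degB k → ∀ x, f (inl degB degU b * x) = sgn K (k * n) • (b * f x)}
  zero_mem' := by simp
  add_mem' {f g} hf hg := by
    refine ⟨fun k x hx => add_mem (hf.1 k x hx) (hg.1 k x hx), fun k b hb x => ?_⟩
    simp only [LinearMap.add_apply, hf.2 k b hb x, hg.2 k b hb x, mul_add, smul_add]
  smul_mem' c f hf := by
    refine ⟨fun k x hx => Submodule.smul_mem _ _ (hf.1 k x hx), fun k b hb x => ?_⟩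
    simp only [LinearMap.smul_apply, hf.2 k b hb x, mul_smul_comm]
    rw [smul_comm]

/-- The differential `f ↦ dB ∘ f - (-1)^n f ∘ D` of the Hom complex, on maps of degree `n`. -/
def homD {degB : κ → ℤ} {degU : υ → ℤ} (dB : Differential K degB)
    (D : Differential K (Sum.elim degB degU)) (n : ℤ) :
    (FreeCGA K (Sum.elim degB degU) →ₗ[K] FreeCGA K degB) →ₗ[K]
      (FreeCGA K (Sum.elim degB degU) →ₗ[K] FreeCGA K degB) where
  toFun f := dB.toLin ∘ₗ f - sgn K n • (f ∘ₗ D.toLin)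
  map_add' f g := by ext x; simp; abel
  map_smul' c f := by ext x; simp [smul_sub]; rw [smul_comm]

/-- The cocycles of degree `n` of `Hom_B(B ⊗ ∧U, B)`. -/
def cocycles {degB : κ → ℤ} {degU : υ → ℤ} (dB : Differential K degB)
    (D : Differential K (Sum.elim degB degU)) (n : ℤ) :
    Submodule K (FreeCGA K (Sum.elim degB degU) →ₗ[K] FreeCGA K degB) :=
  homDeg degB degU n ⊓ LinearMap.ker (homD dB D n)

/-- The coboundaries of degree `n` of `Hom_B(B ⊗ ∧U, B)`. -/
def coboundaries {degB : κ → ℤ} {degU : υ → ℤ} (dB : Differential K degB)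
    (D : Differential K (Sum.elim degB degU)) (n : ℤ) :
    Submodule K (FreeCGA K (Sum.elim degB degU) →ₗ[K] FreeCGA K degB) :=
  (homDeg degB degU (n - 1)).map (homD dB D (n - 1))

/-- `H^n(Hom_B(B ⊗ ∧U, B))`. If `(B ⊗ ∧U, D)` is a relative Sullivan model for `φ : B → C`, hence a
semifree resolution of the `B`-module `C`, this is `Ext_B^n(C, B)`. -/
abbrev Ext {degB : κ → ℤ} {degU : υ → ℤ} (dB : Differential K degB)
    (D : Differential K (Sum.elim degB degU)) (n : ℤ) : Type _ :=
  SubQuotient (cocycles dB D n) (coboundaries dB D n)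

/-- The class in `Ext` of a cocycle. -/
def extClass {degB : κ → ℤ} {degU : υ → ℤ} (dB : Differential K degB)
    (D : Differential K (Sum.elim degB degU)) (n : ℤ) (f : cocycles dB D n) : Ext dB D n :=
  SubQuotient.mk _ _ f

/-- `(∧V, d)` is a Gorenstein algebra of dimension `n`: `Ext_{∧V}^l(K, ∧V)` is one-dimensional for
`l = n` and zero for `l ≠ n`. It is computed by a relative Sullivan model `(∧V ⊗ ∧U, D) → K` for
the augmentation, where `K` sits in degree `0`; the choice of the model does not matter. -/
def IsGorenstein {deg : ι → ℤ} (d : Differential K deg) (n : ℤ) : Prop :=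
  ∃ (υ : Type) (degU : υ → ℤ) (D : Differential K (Sum.elim deg degU))
    (m : FreeCGA K (Sum.elim deg degU) →ₐ[K] K),
    IsRelSullivanModel d D (fun l => if l = 0 then ⊤ else ⊥) 0 (aug K deg) m ∧
    ∀ l : ℤ, Module.rank K (Ext d D l) = if l = n then 1 else 0

end Sullivan

/-! ### Semi-pure algebras, nice models and the shriek map

The basis of `V` is indexed by `Fin p ⊕ Fin q`: the element `x_i` is `Sum.inl i`, of even degree, and
`y_j` is `Sum.inr j`, of odd degree. All the ideals below are generated by homogeneous elements, so
that the left ideals they generate are two-sided. -/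

section SemiPure

variable {K : Type*} [Field K] {p q : ℕ} (deg : Fin p ⊕ Fin q → ℤ)

/-- The degrees of the basis of `V̄`, where `V̄^n = V^{n+1}`. -/
abbrev barDeg : Fin p ⊕ Fin q → ℤ := fun i => deg i - 1

/-- The degrees of the basis of `V ⊕ V`. -/
abbrev deg2 : (Fin p ⊕ Fin q) ⊕ (Fin p ⊕ Fin q) → ℤ := Sum.elim deg deg

/-- The degrees of the basis of `V ⊕ V ⊕ V̄`. -/
abbrev deg3 : ((Fin p ⊕ Fin q) ⊕ (Fin p ⊕ Fin q)) ⊕ (Fin p ⊕ Fin q) → ℤ :=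
  Sum.elim (deg2 deg) (barDeg deg)

variable (K)

/-- `v ⊗ 1 ⊗ 1` in `∧V ⊗ ∧V ⊗ ∧V̄`, for `v` in the basis of `V`. -/
def fst (v : Fin p ⊕ Fin q) : FreeCGA K (deg3 deg) := gen K _ (.inl (.inl v))

/-- `1 ⊗ v ⊗ 1` in `∧V ⊗ ∧V ⊗ ∧V̄`, for `v` in the basis of `V`. -/
def snd (v : Fin p ⊕ Fin q) : FreeCGA K (deg3 deg) := gen K _ (.inl (.inr v))

/-- `v̄` in `∧V ⊗ ∧V ⊗ ∧V̄`, for `v` in the basis of `V`. -/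
def bar (v : Fin p ⊕ Fin q) : FreeCGA K (deg3 deg) := gen K _ (.inr v)

/-- The ideal `I_V` of `∧V` generated by the generators of even degree. -/
def evenIdeal : Ideal (FreeCGA K deg) :=
  Ideal.span (Set.range fun i : Fin p => gen K deg (.inl i))

/-- The ideal `Ī_V` of `∧V ⊗ ∧V ⊗ ∧V̄` generated by all the `x_i ⊗ 1`, `1 ⊗ x_i`, `x̄_i`. -/
def evenIdealBar : Ideal (FreeCGA K (deg3 deg)) :=
  Ideal.span {z | ∃ i : Fin p,
    z = fst K deg (.inl i) ∨ z = snd K deg (.inl i) ∨ z = bar K deg (.inl i)}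

/-- The ideal `Ī_{V,i}` of `∧V ⊗ ∧V ⊗ ∧V̄`, generated by all the `x_k ⊗ 1`, `1 ⊗ x_k`, and by the
`x̄_k` with `k ≠ i`. -/
def evenIdealBarExcept (i : Fin p) : Ideal (FreeCGA K (deg3 deg)) :=
  Ideal.span {z | ∃ k : Fin p,
    z = fst K deg (.inl k) ∨ z = snd K deg (.inl k) ∨ (k ≠ i ∧ z = bar K deg (.inl k))}

/-- The ideal of `∧V ⊗ ∧V` generated by the elements `y_j ⊗ y_j`. -/
def diagIdeal : Ideal (FreeCGA K (deg2 deg)) :=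
  Ideal.span (Set.range fun j : Fin q =>
    gen K (deg2 deg) (.inl (.inr j)) * gen K (deg2 deg) (.inr (.inr j)))

variable {K} {deg}

/-- `(∧V, d)` is a semi-pure Sullivan algebra: `d(I_V) ⊆ I_V`. -/
structure IsSemiPure (d : Differential K deg) : Prop where
  isSullivan : IsSullivan d
  map_evenIdeal : ∀ x ∈ (evenIdeal K deg).restrictScalars K,
    d.toLin x ∈ (evenIdeal K deg).restrictScalars K

/-- `m : (∧V ⊗ ∧V ⊗ ∧V̄, D) → (∧V, d)` is a relative Sullivan model for the multiplication of
`∧V`. -/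
abbrev IsMultModel (d : Differential K deg) (D : Differential K (deg3 deg))
    (m : FreeCGA K (deg3 deg) →ₐ[K] FreeCGA K deg) : Prop :=
  IsRelSullivanModel (d.tensor d) D (part K deg) d.toLin (mult K deg) m

/-- A nice relative Sullivan model of the multiplication of the semi-pure algebra `(∧V, d)`. -/
structure IsNice {d : Differential K deg} (hd : IsSemiPure d) (D : Differential K (deg3 deg))
    (m : FreeCGA K (deg3 deg) →ₐ[K] FreeCGA K deg) : Prop where
  isModel : IsMultModel d D m
  map_evenIdealBar : ∀ x ∈ (evenIdealBar K deg).restrictScalars K,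
    D.toLin x ∈ (evenIdealBar K deg).restrictScalars K
  map_bar : ∀ i : Fin p, D (bar K deg (.inl i)) ∈ evenIdealBarExcept K deg i
  map_ideal : ∀ x ∈ (evenIdealBar K deg).restrictScalars K,
    m.toLinearMap x ∈ (evenIdeal K deg).restrictScalars K
  quasiIso_ideal : IsQuasiIso (D.toLin.restrict map_evenIdealBar)
    (d.toLin.restrict hd.map_evenIdeal) (m.toLinearMap.restrict map_ideal)
  quasiIso_quotient : IsQuasiIso
    (Submodule.mapQ _ _ D.toLin map_evenIdealBar) (Submodule.mapQ _ _ d.toLin hd.map_evenIdeal)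
    (Submodule.mapQ _ _ m.toLinearMap map_ideal)

/-- `f(x̄_1 ⋯ x̄_p) = ± ∏_j (1 ⊗ y_j - y_j ⊗ 1) + u`, with `u` in the ideal generated by the
`y_j ⊗ y_j`. -/
def HasGoodValue (f : FreeCGA K (deg3 deg) →ₗ[K] FreeCGA K (deg2 deg)) : Prop :=
  ∃ s : K, (s = 1 ∨ s = -1) ∧ ∃ u ∈ diagIdeal K deg,
    f (List.ofFn fun i : Fin p => bar K deg (.inl i)).prod =
      s • (List.ofFn fun j : Fin q =>
        gen K (deg2 deg) (.inr (.inr j)) - gen K (deg2 deg) (.inl (.inr j))).prod + u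

/-- The cocycle `f` of degree `n` represents the shriek map: `n` is the dimension of the Gorenstein
algebra `(∧V, d)`, the space `Ext_{∧V ⊗ ∧V}^n(∧V, ∧V ⊗ ∧V)` is one-dimensional, and the class of `f`
is a generator of it. -/
def RepresentsShriek (d : Differential K deg) (D : Differential K (deg3 deg)) (n : ℤ)
    (f : cocycles (d.tensor d) D n) : Prop :=
  IsGorenstein d n ∧ Module.rank K (Ext (d.tensor d) D n) = 1 ∧
    Submodule.span K {extClass (d.tensor d) D n f} = ⊤

end SemiPure

end ShriekMap

end

/-! Write B = ∧V ⊗ ∧V and t_v = 1 ⊗ v - v ⊗ 1. The part of D v̄ that is linear in V ⊗ 1 and 1 ⊗ V is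
∑ A_vk t_k, with A an invertible matrix that preserves degrees. Up to terms of higher filtration the
model is therefore a Koszul complex on the t_v, and the cohomology of the Hom complex is obtained by
perturbing the Koszul case. `KoszulData` packages what this needs. It is used twice: for B in the
coordinates t_v, and for the quotient of the model by the first factor.

Leading term. Let ν count t_x and x̄ with +1, t_y and ȳ with -1. The operator `hop`, built from
multiplication by the v̄ and from the derivations dual to the leading terms of D v̄, has graded
commutator with the Koszul differential equal to k + p + q on maps that shift ν by k (`homotopy`,
`opM_homotopy`). In characteristic zero one can divide, so everything contracts except the shift -(p
+ q) (`homotopy_htp`). A nonzero monomial of B has ν at least -q, with equality only if it contains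
every t_y and no t_x. One of ∧V̄ has ν at most p, with equality only for x̄_1 ⋯ x̄_p up to order. So
a map of shift -(p + q) is known from its value on x̄_1 ⋯ x̄_p (`proj0_ext`). In degree N = ∑|y_j| -
∑|x̄_i| it is a multiple of `f0`, which sends x̄_1 ⋯ x̄_p to ∏ t_y. In degree N + 1 it is zero,
because no generator of the base has degree 1.

Perturbation. Give weight Λ to x, x̄ and weight 1 to y, ȳ, with Λ large. The differential minus its
Koszul part strictly raises this filtration, which is bounded in each degree. Hence iterating f ↦ f0
- htp(del f) converges to a cocycle (`exists_cocycle`), and the same reduction makes every cocycle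
of degree N cohomologous to a multiple of it (`cocycle_eq`). A second weight, the lower degree, is
lowered by at most 1 by the differential and is raised by 1 by the homotopy. It shows that the error
f(x̄_1 ⋯ x̄_p) - ∏ t_y has at least q odd factors in each term. Together with its degree and its
larger filtration this puts the error in J (`mem_diagIdeal`).

Non-vanishing. Project B to the exterior algebra on the y_j by killing the second factor and the
x_i. For a coboundary of g, the element g(x̄_1 ⋯ x̄_p) lands one degree below the top, where there
is nothing. By condition (b) and x̄_k² = 0, D(x̄_1 ⋯ x̄_p) lies in the ideal of the x ⊗ 1 and 1 ⊗ x,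
which dies. So a coboundary projects to zero (`map_homD_barx`), while (∗) projects to ±∏ y_j
(`pi1_ne_zero`), which also fixes the degree.

Gorenstein property. Killing the first factor turns the model into a resolution ∧V ⊗ ∧V̄ of K. Every
generator of the base now occurs among the leading terms, so the shift -(p + q) contributes only in
degree N, and there the argument above applies.

Invertibility of A. The model is also a relative Sullivan algebra over its first factor, with fibre
generated by 1 ⊗ V and V̄, and m retracts it onto that factor by a quasi-isomorphism. Lifting the
identity through a cylinder shows that the linear part of the fibre is contractible
(`exists_linear_contraction`). For the quotient by the even generators, where condition (c) enters,
this inverts the odd block of A. For the whole model, combined with D² = 0, it inverts the even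
block (`exists_left_inverse_even`). -/

noncomputable section

namespace ShriekMap

namespace FreeCGA

/-! ### Monomials and weights -/

section Monomials

variable {K : Type*} [Field K] {ι κ : Type*} {deg : ι → ℤ}

variable (K) in
/-- The product of the generators in a list. -/
def mon (deg : ι → ℤ) (l : List ι) : FreeCGA K deg := (l.map (gen K deg)).prod

@[simp] lemma mon_nil : mon K deg [] = 1 := rfl

@[simp] lemma mon_cons (i : ι) (l : List ι) : mon K deg (i :: l) = gen K deg i * mon K deg l := by
  simp [mon]

@[simp] lemma mon_append (l l' : List ι) : mon K deg (l ++ l') = mon K deg l * mon K deg l' := by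
  simp [mon]

variable (K) in
/-- The span of the monomials of a set of lists. -/
def lspan (deg : ι → ℤ) (S : Set (List ι)) : Submodule K (FreeCGA K deg) :=
  Submodule.span K (mon K deg '' S)

lemma mon_mem_lspan {S : Set (List ι)} {l : List ι} (h : l ∈ S) : mon K deg l ∈ lspan K deg S :=
  Submodule.subset_span ⟨l, h, rfl⟩

lemma lspan_le {S : Set (List ι)} {T : Submodule K (FreeCGA K deg)}
    (h : ∀ l ∈ S, mon K deg l ∈ T) : lspan K deg S ≤ T :=
  Submodule.span_le.2 (by rintro _ ⟨l, hl, rfl⟩; exact h l hl)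

lemma lspan_mono {S T : Set (List ι)} (h : S ⊆ T) : lspan K deg S ≤ lspan K deg T :=
  lspan_le fun _ hl => mon_mem_lspan (h hl)

lemma lspan_univ : lspan K deg Set.univ = ⊤ := by
  rw [eq_top_iff]
  rintro x -
  induction x using induction with
  | h0 c =>
    rw [Algebra.algebraMap_eq_smul_one]
    exact Submodule.smul_mem _ _ (mon_mem_lspan (l := []) trivial)
  | h1 i => simpa using mon_mem_lspan (K := K) (deg := deg) (l := [i]) (Set.mem_univ _)
  | hm x y hx hy =>
    unfold lspan at hx hy
    induction hx using Submodule.span_induction with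
    | mem x h =>
      obtain ⟨l, -, rfl⟩ := h
      induction hy using Submodule.span_induction with
      | mem y h =>
        obtain ⟨l', -, rfl⟩ := h
        rw [← mon_append]; exact mon_mem_lspan trivial
      | zero => simp
      | add a b _ _ ha hb => rw [mul_add]; exact add_mem ha hb
      | smul c a _ ha => rw [mul_smul_comm]; exact Submodule.smul_mem _ _ ha
    | zero => simp
    | add a b _ _ ha hb => rw [add_mul]; exact add_mem ha hb
    | smul c a _ ha => rw [smul_mul_assoc]; exact Submodule.smul_mem _ _ ha
  | ha x y hx hy => exact add_mem hx hy

lemma mem_of_mon {T : Submodule K (FreeCGA K deg)} (h : ∀ l, mon K deg l ∈ T) (x) : x ∈ T :=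
  lspan_le (S := Set.univ) (fun l _ => h l) (by rw [lspan_univ]; trivial)

lemma map_mem_of_lspan {M : Type*} [AddCommGroup M] [Module K M] {f : FreeCGA K deg →ₗ[K] M}
    {T : Submodule K M} {S : Set (List ι)} (h : ∀ l ∈ S, f (mon K deg l) ∈ T)
    {x : FreeCGA K deg} (hx : x ∈ lspan K deg S) : f x ∈ T :=
  lspan_le (T := T.comap f) h hx

lemma eq_of_mon {M : Type*} [AddCommGroup M] [Module K M] {f g : FreeCGA K deg →ₗ[K] M}
    (h : ∀ l, f (mon K deg l) = g (mon K deg l)) (x) : f x = g x := by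
  have := mem_of_mon (T := LinearMap.eqLocus f g) h x
  exact this

lemma eq_of_lspan {M : Type*} [AddCommGroup M] [Module K M] {f g : FreeCGA K deg →ₗ[K] M}
    {S : Set (List ι)} (h : ∀ l ∈ S, f (mon K deg l) = g (mon K deg l)) {x}
    (hx : x ∈ lspan K deg S) : f x = g x :=
  lspan_le (T := LinearMap.eqLocus f g) h hx

lemma mul_mem_lspan {S T U : Set (List ι)} (h : ∀ l ∈ S, ∀ l' ∈ T, l ++ l' ∈ U)
    {x y : FreeCGA K deg} (hx : x ∈ lspan K deg S) (hy : y ∈ lspan K deg T) :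
    x * y ∈ lspan K deg U := by
  have := map_mem_of_lspan (f := LinearMap.mulRight K y) (T := lspan K deg U) (fun l hl => by
    have := map_mem_of_lspan (f := LinearMap.mulLeft K (mon K deg l)) (T := lspan K deg U)
      (fun l' hl' => by
        simp only [LinearMap.mulLeft_apply, ← mon_append]
        exact mon_mem_lspan (h l hl l' hl')) hy
    simpa using this) hx
  simpa using this

/-- The sum of the weights of the members of a list. -/
def wt (w : ι → ℤ) (l : List ι) : ℤ := (l.map w).sum

@[simp] lemma wt_nil (w : ι → ℤ) : wt w [] = 0 := rfl
@[simp] lemma wt_cons (w : ι → ℤ) (i : ι) (l : List ι) : wt w (i :: l) = w i + wt w l := by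
  simp [wt]
@[simp] lemma wt_append (w : ι → ℤ) (l l' : List ι) : wt w (l ++ l') = wt w l + wt w l' := by
  simp [wt]
lemma wt_perm (w : ι → ℤ) {l l' : List ι} (h : l.Perm l') : wt w l = wt w l' :=
  (h.map w).sum_eq

lemma wt_nonneg {w : ι → ℤ} (hw : ∀ i, 0 ≤ w i) (l : List ι) : 0 ≤ wt w l := by
  induction l with
  | nil => simp
  | cons i l ih => have := hw i; simp; omega

lemma wt_mono {w w' : ι → ℤ} (hw : ∀ i, w i ≤ w' i) (l : List ι) : wt w l ≤ wt w' l := by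
  induction l with
  | nil => simp
  | cons i l ih => have := hw i; simp; omega

variable (K) in
/-- The span of the monomials of weight `n`. -/
def wpart (deg w : ι → ℤ) (n : ℤ) : Submodule K (FreeCGA K deg) := lspan K deg {l | wt w l = n}

variable (K) in
/-- The span of the monomials of weight at least `n`. -/
def wge (deg w : ι → ℤ) (n : ℤ) : Submodule K (FreeCGA K deg) := lspan K deg {l | n ≤ wt w l}

lemma part_eq_wpart (n : ℤ) : part K deg n = wpart K deg deg n := by
  unfold part wpart lspan
  congr 1
  ext x
  constructor
  · rintro ⟨l, hl, rfl⟩; exact ⟨l, hl, rfl⟩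
  · rintro ⟨l, hl, rfl⟩; exact ⟨l, hl, rfl⟩

lemma mon_mem_part (l : List ι) : mon K deg l ∈ part K deg (wt deg l) := prod_mem_part deg l

lemma mon_mem_wpart (w : ι → ℤ) (l : List ι) : mon K deg l ∈ wpart K deg w (wt w l) :=
  mon_mem_lspan rfl

lemma mon_mem_wge {w : ι → ℤ} {l : List ι} {n : ℤ} (h : n ≤ wt w l) :
    mon K deg l ∈ wge K deg w n := mon_mem_lspan h

lemma gen_mem_wpart (w : ι → ℤ) (i : ι) : gen K deg i ∈ wpart K deg w (w i) := by
  simpa using mon_mem_wpart (K := K) (deg := deg) w [i]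

lemma gen_mem_wge (w : ι → ℤ) (i : ι) : gen K deg i ∈ wge K deg w (w i) := by
  simpa using mon_mem_wge (K := K) (deg := deg) (w := w) (l := [i]) (n := w i) (by simp)

lemma wpart_le_wge (w : ι → ℤ) (n : ℤ) : wpart K deg w n ≤ wge K deg w n :=
  lspan_mono fun _ h => le_of_eq (Eq.symm h)

lemma wge_anti (w : ι → ℤ) {m n : ℤ} (h : m ≤ n) : wge K deg w n ≤ wge K deg w m :=
  lspan_mono fun _ hl => le_trans h hl

lemma mul_mem_wge {w : ι → ℤ} {m n : ℤ} {x y : FreeCGA K deg} (hx : x ∈ wge K deg w m)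
    (hy : y ∈ wge K deg w n) : x * y ∈ wge K deg w (m + n) :=
  mul_mem_lspan (fun l hl l' hl' => by
    simp only [Set.mem_ofPred_eq] at *; rw [wt_append]; omega) hx hy

lemma mul_mem_wpart {w : ι → ℤ} {m n : ℤ} {x y : FreeCGA K deg} (hx : x ∈ wpart K deg w m)
    (hy : y ∈ wpart K deg w n) : x * y ∈ wpart K deg w (m + n) :=
  mul_mem_lspan (fun l hl l' hl' => by
    simp only [Set.mem_ofPred_eq] at *; rw [wt_append]; omega) hx hy

lemma mem_wge_zero {w : ι → ℤ} (hw : ∀ i, 0 ≤ w i) (x : FreeCGA K deg) : x ∈ wge K deg w 0 :=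
  mem_of_mon (fun l => mon_mem_wge (wt_nonneg hw l)) x

/-- The coaction `x ↦ ∑ xₖ Tᵏ`, where `xₖ` is the component of weight `k`. -/
def coact (w : ι → ℤ) : FreeCGA K deg →ₐ[K] AddMonoidAlgebra (FreeCGA K deg) ℤ :=
  lift deg (fun i => AddMonoidAlgebra.single (w i) (gen K deg i)) (fun i j => by
    rw [AddMonoidAlgebra.single_mul_single, AddMonoidAlgebra.single_mul_single,
      AddMonoidAlgebra.smul_single, gen_mul_gen, add_comm])

/-- Monomials are spanning but not known to be independent, so weight components cannot be read off
a basis. They are well defined because they are the coefficients of an algebra homomorphism to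
Laurent polynomials. -/
lemma coact_mon (w : ι → ℤ) (l : List ι) :
    coact w (mon K deg l) = AddMonoidAlgebra.single (wt w l) (mon K deg l) := by
  induction l with
  | nil => rw [mon_nil, map_one, AddMonoidAlgebra.one_def]; rfl
  | cons i l ih =>
    rw [mon_cons, map_mul, ih, coact, lift_gen, AddMonoidAlgebra.single_mul_single, wt_cons]

variable {M : Type*} [AddCommGroup M] [Module K M]

/-- The linear map which is `g k` on elements of weight `k`. -/
def wsum (w : ι → ℤ) (g : ℤ → FreeCGA K deg →ₗ[K] M) : FreeCGA K deg →ₗ[K] M :=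
  Finsupp.lsum K g ∘ₗ (AddMonoidAlgebra.coeffLinearEquiv K).toLinearMap ∘ₗ (coact w).toLinearMap

lemma wsum_mon (w : ι → ℤ) (g : ℤ → FreeCGA K deg →ₗ[K] M) (l : List ι) :
    wsum w g (mon K deg l) = g (wt w l) (mon K deg l) := by
  have h : wsum w g (mon K deg l) = (coact w (mon K deg l)).coeff.sum fun i => g i := rfl
  rw [h, coact_mon, AddMonoidAlgebra.coeff_single]
  exact Finsupp.sum_single_index (map_zero (g _))

lemma wsum_of_mem {w : ι → ℤ} (g : ℤ → FreeCGA K deg →ₗ[K] M) {n : ℤ} {x : FreeCGA K deg}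
    (hx : x ∈ wpart K deg w n) : wsum w g x = g n x := by
  refine eq_of_lspan ?_ hx
  rintro l rfl
  exact wsum_mon w g l

/-- The projection to the component of weight `n`. -/
def wproj (w : ι → ℤ) (n : ℤ) : FreeCGA K deg →ₗ[K] FreeCGA K deg :=
  wsum w fun k => if k = n then LinearMap.id else 0

lemma wproj_mon (w : ι → ℤ) (n : ℤ) (l : List ι) :
    wproj w n (mon K deg l) = if wt w l = n then mon K deg l else 0 := by
  rw [wproj, wsum_mon]; split_ifs <;> simp

lemma wproj_of_mem {w : ι → ℤ} {n : ℤ} {x : FreeCGA K deg} (hx : x ∈ wpart K deg w n) :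
    wproj w n x = x := by
  rw [wproj, wsum_of_mem _ hx]; simp

lemma wproj_of_mem_ne {w : ι → ℤ} {n m : ℤ} {x : FreeCGA K deg} (hx : x ∈ wpart K deg w n)
    (h : n ≠ m) : wproj w m x = 0 := by
  rw [wproj, wsum_of_mem _ hx]; simp [h]

lemma eq_zero_of_mem_wpart {w : ι → ℤ} {n m : ℤ} {x : FreeCGA K deg} (hx : x ∈ wpart K deg w n)
    (hy : x ∈ wpart K deg w m) (h : n ≠ m) : x = 0 := by
  rw [← wproj_of_mem hy, wproj_of_mem_ne hx h]

lemma wproj_mem_lspan {w : ι → ℤ} (n : ℤ) {S : Set (List ι)} {x : FreeCGA K deg}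
    (hx : x ∈ lspan K deg S) : wproj w n x ∈ lspan K deg (S ∩ {l | wt w l = n}) := by
  refine map_mem_of_lspan (fun l hl => ?_) hx
  rw [wproj_mon]
  split_ifs with h
  · exact mon_mem_lspan ⟨hl, h⟩
  · simp

lemma wproj_mem_wpart (w : ι → ℤ) (n : ℤ) (x : FreeCGA K deg) : wproj w n x ∈ wpart K deg w n := by
  have := wproj_mem_lspan (w := w) n (S := Set.univ) (x := x) (by rw [lspan_univ]; trivial)
  exact lspan_mono (fun l hl => hl.2) this

/-- An element of `lspan S` whose weights satisfy `Q` is in the span of the monomials of `S` whose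
weights satisfy `Q`. -/
lemma mem_lspan_inter {w : ι → ℤ} {S : Set (List ι)} {Q : ℤ → Prop} {x : FreeCGA K deg}
    (hx : x ∈ lspan K deg S) (hy : x ∈ lspan K deg {l | Q (wt w l)}) :
    x ∈ lspan K deg (S ∩ {l | Q (wt w l)}) := by
  classical
  -- The projection to the components with weight in `Q` fixes `x`, and it sends each monomial of
  -- `S` to itself or to zero.
  let g : FreeCGA K deg →ₗ[K] FreeCGA K deg :=
    wsum w fun k => if Q k then LinearMap.id else 0
  have h1 : g x = x := by
    refine eq_of_lspan (g := LinearMap.id) (fun l hl => ?_) hy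
    simp only [Set.mem_ofPred_eq] at hl
    simp [g, wsum_mon, hl]
  rw [← h1]
  refine map_mem_of_lspan (fun l hl => ?_) hx
  by_cases h : Q (wt w l)
  · simpa [g, wsum_mon, h] using mon_mem_lspan (K := K) (deg := deg)
      (show l ∈ S ∩ {l | Q (wt w l)} from ⟨hl, h⟩)
  · simp [g, wsum_mon, h]

lemma mem_lspan_part {S : Set (List ι)} {n : ℤ} {x : FreeCGA K deg}
    (hx : x ∈ lspan K deg S) (hy : x ∈ part K deg n) :
    x ∈ lspan K deg (S ∩ {l | wt deg l = n}) := by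
  rw [part_eq_wpart] at hy
  exact mem_lspan_inter (Q := fun k => k = n) hx hy

lemma mem_part_lspan {n : ℤ} {x : FreeCGA K deg} :
    x ∈ part K deg n ↔ x ∈ lspan K deg {l | wt deg l = n} := by
  rw [part_eq_wpart]; rfl

end Monomials

end FreeCGA

/-! ### Signs, reordering of monomials, squares of odd generators. -/

section Signs

variable (K : Type*) [Field K]

lemma sgn_eq_or (n : ℤ) : sgn K n = 1 ∨ sgn K n = -1 := by
  rcases Int.even_or_odd n with h | h
  · exact Or.inl (sgn_even K h)
  · exact Or.inr (sgn_odd K h)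

lemma sgn_mul_self (n : ℤ) : sgn K n * sgn K n = 1 := by
  rcases sgn_eq_or K n with h | h <;> simp [h]

lemma sgn_congr {m n : ℤ} (h : Even (m - n)) : sgn K m = sgn K n := by
  have : m = (m - n) + n := by ring
  rw [this, sgn_add, sgn_even K h, one_mul]

end Signs

namespace FreeCGA

section Odd

variable {K : Type*} [Field K] {ι : Type*} {deg : ι → ℤ}

lemma mon_perm {l l' : List ι} (h : l.Perm l') :
    ∃ s : K, (s = 1 ∨ s = -1) ∧ mon K deg l = s • mon K deg l' := by
  induction h with
  | nil => exact ⟨1, Or.inl rfl, by simp⟩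
  | cons x _ ih =>
    obtain ⟨s, hs, e⟩ := ih
    exact ⟨s, hs, by rw [mon_cons, mon_cons, e, mul_smul_comm]⟩
  | swap x y l =>
    refine ⟨sgn K (deg y * deg x), sgn_eq_or K _, ?_⟩
    simp only [mon_cons]
    rw [← mul_assoc, gen_mul_gen, smul_mul_assoc, mul_assoc]
  | trans _ _ ih1 ih2 =>
    obtain ⟨s, hs, e⟩ := ih1
    obtain ⟨t, ht, e'⟩ := ih2
    refine ⟨s * t, ?_, by rw [e, e', smul_smul]⟩
    rcases hs with rfl | rfl <;> rcases ht with rfl | rfl <;> simp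

variable [CharZero K]

/-- The relation gives a² = -a², and 2 is invertible in characteristic zero. -/
lemma gen_mul_self {i : ι} (h : Odd (deg i)) : gen K deg i * gen K deg i = 0 := by
  have := gen_mul_gen (K := K) deg i i
  rw [sgn_odd K (h.mul h), neg_one_smul] at this
  have h2 : (2 : K) • (gen K deg i * gen K deg i) = 0 := by
    rw [two_smul]; nth_rewrite 1 [this]; simp
  exact (smul_eq_zero.1 h2).resolve_left two_ne_zero

lemma mon_eq_zero [DecidableEq ι] {i : ι} (h : Odd (deg i)) {l : List ι} (hl : 2 ≤ l.count i) :
    mon K deg l = 0 := by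
  have h1 : i ∈ l := List.count_pos_iff.1 (by omega)
  have h2 : i ∈ l.erase i := by
    apply List.count_pos_iff.1; rw [List.count_erase_self]; omega
  obtain ⟨s, -, e⟩ := mon_perm (K := K) (deg := deg)
    ((List.perm_cons_erase h1).trans ((List.perm_cons_erase h2).cons i))
  rw [e, mon_cons, mon_cons, ← mul_assoc, gen_mul_self h, zero_mul, smul_zero]

end Odd

/-! ### Derivations -/

section Derivations

variable {K : Type*} [Field K] {ι κ : Type*} {deg : ι → ℤ} {deg' : κ → ℤ}
variable {A : Type*} [Ring A] [Algebra K A]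

/-- `θ` is a derivation of degree `k` along the algebra homomorphism `φ`. -/
structure IsDer (φ : FreeCGA K deg →ₐ[K] A) (k : ℤ) (θ : FreeCGA K deg →ₗ[K] A) : Prop where
  one : θ 1 = 0
  gen_mul : ∀ i x, θ (gen K deg i * x) =
    θ (gen K deg i) * φ x + sgn K (k * deg i) • (φ (gen K deg i) * θ x)

namespace IsDer

variable {φ : FreeCGA K deg →ₐ[K] A} {k : ℤ} {θ θ' : FreeCGA K deg →ₗ[K] A}

lemma mul (h : IsDer φ k θ) {n : ℤ} {x : FreeCGA K deg} (hx : x ∈ part K deg n)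
    (y : FreeCGA K deg) : θ (x * y) = θ x * φ y + sgn K (k * n) • (φ x * θ y) := by
  rw [mem_part_lspan] at hx
  refine eq_of_lspan (f := θ ∘ₗ LinearMap.mulRight K y)
    (g := LinearMap.mulRight K (φ y) ∘ₗ θ +
      sgn K (k * n) • (LinearMap.mulRight K (θ y) ∘ₗ φ.toLinearMap)) ?_ hx
  rintro l rfl
  simp only [LinearMap.comp_apply, LinearMap.mulRight_apply, LinearMap.add_apply,
    LinearMap.smul_apply, AlgHom.toLinearMap_apply]
  clear hx
  induction l with
  | nil => simp [h.one, sgn_zero]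
  | cons i l ih =>
    rw [mon_cons, mul_assoc, h.gen_mul, ih, h.gen_mul, wt_cons, mul_add k, sgn_add]
    simp only [map_mul, mul_add, add_mul, smul_add, mul_smul_comm, smul_mul_assoc, smul_smul,
      mul_assoc, add_assoc]

/-- The operator identities below rest on this: both sides are derivations of the same degree along
the same homomorphism, so only generators need checking. -/
lemma ext (h : IsDer φ k θ) (h' : IsDer φ k θ')
    (e : ∀ i, θ (gen K deg i) = θ' (gen K deg i)) (x) : θ x = θ' x := by
  refine eq_of_mon (fun l => ?_) x
  induction l with
  | nil => simp [h.one, h'.one]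
  | cons i l ih => rw [mon_cons, h.gen_mul, h'.gen_mul, ih, e]

lemma eq_zero (h : IsDer φ k θ) (e : ∀ i, θ (gen K deg i) = 0) (x) : θ x = 0 :=
  h.ext (θ' := 0) ⟨rfl, by simp⟩ e x

lemma add (h : IsDer φ k θ) (h' : IsDer φ k θ') : IsDer φ k (θ + θ') where
  one := by simp [h.one, h'.one]
  gen_mul i x := by
    simp only [LinearMap.add_apply, h.gen_mul, h'.gen_mul, add_mul, mul_add, smul_add]; abel

lemma smul (h : IsDer φ k θ) (c : K) : IsDer φ k (c • θ) where
  one := by simp [h.one]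
  gen_mul i x := by
    simp only [LinearMap.smul_apply, h.gen_mul, smul_add, smul_mul_assoc, mul_smul_comm]
    rw [smul_comm c]

lemma sum {υ : Type*} (s : Finset υ) {θ : υ → FreeCGA K deg →ₗ[K] A}
    (h : ∀ u ∈ s, IsDer φ k (θ u)) : IsDer φ k (∑ u ∈ s, θ u) where
  one := by
    rw [LinearMap.sum_apply]; exact Finset.sum_eq_zero fun u hu => (h u hu).one
  gen_mul i x := by
    simp only [LinearMap.sum_apply, Finset.sum_mul, Finset.mul_sum, Finset.smul_sum]
    rw [← Finset.sum_add_distrib]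
    exact Finset.sum_congr rfl fun u hu => (h u hu).gen_mul i x

lemma congr_degree (h : IsDer φ k θ) {k' : ℤ} (e : Even (k - k')) : IsDer φ k' θ where
  one := h.one
  gen_mul i x := by
    rw [h.gen_mul, sgn_congr K (n := k' * deg i)]
    rw [← sub_mul]; exact e.mul_right _

lemma algHom_comp {A' : Type*} [Ring A'] [Algebra K A'] (h : IsDer φ k θ) (ψ : A →ₐ[K] A') :
    IsDer (ψ.comp φ) k (ψ.toLinearMap ∘ₗ θ) where
  one := by simp [h.one]
  gen_mul i x := by simp [h.gen_mul]

lemma comp_algHom (h : IsDer φ k θ) (ψ : FreeCGA K deg' →ₐ[K] FreeCGA K deg)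
    (hψ : ∀ i, ψ (gen K deg' i) ∈ part K deg (deg' i)) :
    IsDer (φ.comp ψ) k (θ ∘ₗ ψ.toLinearMap) where
  one := by simp [h.one]
  gen_mul i x := by
    simp only [LinearMap.comp_apply, AlgHom.toLinearMap_apply, map_mul, h.mul (hψ i),
      AlgHom.comp_apply]

end IsDer

section Weights

variable {w : ι → ℤ} {w' : κ → ℤ}

lemma algHom_map_wge {φ : FreeCGA K deg →ₐ[K] FreeCGA K deg'}
    (h : ∀ i, φ (gen K deg i) ∈ wge K deg' w' (w i)) {n : ℤ} {x : FreeCGA K deg}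
    (hx : x ∈ wge K deg w n) : φ x ∈ wge K deg' w' n := by
  refine map_mem_of_lspan (f := φ.toLinearMap) (fun l hl => ?_) hx
  refine wge_anti w' hl ?_
  clear hl
  induction l with
  | nil => simpa using mon_mem_wge (K := K) (deg := deg') (w := w') (l := []) (n := 0) (by simp)
  | cons i l ih =>
    simp only [mon_cons, wt_cons, AlgHom.toLinearMap_apply, map_mul] at *
    exact mul_mem_wge (h i) ih

lemma algHom_map_wpart {φ : FreeCGA K deg →ₐ[K] FreeCGA K deg'}
    (h : ∀ i, φ (gen K deg i) ∈ wpart K deg' w' (w i)) {n : ℤ} {x : FreeCGA K deg}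
    (hx : x ∈ wpart K deg w n) : φ x ∈ wpart K deg' w' n := by
  refine map_mem_of_lspan (f := φ.toLinearMap) (fun l hl => ?_) hx
  rw [← show wt w l = n from hl]
  clear hl
  induction l with
  | nil => simpa using mon_mem_wpart (K := K) (deg := deg') w' []
  | cons i l ih =>
    simp only [mon_cons, wt_cons, AlgHom.toLinearMap_apply, map_mul] at *
    exact mul_mem_wpart (h i) ih

lemma algHom_map_part {φ : FreeCGA K deg →ₐ[K] FreeCGA K deg'}
    (h : ∀ i, φ (gen K deg i) ∈ part K deg' (deg i)) {n : ℤ} {x : FreeCGA K deg}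
    (hx : x ∈ part K deg n) : φ x ∈ part K deg' n := by
  simp only [part_eq_wpart] at *
  exact algHom_map_wpart h hx

namespace IsDer

variable {k r : ℤ} {θ : FreeCGA K deg →ₗ[K] FreeCGA K deg}

lemma map_wge (hθ : IsDer (AlgHom.id K _) k θ)
    (h : ∀ i, θ (gen K deg i) ∈ wge K deg w (w i + r)) {n : ℤ} {x : FreeCGA K deg}
    (hx : x ∈ wge K deg w n) : θ x ∈ wge K deg w (n + r) := by
  refine map_mem_of_lspan (fun l hl => ?_) hx
  refine wge_anti w (add_le_add_left hl r) ?_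
  clear hl
  induction l with
  | nil => simp [hθ.one]
  | cons i l ih =>
    rw [mon_cons, hθ.gen_mul, wt_cons]
    refine add_mem ?_ (Submodule.smul_mem _ _ ?_)
    · rw [add_right_comm]
      exact mul_mem_wge (h i) (mon_mem_wge le_rfl)
    · rw [add_assoc]
      exact mul_mem_wge (gen_mem_wge w i) ih

lemma map_wpart (hθ : IsDer (AlgHom.id K _) k θ)
    (h : ∀ i, θ (gen K deg i) ∈ wpart K deg w (w i + r)) {n : ℤ} {x : FreeCGA K deg}
    (hx : x ∈ wpart K deg w n) : θ x ∈ wpart K deg w (n + r) := by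
  refine map_mem_of_lspan (fun l hl => ?_) hx
  rw [← show wt w l = n from hl]
  clear hl
  induction l with
  | nil => simp [hθ.one]
  | cons i l ih =>
    rw [mon_cons, hθ.gen_mul, wt_cons]
    refine add_mem ?_ (Submodule.smul_mem _ _ ?_)
    · rw [add_right_comm]
      exact mul_mem_wpart (h i) (mon_mem_wpart w l)
    · rw [add_assoc]
      exact mul_mem_wpart (gen_mem_wpart w i) ih

lemma map_part (hθ : IsDer (AlgHom.id K _) k θ)
    (h : ∀ i, θ (gen K deg i) ∈ part K deg (deg i + r)) {n : ℤ} {x : FreeCGA K deg}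
    (hx : x ∈ part K deg n) : θ x ∈ part K deg (n + r) := by
  simp only [part_eq_wpart] at *
  exact hθ.map_wpart h hx

/-- The graded commutator of two derivations is a derivation. -/
lemma commutator {k' : ℤ} {θ' : FreeCGA K deg →ₗ[K] FreeCGA K deg}
    (hθ : IsDer (AlgHom.id K _) k θ) (hθ' : IsDer (AlgHom.id K _) k' θ')
    (h : ∀ i, θ (gen K deg i) ∈ part K deg (deg i + k))
    (h' : ∀ i, θ' (gen K deg i) ∈ part K deg (deg i + k')) :
    IsDer (AlgHom.id K _) (k + k') (θ ∘ₗ θ' - sgn K (k * k') • (θ' ∘ₗ θ)) where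
  one := by simp [hθ.one, hθ'.one]
  gen_mul i x := by
    simp only [LinearMap.sub_apply, LinearMap.comp_apply, LinearMap.smul_apply, hθ.gen_mul,
      hθ'.gen_mul, map_add, map_smul, AlgHom.coe_id, id, hθ.mul (h' i), hθ'.mul (h i)]
    have e1 : sgn K (k * (deg i + k')) = sgn K (k * deg i) * sgn K (k * k') := by
      rw [← sgn_add]; ring_nf
    have e2 : sgn K (k' * (deg i + k)) = sgn K (k' * deg i) * sgn K (k * k') := by
      rw [← sgn_add]; ring_nf
    have e3 : sgn K ((k + k') * deg i) = sgn K (k * deg i) * sgn K (k' * deg i) := by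
      rw [← sgn_add]; ring_nf
    have e4 := sgn_mul_self K (k * k')
    rw [e1, e2, e3]
    simp only [sub_mul, mul_sub, smul_add, smul_sub, smul_smul, smul_mul_assoc, mul_smul_comm]
    rw [show sgn K (k * k') * (sgn K (k' * deg i) * sgn K (k * k')) = sgn K (k' * deg i) by
        rw [mul_left_comm, e4, mul_one]]
    module

/-- Left multiplication by a homogeneous element sends derivations to derivations. -/
lemma mulLeft {j : ℤ} {c : FreeCGA K deg} (hc : c ∈ part K deg j)
    (hθ : IsDer (AlgHom.id K _) k θ) :
    IsDer (AlgHom.id K _) (j + k) (LinearMap.mulLeft K c ∘ₗ θ) where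
  one := by simp [hθ.one]
  gen_mul i x := by
    simp only [LinearMap.comp_apply, LinearMap.mulLeft_apply, hθ.gen_mul, mul_add,
      AlgHom.coe_id, id, mul_smul_comm, mul_assoc]
    congr 1
    rw [← mul_assoc, graded_comm hc (gen_mem_part deg i), smul_mul_assoc, smul_smul, add_mul,
      sgn_add, mul_comm (sgn K (j * deg i)), mul_assoc]

end IsDer

end Weights

lemma Differential.isDer (d : Differential K deg) : IsDer (AlgHom.id K _) 1 d.toLin where
  one := d.map_one
  gen_mul i x := by
    rw [d.leibniz _ _ _ (gen_mem_part deg i), one_mul]; rfl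

variable (K) in
/-- The Euler derivation, which multiplies elements of weight `k` by `k`. -/
def euler (deg w : ι → ℤ) : FreeCGA K deg →ₗ[K] FreeCGA K deg :=
  wsum w fun k => (k : K) • LinearMap.id

lemma euler_mon (w : ι → ℤ) (l : List ι) :
    euler K deg w (mon K deg l) = (wt w l : K) • mon K deg l := by
  simp [euler, wsum_mon]

lemma euler_of_mem {w : ι → ℤ} {n : ℤ} {x : FreeCGA K deg} (hx : x ∈ wpart K deg w n) :
    euler K deg w x = (n : K) • x := by
  simp [euler, wsum_of_mem _ hx]

lemma euler_isDer (w : ι → ℤ) : IsDer (AlgHom.id K (FreeCGA K deg)) 0 (euler K deg w) where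
  one := by simpa using euler_mon (K := K) (deg := deg) w []
  gen_mul i x := by
    refine eq_of_mon (f := euler K deg w ∘ₗ LinearMap.mulLeft K (gen K deg i))
      (g := LinearMap.mulLeft K (euler K deg w (gen K deg i)) +
        sgn K (0 * deg i) • LinearMap.mulLeft K (gen K deg i) ∘ₗ euler K deg w) (fun l => ?_) x
    simp only [LinearMap.comp_apply, LinearMap.mulLeft_apply, LinearMap.add_apply,
      LinearMap.smul_apply]
    rw [← mon_cons, euler_mon, euler_mon, euler_of_mem (gen_mem_wpart w i), zero_mul, sgn_zero,
      one_smul, wt_cons, mon_cons, smul_mul_assoc, mul_smul_comm, ← add_smul]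
    push_cast; rfl

/-- Upper triangular matrices encoding a derivation of degree `k`. -/
def derMat (k : ℤ) (δ : ι → FreeCGA K deg) (hδ : ∀ i, δ i ∈ part K deg (deg i + k)) :
    FreeCGA K deg →ₐ[K] Matrix (Fin 2) (Fin 2) (FreeCGA K deg) :=
  lift deg (fun i => !![sgn K (k * deg i) • gen K deg i, δ i; 0, gen K deg i]) (fun i j => by
    have e1 := gen_mul_gen (K := K) deg i j
    have e2 := gen_mul i (hδ j)
    have e3 := gen_mul j (hδ i)
    have hij := sgn_mul_self K (deg i * deg j)
    have hki := sgn_mul_self K (k * deg i)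
    have hkj := sgn_mul_self K (k * deg j)
    rw [mul_add, sgn_add, mul_comm _ k] at e2 e3
    rw [mul_comm (deg j) (deg i)] at e3
    ext a b
    fin_cases a <;> fin_cases b
    · simp [e1, smul_smul]
      ring_nf
    · simp only [Matrix.mul_fin_two, Matrix.smul_apply]
      simp only [Matrix.of_apply, Matrix.cons_val', Matrix.cons_val_zero, Matrix.cons_val_one,
        Matrix.cons_val_fin_one, Fin.zero_eta, Fin.mk_one, smul_mul_assoc, e2, e3, smul_add,
        smul_smul]
      rw [show sgn K (k * deg i) * (sgn K (deg i * deg j) * sgn K (k * deg i))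
          = sgn K (deg i * deg j) * (sgn K (k * deg i) * sgn K (k * deg i)) by ring, hki,
        show sgn K (deg i * deg j) * (sgn K (k * deg j) * (sgn K (deg i * deg j) * sgn K (k * deg j)))
          = (sgn K (deg i * deg j) * sgn K (deg i * deg j)) * (sgn K (k * deg j) * sgn K (k * deg j))
          by ring, hij, hkj, mul_one, mul_one, one_smul, add_comm]
    · simp
    · simp [e1])

lemma derMat_gen (k : ℤ) (δ : ι → FreeCGA K deg) (hδ : ∀ i, δ i ∈ part K deg (deg i + k)) (i : ι) :
    derMat k δ hδ (gen K deg i) = !![sgn K (k * deg i) • gen K deg i, δ i; 0, gen K deg i] :=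
  lift_gen _ _ _ _

lemma derMat_diag (k : ℤ) (δ : ι → FreeCGA K deg) (hδ : ∀ i, δ i ∈ part K deg (deg i + k)) (x) :
    derMat k δ hδ x 1 0 = 0 ∧ derMat k δ hδ x 1 1 = x := by
  induction x using induction with
  | h0 c => simp [Matrix.algebraMap_matrix_apply]
  | h1 i => rw [derMat_gen]; simp
  | hm x y hx hy =>
    simp only [map_mul, Matrix.mul_apply, Fin.sum_univ_two, hx.1, hx.2, hy.1, hy.2]
    simp
  | ha x y hx hy =>
    simp only [map_add, Matrix.add_apply, hx.1, hx.2, hy.1, hy.2]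
    simp

/-- The derivation of degree `k` with given values on the generators. -/
def der (k : ℤ) (δ : ι → FreeCGA K deg) (hδ : ∀ i, δ i ∈ part K deg (deg i + k)) :
    FreeCGA K deg →ₗ[K] FreeCGA K deg :=
  Matrix.entryLinearMap K (FreeCGA K deg) 0 1 ∘ₗ (derMat k δ hδ).toLinearMap

lemma der_gen (k : ℤ) (δ : ι → FreeCGA K deg) (hδ : ∀ i, δ i ∈ part K deg (deg i + k)) (i : ι) :
    der k δ hδ (gen K deg i) = δ i := by
  simp [der, derMat_gen]

lemma der_isDer (k : ℤ) (δ : ι → FreeCGA K deg) (hδ : ∀ i, δ i ∈ part K deg (deg i + k)) :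
    IsDer (AlgHom.id K _) k (der k δ hδ) where
  one := by simp [der]
  gen_mul i x := by
    have h1 : der k δ hδ (gen K deg i * x) =
        (derMat k δ hδ (gen K deg i) * derMat k δ hδ x) 0 1 := by simp [der]
    rw [h1, Matrix.mul_apply, Fin.sum_univ_two, (derMat_diag k δ hδ x).2, derMat_gen]
    simp [der, derMat_gen, add_comm]

/-- A derivation of degree `1` whose square vanishes on the generators is a differential. -/
def Differential.ofGens (θ : FreeCGA K deg →ₗ[K] FreeCGA K deg) (hθ : IsDer (AlgHom.id K _) 1 θ)
    (h : ∀ i, θ (gen K deg i) ∈ part K deg (deg i + 1))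
    (h2 : ∀ i, θ (θ (gen K deg i)) = 0) : Differential K deg where
  toLin := θ
  map_part _ _ hx := hθ.map_part h hx
  leibniz n x y hx := by rw [hθ.mul hx, one_mul]; rfl
  sq_zero x := by
    have h3 := hθ.commutator hθ h h
    rw [mul_one, sgn_odd K odd_one] at h3
    have h4 : ∀ x, (θ ∘ₗ θ) x = 0 := by
      -- On a product the two cross terms of θ² carry opposite signs, because θ changes the degree
      -- of the generator by one. So θ² is a derivation of degree 2 that vanishes on generators.
      refine IsDer.eq_zero (φ := AlgHom.id K _) (k := 1 + 1) ⟨by simp [hθ.one], fun i x => ?_⟩ h2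
      have := hθ.mul (x := θ (gen K deg i)) (h i) x
      simp only [LinearMap.comp_apply, hθ.gen_mul, map_add, map_smul, this, h2, AlgHom.coe_id, id]
      have e1 : sgn K (1 * (deg i + 1)) = - sgn K (1 * deg i) := by
        rw [one_mul, one_mul, sgn_add, sgn_odd K odd_one]; ring
      have e2 : sgn K ((1 + 1) * deg i) = 1 := sgn_even K ⟨deg i, by ring⟩
      rw [e1, e2]
      simp [smul_add, smul_smul, sgn_mul_self K (deg i)]
    exact h4 x

end Derivations

end FreeCGA

open FreeCGA

/-! ### Maps linear over the base, and their determination by monomials of the fibre. -/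

section HomDeg

variable {K : Type*} [Field K] {κ υ : Type*} {degB : κ → ℤ} {degU : υ → ℤ}

@[simp] lemma inl_gen (b : κ) : inl degB degU (gen K degB b) = gen K (Sum.elim degB degU) (.inl b) :=
  map_gen _ _ _

@[simp] lemma inr_gen (u : υ) : inr degB degU (gen K degU u) = gen K (Sum.elim degB degU) (.inr u) :=
  map_gen _ _ _

lemma inl_mem_part {n : ℤ} {b : FreeCGA K degB} (hb : b ∈ part K degB n) :
    inl degB degU b ∈ part K (Sum.elim degB degU) n := map_mem_part _ _ hb

lemma gen_inl_mem_part (b : κ) :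
    gen K (Sum.elim degB degU) (.inl b) ∈ part K (Sum.elim degB degU) (degB b) :=
  gen_mem_part (Sum.elim degB degU) (Sum.inl b)

/-- It is enough to check linearity over the base on the generators of the base. -/
lemma mem_homDeg_of_gens {n : ℤ} {f : FreeCGA K (Sum.elim degB degU) →ₗ[K] FreeCGA K degB}
    (h1 : ∀ l, f (mon K (Sum.elim degB degU) l) ∈ part K degB (wt (Sum.elim degB degU) l + n))
    (h2 : ∀ b x, f (gen K (Sum.elim degB degU) (.inl b) * x) =
      sgn K (degB b * n) • (gen K degB b * f x)) : f ∈ homDeg degB degU n := by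
  refine ⟨fun k x hx => ?_, fun k b hb x => ?_⟩
  · rw [mem_part_lspan] at hx
    refine map_mem_of_lspan ?_ hx
    rintro l rfl
    exact h1 l
  · rw [mem_part_lspan] at hb
    refine eq_of_lspan (f := f ∘ₗ LinearMap.mulRight K x ∘ₗ (inl degB degU).toLinearMap)
      (g := sgn K (k * n) • LinearMap.mulRight K (f x)) ?_ hb
    rintro l rfl
    simp only [LinearMap.comp_apply, LinearMap.mulRight_apply, LinearMap.smul_apply,
      AlgHom.toLinearMap_apply]
    clear hb
    induction l with
    | nil => simp [sgn_zero]
    | cons i l ih =>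
      rw [mon_cons, map_mul (inl degB degU), inl_gen, mul_assoc, h2, ih, wt_cons, add_mul, sgn_add,
        mul_smul_comm, smul_smul, mul_assoc]

lemma homDeg_gen {n : ℤ} {f : FreeCGA K (Sum.elim degB degU) →ₗ[K] FreeCGA K degB}
    (hf : f ∈ homDeg degB degU n) (b : κ) (x) :
    f (gen K (Sum.elim degB degU) (.inl b) * x) = sgn K (degB b * n) • (gen K degB b * f x) := by
  rw [← hf.2 _ _ (gen_mem_part degB b) x, inl_gen]

/-- Every monomial is, up to sign, a product of a monomial in the base and one in the fibre. -/
lemma mon_split (l : List (κ ⊕ υ)) : ∃ (l1 : List κ) (l2 : List υ) (s : K), (s = 1 ∨ s = -1) ∧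
    l.Perm (l1.map .inl ++ l2.map .inr) ∧
    mon K (Sum.elim degB degU) l = s • (inl degB degU (mon K degB l1) * inr degB degU (mon K degU l2)) := by
  have h : ∃ (l1 : List κ) (l2 : List υ), l.Perm (l1.map .inl ++ l2.map .inr) := by
    induction l with
    | nil => exact ⟨[], [], by simp⟩
    | cons a l ih =>
      obtain ⟨l1, l2, h⟩ := ih
      rcases a with a | a
      · exact ⟨a :: l1, l2, by simpa using h⟩
      · exact ⟨l1, a :: l2, (h.cons _).trans (by simpa using List.perm_middle.symm)⟩
  obtain ⟨l1, l2, h⟩ := h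
  obtain ⟨s, hs, e⟩ := mon_perm (K := K) (deg := Sum.elim degB degU) h
  refine ⟨l1, l2, s, hs, h, ?_⟩
  have e1 : ∀ l : List κ, mon K (Sum.elim degB degU) (l.map .inl) = inl degB degU (mon K degB l) := by
    intro l
    induction l with
    | nil => simp
    | cons a l ih => simp [ih]
  have e2 : ∀ l : List υ, mon K (Sum.elim degB degU) (l.map .inr) = inr degB degU (mon K degU l) := by
    intro l
    induction l with
    | nil => simp
    | cons a l ih => simp [ih]
  rw [e, mon_append, e1, e2]

/-- Elements of `homDeg` are determined by their values on the monomials of the fibre. -/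
lemma homDeg_ext {n : ℤ} {f g : FreeCGA K (Sum.elim degB degU) →ₗ[K] FreeCGA K degB}
    (hf : f ∈ homDeg degB degU n) (hg : g ∈ homDeg degB degU n)
    (h : ∀ l, f (inr degB degU (mon K degU l)) = g (inr degB degU (mon K degU l))) : f = g := by
  refine LinearMap.ext (eq_of_mon fun l => ?_)
  obtain ⟨l1, l2, s, -, -, e⟩ := mon_split (K := K) (degB := degB) (degU := degU) l
  rw [e, map_smul, map_smul, hf.2 _ _ (mon_mem_part l1), hg.2 _ _ (mon_mem_part l1), h]

end HomDeg

/-- The data of a differential on `B ⊗ ∧V̄` whose leading term is that of a Koszul complex: the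
generator `v̄` is sent to `∑ A v k • e k`, up to terms of larger filtration. -/
structure KoszulData (K : Type*) [Field K] (p q : ℕ) (β : Type*) where
  deg : Fin p ⊕ Fin q → ℤ
  two_le : ∀ v, 2 ≤ deg v
  even : ∀ i, Even (deg (.inl i))
  odd : ∀ j, Odd (deg (.inr j))
  degB : β → ℤ
  two_le_B : ∀ b, 2 ≤ degB b
  e : Fin p ⊕ Fin q → β
  inj : Function.Injective e
  deg_e : ∀ v, degB (e v) = deg v
  dB : Differential K degB
  D : Differential K (Sum.elim degB (barDeg deg))
  D_inl : ∀ b, D (inl _ _ b) = inl _ _ (dB b)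
  -- `A` and `A'` are mutually inverse and preserve degrees, so the leading terms of the D v̄ are as
  -- good a system of coordinates as the generators `e k`.
  A : Fin p ⊕ Fin q → Fin p ⊕ Fin q → K
  A' : Fin p ⊕ Fin q → Fin p ⊕ Fin q → K
  A_deg : ∀ v k, A v k ≠ 0 → deg v = deg k
  A'_deg : ∀ k v, A' k v ≠ 0 → deg k = deg v
  A_mul : ∀ u v, ∑ k, A u k * A' k v = if u = v then 1 else 0
  A'_mul : ∀ k l, ∑ v, A' k v * A v l = if k = l then 1 else 0
  -- The weight of the even generators. It dominates all degrees, so that degree minus weight is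
  -- nonpositive on even generators of the base; the filtration of a single map is bounded below for
  -- this reason.
  Lam : ℤ
  le_Lam : ∀ b, degB b ≤ Lam
  one_le_Lam : 1 ≤ Lam
  dB_raise : ∀ b, dB (gen K degB b) ∈ wge K degB (fun b => if Even (degB b) then Lam else 1)
    ((if Even (degB b) then Lam else 1) + 1)
  D_raise : ∀ v, D (gen K _ (.inr v)) - ∑ k, A v k • gen K _ (.inl (e k)) ∈
    wge K (Sum.elim degB (barDeg deg)) (Sum.elim (fun b => if Even (degB b) then Lam else 1)
      (Sum.elim (fun _ => Lam) (fun _ => 1))) (Sum.elim (fun _ => Lam) (fun _ => 1) v + 1)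

/-! ### The Koszul differential, partial derivatives and Euler identities. -/

namespace KoszulData

variable {K : Type*} [Field K] {p q : ℕ} {β : Type*} (S : KoszulData K p q β)

/-- The degrees of the generators of `B ⊗ ∧V̄`. -/
abbrev degP : β ⊕ (Fin p ⊕ Fin q) → ℤ := Sum.elim S.degB (barDeg S.deg)

/-- The algebra `B`. -/
abbrev B : Type _ := FreeCGA K S.degB

/-- The algebra `B ⊗ ∧V̄`. -/
abbrev P : Type _ := FreeCGA K S.degP

/-- The generator `v̄`. -/
abbrev bar (v : Fin p ⊕ Fin q) : S.P := gen K S.degP (.inr v)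

/-- The generator of `B ⊗ ∧V̄` coming from a generator of `B`. -/
abbrev base (b : β) : S.P := gen K S.degP (.inl b)

variable (K p q) in
/-- The sign of the parity of a basis element. -/
def nu : Fin p ⊕ Fin q → ℤ := Sum.elim (fun _ => 1) (fun _ => -1)

open Classical in
/-- The weight counting the `t_x` minus the `t_y`. -/
def nuB (b : β) : ℤ := ∑ v, if S.e v = b then nu p q v else 0

/-- The weight counting the `t_x` and `x̄` minus the `t_y` and `ȳ`. -/
def nuP : β ⊕ (Fin p ⊕ Fin q) → ℤ := Sum.elim S.nuB (nu p q)

/-- The leading term of `D v̄`. -/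
def w (v : Fin p ⊕ Fin q) : S.B := ∑ k, S.A v k • gen K S.degB (S.e k)

open Classical in
/-- The coefficients of the derivations `∂_v`. -/
def coef (b : β) (v : Fin p ⊕ Fin q) : K := ∑ k, if S.e k = b then S.A' k v else 0

lemma coef_e (k v : Fin p ⊕ Fin q) : S.coef (S.e k) v = S.A' k v := by
  classical
  unfold coef
  rw [Finset.sum_eq_single k]
  · simp
  · intro l _ hl; rw [if_neg fun h => hl (S.inj h)]
  · simp

lemma coef_ne {b : β} {v : Fin p ⊕ Fin q} (h : S.coef b v ≠ 0) : S.degB b = S.deg v := by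
  classical
  obtain ⟨k, -, hk⟩ := Finset.exists_ne_zero_of_sum_ne_zero h
  split_ifs at hk with h1
  · rw [← h1, S.deg_e, S.A'_deg _ _ hk]
  · exact absurd rfl hk

lemma nuB_e (v : Fin p ⊕ Fin q) : S.nuB (S.e v) = nu p q v := by
  classical
  unfold nuB
  rw [Finset.sum_eq_single v]
  · simp
  · intro l _ hl; rw [if_neg fun h => hl (S.inj h)]
  · simp

lemma nu_eq_of_deg {u v : Fin p ⊕ Fin q} (h : S.deg u = S.deg v) : nu p q u = nu p q v := by
  rcases u with i | i <;> rcases v with j | j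
  · rfl
  · have h1 := S.even i; have h2 := S.odd j; rw [h] at h1
    exact absurd h1 (Int.not_even_iff_odd.2 h2)
  · have h1 := S.even j; have h2 := S.odd i; rw [h] at h2
    exact absurd h1 (Int.not_even_iff_odd.2 h2)
  · rfl

lemma coef_smul_mem (b : β) (v : Fin p ⊕ Fin q) {κ : Type*} (deg' : κ → ℤ) :
    S.coef b v • (1 : FreeCGA K deg') ∈ part K deg' (S.degB b + -S.deg v) := by
  by_cases h : S.coef b v = 0
  · rw [h, zero_smul]; exact zero_mem _
  · rw [S.coef_ne h, add_neg_cancel]; exact Submodule.smul_mem _ _ (one_mem_part _)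

lemma w_mem (v : Fin p ⊕ Fin q) : S.w v ∈ part K S.degB (S.deg v) := by
  refine Submodule.sum_mem _ fun k _ => ?_
  by_cases h : S.A v k = 0
  · rw [h, zero_smul]; exact zero_mem _
  · rw [S.A_deg _ _ h, ← S.deg_e]; exact Submodule.smul_mem _ _ (gen_mem_part _ _)

/-- The derivation `∂_v` of `B`. -/
def parB (v : Fin p ⊕ Fin q) : S.B →ₗ[K] S.B :=
  der (-S.deg v) (fun b => S.coef b v • 1) (fun b => S.coef_smul_mem b v _)

/-- The derivation `∂_v` of `B ⊗ ∧V̄`, vanishing on `V̄`. -/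
def parP (v : Fin p ⊕ Fin q) : S.P →ₗ[K] S.P :=
  der (-S.deg v) (Sum.elim (fun b => S.coef b v • 1) (fun _ => 0)) (by
    rintro (b | u)
    · exact S.coef_smul_mem b v _
    · exact zero_mem _)

/-- The contraction of `B ⊗ ∧V̄` by the basis element dual to `v̄`. -/
def contr (v : Fin p ⊕ Fin q) : S.P →ₗ[K] S.P :=
  der (-(S.deg v - 1)) (Sum.elim (fun _ => 0) (fun u => if u = v then 1 else 0)) (by
    rintro (b | u)
    · exact zero_mem _
    · by_cases h : u = v
      · subst h; simp [barDeg, one_mem_part]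
      · simp [h])

/-- The Koszul differential of `B ⊗ ∧V̄`. -/
def kos : S.P →ₗ[K] S.P :=
  der 1 (Sum.elim (fun _ => 0) (fun v => inl _ _ (S.w v))) (by
    rintro (b | v)
    · exact zero_mem _
    · simpa [barDeg] using inl_mem_part (S.w_mem v))

lemma parB_isDer (v) : IsDer (AlgHom.id K _) (-S.deg v) (S.parB v) := der_isDer _ _ _
lemma parP_isDer (v) : IsDer (AlgHom.id K _) (-S.deg v) (S.parP v) := der_isDer _ _ _
lemma contr_isDer (v) : IsDer (AlgHom.id K _) (-(S.deg v - 1)) (S.contr v) := der_isDer _ _ _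
lemma kos_isDer : IsDer (AlgHom.id K _) 1 S.kos := der_isDer _ _ _

@[simp] lemma parB_gen (v b) : S.parB v (gen K S.degB b) = S.coef b v • 1 := der_gen _ _ _ _
@[simp] lemma parP_base (v b) : S.parP v (S.base b) = S.coef b v • 1 := der_gen _ _ _ _
@[simp] lemma parP_bar (v u) : S.parP v (S.bar u) = 0 := der_gen _ _ _ _
@[simp] lemma contr_base (v b) : S.contr v (S.base b) = 0 := der_gen _ _ _ _
@[simp] lemma contr_bar (v u) : S.contr v (S.bar u) = if u = v then 1 else 0 := der_gen _ _ _ _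
@[simp] lemma kos_base (b) : S.kos (S.base b) = 0 := der_gen _ _ _ _
@[simp] lemma kos_bar (v) : S.kos (S.bar v) = inl _ _ (S.w v) := der_gen _ _ _ _

/-- Since `A'` inverts `A`, the ∂_u are the partial derivatives for the coordinates w_v. -/
lemma parB_w (u v : Fin p ⊕ Fin q) : S.parB u (S.w v) = if v = u then 1 else 0 := by
  simp only [w, map_sum, map_smul, parB_gen, coef_e, smul_smul, ← Finset.sum_smul, S.A_mul]
  split_ifs <;> simp

lemma parP_w (u v : Fin p ⊕ Fin q) :
    S.parP u (inl _ _ (S.w v)) = if v = u then 1 else 0 := by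
  simp only [w, map_sum, map_smul, inl_gen, parP_base, coef_e, smul_smul, ← Finset.sum_smul,
    S.A_mul]
  split_ifs <;> simp

lemma parP_mem (v) (i : β ⊕ (Fin p ⊕ Fin q)) :
    S.parP v (gen K S.degP i) ∈ part K S.degP (S.degP i + -S.deg v) := by
  rcases i with b | u
  · rw [parP_base]; exact S.coef_smul_mem b v _
  · rw [parP_bar]; exact zero_mem _

lemma parB_mem (v) (b : β) :
    S.parB v (gen K S.degB b) ∈ part K S.degB (S.degB b + -S.deg v) := by
  rw [parB_gen]; exact S.coef_smul_mem b v _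

lemma kos_mem (i : β ⊕ (Fin p ⊕ Fin q)) :
    S.kos (gen K S.degP i) ∈ part K S.degP (S.degP i + 1) := by
  rcases i with b | u
  · rw [kos_base]; exact zero_mem _
  · rw [kos_bar]; simpa [barDeg] using inl_mem_part (S.w_mem u)

/-- The graded commutator of ∂_v with the Koszul differential is a derivation. On ū it takes the
value ∂_v w_u, which is 1 or 0, so it is the contraction dual to v̄. -/
lemma parP_kos (v) (x : S.P) :
    S.parP v (S.kos x) = sgn K (S.deg v) • S.kos (S.parP v x) + S.contr v x := by
  have h := (S.parP_isDer v).commutator S.kos_isDer (S.parP_mem v) S.kos_mem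
  have h2 := (S.contr_isDer v).congr_degree (k' := -S.deg v + 1) ⟨0, by ring⟩
  have h3 := h.ext h2 (by
    rintro (b | u)
    · simp [S.kos_isDer.one]
    · simp [parP_w]) x
  simp only [LinearMap.sub_apply, LinearMap.comp_apply, LinearMap.smul_apply] at h3
  rw [sub_eq_iff_eq_add] at h3
  rw [h3, add_comm, sgn_congr K (n := S.deg v)]
  exact ⟨-S.deg v, by ring⟩

/-- Both sides are derivations of degree 0. On a generator `e k` the left side gives ν_k times that
generator, because `A'` times `A` is the identity and `A'` only mixes basis elements of equal
degree, hence equal ν. Generators outside the image of `e` are killed by both. -/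
lemma euler_B (y : S.B) :
    ∑ v, (nu p q v : K) • (S.w v * S.parB v y) = euler K S.degB S.nuB y := by
  have h : IsDer (AlgHom.id K _) 0
      (∑ v, (nu p q v : K) • (LinearMap.mulLeft K (S.w v) ∘ₗ S.parB v)) :=
    IsDer.sum _ fun v _ => by
      simpa using ((S.parB_isDer v).mulLeft (S.w_mem v)).smul (nu p q v : K)
  have := h.ext (euler_isDer S.nuB) (fun b => ?_) y
  · simpa [LinearMap.sum_apply] using this
  · rw [euler_of_mem (gen_mem_wpart _ b)]
    simp only [LinearMap.sum_apply, LinearMap.smul_apply, LinearMap.comp_apply,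
      LinearMap.mulLeft_apply, parB_gen, mul_smul_comm, mul_one]
    by_cases hb : ∃ k, S.e k = b
    · obtain ⟨k, rfl⟩ := hb
      simp only [coef_e, nuB_e, w, Finset.smul_sum, smul_smul]
      rw [Finset.sum_comm]
      have : ∀ l, ∑ v, ((nu p q v : K) * (S.A' k v * S.A v l)) • gen K S.degB (S.e l) =
          if k = l then (nu p q k : K) • gen K S.degB (S.e k) else 0 := by
        intro l
        have e1 : ∀ v, (nu p q v : K) * (S.A' k v * S.A v l) =
            (nu p q k : K) * (S.A' k v * S.A v l) := by
          intro v
          by_cases h : S.A' k v = 0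
          · simp [h]
          · rw [S.nu_eq_of_deg (S.A'_deg _ _ h)]
        simp only [e1, ← Finset.sum_smul, ← Finset.mul_sum, S.A'_mul]
        split_ifs with h
        · subst h; simp
        · simp
      simp [this]
    · have h1 : S.nuB b = 0 := by
        classical
        exact Finset.sum_eq_zero fun v _ => if_neg fun h => hb ⟨v, h⟩
      have h2 : ∀ v, S.coef b v = 0 := fun v => by
        classical
        exact Finset.sum_eq_zero fun v _ => if_neg fun h => hb ⟨v, h⟩
      simp [h1, h2]

/-- As for B, with the contraction terms counting the v̄. -/
lemma euler_P (x : S.P) :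
    ∑ v, (nu p q v : K) • (inl _ _ (S.w v) * S.parP v x + S.bar v * S.contr v x) =
      euler K S.degP S.nuP x := by
  have h : IsDer (AlgHom.id K _) 0
      (∑ v, (nu p q v : K) • ((LinearMap.mulLeft K (inl _ _ (S.w v)) ∘ₗ S.parP v) +
        LinearMap.mulLeft K (S.bar v) ∘ₗ S.contr v)) :=
    IsDer.sum _ fun v _ => by
      have h1 := (S.parP_isDer v).mulLeft (inl_mem_part (degU := barDeg S.deg) (S.w_mem v))
      have h2 := (S.contr_isDer v).mulLeft (gen_mem_part S.degP (.inr v))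
      rw [add_neg_cancel] at h1
      rw [show S.degP (.inr v) + -(S.deg v - 1) = 0 by simp [barDeg]] at h2
      exact (h1.add h2).smul _
  have := h.ext (euler_isDer S.nuP) (fun i => ?_) x
  · simpa [LinearMap.sum_apply] using this
  · rw [euler_of_mem (gen_mem_wpart _ i)]
    simp only [LinearMap.sum_apply, LinearMap.smul_apply, LinearMap.add_apply,
      LinearMap.comp_apply, LinearMap.mulLeft_apply]
    rcases i with b | u
    · have h2 := congrArg (inl S.degB (barDeg S.deg)) (S.euler_B (gen K S.degB b))
      rw [euler_of_mem (gen_mem_wpart _ b)] at h2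
      simpa [nuP] using h2
    · simp [nuP]

end KoszulData


/-! ### The homotopy for the leading term of the Hom differential. -/

open FreeCGA

namespace KoszulData

variable {K : Type*} [Field K] {p q : ℕ} {β : Type*} (S : KoszulData K p q β)

/-- The graded linear maps of degree `n` from `B ⊗ ∧V̄` to `B`. -/
abbrev hom (n : ℤ) : Submodule K (S.P →ₗ[K] S.B) := homDeg S.degB (barDeg S.deg) n

/-- Multiplication by `v̄`. -/
abbrev mulBar (v : Fin p ⊕ Fin q) : S.P →ₗ[K] S.P := LinearMap.mulLeft K (S.bar v)

variable (K p q) in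
/-- The signs in the homotopy. -/
def sg (n : ℤ) : Fin p ⊕ Fin q → K := Sum.elim (fun _ => sgn K n) (fun _ => -1)

/-- The summand of the homotopy belonging to a basis element. -/
def hop1 (n : ℤ) (v : Fin p ⊕ Fin q) : (S.P →ₗ[K] S.B) →ₗ[K] (S.P →ₗ[K] S.B) where
  toFun f := sg K p q n v • (S.parB v ∘ₗ f ∘ₗ S.mulBar v) -
    (sg K p q n v * sgn K (S.deg v * n)) • (f ∘ₗ S.mulBar v ∘ₗ S.parP v)
  map_add' f g := by ext x; simp; abel
  map_smul' c f := by ext x; simp [smul_sub, smul_smul, mul_comm]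

/-- The homotopy for the leading term of the differential, before normalization. -/
def hop (n : ℤ) : (S.P →ₗ[K] S.B) →ₗ[K] (S.P →ₗ[K] S.B) := ∑ v, S.hop1 n v

/-- The leading term of the differential of the Hom complex. -/
def kosD (n : ℤ) : (S.P →ₗ[K] S.B) →ₗ[K] (S.P →ₗ[K] S.B) where
  toFun f := -(sgn K n • (f ∘ₗ S.kos))
  map_add' f g := by ext x; simp; abel
  map_smul' c f := by ext x; simp [smul_smul, mul_comm]

lemma hop1_apply (n v) (f : S.P →ₗ[K] S.B) (x : S.P) :
    S.hop1 n v f x = sg K p q n v • S.parB v (f (S.bar v * x)) -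
    (sg K p q n v * sgn K (S.deg v * n)) • f (S.bar v * S.parP v x) := rfl

lemma kosD_apply (n) (f : S.P →ₗ[K] S.B) (x : S.P) : S.kosD n f x = -(sgn K n • f (S.kos x)) := rfl

lemma bar_mul_base (v b) (x : S.P) : S.bar v * (S.base b * x) =
    sgn K ((S.deg v - 1) * S.degB b) • (S.base b * (S.bar v * x)) := by
  rw [← mul_assoc, gen_mul_gen, smul_mul_assoc, mul_assoc]; rfl

lemma parP_base_mul (v b) (x : S.P) : S.parP v (S.base b * x) =
    S.coef b v • x + sgn K (S.deg v * S.degB b) • (S.base b * S.parP v x) := by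
  rw [(S.parP_isDer v).gen_mul, parP_base, smul_mul_assoc]
  simp only [AlgHom.coe_id, id, one_mul, Sum.elim_inl]
  rw [sgn_congr K (n := S.deg v * S.degB b)]
  exact ⟨-(S.deg v * S.degB b), by ring⟩

lemma parB_gen_mul (v b) (x : S.B) : S.parB v (gen K S.degB b * x) =
    S.coef b v • x + sgn K (S.deg v * S.degB b) • (gen K S.degB b * S.parB v x) := by
  rw [(S.parB_isDer v).gen_mul, parB_gen, smul_mul_assoc]
  simp only [AlgHom.coe_id, id, one_mul]
  rw [sgn_congr K (n := S.deg v * S.degB b)]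
  exact ⟨-(S.deg v * S.degB b), by ring⟩

/-- Neither summand of `hop1` is linear over B: each produces an extra term in which ∂_v hits the
scalar. The two extra terms cancel, because the coefficient of ∂_v on b is nonzero only if |b| =
|v|, and then (|v| - 1)|b| is even. -/
lemma hop1_mem {n : ℤ} (v) {f : S.P →ₗ[K] S.B} (hf : f ∈ S.hom n) : S.hop1 n v f ∈ S.hom (n - 1) := by
  refine mem_homDeg_of_gens (fun l => ?_) (fun b x => ?_)
  · rw [hop1_apply]
    have hl := mon_mem_part (K := K) (deg := S.degP) l
    refine sub_mem (Submodule.smul_mem _ _ ?_) (Submodule.smul_mem _ _ ?_)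
    · have h1 := (S.parB_isDer v).map_part (S.parB_mem v)
        (hf.1 _ _ (mul_mem_part (gen_mem_part S.degP (.inr v)) hl))
      convert h1 using 1
      simp [barDeg]; ring_nf
    · have h1 := hf.1 _ _ (mul_mem_part (gen_mem_part S.degP (.inr v))
        ((S.parP_isDer v).map_part (S.parP_mem v) hl))
      convert h1 using 1
      simp [barDeg]; ring_nf
  · simp only [hop1_apply, bar_mul_base, parP_base_mul, map_smul, mul_add (S.bar v), map_add,
      mul_smul_comm, homDeg_gen hf, parB_gen_mul]
    have e1 : sgn K (S.degB b * (n - 1)) =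
        sgn K ((S.deg v - 1) * S.degB b) * sgn K (S.degB b * n) * sgn K (S.deg v * S.degB b) := by
      rw [← sgn_add, ← sgn_add]
      refine sgn_congr K ⟨-(S.deg v * S.degB b), by ring⟩
    rw [e1]
    have e2 : (sg K p q n v * (sgn K ((S.deg v - 1) * S.degB b) * sgn K (S.degB b * n)) -
        sg K p q n v * sgn K (S.deg v * n)) * S.coef b v = 0 := by
      by_cases h : S.coef b v = 0
      · rw [h, mul_zero]
      · rw [S.coef_ne h, sgn_even K (n := (S.deg v - 1) * S.deg v), one_mul, sub_self, zero_mul]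
        rw [mul_comm]; exact Int.even_mul_pred_self _
    simp only [mul_sub, mul_smul_comm, smul_sub, smul_smul, smul_add]
    have e3 : ((sg K p q n v * (sgn K ((S.deg v - 1) * S.degB b) * sgn K (S.degB b * n)) -
        sg K p q n v * sgn K (S.deg v * n)) * S.coef b v) • f (S.bar v * x) = 0 := by
      rw [e2, zero_smul]
    rw [← sub_eq_zero, ← e3]
    module

lemma hop_mem {n : ℤ} {f : S.P →ₗ[K] S.B} (hf : f ∈ S.hom n) : S.hop n f ∈ S.hom (n - 1) := by
  rw [hop, LinearMap.sum_apply]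
  exact Submodule.sum_mem _ fun v _ => S.hop1_mem v hf

lemma kos_bar_mul (v) (x : S.P) : S.kos (S.bar v * x) =
    inl _ _ (S.w v) * x - sgn K (S.deg v) • (S.bar v * S.kos x) := by
  rw [S.kos_isDer.gen_mul, kos_bar]
  simp only [AlgHom.coe_id, id, Sum.elim_inr, barDeg, one_mul, sgn_add, sub_eq_add_neg]
  rw [sgn_odd K (n := -1) (by decide)]
  simp

lemma parB_w_mul (v) (y : S.B) :
    S.parB v (S.w v * y) = y + sgn K (S.deg v) • (S.w v * S.parB v y) := by
  rw [(S.parB_isDer v).mul (S.w_mem v), parB_w, if_pos rfl]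
  simp only [AlgHom.coe_id, id, one_mul]
  rw [sgn_congr K (n := S.deg v)]
  have := Int.even_mul_succ_self (S.deg v)
  rw [show -S.deg v * S.deg v - S.deg v = -(S.deg v * (S.deg v + 1)) by ring]
  exact this.neg

/-- Applied to w_v f(x), the derivation ∂_v returns f(x) plus a term w_v ∂_v f(x). On the argument
side the commutator of ∂_v with the Koszul differential is the contraction. The signs `sg` are those
for which the remaining terms cancel; the parity of v turns into the sign ν of the counting terms.
-/
lemma homotopy1 {n : ℤ} (v) {f : S.P →ₗ[K] S.B} (hf : f ∈ S.hom n) (x : S.P) :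
    S.kosD (n - 1) (S.hop1 n v f) x + S.hop1 (n + 1) v (S.kosD n f) x =
      f x + (nu p q v : K) • (S.w v * S.parB v (f x) -
        f (inl _ _ (S.w v) * S.parP v x + S.bar v * S.contr v x)) := by
  have hw : ∀ y, f (inl _ _ (S.w v) * y) = sgn K (S.deg v * n) • (S.w v * f y) :=
    hf.2 _ _ (S.w_mem v)
  simp only [kosD_apply, hop1_apply, kos_bar_mul, parP_kos, map_sub, map_neg, map_smul, mul_add (S.bar v),
    mul_smul_comm, map_add, hw, parB_w_mul]
  have e0 : sgn K (n - 1) = - sgn K n := by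
    rw [sub_eq_add_neg, sgn_add, sgn_odd K (n := -1) (by decide)]; ring
  have e1 : sgn K (n + 1) = - sgn K n := by
    rw [sgn_add, sgn_odd K (n := 1) (by decide)]; ring
  have e2 := sgn_mul_self K n
  rcases v with i | j
  · have h := S.even i
    have d0 : sgn K (S.deg (.inl i)) = 1 := sgn_even K h
    have d1 : sgn K (S.deg (.inl i) * n) = 1 := sgn_even K (h.mul_right _)
    have d2 : sgn K (S.deg (.inl i) * (n + 1)) = 1 := sgn_even K (h.mul_right _)
    simp only [sg, nu, Sum.elim_inl, e0, e1, d0, d1, d2, one_smul, Int.cast_one, mul_one]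
    rcases sgn_eq_or K n with h | h <;> rw [h] <;> module
  · have h := S.odd j
    have d0 : sgn K (S.deg (.inr j)) = -1 := sgn_odd K h
    have d1 : sgn K (S.deg (.inr j) * n) = sgn K n := by
      refine sgn_congr K ?_
      rw [show S.deg (.inr j) * n - n = (S.deg (.inr j) - 1) * n by ring]
      exact (h.sub_odd odd_one).mul_right _
    have d2 : sgn K (S.deg (.inr j) * (n + 1)) = - sgn K n := by
      rw [← e1]
      refine sgn_congr K ?_
      rw [show S.deg (.inr j) * (n + 1) - (n + 1) = (S.deg (.inr j) - 1) * (n + 1) by ring]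
      exact (h.sub_odd odd_one).mul_right _
    simp only [sg, nu, Sum.elim_inr, e0, e1, d0, d1, d2, Int.cast_neg, Int.cast_one]
    rcases sgn_eq_or K n with h | h <;> rw [h] <;> module

/-- The homotopy formula for the leading term of the differential. -/
lemma homotopy {n : ℤ} {f : S.P →ₗ[K] S.B} (hf : f ∈ S.hom n) (x : S.P) :
    S.kosD (n - 1) (S.hop n f) x + S.hop (n + 1) (S.kosD n f) x =
      ((p + q : ℤ) : K) • f x + euler K S.degB S.nuB (f x) - f (euler K S.degP S.nuP x) := by
  rw [hop, hop, LinearMap.sum_apply, map_sum, LinearMap.sum_apply, LinearMap.sum_apply,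
    LinearMap.sum_apply, ← Finset.sum_add_distrib]
  simp only [S.homotopy1 _ hf]
  rw [Finset.sum_add_distrib, ← euler_B, ← euler_P, map_sum, add_sub_assoc,
    ← Finset.sum_sub_distrib]
  congr 1
  · simp [Finset.sum_const, ← Nat.cast_smul_eq_nsmul K]
  · refine Finset.sum_congr rfl fun v _ => ?_
    rw [smul_sub, map_smul]

end KoszulData


open FreeCGA

/-! ### Lists -/

section Lists

lemma wt_sum_ite {ι β : Type*} [Fintype ι] [DecidableEq β] (e : ι → β) (nu : ι → ℤ) (l : List β) :
    wt (fun b => ∑ v, if e v = b then nu v else 0) l = ∑ v, nu v * (l.count (e v) : ℤ) := by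
  induction l with
  | nil => simp
  | cons b l ih =>
    rw [wt_cons, ih, ← Finset.sum_add_distrib]
    refine Finset.sum_congr rfl fun v _ => ?_
    rw [List.count_cons]
    by_cases h : e v = b
    · subst h; simp; ring
    · have : ¬ b = e v := fun h' => h h'.symm
      simp [h, this]

lemma perm_append_filter {β : Type*} [DecidableEq β] {l L : List β} (hL : L.Nodup)
    (h : ∀ b ∈ L, l.count b = 1) : l.Perm (L ++ l.filter (fun b => b ∉ L)) := by
  rw [List.perm_iff_count]
  intro a
  rw [List.count_append]
  by_cases ha : a ∈ L
  · rw [h a ha, List.count_eq_one_of_mem hL ha, List.count_eq_zero_of_not_mem (by simp [ha])]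
  · rw [List.count_eq_zero_of_not_mem ha, List.count_filter (by simpa using ha), zero_add]

end Lists

lemma FreeCGA.IsDer.mon_eq_zero {K : Type*} [Field K] {ι : Type*} {deg : ι → ℤ} {A : Type*} [Ring A]
    [Algebra K A] {φ : FreeCGA K deg →ₐ[K] A} {k : ℤ} {θ : FreeCGA K deg →ₗ[K] A}
    (h : IsDer φ k θ) {l : List ι} (hl : ∀ i ∈ l, θ (gen K deg i) = 0) : θ (mon K deg l) = 0 := by
  induction l with
  | nil => simp [h.one]
  | cons i l ih =>
    rw [mon_cons, h.gen_mul, hl i (by simp), ih fun j hj => hl j (by simp [hj])]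
    simp

namespace KoszulData

variable {K : Type*} [Field K] {p q : ℕ} {β : Type*} (S : KoszulData K p q β)

/-! ### Operators scaling by the weight shift -/

/-- Scaling the component of weight `l` by `c l`. -/
def scaleB (c : ℤ → K) : S.B →ₗ[K] S.B := wsum S.nuB fun l => c l • LinearMap.id

lemma scaleB_mon (c : ℤ → K) (l : List β) :
    S.scaleB c (mon K S.degB l) = c (wt S.nuB l) • mon K S.degB l := by simp [scaleB, wsum_mon]

lemma scaleB_gen_mul (c : ℤ → K) (b : β) (y : S.B) :
    S.scaleB c (gen K S.degB b * y) = gen K S.degB b * S.scaleB (fun l => c (S.nuB b + l)) y := by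
  refine eq_of_mon (f := S.scaleB c ∘ₗ LinearMap.mulLeft K (gen K S.degB b))
    (g := LinearMap.mulLeft K (gen K S.degB b) ∘ₗ S.scaleB (fun l => c (S.nuB b + l)))
    (fun l => ?_) y
  simp only [LinearMap.comp_apply, LinearMap.mulLeft_apply, ← mon_cons, scaleB_mon]
  rw [wt_cons, mon_cons, mul_smul_comm]

lemma scaleB_lspan (c : ℤ → K) {T : Set (List β)} {y : S.B} (hy : y ∈ lspan K S.degB T) :
    S.scaleB c y ∈ lspan K S.degB T := by
  refine map_mem_of_lspan (fun l hl => ?_) hy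
  rw [scaleB_mon]; exact Submodule.smul_mem _ _ (mon_mem_lspan hl)

/-- Scaling the part of a linear map that shifts the weight by `k` by `c k`. -/
def opM (c : ℤ → K) : (S.P →ₗ[K] S.B) →ₗ[K] (S.P →ₗ[K] S.B) where
  toFun f := wsum S.nuP fun k => S.scaleB (fun l => c (l - k)) ∘ₗ f
  map_add' f g := by
    refine LinearMap.ext (eq_of_mon fun l => ?_)
    simp [wsum_mon]
  map_smul' a f := by
    refine LinearMap.ext (eq_of_mon fun l => ?_)
    simp [wsum_mon]

lemma opM_of_mem (c : ℤ → K) (f : S.P →ₗ[K] S.B) {k : ℤ} {x : S.P}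
    (hx : x ∈ wpart K S.degP S.nuP k) : S.opM c f x = S.scaleB (fun l => c (l - k)) (f x) :=
  wsum_of_mem _ hx

lemma opM_mon (c : ℤ → K) (f : S.P →ₗ[K] S.B) (l : List (β ⊕ (Fin p ⊕ Fin q))) :
    S.opM c f (mon K S.degP l) =
      S.scaleB (fun m => c (m - wt S.nuP l)) (f (mon K S.degP l)) :=
  S.opM_of_mem c f (mon_mem_wpart _ l)

/-- A base generator adds the same weight to the argument and to the value, so the weight shift is
unaffected by scalars from B. -/
lemma opM_mem (c : ℤ → K) {n : ℤ} {f : S.P →ₗ[K] S.B} (hf : f ∈ S.hom n) :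
    S.opM c f ∈ S.hom n := by
  refine mem_homDeg_of_gens (fun l => ?_) (fun b x => ?_)
  · rw [opM_mon, mem_part_lspan]
    exact S.scaleB_lspan _ (mem_part_lspan.1 (hf.1 _ _ (mon_mem_part l)))
  · refine eq_of_mon (f := S.opM c f ∘ₗ LinearMap.mulLeft K (S.base b))
      (g := sgn K (S.degB b * n) • LinearMap.mulLeft K (gen K S.degB b) ∘ₗ S.opM c f)
      (fun l => ?_) x
    simp only [LinearMap.comp_apply, LinearMap.mulLeft_apply, LinearMap.smul_apply]
    rw [← mon_cons, opM_mon, opM_mon, mon_cons, homDeg_gen hf, map_smul, scaleB_gen_mul]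
    congr 4
    funext m
    rw [wt_cons]
    simp only [nuP, Sum.elim_inl]
    ring_nf

/-- The element w_v has the weight of v̄, since `A` preserves degree and therefore parity.
Consequently the Koszul differential of the Hom complex commutes with scaling by the weight shift.
-/
lemma kos_mem_wpart {k : ℤ} {x : S.P} (hx : x ∈ wpart K S.degP S.nuP k) :
    S.kos x ∈ wpart K S.degP S.nuP k := by
  have := S.kos_isDer.map_wpart (w := S.nuP) (r := 0) (fun i => ?_) hx
  · simpa using this
  · rcases i with b | v
    · rw [kos_base]; exact zero_mem _
    · rw [kos_bar, add_zero, w, map_sum]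
      refine Submodule.sum_mem _ fun k _ => ?_
      rw [map_smul, inl_gen]
      by_cases h : S.A v k = 0
      · rw [h, zero_smul]; exact zero_mem _
      · refine Submodule.smul_mem _ _ ?_
        have h1 := gen_mem_wpart (K := K) (deg := S.degP) S.nuP (.inl (S.e k))
        simpa [nuP, nuB_e, S.nu_eq_of_deg (S.A_deg _ _ h)] using h1

lemma kosD_opM (c : ℤ → K) (n : ℤ) (f : S.P →ₗ[K] S.B) :
    S.kosD n (S.opM c f) = S.opM c (S.kosD n f) := by
  refine LinearMap.ext (eq_of_mon fun l => ?_)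
  rw [kosD_apply, opM_mon, S.opM_of_mem c f (S.kos_mem_wpart (mon_mem_wpart _ l)), kosD_apply,
    map_neg, map_smul]

/-- The inverse of the homotopy operator where it is invertible. -/
def nrm : (S.P →ₗ[K] S.B) →ₗ[K] (S.P →ₗ[K] S.B) :=
  S.opM fun k => if k + (p + q) = 0 then 0 else ((k + (p + q) : ℤ) : K)⁻¹

/-- The projection to the part of weight shift `-(p + q)`. -/
def proj0 : (S.P →ₗ[K] S.B) →ₗ[K] (S.P →ₗ[K] S.B) :=
  S.opM fun k => if k + (p + q) = 0 then 1 else 0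

/-- The normalized homotopy. -/
def htp (n : ℤ) : (S.P →ₗ[K] S.B) →ₗ[K] (S.P →ₗ[K] S.B) := S.nrm ∘ₗ S.hop n

lemma htp_mem {n : ℤ} {f : S.P →ₗ[K] S.B} (hf : f ∈ S.hom n) : S.htp n f ∈ S.hom (n - 1) := by
  rw [htp, LinearMap.comp_apply, nrm]; exact S.opM_mem _ (S.hop_mem hf)

lemma opM_sub (c c' : ℤ → K) (f : S.P →ₗ[K] S.B) :
    S.opM c f - S.opM c' f = S.opM (fun k => c k - c' k) f := by
  refine LinearMap.ext (eq_of_mon fun l => ?_)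
  rw [LinearMap.sub_apply, opM_mon, opM_mon, opM_mon]
  generalize f (mon K S.degP l) = y
  refine eq_of_mon (f := S.scaleB _ - S.scaleB _) (fun l => ?_) y
  rw [LinearMap.sub_apply, scaleB_mon, scaleB_mon, scaleB_mon, sub_smul]

lemma opM_one (f : S.P →ₗ[K] S.B) : S.opM (fun _ => 1) f = f := by
  refine LinearMap.ext (eq_of_mon fun l => ?_)
  rw [opM_mon]
  generalize f (mon K S.degP l) = y
  refine eq_of_mon (g := LinearMap.id) (fun l => ?_) y
  rw [scaleB_mon, one_smul]; rfl

lemma scaleB_euler (c : ℤ → K) (a b : K) (y : S.B) :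
    S.scaleB c (a • y + euler K S.degB S.nuB y - b • y) =
      S.scaleB (fun l => c l * (a + (l : K) - b)) y := by
  have h : ∀ y, (S.scaleB c ∘ₗ (a • LinearMap.id + euler K S.degB S.nuB
      - b • LinearMap.id)) y = S.scaleB (fun l => c l * (a + (l : K) - b)) y :=
    eq_of_mon fun l => by
      rw [LinearMap.comp_apply, LinearMap.sub_apply, LinearMap.add_apply, LinearMap.smul_apply,
        LinearMap.smul_apply, LinearMap.id_apply, euler_mon, ← add_smul, ← sub_smul, map_smul,
        scaleB_mon, scaleB_mon, smul_smul, mul_comm]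
  exact h y

/-- On the part of f that shifts the weight by k, the two Euler terms of `homotopy` differ by the
factor k, so the right side there is multiplication by k + p + q. -/
lemma opM_homotopy (c : ℤ → K) {n : ℤ} {f : S.P →ₗ[K] S.B} (hf : f ∈ S.hom n) :
    S.opM c (S.kosD (n - 1) (S.hop n f) + S.hop (n + 1) (S.kosD n f)) =
      S.opM (fun k => c k * ((k + (p + q) : ℤ) : K)) f := by
  refine LinearMap.ext (eq_of_mon fun l => ?_)
  rw [opM_mon, LinearMap.add_apply, S.homotopy hf, opM_mon, euler_mon, map_smul, scaleB_euler]
  congr 2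
  funext m
  push_cast; ring

/-- Division by k + p + q is possible in characteristic zero except for the shift k = -(p + q),
which is what `proj0` retains. -/
lemma homotopy_htp [CharZero K] {n : ℤ} {f : S.P →ₗ[K] S.B} (hf : f ∈ S.hom n) :
    S.kosD (n - 1) (S.htp n f) + S.htp (n + 1) (S.kosD n f) = f - S.proj0 f := by
  have h := S.opM_homotopy (fun k => if k + (p + q) = 0 then 0 else ((k + (p + q) : ℤ) : K)⁻¹) hf
  nth_rewrite 3 [← S.opM_one f]
  rw [proj0, opM_sub]
  rw [map_add, ← kosD_opM] at h
  refine h.trans ?_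
  congr 2
  funext k
  by_cases h : k + (p + q : ℤ) = 0
  · rw [if_pos h, if_pos h, zero_mul, sub_self]
  · have h2 : ((k + (p + q) : ℤ) : K) ≠ 0 := by exact_mod_cast h
    rw [if_neg h, if_neg h, inv_mul_cancel₀ h2, sub_zero]

/-! ### Filtrations of the Hom complex -/

/-- The maps that raise the filtrations given by two weights by at least `s`. -/
def shift (wP : β ⊕ (Fin p ⊕ Fin q) → ℤ) (wB : β → ℤ) (s : ℤ) : Submodule K (S.P →ₗ[K] S.B) where
  carrier := {f | ∀ a x, x ∈ wge K S.degP wP a → f x ∈ wge K S.degB wB (a + s)}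
  zero_mem' := by simp
  add_mem' hf hg a x hx := add_mem (hf a x hx) (hg a x hx)
  smul_mem' c f hf a x hx := Submodule.smul_mem _ _ (hf a x hx)

variable {S} in
lemma mem_shift_of_mon {wP : β ⊕ (Fin p ⊕ Fin q) → ℤ} {wB : β → ℤ} {s : ℤ} {f : S.P →ₗ[K] S.B}
    (h : ∀ l, f (mon K S.degP l) ∈ wge K S.degB wB (wt wP l + s)) : f ∈ S.shift wP wB s :=
  fun _ _ hx => map_mem_of_lspan (fun l hl => wge_anti wB (add_le_add_left hl s) (h l)) hx

variable {S} in
lemma shift_anti {wP : β ⊕ (Fin p ⊕ Fin q) → ℤ} {wB : β → ℤ} {s t : ℤ} (h : s ≤ t) :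
    S.shift wP wB t ≤ S.shift wP wB s :=
  fun _ hf a x hx => wge_anti wB (add_le_add_right h a) (hf a x hx)

lemma opM_shift (c : ℤ → K) {wP : β ⊕ (Fin p ⊕ Fin q) → ℤ} {wB : β → ℤ} {s : ℤ}
    {f : S.P →ₗ[K] S.B} (hf : f ∈ S.shift wP wB s) : S.opM c f ∈ S.shift wP wB s :=
  mem_shift_of_mon fun l => by
    rw [opM_mon]; exact S.scaleB_lspan _ (hf _ _ (mon_mem_wge le_rfl))

/-- Multiplying by v̄ adds `wU v`, and ∂_v removes a generator of weight `wU v - r`. The gain is r.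
It is used with r = 0 for the main filtration and with r = 1 for the lower degree. -/
lemma hop_shift (n : ℤ) {wB : β → ℤ} {wU : Fin p ⊕ Fin q → ℤ} {r s : ℤ}
    (h : ∀ b v, S.coef b v ≠ 0 → wB b + r = wU v) {f : S.P →ₗ[K] S.B}
    (hf : f ∈ S.shift (Sum.elim wB wU) wB s) : S.hop n f ∈ S.shift (Sum.elim wB wU) wB (s + r) := by
  rw [hop, LinearMap.sum_apply]
  refine Submodule.sum_mem _ fun v _ a x hx => ?_
  have hB : ∀ {m : ℤ} {y : S.B}, y ∈ wge K S.degB wB m →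
      S.parB v y ∈ wge K S.degB wB (m + (r - wU v)) :=
    fun hy => (S.parB_isDer v).map_wge (fun b => by
      rw [parB_gen]
      by_cases hb : S.coef b v = 0
      · rw [hb, zero_smul]; exact zero_mem _
      · rw [← h b v hb]
        refine Submodule.smul_mem _ _ (mon_mem_wge (l := []) ?_)
        simp) hy
  have hP : ∀ {m : ℤ} {y : S.P}, y ∈ wge K S.degP (Sum.elim wB wU) m →
      S.parP v y ∈ wge K S.degP (Sum.elim wB wU) (m + (r - wU v)) :=
    fun hy => (S.parP_isDer v).map_wge (fun i => by
      rcases i with b | u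
      · rw [parP_base]
        by_cases hb : S.coef b v = 0
        · rw [hb, zero_smul]; exact zero_mem _
        · rw [← h b v hb]
          refine Submodule.smul_mem _ _ (mon_mem_wge (l := []) ?_)
          simp
      · rw [parP_bar]; exact zero_mem _) hy
  have hv : S.bar v ∈ wge K S.degP (Sum.elim wB wU) (wU v) :=
    gen_mem_wge (Sum.elim wB wU) (Sum.inr v)
  rw [hop1_apply]
  refine sub_mem (Submodule.smul_mem _ _ ?_) (Submodule.smul_mem _ _ ?_)
  · refine wge_anti wB (le_of_eq ?_) (hB (hf _ _ (mul_mem_wge hv hx)))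
    ring
  · refine wge_anti wB (le_of_eq ?_) (hf _ _ (mul_mem_wge hv (hP hx)))
    ring

lemma htp_shift (n : ℤ) {wB : β → ℤ} {wU : Fin p ⊕ Fin q → ℤ} {r s : ℤ}
    (h : ∀ b v, S.coef b v ≠ 0 → wB b + r = wU v) {f : S.P →ₗ[K] S.B}
    (hf : f ∈ S.shift (Sum.elim wB wU) wB s) : S.htp n f ∈ S.shift (Sum.elim wB wU) wB (s + r) := by
  rw [htp, LinearMap.comp_apply, nrm]; exact S.opM_shift _ (S.hop_shift n h hf)

/-- The weight `Λ` on `x` and `1` on `y`. -/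
def omB (b : β) : ℤ := if Even (S.degB b) then S.Lam else 1

/-- The weight `Λ` on `x̄` and `1` on `ȳ`. -/
def omU : Fin p ⊕ Fin q → ℤ := Sum.elim (fun _ => S.Lam) (fun _ => 1)

/-- The weight `Λ` on `x`, `x̄` and `1` on `y`, `ȳ`. -/
abbrev omP : β ⊕ (Fin p ⊕ Fin q) → ℤ := Sum.elim S.omB S.omU

/-- The weight `0` on `x` and `1` on `y`. -/
def lowB (b : β) : ℤ := if Even (S.degB b) then 0 else 1

variable (p q) in
/-- The weight `1` on `x̄` and `2` on `ȳ`. -/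
def lowU : Fin p ⊕ Fin q → ℤ := Sum.elim (fun _ => 1) (fun _ => 2)

/-- The lower degree: `0` on `x`, `1` on `y` and `x̄`, `2` on `ȳ`. -/
abbrev lowP : β ⊕ (Fin p ⊕ Fin q) → ℤ := Sum.elim S.lowB (lowU p q)

lemma omB_e (v) : S.omB (S.e v) = S.omU v := by
  rw [omB, S.deg_e]
  rcases v with i | j
  · rw [if_pos (S.even i)]; rfl
  · rw [if_neg (Int.not_even_iff_odd.2 (S.odd j))]; rfl

lemma lowB_e (v) : S.lowB (S.e v) + 1 = lowU p q v := by
  rw [lowB, S.deg_e]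
  rcases v with i | j
  · rw [if_pos (S.even i)]; rfl
  · rw [if_neg (Int.not_even_iff_odd.2 (S.odd j))]; rfl

lemma coef_omB {b v} (h : S.coef b v ≠ 0) : S.omB b + 0 = S.omU v := by
  rw [add_zero, ← omB_e, omB, omB, S.coef_ne h, S.deg_e]

lemma coef_lowB {b v} (h : S.coef b v ≠ 0) : S.lowB b + 1 = lowU p q v := by
  rw [← S.lowB_e, lowB, lowB, S.coef_ne h, S.deg_e]

lemma one_le_omB (b) : 1 ≤ S.omB b := by
  have := S.one_le_Lam
  unfold omB; split_ifs <;> omega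

lemma one_le_omU (v) : 1 ≤ S.omU v := by
  have := S.one_le_Lam
  rcases v with i | j <;> simp [omU, this]

lemma one_le_omP (i) : 1 ≤ S.omP i := by
  rcases i with b | v
  · exact S.one_le_omB b
  · exact S.one_le_omU v

lemma lowB_nonneg (b) : 0 ≤ S.lowB b := by
  unfold lowB; split_ifs <;> omega

lemma lowP_nonneg (i) : 0 ≤ S.lowP i := by
  rcases i with b | (i | j)
  · exact S.lowB_nonneg b
  · simp [lowU]
  · simp [lowU]

/-- The differential of the Hom complex. -/
abbrev hD (n : ℤ) : (S.P →ₗ[K] S.B) →ₗ[K] (S.P →ₗ[K] S.B) := homD S.dB S.D n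

lemma hD_apply (n : ℤ) (f : S.P →ₗ[K] S.B) (x : S.P) :
    S.hD n f x = S.dB (f x) - sgn K n • f (S.D x) := rfl

lemma homD_mem {κ υ : Type*} {degB : κ → ℤ} {degU : υ → ℤ} {dB : Differential K degB}
    {D : Differential K (Sum.elim degB degU)} (hD : ∀ b, D (inl _ _ b) = inl _ _ (dB b)) {n : ℤ}
    {f : FreeCGA K (Sum.elim degB degU) →ₗ[K] FreeCGA K degB} (hf : f ∈ homDeg degB degU n) :
    homD dB D n f ∈ homDeg degB degU (n + 1) := by
  refine ⟨fun k x hx => ?_, fun k b hb x => ?_⟩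
  · change dB.toLin (f x) - sgn K n • f (D.toLin x) ∈ _
    refine sub_mem ?_ (Submodule.smul_mem _ _ ?_)
    · rw [← add_assoc]; exact dB.map_part _ _ (hf.1 k x hx)
    · have := hf.1 _ _ (D.map_part _ _ hx)
      convert this using 2; ring
  · have e1 : D.toLin (inl _ _ b * x) = _ := D.leibniz k _ x (inl_mem_part hb)
    have e2 : dB.toLin (b * f x) = _ := dB.leibniz k _ (f x) hb
    have e3 : D.toLin (inl _ _ b) = _ := hD b
    change dB.toLin (f (inl _ _ b * x)) - sgn K n • f (D.toLin (inl _ _ b * x)) =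
      sgn K (k * (n + 1)) • (b * (dB.toLin (f x) - sgn K n • f (D.toLin x)))
    rw [e1, hf.2 k b hb x, map_smul, e2, map_add, map_smul, hf.2 k b hb, e3,
      hf.2 _ _ (dB.map_part _ _ hb), mul_add, mul_one, sgn_add, add_mul, sgn_add, one_mul]
    simp only [mul_sub, mul_smul_comm, smul_sub, smul_add, smul_smul]
    rcases sgn_eq_or K n with h | h <;> rw [h] <;> module

lemma hD_mem {n : ℤ} {f : S.P →ₗ[K] S.B} (hf : f ∈ S.hom n) : S.hD n f ∈ S.hom (n + 1) :=
  homD_mem S.D_inl hf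

lemma homD_homD {κ υ : Type*} {degB : κ → ℤ} {degU : υ → ℤ} (dB : Differential K degB)
    (D : Differential K (Sum.elim degB degU)) (n : ℤ)
    (f : FreeCGA K (Sum.elim degB degU) →ₗ[K] FreeCGA K degB) :
    homD dB D (n + 1) (homD dB D n f) = 0 := by
  ext x
  change dB.toLin (dB.toLin (f x) - sgn K n • f (D.toLin x)) - sgn K (n + 1) •
    (dB.toLin (f (D.toLin x)) - sgn K n • f (D.toLin (D.toLin x))) = 0
  rw [map_sub, map_smul, dB.sq_zero, D.sq_zero, sgn_add, sgn_odd K odd_one]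
  simp

lemma kosD_kosD (n : ℤ) (f : S.P →ₗ[K] S.B) : S.kosD (n + 1) (S.kosD n f) = 0 := by
  have h := S.kos_isDer
  have h2 : ∀ x, S.kos (S.kos x) = 0 := (Differential.ofGens S.kos h S.kos_mem (by
    rintro (b | v)
    · rw [kos_base, map_zero]
    · simp [w])).sq_zero
  ext x
  rw [kosD_apply, kosD_apply, h2]
  simp

lemma kosD_mem {n : ℤ} {f : S.P →ₗ[K] S.B} (hf : f ∈ S.hom n) : S.kosD n f ∈ S.hom (n + 1) := by
  -- `kosD` is the Hom differential for the zero differential on B and the Koszul differential on B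
  -- ⊗ ∧V̄.
  have h0 : IsDer (AlgHom.id K S.B) 1 (0 : S.B →ₗ[K] S.B) := ⟨rfl, by simp⟩
  have := homD_mem (dB := Differential.ofGens 0 h0 (fun i => zero_mem _) (fun i => rfl))
    (D := Differential.ofGens S.kos S.kos_isDer S.kos_mem (by
      rintro (b | v)
      · rw [kos_base, map_zero]
      · simp [w])) (fun b => by
        have h1 := S.kos_isDer.comp_algHom (inl S.degB (barDeg S.deg)) (fun b => by
          rw [inl_gen]; exact gen_inl_mem_part b)
        exact (h1.eq_zero (fun b => by simp) b).trans (map_zero (inl S.degB (barDeg S.deg))).symm) hf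
  convert this using 1
  ext x
  rw [kosD_apply]
  exact (zero_sub _).symm

/-- The part of the differential of the Hom complex that raises the filtration. -/
def del (n : ℤ) : (S.P →ₗ[K] S.B) →ₗ[K] (S.P →ₗ[K] S.B) := S.hD n - S.kosD n

lemma hD_eq (n : ℤ) (f : S.P →ₗ[K] S.B) : S.hD n f = S.kosD n f + S.del n f := by
  simp [del]

lemma del_mem {n : ℤ} {f : S.P →ₗ[K] S.B} (hf : f ∈ S.hom n) : S.del n f ∈ S.hom (n + 1) :=
  sub_mem (S.hD_mem hf) (S.kosD_mem hf)

/-- The perturbation consists of dB and of the difference of D and the Koszul differential; both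
raise the filtration on generators, hence everywhere by the Leibniz rule. -/
lemma del_shift {n : ℤ} {s : ℤ} {f : S.P →ₗ[K] S.B} (hf : f ∈ S.shift S.omP S.omB s) :
    S.del n f ∈ S.shift S.omP S.omB (s + 1) := by
  intro a x hx
  have h1 : (S.D.toLin - S.kos) x ∈ wge K S.degP S.omP (a + 1) := by
    have hder : IsDer (AlgHom.id K _) 1 (S.D.toLin - S.kos) := by
      rw [sub_eq_add_neg, ← neg_one_smul K S.kos]
      exact S.D.isDer.add (S.kos_isDer.smul _)
    refine hder.map_wge (fun i => ?_) hx
    rcases i with b | v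
    · rw [LinearMap.sub_apply, kos_base, sub_zero]
      have h2 := S.D_inl (gen K S.degB b)
      rw [inl_gen] at h2
      rw [h2]
      refine algHom_map_wge (fun b => ?_) (S.dB_raise b)
      rw [inl_gen]
      exact gen_mem_wge S.omP (.inl b)
    · rw [LinearMap.sub_apply, kos_bar]
      have h2 := S.D_raise v
      rw [w, map_sum]
      simp only [map_smul, inl_gen]
      exact h2
  have h2 : S.dB (f x) ∈ wge K S.degB S.omB (a + s + 1) :=
    S.dB.isDer.map_wge S.dB_raise (hf a x hx)
  have e : S.del n f x = S.dB (f x) - sgn K n • f ((S.D.toLin - S.kos) x) := by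
    rw [del, LinearMap.sub_apply, LinearMap.sub_apply, hD_apply, kosD_apply, LinearMap.sub_apply,
      map_sub, smul_sub]
    abel
  rw [e]
  refine sub_mem ?_ (Submodule.smul_mem _ _ ?_)
  · rwa [← add_assoc]
  · have := hf _ _ h1
    rwa [add_right_comm, add_assoc] at this

/-- The weight is congruent to the degree mod 2, so a differential changes its parity. From a
generator of weight 2 one can only reach odd nonnegative weights, hence at least 1; from weight 0 or
1 nonnegativity suffices. -/
lemma wge_neg_one {ι : Type*} {deg : ι → ℤ} {w : ι → ℤ} (hw : ∀ i, 0 ≤ w i) (h2 : ∀ i, w i ≤ 2)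
    (hodd : ∀ i, Even (deg i - w i)) (D : Differential K deg) {a : ℤ} {x : FreeCGA K deg}
    (hx : x ∈ wge K deg w a) : D x ∈ wge K deg w (a + -1) := by
  refine D.isDer.map_wge (fun i => ?_) hx
  have h := D.map_part _ _ (gen_mem_part deg i)
  rw [mem_part_lspan] at h
  refine lspan_mono (fun l hl' => ?_) h
  have hl : wt deg l = deg i + 1 := hl'
  have h1 := wt_nonneg hw l
  have h3 : Even (wt deg l - wt w l) := by
    clear hl hl' h1 h
    induction l with
    | nil => simp
    | cons j l ih =>
      rw [wt_cons, wt_cons, show deg j + wt deg l - (w j + wt w l) =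
        (deg j - w j) + (wt deg l - wt w l) by ring]
      exact (hodd j).add ih
  change w i + -1 ≤ wt w l
  have h4 := hodd i
  have h5 := h2 i
  rw [hl] at h3
  obtain ⟨c, hc⟩ := h3
  obtain ⟨c', hc'⟩ := h4
  omega

lemma even_sub_lowP (i) : Even (S.degP i - S.lowP i) := by
  rcases i with b | (i | j)
  · simp only [degP, lowP, Sum.elim_inl, lowB]
    split_ifs with h
    · simpa using h
    · exact (Int.not_even_iff_odd.1 h).sub_odd odd_one
  · have := S.even i
    simp only [degP, lowP, Sum.elim_inr, lowU, barDeg, Sum.elim_inl]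
    rw [show S.deg (.inl i) - 1 - 1 = S.deg (.inl i) - 2 by ring]
    exact this.sub even_two
  · have := S.odd j
    simp only [degP, lowP, Sum.elim_inr, lowU, barDeg]
    exact (this.sub_odd odd_one).sub even_two

lemma lowP_le (i) : S.lowP i ≤ 2 := by
  rcases i with b | (i | j)
  · simp only [lowP, Sum.elim_inl, lowB]; split_ifs <;> omega
  · simp [lowU]
  · simp [lowU]

lemma del_low {n : ℤ} {s : ℤ} {f : S.P →ₗ[K] S.B} (hf : f ∈ S.shift S.lowP S.lowB s) :
    S.del n f ∈ S.shift S.lowP S.lowB (s + -1) := by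
  refine sub_mem (fun a x hx => ?_) (fun a x hx => ?_)
  · rw [hD_apply]
    refine sub_mem ?_ (Submodule.smul_mem _ _ ?_)
    · rw [← add_assoc]
      exact wge_neg_one S.lowB_nonneg (fun b => S.lowP_le (.inl b))
        (fun b => S.even_sub_lowP (.inl b)) S.dB (hf a x hx)
    · have := hf _ _ (wge_neg_one S.lowP_nonneg S.lowP_le S.even_sub_lowP S.D hx)
      rwa [add_right_comm, add_assoc] at this
  · rw [kosD_apply]
    refine neg_mem (Submodule.smul_mem _ _ ?_)
    have h1 : S.kos x ∈ wge K S.degP S.lowP (a + -1) :=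
      wge_neg_one S.lowP_nonneg S.lowP_le S.even_sub_lowP (Differential.ofGens S.kos S.kos_isDer
        S.kos_mem (by
          rintro (b | v)
          · rw [kos_base, map_zero]
          · simp [w])) hx
    have := hf _ _ h1
    rwa [add_right_comm, add_assoc] at this

end KoszulData


/-! ### Extremal monomials and the part of weight shift -(p + q). -/

open FreeCGA

/-- The derivations dual to the generators strip off the factors one by one until 1 is left, which
the augmentation detects. -/
lemma FreeCGA.mon_ne_zero {K : Type*} [Field K] {ι : Type*} {deg : ι → ℤ} {l : List ι}
    (hl : l.Nodup) : mon K deg l ≠ 0 := by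
  classical
  induction l with
  | nil =>
    intro h
    have := congrArg (aug K deg) h
    simp at this
  | cons i l ih =>
    rw [List.nodup_cons] at hl
    intro h
    have hδ : ∀ j, (if j = i then (1 : FreeCGA K deg) else 0) ∈ part K deg (deg j + -deg i) := by
      intro j
      split_ifs with h
      · subst h; simp [one_mem_part]
      · exact zero_mem _
    have h1 := der_isDer _ _ hδ
    refine ih hl.2 ?_
    have h2 := congrArg (der _ _ hδ) h
    rw [mon_cons, h1.gen_mul, der_gen, if_pos rfl, h1.mon_eq_zero, map_zero] at h2
    · simpa using h2
    · intro j hj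
      rw [der_gen, if_neg]
      rintro rfl; exact hl.1 hj

section Lists

variable {K : Type*} [Field K] [CharZero K] {ι : Type*} {deg : ι → ℤ}

lemma count_le_one [DecidableEq ι] {i : ι} (h : Odd (deg i)) {l : List ι}
    (hl : mon K deg l ≠ 0) : l.count i ≤ 1 := by
  by_contra hc
  exact hl (mon_eq_zero h (by omega))

lemma wt_eq_sum_count [Fintype ι] [DecidableEq ι] (c : ι → ℤ) (l : List ι) :
    wt c l = ∑ i, c i * (l.count i : ℤ) := by
  rw [← wt_sum_ite (fun i => i) c l]
  congr 1
  funext b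
  simp

lemma wt_le_sum [Fintype ι] {c : ι → ℤ} (h0 : ∀ i, 0 ≤ c i) (h : ∀ i, c i ≠ 0 → Odd (deg i))
    {l : List ι} (hl : mon K deg l ≠ 0) : wt c l ≤ ∑ i, c i := by
  classical
  rw [wt_eq_sum_count]
  refine Finset.sum_le_sum fun i _ => ?_
  by_cases hc : c i = 0
  · simp [hc]
  · have := count_le_one (h i hc) hl
    exact mul_le_of_le_one_right (h0 i) (by exact_mod_cast this)

lemma sum_eq_card {α : Type*} [Fintype α] {a : α → ℤ} (h1 : ∀ i, a i ≤ 1)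
    (h : ∑ i, a i = Fintype.card α) (i : α) : a i = 1 := by
  have h2 : ∑ i, (1 - a i) = 0 := by simp [Finset.sum_sub_distrib, h]
  have := (Finset.sum_eq_zero_iff_of_nonneg (fun i _ => by have := h1 i; omega)).1 h2 i
    (Finset.mem_univ i)
  omega

end Lists

namespace KoszulData

variable {K : Type*} [Field K] {p q : ℕ} {β : Type*} (S : KoszulData K p q β)

variable (p q) in
/-- The list of the even basis elements. -/
def xs : List (Fin p ⊕ Fin q) := List.ofFn Sum.inl

variable (p q) in
/-- The list of the odd basis elements. -/
def ys : List (Fin p ⊕ Fin q) := List.ofFn Sum.inr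

lemma nodup_xs : (xs p q).Nodup := List.nodup_ofFn.2 Sum.inl_injective
lemma nodup_ys : (ys p q).Nodup := List.nodup_ofFn.2 Sum.inr_injective

/-- The product of the generators `t_y`. -/
def ty : S.B := mon K S.degB ((ys p q).map S.e)

lemma ty_ne_zero : S.ty ≠ 0 := mon_ne_zero ((List.nodup_map_iff S.inj).2 nodup_ys)

/-- The product of the `x̄`. -/
def barx : S.P := mon K S.degP ((xs p q).map Sum.inr)

/-- The degree of the shriek map. -/
def N : ℤ := wt S.deg (ys p q) - wt (barDeg S.deg) (xs p q)

section CharZero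

variable [CharZero K]

/-- Only the t_y count negatively, and each is odd, so it occurs at most once in a nonzero monomial.
Weight -q forces all of them and excludes every t_x; what remains lies outside the image of `e`. -/
lemma wt_nuB {l : List β} (hl : mon K S.degB l ≠ 0) : -(q : ℤ) ≤ wt S.nuB l ∧
    (wt S.nuB l = -q → ∃ r : List β, (∀ b ∈ r, b ∉ Set.range S.e) ∧
      l.Perm ((ys p q).map S.e ++ r)) := by
  classical
  have h : wt S.nuB l = ∑ i : Fin p, (l.count (S.e (.inl i)) : ℤ) -
      ∑ j : Fin q, (l.count (S.e (.inr j)) : ℤ) := by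
    have := wt_sum_ite S.e (nu p q) l
    rw [Fintype.sum_sum_type] at this
    simp only [nu, Sum.elim_inl, Sum.elim_inr, one_mul, neg_one_mul, Finset.sum_neg_distrib] at this
    rw [sub_eq_add_neg, ← this]
    congr 1
  have h1 : ∀ j : Fin q, (l.count (S.e (.inr j)) : ℤ) ≤ 1 := fun j => by
    exact_mod_cast count_le_one (by rw [S.deg_e]; exact S.odd j) hl
  have h0 : ∀ i : Fin p, 0 ≤ (l.count (S.e (.inl i)) : ℤ) := fun i => by positivity
  have hx := Finset.sum_nonneg fun i (_ : i ∈ Finset.univ) => h0 i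
  have hy : ∑ j : Fin q, (l.count (S.e (.inr j)) : ℤ) ≤ q := by
    have := Finset.sum_le_sum fun j (_ : j ∈ Finset.univ) => h1 j
    simpa using this
  refine ⟨by omega, fun e => ?_⟩
  have e1 : ∑ i : Fin p, (l.count (S.e (.inl i)) : ℤ) = 0 := by omega
  have e2 := sum_eq_card h1 (by rw [Fintype.card_fin]; omega)
  rw [Finset.sum_eq_zero_iff_of_nonneg fun i _ => h0 i] at e1
  refine ⟨_, ?_, perm_append_filter ((List.nodup_map_iff S.inj).2 nodup_ys) ?_⟩
  · rintro b hb ⟨v, rfl⟩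
    rw [List.mem_filter] at hb
    rcases v with i | j
    · have := e1 i (Finset.mem_univ i)
      exact absurd hb.1 (List.count_eq_zero.1 (by exact_mod_cast this))
    · simp [ys, S.inj.eq_iff] at hb
  · intro b hb
    simp only [ys, List.mem_map, List.mem_ofFn] at hb
    obtain ⟨_, ⟨j, rfl⟩, rfl⟩ := hb
    exact_mod_cast e2 j

/-- The bar exchanges parities: now the x̄ are odd and occur at most once, while the ȳ count
negatively. -/
lemma wt_nu {l : List (Fin p ⊕ Fin q)} (hl : mon K (barDeg S.deg) l ≠ 0) : wt (nu p q) l ≤ p ∧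
    (wt (nu p q) l = p → l.Perm (xs p q)) := by
  let _ : BEq (Fin p ⊕ Fin q) := instBEqOfDecidableEq
  have h : wt (nu p q) l = ∑ i : Fin p, (l.count (.inl i) : ℤ) -
      ∑ j : Fin q, (l.count (.inr j) : ℤ) := by
    rw [wt_eq_sum_count, Fintype.sum_sum_type]
    simp only [nu, Sum.elim_inl, Sum.elim_inr, one_mul, neg_one_mul, Finset.sum_neg_distrib,
      sub_eq_add_neg]
  have h1 : ∀ i : Fin p, (l.count (.inl i) : ℤ) ≤ 1 := fun i => by
    exact_mod_cast count_le_one (deg := barDeg S.deg) (i := Sum.inl i)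
      ((S.even i).sub_odd odd_one) hl
  have h0 : ∀ j : Fin q, 0 ≤ (l.count (.inr j) : ℤ) := fun i => by positivity
  have hy := Finset.sum_nonneg fun j (_ : j ∈ Finset.univ) => h0 j
  have hx : ∑ i : Fin p, (l.count (.inl i) : ℤ) ≤ p := by
    have := Finset.sum_le_sum fun j (_ : j ∈ Finset.univ) => h1 j
    simpa using this
  refine ⟨by omega, fun e => ?_⟩
  have e1 : ∑ j : Fin q, (l.count (.inr j) : ℤ) = 0 := by omega
  have e2 := sum_eq_card h1 (by rw [Fintype.card_fin]; omega)
  rw [Finset.sum_eq_zero_iff_of_nonneg fun i _ => h0 i] at e1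
  rw [List.perm_iff_count]
  rintro (i | j)
  · rw [List.count_eq_one_of_mem nodup_xs (by simp [xs])]
    exact_mod_cast e2 i
  · rw [List.count_eq_zero_of_not_mem (a := Sum.inr j) (l := xs p q) (by simp [xs])]
    exact_mod_cast e1 j (Finset.mem_univ j)


end CharZero

/-! ### The leading term of the shriek map -/

/-- The projection of `B ⊗ ∧V̄` to `B` sending `V̄` to zero. -/
def epsP : S.P →ₐ[K] S.B :=
  lift S.degP (Sum.elim (gen K S.degB) (fun _ => 0)) (by
    rintro (b | v) (b' | v') <;> simp
    exact gen_mul_gen _ _ _)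

@[simp] lemma epsP_base (b) : S.epsP (S.base b) = gen K S.degB b := lift_gen _ _ _ _
@[simp] lemma epsP_bar (v) : S.epsP (S.bar v) = 0 := lift_gen _ _ _ _

/-- The composition of contractions. -/
def contrL : List (Fin p ⊕ Fin q) → S.P →ₗ[K] S.P
  | [] => LinearMap.id
  | v :: l => contrL l ∘ₗ S.contr v

lemma contrL_mon {l : List (Fin p ⊕ Fin q)} (hl : l.Nodup) :
    S.contrL l (mon K S.degP (l.map Sum.inr)) = 1 := by
  induction l with
  | nil => simp [contrL]
  | cons v l ih =>
    rw [List.nodup_cons] at hl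
    have : S.contr v (mon K S.degP (l.map Sum.inr)) = 0 :=
      (S.contr_isDer v).mon_eq_zero fun i hi => by
        obtain ⟨u, hu, rfl⟩ := List.mem_map.1 hi
        rw [contr_bar, if_neg]
        rintro rfl; exact hl.1 hu
    rw [contrL, LinearMap.comp_apply, List.map_cons, mon_cons, (S.contr_isDer v).gen_mul, contr_bar,
      if_pos rfl, this, mul_zero, smul_zero, add_zero, one_mul]
    exact ih hl.2

lemma contrL_wpart (l : List (Fin p ⊕ Fin q)) {wB : β → ℤ} {wU : Fin p ⊕ Fin q → ℤ} {k : ℤ} {x : S.P}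
    (hx : x ∈ wpart K S.degP (Sum.elim wB wU) k) :
    S.contrL l x ∈ wpart K S.degP (Sum.elim wB wU) (k - wt wU l) := by
  induction l generalizing x k with
  | nil => simpa [contrL] using hx
  | cons v l ih =>
    rw [wt_cons, ← sub_sub]
    refine ih ((S.contr_isDer v).map_wpart (r := -wU v) (fun i => ?_) hx)
    rcases i with b | u
    · rw [contr_base]; exact zero_mem _
    · rw [contr_bar]
      split_ifs with h
      · subst h
        simpa using mon_mem_wpart (K := K) (deg := S.degP) (Sum.elim wB wU) []
      · exact zero_mem _

lemma contrL_base_mul (l : List (Fin p ⊕ Fin q)) (b : β) (x : S.P) :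
    S.contrL l (S.base b * x) =
      sgn K (S.degB b * wt (barDeg S.deg) l) • (S.base b * S.contrL l x) := by
  induction l generalizing x with
  | nil => simp [contrL, sgn_zero]
  | cons v l ih =>
    rw [contrL, LinearMap.comp_apply, (S.contr_isDer v).gen_mul, contr_base, zero_mul, zero_add,
      map_smul]
    simp only [AlgHom.coe_id, id, LinearMap.comp_apply]
    rw [ih, smul_smul, ← sgn_add, wt_cons]
    congr 1
    refine sgn_congr K ⟨-(S.deg v - 1) * S.degB b, ?_⟩
    simp only [degP, Sum.elim_inl, barDeg]
    ring

/-- The leading term of the shriek map. -/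
def f0 : S.P →ₗ[K] S.B :=
  LinearMap.mulLeft K S.ty ∘ₗ S.epsP.toLinearMap ∘ₗ S.contrL (xs p q)

lemma f0_apply (x) : S.f0 x = S.ty * S.epsP (S.contrL (xs p q) x) := rfl

lemma f0_barx : S.f0 S.barx = S.ty := by
  rw [f0_apply, barx, contrL_mon _ nodup_xs, map_one, mul_one]

lemma wt_map {ι κ : Type*} (w : κ → ℤ) (f : ι → κ) (l : List ι) : wt w (l.map f) = wt (w ∘ f) l := by
  simp [wt]

lemma ty_mem (w : β → ℤ) : S.ty ∈ wpart K S.degB w (wt (w ∘ S.e) (ys p q)) := by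
  rw [← wt_map]; exact mon_mem_wpart _ _

lemma f0_wpart {wB : β → ℤ} {wU : Fin p ⊕ Fin q → ℤ} {k : ℤ} {x : S.P}
    (hx : x ∈ wpart K S.degP (Sum.elim wB wU) k) :
    S.f0 x ∈ wpart K S.degB wB (k + (wt (wB ∘ S.e) (ys p q) - wt wU (xs p q))) := by
  have h1 := algHom_map_wpart (φ := S.epsP) (w' := wB) (by
    rintro (b | v)
    · rw [epsP_base]; exact gen_mem_wpart _ _
    · rw [epsP_bar]; exact zero_mem _) (S.contrL_wpart (xs p q) hx)
  have h2 := mul_mem_wpart (S.ty_mem wB) h1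
  rw [f0_apply]
  convert h2 using 1
  ring_nf

lemma f0_mem : S.f0 ∈ S.hom S.N := by
  have e : S.degB ∘ S.e = S.deg := funext S.deg_e
  refine mem_homDeg_of_gens (fun l => ?_) (fun b x => ?_)
  · rw [part_eq_wpart]
    have := S.f0_wpart (mon_mem_wpart (K := K) (deg := S.degP) (Sum.elim S.degB (barDeg S.deg)) l)
    rwa [e] at this
  · have h1 := S.ty_mem S.degB
    rw [← part_eq_wpart, e] at h1
    rw [f0_apply, contrL_base_mul, map_smul, map_mul, epsP_base, mul_smul_comm, ← mul_assoc,
      graded_comm h1 (gen_mem_part _ b), smul_mul_assoc, smul_smul, ← sgn_add, mul_assoc, f0_apply]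
    congr 1
    refine sgn_congr K ⟨S.degB b * wt (barDeg S.deg) (xs p q), ?_⟩
    rw [N]; ring

lemma f0_shift (wB : β → ℤ) (wU : Fin p ⊕ Fin q → ℤ) :
    S.f0 ∈ S.shift (Sum.elim wB wU) wB (wt (wB ∘ S.e) (ys p q) - wt wU (xs p q)) :=
  mem_shift_of_mon fun l => wpart_le_wge _ _ (S.f0_wpart (mon_mem_wpart _ l))

lemma wt_const {ι : Type*} {w : ι → ℤ} {c : ℤ} {l : List ι} (h : ∀ i ∈ l, w i = c) :
    wt w l = l.length * c := by
  induction l with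
  | nil => simp
  | cons i l ih =>
    rw [wt_cons, h i (by simp), ih fun j hj => h j (by simp [hj]), List.length_cons]
    push_cast; ring

lemma wt_xs {w : Fin p ⊕ Fin q → ℤ} {c : ℤ} (h : ∀ i, w (.inl i) = c) : wt w (xs p q) = p * c := by
  rw [wt_const (c := c)]
  · simp [xs]
  · simp [xs, h]

lemma wt_ys {w : Fin p ⊕ Fin q → ℤ} {c : ℤ} (h : ∀ i, w (.inr i) = c) : wt w (ys p q) = q * c := by
  rw [wt_const (c := c)]
  · simp [ys]
  · simp [ys, h]

/-- The filtration degree of the leading term. -/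
def s0 : ℤ := q - p * S.Lam

lemma f0_om : S.f0 ∈ S.shift S.omP S.omB S.s0 := by
  have := S.f0_shift S.omB S.omU
  rwa [wt_xs (c := S.Lam) (fun _ => rfl), wt_ys (c := 1) (fun j => by
    rw [Function.comp_apply, omB_e]; rfl), mul_one] at this

lemma f0_low : S.f0 ∈ S.shift S.lowP S.lowB (q - p) := by
  have := S.f0_shift S.lowB (lowU p q)
  rwa [wt_xs (c := 1) (fun _ => rfl), wt_ys (c := 1) (fun j => by
    have := S.lowB_e (.inr j)
    rw [Function.comp_apply]; simp [lowU] at this; omega), mul_one, mul_one] at this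

lemma opM_of_shift (c : ℤ → K) {r : ℤ} {f : S.P →ₗ[K] S.B}
    (h : ∀ l, f (mon K S.degP l) ∈ wpart K S.degB S.nuB (wt S.nuP l + r)) :
    S.opM c f = c r • f := by
  refine LinearMap.ext (eq_of_mon fun l => ?_)
  rw [opM_mon, scaleB, wsum_of_mem _ (h l)]
  simp

/-- Contracting all the x̄ removes p from the weight and multiplying by ∏ t_y removes q, so `f0` has
the single shift -(p + q). -/
lemma proj0_f0 : S.proj0 S.f0 = S.f0 := by
  rw [proj0, S.opM_of_shift _ (r := -q - p), if_pos (by ring), one_smul]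
  intro l
  have := S.f0_wpart (wB := S.nuB) (wU := nu p q) (mon_mem_wpart _ l)
  rwa [wt_xs (c := 1) (fun _ => rfl), wt_ys (c := -1) (fun j => by
    rw [Function.comp_apply, nuB_e]; rfl), mul_one, mul_neg_one] at this

lemma proj0_mem {n : ℤ} {f : S.P →ₗ[K] S.B} (hf : f ∈ S.hom n) : S.proj0 f ∈ S.hom n := by
  rw [proj0]; exact S.opM_mem _ hf

lemma barx_mem_part : S.barx ∈ part K S.degP (wt (barDeg S.deg) (xs p q)) := by
  have := mon_mem_part (K := K) (deg := S.degP) ((xs p q).map Sum.inr)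
  rwa [wt_map] at this

lemma inr_mon (l : List (Fin p ⊕ Fin q)) :
    inr S.degB (barDeg S.deg) (mon K _ l) = mon K S.degP (l.map Sum.inr) := by
  induction l with
  | nil => simp
  | cons a l ih => simp [ih]

lemma wpart_eq_zero {ι : Type*} {deg w : ι → ℤ} {k : ℤ} {x : FreeCGA K deg}
    (hx : x ∈ wpart K deg w k) (h : ∀ l, wt w l = k → mon K deg l = 0) : x = 0 :=
  lspan_le (T := ⊥) (fun l hl => by rw [h l hl]; exact zero_mem _) hx

lemma proj0_wpart (f : S.P →ₗ[K] S.B) (l : List (β ⊕ (Fin p ⊕ Fin q))) :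
    S.proj0 f (mon K S.degP l) ∈ wpart K S.degB S.nuB (wt S.nuP l - (p + q)) := by
  rw [proj0, opM_mon]
  refine mem_of_mon (T := (wpart K S.degB S.nuB _).comap (S.scaleB _)) (fun m => ?_) _
  rw [Submodule.mem_comap, scaleB_mon]
  split_ifs with h
  · rw [one_smul, show wt S.nuP l - (p + q) = wt S.nuB m by omega]
    exact mon_mem_wpart _ m
  · rw [zero_smul]; exact zero_mem _

lemma eq_nil_of_wt_lt {l : List β} (h : wt S.degB l < 2) : l = [] := by
  have h0 : ∀ b, 0 ≤ S.degB b := fun b => by have := S.two_le_B b; omega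
  cases l with
  | nil => rfl
  | cons b l =>
    have := wt_nonneg h0 l
    have := S.two_le_B b
    rw [wt_cons] at h; omega

variable [CharZero K]

/-- A fibre monomial of weight k has its value in weight k - (p + q), and B has nothing below -q. So
k must be p, and the monomial is x̄_1 ⋯ x̄_p up to order. -/
lemma proj0_ext {n : ℤ} {f g : S.P →ₗ[K] S.B} (hf : f ∈ S.hom n) (hg : g ∈ S.hom n)
    (h : S.proj0 f S.barx = S.proj0 g S.barx) : S.proj0 f = S.proj0 g := by
  refine homDeg_ext (S.proj0_mem hf) (S.proj0_mem hg) fun l => ?_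
  by_cases hl : mon K (barDeg S.deg) l = 0
  · rw [hl, map_zero, map_zero, map_zero]
  obtain ⟨h1, h2⟩ := S.wt_nu hl
  by_cases h3 : wt (nu p q) l = p
  · obtain ⟨s, -, e⟩ := mon_perm (K := K) (deg := S.degP) ((h2 h3).map Sum.inr)
    rw [inr_mon, e, map_smul, map_smul]
    exact congrArg _ h
  · have hz : ∀ f : S.P →ₗ[K] S.B, S.proj0 f (mon K S.degP (l.map Sum.inr)) = 0 := fun f => by
      refine wpart_eq_zero (S.proj0_wpart f _) fun m hm => ?_
      rw [wt_map, show S.nuP ∘ Sum.inr = nu p q from rfl] at hm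
      by_contra hne
      have := (S.wt_nuB hne).1
      omega
    rw [inr_mon, hz, hz]

/-- The value has the extremal weight -q, so its monomials are ∏ t_y times a word in generators
outside the image of `e`, of degree n - N. The hypothesis allows only the empty word, which requires
n = N. -/
lemma proj0_barx {n : ℤ} {f : S.P →ₗ[K] S.B} (hf : f ∈ S.hom n)
    (hoff : ∀ r : List β, (∀ b ∈ r, b ∉ Set.range S.e) → wt S.degB r = n - S.N → r = []) :
    S.proj0 f S.barx ∈ Submodule.span K {S.ty} ∧ (n ≠ S.N → S.proj0 f S.barx = 0) := by
  have h1 : S.proj0 f S.barx ∈ wpart K S.degB S.nuB (-q) := by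
    have := S.proj0_wpart f ((xs p q).map Sum.inr)
    rw [wt_map, show S.nuP ∘ Sum.inr = nu p q from rfl, wt_xs (c := 1) (fun _ => rfl)] at this
    rw [show -(q : ℤ) = p * 1 - (p + q) by ring]
    exact this
  have h2 := mem_lspan_part h1 ((S.proj0_mem hf).1 _ _ S.barx_mem_part)
  have key : ∀ l ∈ {l | wt S.nuB l = -q} ∩ {l | wt S.degB l = wt (barDeg S.deg) (xs p q) + n},
      mon K S.degB l ≠ 0 → n = S.N ∧ ∃ s : K, mon K S.degB l = s • S.ty := by
    rintro l ⟨hl1, hl2⟩ hne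
    obtain ⟨r, hr, hp⟩ := (S.wt_nuB hne).2 hl1
    have e1 := wt_perm S.degB hp
    rw [wt_append, wt_map, show S.degB ∘ S.e = S.deg from funext S.deg_e] at e1
    have e2 : wt S.degB l = _ := hl2
    have e3 := hoff r hr (by rw [N]; omega)
    subst e3
    rw [wt_nil] at e1
    refine ⟨by rw [N]; omega, ?_⟩
    rw [List.append_nil] at hp
    obtain ⟨s, -, e⟩ := mon_perm (K := K) (deg := S.degB) hp
    exact ⟨s, e⟩
  constructor
  · refine lspan_le (fun l hl => ?_) h2
    by_cases hne : mon K S.degB l = 0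
    · rw [hne]; exact zero_mem _
    · obtain ⟨-, s, e⟩ := key l hl hne
      rw [e]; exact Submodule.smul_mem _ _ (Submodule.mem_span_singleton_self _)
  · intro hn
    refine lspan_le (T := ⊥) (fun l hl => ?_) h2
    by_contra hne
    exact hn (key l hl hne).1

lemma proj0_N {f : S.P →ₗ[K] S.B} (hf : f ∈ S.hom S.N) : ∃ c : K, S.proj0 f = c • S.f0 := by
  obtain ⟨c, hc⟩ := Submodule.mem_span_singleton.1
    (S.proj0_barx hf fun r _ hr => S.eq_nil_of_wt_lt (by omega)).1
  refine ⟨c, ?_⟩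
  have := S.proj0_ext hf (Submodule.smul_mem _ c S.f0_mem) (by
    rw [map_smul, proj0_f0, LinearMap.smul_apply, f0_barx, hc])
  rw [this, map_smul, proj0_f0]

lemma proj0_eq_zero {n : ℤ} (hn : n ≠ S.N) {f : S.P →ₗ[K] S.B} (hf : f ∈ S.hom n)
    (hoff : ∀ r : List β, (∀ b ∈ r, b ∉ Set.range S.e) → wt S.degB r = n - S.N → r = []) :
    S.proj0 f = 0 := by
  have := S.proj0_ext hf (zero_mem _) (by
    rw [(S.proj0_barx hf hoff).2 hn, map_zero, LinearMap.zero_apply])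
  rw [this, map_zero]

/-- The leftover word would have degree 1, below the degree of every generator. This is why
constructing the cocycle meets no obstruction. -/
lemma proj0_N_add_one {f : S.P →ₗ[K] S.B} (hf : f ∈ S.hom (S.N + 1)) : S.proj0 f = 0 :=
  S.proj0_eq_zero (by omega) hf fun r _ hr => S.eq_nil_of_wt_lt (by omega)

end KoszulData


open FreeCGA

namespace KoszulData

variable {K : Type*} [Field K] {p q : ℕ} {β : Type*} (S : KoszulData K p q β)

/-! ### Convergence -/

/-- Each generator has weight at most Λ times its degree. So the filtration is finite in each
degree, and all limits below are eventually constant degree by degree. -/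
lemma omB_eq_zero {n a : ℤ} {y : S.B} (h1 : y ∈ part K S.degB n) (h2 : y ∈ wge K S.degB S.omB a)
    (h : S.Lam * n < a) : y = 0 := by
  have h3 := mem_lspan_part h2 h1
  refine lspan_le (T := ⊥) (fun l hl => ?_) h3
  have e1 : a ≤ wt S.omB l := hl.1
  have e2 : wt S.degB l = n := hl.2
  have e3 : wt S.omB l ≤ wt (fun b => S.Lam * S.degB b) l := wt_mono (fun b => by
    have h1 := S.one_le_Lam
    have h2 := S.two_le_B b
    rw [omB]
    split_ifs <;> nlinarith) l
  have e4 : wt (fun b => S.Lam * S.degB b) l = S.Lam * wt S.degB l := by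
    rw [wt, wt, ← List.sum_map_mul_left]
  rw [e4, e2] at e3
  omega

lemma omP_nonneg (i) : 0 ≤ S.omP i := by have := S.one_le_omP i; omega

lemma eq_zero_of_shift {n s k : ℤ} {f : S.P →ₗ[K] S.B} (hf : f ∈ S.hom n)
    (hs : f ∈ S.shift S.omP S.omB s) (h : S.Lam * (k + n) < s) {x : S.P}
    (hx : x ∈ part K S.degP k) : f x = 0 :=
  S.omB_eq_zero (hf.1 _ _ hx) (hs 0 x (mem_wge_zero S.omP_nonneg x)) (by omega)

lemma sub_mem_shift {s : ℤ} {F : ℕ → S.P →ₗ[K] S.B}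
    (h : ∀ m : ℕ, F (m + 1) - F m ∈ S.shift S.omP S.omB (s + m)) {m m' : ℕ} (hm : m ≤ m') :
    F m' - F m ∈ S.shift S.omP S.omB (s + m) := by
  induction m', hm using Nat.le_induction with
  | base => rw [sub_self]; exact zero_mem _
  | succ k hk ih =>
    rw [← sub_add_sub_cancel (F (k + 1)) (F k)]
    exact add_mem (shift_anti (by omega) (h k)) ih

lemma exists_limit {n s : ℤ} {F : ℕ → S.P →ₗ[K] S.B} (hF : ∀ m, F m ∈ S.hom n)
    (h : ∀ m : ℕ, F (m + 1) - F m ∈ S.shift S.omP S.omB (s + m)) :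
    ∃ f ∈ S.hom n, (∀ m : ℕ, f - F m ∈ S.shift S.omP S.omB (s + m)) ∧
      ∀ k : ℤ, ∃ M : ℕ, ∀ m ≥ M, ∀ x ∈ part K S.degP k, f x = F m x := by
  -- The index beyond which the differences vanish on degree k: values have degree k + n, hence
  -- filtration at most Λ(k + n) unless zero. The added 1 makes the inequality strict.
  let M : ℤ → ℕ := fun k => (S.Lam * (k + n) - s).toNat + 1
  have hM : ∀ k, ∀ m ≥ M k, ∀ x ∈ part K S.degP k, F (M k) x = F m x := fun k m hm x hx => by
    have := S.eq_zero_of_shift (sub_mem (hF m) (hF (M k))) (S.sub_mem_shift h hm) (k := k)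
      (by simp only [M]; push_cast; omega) hx
    rw [LinearMap.sub_apply, sub_eq_zero] at this
    exact this.symm
  let f : S.P →ₗ[K] S.B := wsum S.degP fun k => F (M k)
  have hf : ∀ k, ∀ m ≥ M k, ∀ x ∈ part K S.degP k, f x = F m x := fun k m hm x hx => by
    rw [← hM k m hm x hx]
    rw [part_eq_wpart] at hx
    exact wsum_of_mem _ hx
  refine ⟨f, ?_, fun m => mem_shift_of_mon fun l => ?_, fun k => ⟨M k, hf k⟩⟩
  · refine mem_homDeg_of_gens (fun l => ?_) (fun b x => ?_)
    · rw [hf _ _ le_rfl _ (mon_mem_part l)]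
      exact (hF _).1 _ _ (mon_mem_part l)
    · refine eq_of_mon (f := f ∘ₗ LinearMap.mulLeft K (S.base b))
        (g := sgn K (S.degB b * n) • LinearMap.mulLeft K (gen K S.degB b) ∘ₗ f)
        (fun l => ?_) x
      simp only [LinearMap.comp_apply, LinearMap.mulLeft_apply, LinearMap.smul_apply]
      rw [← mon_cons, hf _ (max (M _) (M _)) (le_max_right (M (wt S.degP l)) _) _ (mon_mem_part _),
        hf _ (max (M _) (M (wt S.degP (.inl b :: l)))) (le_max_left (M _) _) _ (mon_mem_part l),
        mon_cons, homDeg_gen (hF _)]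
  · rw [LinearMap.sub_apply, hf _ (max m (M _)) (le_max_right m _) _ (mon_mem_part l),
      ← LinearMap.sub_apply]
    exact S.sub_mem_shift h (le_max_left _ _) _ _ (mon_mem_wge le_rfl)

lemma hD_eq_of_limit {n : ℤ} {F : ℕ → S.P →ₗ[K] S.B} {f : S.P →ₗ[K] S.B}
    (h : ∀ k : ℤ, ∃ M : ℕ, ∀ m ≥ M, ∀ x ∈ part K S.degP k, f x = F m x) (k : ℤ) :
    ∃ M : ℕ, ∀ m ≥ M, ∀ x ∈ part K S.degP k, S.hD n f x = S.hD n (F m) x := by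
  obtain ⟨M1, h1⟩ := h k
  obtain ⟨M2, h2⟩ := h (k + 1)
  refine ⟨max M1 M2, fun m hm x hx => ?_⟩
  rw [hD_apply, hD_apply, h1 m (le_of_max_le_left hm) x hx,
    h2 m (le_of_max_le_right hm) _ (S.D.map_part _ _ hx)]

/-- Split the outer differential in hD ∘ hD = 0 into its two parts and use that the Koszul part
squares to zero. -/
lemma kosD_del {n : ℤ} (f : S.P →ₗ[K] S.B) :
    S.kosD (n + 1) (S.del n f) = - S.del (n + 1) (S.hD n f) := by
  have h : S.hD (n + 1) (S.hD n f) = 0 := homD_homD _ _ _ _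
  have h2 := S.hD_eq (n + 1) (S.hD n f)
  nth_rewrite 2 [S.hD_eq n f] at h2
  rw [h, map_add, kosD_kosD, zero_add] at h2
  exact eq_neg_of_add_eq_zero_left h2.symm

lemma htp_om {n s : ℤ} {f : S.P →ₗ[K] S.B} (hf : f ∈ S.shift S.omP S.omB s) :
    S.htp n f ∈ S.shift S.omP S.omB s := by
  have := S.htp_shift n (wB := S.omB) (wU := S.omU) (r := 0) (fun _ _ h => S.coef_omB h) hf
  rwa [add_zero] at this

lemma htp_low {n s : ℤ} {f : S.P →ₗ[K] S.B} (hf : f ∈ S.shift S.lowP S.lowB s) :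
    S.htp n f ∈ S.shift S.lowP S.lowB (s + 1) :=
  S.htp_shift n (wB := S.lowB) (wU := lowU p q) (r := 1) (fun _ _ h => S.coef_lowB h) hf

/-- Because f is B-linear of fixed degree, it suffices to compare degree and weight on its values on
fibre monomials. The two comparisons can fail in the needed direction only at odd base generators
and at the x̄. Those are finitely many and occur at most once in a nonzero monomial, so the total
loss is bounded. -/
lemma exists_shift [CharZero K] [Fintype β] {n : ℤ} {f : S.P →ₗ[K] S.B} (hf : f ∈ S.hom n) :
    ∃ s, f ∈ S.shift S.omP S.omB s := by
  classical
  -- `cB` bounds the excess of degree over weight on the base, `cU` the excess of weight over degree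
  -- on the fibre.
  let cB : β → ℤ := fun b => if Even (S.degB b) then 0 else S.degB b
  let cU : Fin p ⊕ Fin q → ℤ := Sum.elim (fun _ => S.Lam) (fun _ => 0)
  refine ⟨n - ∑ b, cB b - ∑ v, cU v, mem_shift_of_mon fun l => ?_⟩
  obtain ⟨l1, l2, s, -, hp, e⟩ := mon_split (K := K) (degB := S.degB) (degU := barDeg S.deg) l
  rw [e, map_smul, hf.2 _ _ (mon_mem_part l1), wt_perm _ hp, wt_append, wt_map, wt_map]
  refine Submodule.smul_mem _ _ (Submodule.smul_mem _ _ ?_)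
  by_cases hl2 : mon K (barDeg S.deg) l2 = 0
  · rw [hl2, map_zero, map_zero, mul_zero]; exact zero_mem _
  rw [add_assoc]
  refine mul_mem_wge (mon_mem_wge le_rfl) ?_
  have h1 := hf.1 _ _ (mon_mem_part (K := K) (deg := S.degP) (l2.map Sum.inr))
  rw [wt_map, ← inr_mon, mem_part_lspan] at h1
  refine lspan_le (fun m hm => ?_) h1
  by_cases hm0 : mon K S.degB m = 0
  · rw [hm0]; exact zero_mem _
  refine mon_mem_wge ?_
  have e1 : wt S.degB m = wt (barDeg S.deg) l2 + n := hm
  have e2 : wt S.degB m ≤ wt S.omB m + wt cB m := by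
    have : wt S.omB m + wt cB m = wt (fun b => S.omB b + cB b) m := by
      rw [wt, wt, wt, ← List.sum_map_add]
    rw [this]
    refine wt_mono (fun b => ?_) m
    have := S.le_Lam b
    simp only [omB, cB]
    split_ifs <;> omega
  have e3 : wt cB m ≤ ∑ b, cB b := by
    refine wt_le_sum (fun b => ?_) (fun b hb => ?_) hm0
    · have := S.two_le_B b
      simp only [cB]; split_ifs <;> omega
    · by_contra h
      rw [Int.not_odd_iff_even] at h
      exact hb (if_pos h)
  have e4 : wt S.omU l2 ≤ wt (barDeg S.deg) l2 + wt cU l2 := by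
    have : wt (barDeg S.deg) l2 + wt cU l2 = wt (fun b => barDeg S.deg b + cU b) l2 := by
      rw [wt, wt, wt, ← List.sum_map_add]
    rw [this]
    refine wt_mono (fun v => ?_) l2
    have := S.two_le v
    rcases v with i | j
    · simp only [omU, cU, Sum.elim_inl, barDeg]; omega
    · simp only [omU, cU, Sum.elim_inr, barDeg]; omega
  have e5 : wt cU l2 ≤ ∑ v, cU v := by
    refine wt_le_sum (fun v => ?_) (fun v hv => ?_) hl2
    · have := S.one_le_Lam
      rcases v with i | j
      · simp only [cU, Sum.elim_inl]; omega
      · simp [cU]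
    · rcases v with i | j
      · exact (S.even i).sub_odd odd_one
      · simp [cU] at hv
  have e6 : wt (S.omP ∘ Sum.inr) l2 = wt S.omU l2 := rfl
  omega

/-! ### Existence of the cocycle -/

/-- The approximations of the cocycle. -/
def approx : ℕ → S.P →ₗ[K] S.B
  | 0 => 0
  -- Fixed point iteration for f = f0 - htp(del f), started at 0 so that the first step is f0.
  | m + 1 => S.f0 - S.htp (S.N + 1) (S.del S.N (approx m))

lemma htp_mem' {n : ℤ} {f : S.P →ₗ[K] S.B} (hf : f ∈ S.hom (n + 1)) : S.htp (n + 1) f ∈ S.hom n := by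
  have := S.htp_mem hf
  rwa [add_sub_cancel_right] at this

/-- The perturbation loses at most one unit of lower degree and the homotopy regains it, so all
approximations keep the bound of `f0`. -/
lemma approx_low (m : ℕ) : S.approx m ∈ S.shift S.lowP S.lowB (q - p) := by
  induction m with
  | zero => exact zero_mem _
  | succ m ih =>
    refine sub_mem S.f0_low ?_
    have := S.htp_low (n := S.N + 1) (S.del_low (n := S.N) ih)
    rwa [neg_add_cancel_right] at this

lemma approx_one : S.approx 1 = S.f0 := by
  simp [approx]

lemma hD_hD' {n : ℤ} (G : S.P →ₗ[K] S.B) : S.hD n (S.hD (n - 1) G) = 0 := by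
  have := homD_homD S.dB S.D (n - 1) G
  rwa [sub_add_cancel] at this

lemma hD_mem' {n : ℤ} {G : S.P →ₗ[K] S.B} (hG : G ∈ S.hom (n - 1)) :
    S.hD (n - 1) G ∈ S.hom n := by
  have := S.hD_mem hG
  rwa [sub_add_cancel] at this

lemma approx_succ (m : ℕ) :
    S.approx (m + 1) = S.f0 - S.htp (S.N + 1) (S.del S.N (S.approx m)) := rfl

lemma approx_mem (m : ℕ) : S.approx m ∈ S.hom S.N := by
  induction m with
  | zero => exact zero_mem _
  | succ m ih => exact sub_mem S.f0_mem (S.htp_mem' (S.del_mem ih))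

lemma approx_sub (m : ℕ) : S.approx (m + 1) - S.approx m ∈ S.shift S.omP S.omB (S.s0 + m) := by
  induction m with
  | zero => simpa [approx_one, approx] using S.f0_om
  | succ m ih =>
    have : S.approx (m + 1 + 1) - S.approx (m + 1) =
        - S.htp (S.N + 1) (S.del S.N (S.approx (m + 1) - S.approx m)) := by
      rw [map_sub, map_sub, approx_succ, approx_succ S m]
      abel
    rw [this]
    refine neg_mem (S.htp_om ?_)
    have := S.del_shift (n := S.N) ih
    rwa [add_assoc] at this

variable [CharZero K]

/-- It has shift -(p + q), as `f0` does, and degree N + 1, where that part is zero. -/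
lemma kosD_f0 : S.kosD S.N S.f0 = 0 := by
  have h := S.proj0_N_add_one (S.kosD_mem S.f0_mem)
  rwa [proj0, ← kosD_opM, ← proj0, proj0_f0] at h

/-- The homotopy formula applies to del(approx m), whose `proj0` vanishes, and kosD ∘ del = -del ∘
hD. What is left of the differential of approx (m + 1) is del of the last increment and
htp(del(hD(approx m))) up to sign; both are one step deeper. -/
lemma hD_approx (m : ℕ) : S.hD S.N (S.approx m) ∈ S.shift S.omP S.omB (S.s0 + m) := by
  induction m with
  | zero => rw [approx, map_zero]; exact zero_mem _
  | succ m ih =>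
    have h := S.homotopy_htp (S.del_mem (S.approx_mem m))
    rw [S.proj0_N_add_one (S.del_mem (S.approx_mem m)), sub_zero, add_sub_cancel_right] at h
    have e : S.hD S.N (S.approx (m + 1)) = S.del S.N (S.approx (m + 1) - S.approx m) +
        S.htp (S.N + 1 + 1) (S.kosD (S.N + 1) (S.del S.N (S.approx m))) := by
      rw [hD_eq, map_sub, eq_sub_of_add_eq' h]
      nth_rewrite 1 [approx_succ]
      rw [map_sub, kosD_f0, zero_sub]
      abel
    rw [e]
    have e1 : S.s0 + ((m + 1 : ℕ) : ℤ) = S.s0 + m + 1 := by push_cast; ring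
    rw [e1, kosD_del]
    refine add_mem (S.del_shift (S.approx_sub m)) (S.htp_om (neg_mem (S.del_shift ih)))

/-- There is a cocycle with the given leading term. -/
theorem exists_cocycle : ∃ f ∈ S.hom S.N, S.hD S.N f = 0 ∧
    f - S.f0 ∈ S.shift S.omP S.omB (S.s0 + 1) ∧ f ∈ S.shift S.lowP S.lowB (q - p) := by
  obtain ⟨f, h1, h2, h3⟩ := S.exists_limit S.approx_mem S.approx_sub
  refine ⟨f, h1, LinearMap.ext (eq_of_mon fun l => ?_), ?_, mem_shift_of_mon fun l => ?_⟩
  · obtain ⟨M, hM⟩ := S.hD_eq_of_limit (n := S.N) h3 (wt S.degP l)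
    rw [hM (max M ((S.Lam * (wt S.degP l + (S.N + 1)) - S.s0).toNat + 1)) (le_max_left _ _) _
      (mon_mem_part l)]
    refine S.eq_zero_of_shift (S.hD_mem (S.approx_mem _)) (S.hD_approx _) ?_ (mon_mem_part l)
    have := le_max_right M ((S.Lam * (wt S.degP l + (S.N + 1)) - S.s0).toNat + 1)
    omega
  · simpa [approx_one] using h2 1
  · obtain ⟨M, hM⟩ := h3 (wt S.degP l)
    rw [hM M le_rfl _ (mon_mem_part l)]
    exact S.approx_low M _ _ (mon_mem_wge le_rfl)

/-! ### Uniqueness -/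

/-- One step of the reduction of a cocycle. -/
lemma sub_hD_htp {n s : ℤ} {F : S.P →ₗ[K] S.B} (hF : F ∈ S.hom n)
    (hs : F ∈ S.shift S.omP S.omB s) (hc : S.hD n F = 0) :
    F - S.hD (n - 1) (S.htp n F) - S.proj0 F ∈ S.shift S.omP S.omB (s + 1) := by
  have h := S.homotopy_htp hF
  have e : F - S.hD (n - 1) (S.htp n F) - S.proj0 F =
      - S.htp (n + 1) (S.del n F) - S.del (n - 1) (S.htp n F) := by
    -- For a cocycle the Koszul part equals minus the perturbation, which already gains one step of
    -- filtration.
    have hk : S.kosD n F = - S.del n F := by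
      rw [hD_eq] at hc; exact eq_neg_of_add_eq_zero_left hc
    rw [hk, map_neg] at h
    rw [hD_eq, sub_right_comm, ← h]
    abel
  rw [e]
  exact sub_mem (neg_mem (S.htp_om (S.del_shift hs))) (S.del_shift (S.htp_om hs))

/-- The successive remainders of a cocycle. -/
def rem (n : ℤ) (F : S.P →ₗ[K] S.B) : ℕ → S.P →ₗ[K] S.B
  | 0 => F
  | m + 1 => rem n F m - S.hD (n - 1) (S.htp n (rem n F m))

/-- Where `proj0` vanishes, subtracting the coboundary of the homotopy gains one step each time and
keeps a cocycle. -/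
lemma rem_spec {n s : ℤ} (hp : ∀ F ∈ S.hom n, F ∈ S.shift S.omP S.omB s → S.proj0 F = 0)
    {F : S.P →ₗ[K] S.B} (hF : F ∈ S.hom n) (hs : F ∈ S.shift S.omP S.omB s)
    (hc : S.hD n F = 0) (m : ℕ) :
    S.rem n F m ∈ S.hom n ∧ S.rem n F m ∈ S.shift S.omP S.omB (s + m) ∧
      S.hD n (S.rem n F m) = 0 := by
  induction m with
  | zero => simpa [rem] using ⟨hF, hs, hc⟩
  | succ m ih =>
    obtain ⟨h1, h2, h3⟩ := ih
    refine ⟨sub_mem h1 (S.hD_mem' (S.htp_mem h1)), ?_, ?_⟩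
    · have := S.sub_hD_htp h1 h2 h3
      rw [hp _ h1 (shift_anti (by omega) h2), sub_zero] at this
      rw [rem, show s + ((m + 1 : ℕ) : ℤ) = s + m + 1 by push_cast; ring]
      exact this
    · rw [rem, map_sub, h3, hD_hD', sub_zero]

/-- Cocycles of large filtration are coboundaries. -/
lemma coboundary_of_shift {n s : ℤ}
    (hp : ∀ F ∈ S.hom n, F ∈ S.shift S.omP S.omB s → S.proj0 F = 0)
    {F : S.P →ₗ[K] S.B} (hF : F ∈ S.hom n) (hs : F ∈ S.shift S.omP S.omB s)
    (hc : S.hD n F = 0) : ∃ G ∈ S.hom (n - 1), S.hD (n - 1) G = F := by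
  have hr := S.rem_spec hp hF hs hc
  let G : ℕ → S.P →ₗ[K] S.B := fun m => ∑ i ∈ Finset.range m, S.htp n (S.rem n F i)
  have hG : ∀ m, F - S.hD (n - 1) (G m) = S.rem n F m := by
    intro m
    induction m with
    | zero => simp [G, rem]
    | succ m ih =>
      simp only [G, Finset.sum_range_succ, map_add]
      rw [← sub_sub]
      simp only [G] at ih
      rw [ih, rem]
  obtain ⟨g, h1, -, h3⟩ := S.exists_limit (F := G) (n := n - 1) (s := s)
    (fun m => Submodule.sum_mem _ fun i _ => S.htp_mem (hr i).1)
    (fun m => by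
      simp only [G, Finset.sum_range_succ, add_sub_cancel_left]
      exact S.htp_om (hr m).2.1)
  refine ⟨g, h1, LinearMap.ext (eq_of_mon fun l => ?_)⟩
  obtain ⟨M, hM⟩ := S.hD_eq_of_limit (n := n - 1) h3 (wt S.degP l)
  let m := max M ((S.Lam * (wt S.degP l + n) - s).toNat + 1)
  rw [hM m (le_max_left _ _) _ (mon_mem_part l), eq_comm, ← sub_eq_zero, ← LinearMap.sub_apply, hG]
  refine S.eq_zero_of_shift (hr m).1 (hr m).2.1 ?_ (mon_mem_part l)
  have : (S.Lam * (wt S.degP l + n) - s).toNat + 1 ≤ m := le_max_right M _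
  omega

/-- On x̄_1 ⋯ x̄_p a multiple c of `f0` takes the value c ∏ t_y, of weight exactly q, while the
hypothesis demands at least q + 1. -/
lemma proj0_eq_zero_of_shift {F : S.P →ₗ[K] S.B} (hF : F ∈ S.hom S.N)
    (hs : F ∈ S.shift S.omP S.omB (S.s0 + 1)) : S.proj0 F = 0 := by
  obtain ⟨c, hc⟩ := S.proj0_N hF
  have h1 : S.proj0 F ∈ S.shift S.omP S.omB (S.s0 + 1) := by
    rw [proj0]; exact S.opM_shift _ hs
  have h2 := h1 (p * S.Lam) S.barx (by
    refine mon_mem_wge (le_of_eq ?_)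
    rw [wt_map, show S.omP ∘ Sum.inr = S.omU from rfl, wt_xs (c := S.Lam) (fun _ => rfl)])
  rw [hc, LinearMap.smul_apply, f0_barx, show p * S.Lam + (S.s0 + 1) = q + 1 by rw [s0]; ring] at h2
  have h3 : c • S.ty ∈ wpart K S.degB S.omB q := Submodule.smul_mem _ _ (by
    have := S.ty_mem S.omB
    rwa [wt_ys (c := 1) (fun j => by rw [Function.comp_apply, omB_e]; rfl), mul_one] at this)
  have h4 := mem_lspan_inter (Q := fun k => k = q) h2 h3
  have h5 : c • S.ty ∈ (⊥ : Submodule K S.B) := by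
    refine lspan_le (fun l hl => ?_) h4
    have e1 : (q : ℤ) + 1 ≤ wt S.omB l := hl.1
    have e2 : wt S.omB l = q := hl.2
    omega
  rw [Submodule.mem_bot, smul_eq_zero] at h5
  rw [hc, h5.resolve_right S.ty_ne_zero, zero_smul]

variable [Fintype β]

/-- Every cocycle in the degree of the shriek map is cohomologous to a multiple of it. -/
theorem cocycle_eq {f : S.P →ₗ[K] S.B} (hf : f ∈ S.hom S.N) (hD : S.hD S.N f = 0)
    (hf0 : f - S.f0 ∈ S.shift S.omP S.omB (S.s0 + 1)) {F : S.P →ₗ[K] S.B} (hF : F ∈ S.hom S.N)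
    (hc : S.hD S.N F = 0) : ∃ c : K, ∃ G ∈ S.hom (S.N - 1), F = c • f + S.hD (S.N - 1) G := by
  -- Induction on how far F lies below the filtration s0 + 1. One reduction step leaves only a
  -- multiple a of `f0`; subtracting a f removes it up to filtration s0 + 1. From s0 + 1 on, F is a
  -- coboundary.
  have key : ∀ k : ℕ, ∀ F ∈ S.hom S.N, S.hD S.N F = 0 →
      F ∈ S.shift S.omP S.omB (S.s0 + 1 - k) →
      ∃ c : K, ∃ G ∈ S.hom (S.N - 1), F = c • f + S.hD (S.N - 1) G := by
    intro k
    induction k with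
    | zero =>
      intro F hF hc hs
      rw [Nat.cast_zero, sub_zero] at hs
      obtain ⟨G, hG, e⟩ := S.coboundary_of_shift (fun F => S.proj0_eq_zero_of_shift) hF hs hc
      exact ⟨0, G, hG, by rw [e, zero_smul, zero_add]⟩
    | succ k ih =>
      intro F hF hc hs
      obtain ⟨a, ha⟩ := S.proj0_N hF
      have h1 := S.sub_hD_htp hF hs hc
      have hG := S.htp_mem hF
      have h2 : F - S.hD (S.N - 1) (S.htp S.N F) - a • f ∈
          S.shift S.omP S.omB (S.s0 + 1 - k) := by
        have : F - S.hD (S.N - 1) (S.htp S.N F) - a • f =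
            (F - S.hD (S.N - 1) (S.htp S.N F) - S.proj0 F) - a • (f - S.f0) := by
          rw [ha, smul_sub]; abel
        rw [this]
        refine sub_mem (shift_anti ?_ h1) (Submodule.smul_mem _ _ (shift_anti ?_ hf0))
        · push_cast; omega
        · omega
      obtain ⟨c, G, hG', e⟩ := ih _ (sub_mem (sub_mem hF (S.hD_mem' hG)) (Submodule.smul_mem _ a hf))
        (by rw [map_sub, map_sub, hc, hD_hD', map_smul, hD]; simp) h2
      refine ⟨a + c, S.htp S.N F + G, add_mem hG hG', ?_⟩
      rw [map_add, add_smul]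
      rw [sub_sub, sub_eq_iff_eq_add] at e
      refine e.trans ?_
      abel
  obtain ⟨s, hs⟩ := S.exists_shift hF
  exact key (S.s0 + 1 - s).toNat F hF hc (shift_anti (by omega) hs)

/-- If every generator occurs in the leading term, the cohomology vanishes in the other degrees. -/
theorem coboundary_of_ne (he : Function.Surjective S.e) {n : ℤ} (hn : n ≠ S.N)
    {F : S.P →ₗ[K] S.B} (hF : F ∈ S.hom n) (hc : S.hD n F = 0) :
    ∃ G ∈ S.hom (n - 1), S.hD (n - 1) G = F := by
  obtain ⟨s, hs⟩ := S.exists_shift hF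
  -- A word in generators outside the image of `e` is empty here, whatever its degree.
  refine S.coboundary_of_shift (fun F hF _ => S.proj0_eq_zero hn hF fun r hr _ => ?_) hF hs hc
  cases r with
  | nil => rfl
  | cons b r => exact absurd (he b) (hr b (by simp))

end KoszulData


open FreeCGA

/-! ### Detecting coboundaries -/

section Detect

variable {K : Type*} [Field K]

lemma FreeCGA.IsDer.map_mon_mem {ι : Type*} {deg : ι → ℤ} {k : ℤ}
    {θ : FreeCGA K deg →ₗ[K] FreeCGA K deg} (hθ : IsDer (AlgHom.id K _) k θ) (L : List ι)
    {T : Submodule K (FreeCGA K deg)}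
    (h : ∀ l1 a l2, L = l1 ++ a :: l2 → mon K deg l1 * θ (gen K deg a) * mon K deg l2 ∈ T) :
    θ (mon K deg L) ∈ T := by
  induction L generalizing T with
  | nil => rw [mon_nil, hθ.one]; exact zero_mem _
  | cons a L ih =>
    rw [mon_cons, hθ.gen_mul]
    refine add_mem (by simpa using h [] a L rfl) (Submodule.smul_mem _ _ ?_)
    refine ih (T := T.comap (LinearMap.mulLeft K (gen K deg a))) fun l1 b l2 e => ?_
    rw [Submodule.mem_comap, LinearMap.mulLeft_apply, ← mul_assoc, ← mul_assoc, ← mon_cons]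
    exact h _ _ _ (by rw [e]; rfl)

variable [CharZero K] {p q : ℕ} {β : Type*} {degB : β → ℤ} {deg : Fin p ⊕ Fin q → ℤ}

open KoszulData

variable (deg) in
/-- The degrees of the odd generators. -/
abbrev degY (j : Fin q) : ℤ := deg (.inr j)

lemma ys_eq : ys p q = (List.finRange q).map Sum.inr := List.ofFn_eq_map

lemma wt_degY : wt (degY deg) (List.finRange q) = wt deg (ys p q) := by
  rw [ys_eq, wt_map]; rfl

/-- A nonzero monomial uses each y at most once. One degree below the top, the missing generators
would have total degree 1, but each has degree at least 2. -/
lemma degY_part_eq_zero (hdeg : ∀ v, 2 ≤ deg v) (hodd : ∀ j, Odd (deg (.inr j)))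
    {x : FreeCGA K (degY deg)} (hx : x ∈ part K (degY deg) (wt deg (ys p q) - 1)) : x = 0 := by
  rw [part_eq_wpart] at hx
  refine wpart_eq_zero hx fun l hl => ?_
  by_contra hne
  have h1 : ∀ j, (l.count j : ℤ) ≤ 1 := fun j => by exact_mod_cast count_le_one (deg := degY deg) (i := j) (hodd j) hne
  rw [← wt_degY, wt_eq_sum_count, wt_eq_sum_count] at hl
  simp only [List.count_eq_one_of_mem (List.nodup_finRange q) (List.mem_finRange _), Nat.cast_one]
    at hl
  have h2 : ∑ j, degY deg j * (1 - (l.count j : ℤ)) = 1 := by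
    simp only [mul_sub, Finset.sum_sub_distrib]; omega
  obtain ⟨j, -, hj⟩ : ∃ j ∈ Finset.univ, degY deg j * (1 - (l.count j : ℤ)) ≠ 0 :=
    Finset.exists_ne_zero_of_sum_ne_zero (by rw [h2]; exact one_ne_zero)
  have h0 : ∀ j, 0 ≤ degY deg j * (1 - (l.count j : ℤ)) := fun j =>
    mul_nonneg (by have := hdeg (.inr j); rw [degY]; omega) (by have := h1 j; omega)
  have h3 := Finset.single_le_sum (fun j _ => h0 j) (Finset.mem_univ j)
  rw [h2] at h3
  have h4 : 1 ≤ 1 - (l.count j : ℤ) := by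
    have : 1 - (l.count j : ℤ) ≠ 0 := right_ne_zero_of_mul hj
    have := h1 j
    omega
  have h5 : 2 ≤ degY deg j := hdeg (.inr j)
  nlinarith

/-- A criterion for the vanishing of the leading value of a coboundary. -/
lemma map_homD_barx (hdeg : ∀ v, 2 ≤ deg v) (heven : ∀ i, Even (deg (.inl i)))
    (hodd : ∀ j, Odd (deg (.inr j))) {dB : Differential K degB}
    {D : Differential K (Sum.elim degB (barDeg deg))} {π : FreeCGA K degB →ₐ[K] FreeCGA K (degY deg)}
    (hπ : ∀ b, π (gen K degB b) ∈ part K (degY deg) (degB b))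
    {θ : FreeCGA K (degY deg) →ₗ[K] FreeCGA K (degY deg)} (hθ : ∀ b, π (dB b) = θ (π b))
    {X : Set β} (hX : ∀ b ∈ X, π (gen K degB b) = 0)
    (hD : ∀ i, D (gen K _ (.inr (.inl i))) ∈ lspan K (Sum.elim degB (barDeg deg))
      {l | (∃ b ∈ X, .inl b ∈ l) ∨ ∃ k ≠ i, .inr (.inl k) ∈ l})
    {n : ℤ} (hn : wt (barDeg deg) (xs p q) + n = wt deg (ys p q))
    {g : FreeCGA K (Sum.elim degB (barDeg deg)) →ₗ[K] FreeCGA K degB}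
    (hg : g ∈ homDeg degB (barDeg deg) (n - 1)) :
    π (homD dB D (n - 1) g (mon K _ ((xs p q).map Sum.inr))) = 0 := by
  have _ : DecidableEq β := Classical.decEq β
  let _ : BEq (β ⊕ (Fin p ⊕ Fin q)) := instBEqOfDecidableEq
  change π (dB.toLin (g _) - sgn K (n - 1) • g (D.toLin _)) = 0
  have h1 : π (g (mon K _ ((xs p q).map Sum.inr))) = 0 := by
    refine degY_part_eq_zero hdeg hodd (algHom_map_part hπ ?_)
    have := hg.1 _ _ (mon_mem_part (K := K) (deg := Sum.elim degB (barDeg deg))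
      ((xs p q).map Sum.inr))
    rw [wt_map] at this
    convert this using 2
    change _ = wt (barDeg deg) _ + _
    omega
  -- By the Leibniz rule one factor x̄_i is replaced by D x̄_i. A term of it containing x̄_k with k
  -- ≠ i meets the factor x̄_k still present, and the product is zero because x̄_k is odd. Only
  -- terms with a base generator from `X` survive.
  have h2 : D.toLin (mon K _ ((xs p q).map Sum.inr)) ∈ lspan K (Sum.elim degB (barDeg deg))
      {l | ∃ b ∈ X, .inl b ∈ l} := by
    refine D.isDer.map_mon_mem _ fun l1 a l2 e => ?_
    have ha : a ∈ (xs p q).map Sum.inr := by rw [e]; simp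
    obtain ⟨v, hv, rfl⟩ := List.mem_map.1 ha
    obtain ⟨i, rfl⟩ : ∃ i, .inl i = v := by simpa [xs] using hv
    refine map_mem_of_lspan (f := LinearMap.mulRight K (mon K _ l2) ∘ₗ
      LinearMap.mulLeft K (mon K _ l1)) (fun l hl => ?_) (hD i)
    rw [LinearMap.comp_apply, LinearMap.mulLeft_apply, LinearMap.mulRight_apply, ← mon_append,
      ← mon_append]
    rcases hl with ⟨b, hb, hl⟩ | ⟨k, hk, hl⟩
    · exact mon_mem_lspan ⟨b, hb, by simp [hl]⟩
    · have hk2 : Sum.inr (Sum.inl k) ∈ l1 ++ Sum.inr (Sum.inl i) :: l2 := by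
        rw [← e]; simp [xs]
      rw [mon_eq_zero (i := Sum.inr (Sum.inl k))]
      · exact zero_mem _
      · exact (heven k).sub_odd odd_one
      · have h1 : 1 ≤ l.count (Sum.inr (Sum.inl k)) := List.one_le_count_iff.2 hl
        have h2 : 1 ≤ (l1 ++ l2).count (Sum.inr (Sum.inl k)) := by
          refine List.one_le_count_iff.2 ?_
          simpa [hk] using hk2
        simp only [List.count_append] at h2 ⊢
        omega
  have h3 : π (g (D.toLin (mon K _ ((xs p q).map Sum.inr)))) = 0 := by
    refine eq_of_lspan (f := π.toLinearMap ∘ₗ g) (g := 0) ?_ h2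
    rintro l ⟨b, hb, hl⟩
    obtain ⟨s, -, e⟩ := mon_perm (K := K) (deg := Sum.elim degB (barDeg deg))
      (List.perm_cons_erase hl)
    rw [LinearMap.comp_apply, e, map_smul, mon_cons, homDeg_gen hg]
    simp [hX b hb]
  rw [map_sub, map_smul, h3, smul_zero, sub_zero]
  have := hθ (g (mon K _ ((xs p q).map Sum.inr)))
  rw [h1, map_zero] at this
  exact this

end Detect


open FreeCGA

/-! ### Homomorphisms and differentials on generators -/

section Homs

variable {K : Type*} [Field K] {ι κ : Type*} {deg : ι → ℤ} {deg' : κ → ℤ}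

/-- The algebra homomorphism with given homogeneous values on the generators. -/
def FreeCGA.ofGens (g : ι → FreeCGA K deg') (hg : ∀ i, g i ∈ part K deg' (deg i)) :
    FreeCGA K deg →ₐ[K] FreeCGA K deg' :=
  lift deg g fun i j => graded_comm (hg i) (hg j)

@[simp] lemma FreeCGA.ofGens_gen (g : ι → FreeCGA K deg') (hg : ∀ i, g i ∈ part K deg' (deg i)) (i : ι) :
    ofGens g hg (gen K deg i) = g i := lift_gen _ _ _ _

lemma FreeCGA.algHom_ext {A : Type*} [Ring A] [Algebra K A] {φ ψ : FreeCGA K deg →ₐ[K] A}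
    (h : ∀ i, φ (gen K deg i) = ψ (gen K deg i)) (x : FreeCGA K deg) : φ x = ψ x := by
  induction x using FreeCGA.induction with
  | h0 c => simp
  | h1 i => exact h i
  | hm x y hx hy => rw [map_mul, map_mul, hx, hy]
  | ha x y hx hy => rw [map_add, map_add, hx, hy]

/-- It is enough to check on generators that a homomorphism commutes with differentials. -/
lemma FreeCGA.algHom_comm {d : Differential K deg} {d' : Differential K deg'}
    {φ : FreeCGA K deg →ₐ[K] FreeCGA K deg'} (hφ : ∀ i, φ (gen K deg i) ∈ part K deg' (deg i))
    (h : ∀ i, φ (d (gen K deg i)) = d' (φ (gen K deg i))) (x) : φ (d x) = d' (φ x) :=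
  (d.isDer.algHom_comp φ).ext (d'.isDer.comp_algHom φ hφ) h x

lemma FreeCGA.algHom_signAut {φ : FreeCGA K deg →ₐ[K] FreeCGA K deg'}
    (hφ : ∀ i, φ (gen K deg i) ∈ part K deg' (deg i)) (x) :
    φ (signAut K deg x) = signAut K deg' (φ x) := by
  refine algHom_ext (φ := φ.comp (signAut K deg)) (ψ := (signAut K deg').comp φ) (fun i => ?_) x
  rw [AlgHom.comp_apply, AlgHom.comp_apply, signAut_part (gen_mem_part _ i), map_smul,
    signAut_part (hφ i)]

lemma exists_section {X Y : Type*} [AddCommGroup X] [Module K X] [AddCommGroup Y] [Module K Y]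
    (f : X →ₗ[K] Y) : ∃ g : Y →ₗ[K] X, ∀ x, f (g (f x)) = f x := by
  obtain ⟨g0, h0⟩ := f.rangeRestrict.exists_rightInverse_of_surjective f.range_rangeRestrict
  obtain ⟨g, hg⟩ := LinearMap.exists_extend g0
  refine ⟨g, fun x => ?_⟩
  have h1 : g (f x) = g0 (f.rangeRestrict x) := LinearMap.congr_fun hg (f.rangeRestrict x)
  have h2 := LinearMap.congr_fun h0 (f.rangeRestrict x)
  rw [h1]
  exact congrArg Subtype.val h2

end Homs

/-! ### Linear parts -/

section LinearPart

variable {K : Type*} [Field K] {ι κ : Type*} {deg : ι → ℤ} {deg' : κ → ℤ}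

open Classical in
variable (K deg) in
/-- The coefficient of a generator in the linear part of an element. -/
def lin (i : ι) : FreeCGA K deg →ₗ[K] K :=
  TrivSqZeroExt.sndHom K K ∘ₗ (lift deg (fun j => if j = i then (DualNumber.eps : DualNumber K) else 0)
    (by intro j k; split_ifs <;> simp)).toLinearMap

/-- The linear coefficient is the ε-part of a homomorphism to the dual numbers whose constant part
is the augmentation; the product rule `lin_mul` follows. -/
lemma lin_aux (i : ι) : ∃ φ : FreeCGA K deg →ₐ[K] DualNumber K, (∀ x, lin K deg i x = (φ x).snd) ∧
    (∀ x, (φ x).fst = aug K deg x) := by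
  classical
  refine ⟨lift deg (fun j => if j = i then (DualNumber.eps : DualNumber K) else 0)
    (by intro j k; split_ifs <;> simp), fun x => by unfold lin; congr!, fun x => ?_⟩
  refine algHom_ext (φ := (TrivSqZeroExt.fstHom K K K).comp _) (fun j => ?_) x
  rw [AlgHom.comp_apply, lift_gen, aug, lift_gen]
  split_ifs <;> simp

lemma lin_mul (i : ι) (x y : FreeCGA K deg) :
    lin K deg i (x * y) = aug K deg x * lin K deg i y + lin K deg i x * aug K deg y := by
  obtain ⟨φ, h1, h2⟩ := lin_aux (K := K) (deg := deg) i
  simp [h1, ← h2, mul_comm]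

lemma lin_one (i : ι) : lin K deg i 1 = 0 := by
  obtain ⟨φ, h1, h2⟩ := lin_aux (K := K) (deg := deg) i
  simp [h1]

lemma lin_gen [DecidableEq ι] (i j : ι) : lin K deg i (gen K deg j) = if j = i then 1 else 0 := by
  rw [lin, LinearMap.comp_apply, AlgHom.toLinearMap_apply, lift_gen]
  split_ifs <;> simp

lemma aug_mon_cons (i : ι) (l : List ι) : aug K deg (mon K deg (i :: l)) = 0 := by
  rw [mon_cons, map_mul, aug, lift_gen, zero_mul]

lemma lin_of_wge {i : ι} {x : FreeCGA K deg} (hx : x ∈ wge K deg (fun _ => 1) 2) :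
    lin K deg i x = 0 := by
  refine lspan_le (T := LinearMap.ker (lin K deg i)) (fun l hl => ?_) hx
  have h : (2 : ℤ) ≤ wt (fun _ => 1) l := hl
  rcases l with _ | ⟨a, _ | ⟨b, l⟩⟩
  · simp at h
  · simp at h
  · rw [LinearMap.mem_ker, mon_cons, lin_mul, aug_mon_cons, mul_zero, aug, lift_gen, zero_mul,
      add_zero]

/-- An element without constant term is the sum of its linear part and an element of word
length at least two. -/
lemma sub_lin_mem [Fintype ι] {x : FreeCGA K deg} (hx : x ∈ wge K deg (fun _ => 1) 1) :
    x - ∑ i, lin K deg i x • gen K deg i ∈ wge K deg (fun _ => 1) 2 := by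
  classical
  refine map_mem_of_lspan (f := LinearMap.id - ∑ i, (lin K deg i).smulRight (gen K deg i))
    (T := wge K deg (fun _ => 1) 2) (fun l hl => ?_) hx |> fun h => by
      simpa [LinearMap.sum_apply] using h
  have h : (1 : ℤ) ≤ wt (fun _ => 1) l := hl
  simp only [LinearMap.sub_apply, LinearMap.id_apply, LinearMap.sum_apply,
    LinearMap.smulRight_apply]
  rcases l with _ | ⟨a, _ | ⟨b, l⟩⟩
  · simp at h
  · simp [lin_gen]
  · have h2 : mon K deg (a :: b :: l) ∈ wge K deg (fun _ => 1) 2 := mon_mem_wge (by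
      have := wt_nonneg (w := fun _ : ι => (1 : ℤ)) (fun _ => by norm_num) l
      rw [wt_cons, wt_cons]; omega)
    rw [Finset.sum_eq_zero fun i _ => by rw [lin_of_wge h2, zero_smul], sub_zero]
    exact h2

lemma part_le_wge {n : ℤ} (hn : n ≠ 0) :
    part K deg n ≤ wge K deg (fun _ => 1) 1 := by
  intro x hx
  rw [mem_part_lspan] at hx
  refine lspan_mono (fun l hl => ?_) hx
  have hl : wt deg l = n := hl
  rcases l with _ | ⟨a, l⟩
  · exact absurd hl.symm hn
  · have := wt_nonneg (w := fun _ : ι => (1 : ℤ)) (fun _ => by norm_num) l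
    change 1 ≤ wt _ (a :: l)
    rw [wt_cons]; omega

lemma lin_of_part {i : ι} {n : ℤ} {x : FreeCGA K deg} (hx : x ∈ part K deg n) (h : lin K deg i x ≠ 0) :
    deg i = n := by
  classical
  by_contra hne
  rw [mem_part_lspan] at hx
  refine h (lspan_le (T := LinearMap.ker (lin K deg i)) (fun l hl => ?_) hx)
  have hl : wt deg l = n := hl
  rcases l with _ | ⟨a, _ | ⟨b, l⟩⟩
  · exact lin_one i
  · rw [LinearMap.mem_ker, mon_cons, mon_nil, mul_one, lin_gen, if_neg]
    rintro rfl; simp at hl; exact hne hl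
  · refine lin_of_wge (mon_mem_wge ?_)
    have := wt_nonneg (w := fun _ : ι => (1 : ℤ)) (fun _ => by norm_num) l
    rw [wt_cons, wt_cons]; omega

/-- The linear part of the image under a map which does not decrease word length. -/
lemma lin_map [Fintype ι] {f : FreeCGA K deg →ₗ[K] FreeCGA K deg'} (i : κ)
    (hf : ∀ x ∈ wge K deg (fun _ => 1) 2, f x ∈ wge K deg' (fun _ => 1) 2)
    {x : FreeCGA K deg} (hx : x ∈ wge K deg (fun _ => 1) 1) :
    lin K deg' i (f x) = ∑ j, lin K deg j x * lin K deg' i (f (gen K deg j)) := by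
  have h := lin_of_wge (i := i) (hf _ (sub_lin_mem hx))
  rw [map_sub, map_sub, sub_eq_zero] at h
  rw [h]
  simp [map_sum]

end LinearPart


open FreeCGA

/-! ### Relative Sullivan algebras and their linear contractions -/

section Tower

variable {K : Type*} [Field K] {κ ζ : Type*} {degC : κ → ℤ} {degZ : ζ → ℤ}

/-- Subspaces of the generators of the fibre that are reached by finitely many steps of a relative
Sullivan filtration. -/
inductive Tower (D : Differential K (Sum.elim degC degZ)) :
    Submodule K (FreeCGA K (Sum.elim degC degZ)) → Prop
  | bot : Tower D ⊥
  | step {G G' : Submodule K (FreeCGA K (Sum.elim degC degZ))} (hG : Tower D G)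
      (hgr : IsGradedSubspace G') (hle : G ≤ G') (hgens : G' ≤ gens K (Sum.elim degC degZ))
      (h : ∀ v ∈ G', D v ∈ Algebra.adjoin K
        (Set.range (inl degC degZ) ∪ (G : Set (FreeCGA K (Sum.elim degC degZ))))) : Tower D G'

lemma IsGradedSubspace.induction {ι : Type*} {deg : ι → ℤ} {F : Submodule K (FreeCGA K deg)}
    (hF : IsGradedSubspace F) {P : FreeCGA K deg → Prop} (h0 : P 0)
    (h : ∀ n, ∀ x ∈ F, x ∈ part K deg n → P x) (ha : ∀ x y, P x → P y → P (x + y)) {x} (hx : x ∈ F) :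
    P x := by
  rw [hF] at hx
  exact Submodule.iSup_induction _ (motive := P) hx (fun n x hx => h n x hx.1 hx.2) h0 ha

lemma isGradedSubspace_bot {ι : Type*} {deg : ι → ℤ} :
    IsGradedSubspace (⊥ : Submodule K (FreeCGA K deg)) := by
  simp [IsGradedSubspace]

lemma Tower.isGraded {D : Differential K (Sum.elim degC degZ)} {G} (h : Tower D G) :
    IsGradedSubspace G := by
  cases h with
  | bot => exact isGradedSubspace_bot
  | step _ h _ _ _ => exact h

end Tower

/-! ### The cylinder C ⊗ ∧(Z ⊕ dZ) and lifting through its projection. -/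

namespace Cyl

variable {K : Type*} [Field K] {κ ζ : Type*} (degC : κ → ℤ) (degZ : ζ → ℤ)

/-- The degrees of the generators of the cylinder. -/
abbrev degE : (κ ⊕ ζ) ⊕ ζ → ℤ := Sum.elim (Sum.elim degC degZ) (fun z => degZ z + 1)

/-- The weight that does not count the generators of the base. -/
def wtE : (κ ⊕ ζ) ⊕ ζ → ℤ := Sum.elim (Sum.elim (fun _ => 0) (fun _ => 1)) (fun _ => 1)

variable {degC degZ}

/-- The inclusion of the base in the cylinder. -/
def baseE : FreeCGA K degC →ₐ[K] FreeCGA K (degE degC degZ) :=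
  ofGens (fun c => gen K (degE degC degZ) (.inl (.inl c)))
    (fun c => gen_mem_part (degE degC degZ) (.inl (.inl c)))

@[simp] lemma baseE_gen (c : κ) :
    baseE (degZ := degZ) (gen K degC c) = gen K (degE degC degZ) (.inl (.inl c)) := ofGens_gen _ _ _

lemma baseE_mem_part (c : κ) : baseE (degZ := degZ) (gen K degC c) ∈ part K (degE degC degZ) (degC c) := by
  rw [baseE_gen]; exact gen_mem_part (degE degC degZ) (.inl (.inl c))

lemma baseE_wpart (x : FreeCGA K degC) :
    baseE (degZ := degZ) x ∈ wpart K (degE degC degZ) wtE 0 := by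
  have hx : x ∈ wpart K degC (fun _ => 0) 0 := mem_of_mon (fun l => by
    have := mon_mem_wpart (K := K) (deg := degC) (fun _ => 0) l
    rwa [wt, List.sum_eq_zero (by simp)] at this) x
  exact algHom_map_wpart (fun c => by
    rw [baseE_gen]; exact gen_mem_wpart wtE (Sum.inl (Sum.inl c))) hx

variable (dC : Differential K degC)

/-- The values of the differential of the cylinder on the generators. -/
def dEgen : (κ ⊕ ζ) ⊕ ζ → FreeCGA K (degE degC degZ) :=
  Sum.elim (Sum.elim (fun c => baseE (dC (gen K degC c))) (fun z => gen K _ (.inr z))) (fun _ => 0)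

lemma dEgen_mem (i : (κ ⊕ ζ) ⊕ ζ) :
    dEgen (degZ := degZ) dC i ∈ part K (degE degC degZ) (degE degC degZ i + 1) := by
  rcases i with (c | z) | z
  · exact algHom_map_part baseE_mem_part (dC.map_part _ _ (gen_mem_part _ c))
  · exact gen_mem_part (degE degC degZ) (.inr z)
  · exact zero_mem _

lemma der_baseE (x : FreeCGA K degC) :
    der (K := K) 1 (dEgen (degZ := degZ) dC) (dEgen_mem dC) (baseE x) = baseE (dC x) :=
  ((der_isDer 1 _ (dEgen_mem dC)).comp_algHom baseE baseE_mem_part).ext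
    (dC.isDer.algHom_comp baseE) (fun c => by
      simp only [LinearMap.comp_apply, AlgHom.toLinearMap_apply, baseE_gen, der_gen]; rfl) x

/-- The differential of the cylinder. -/
def dE : Differential K (degE degC degZ) :=
  Differential.ofGens (der 1 (dEgen dC) (dEgen_mem dC)) (der_isDer _ _ _)
    (fun i => by rw [der_gen]; exact dEgen_mem dC i) (fun i => by
      rw [der_gen]
      rcases i with (c | z) | z
      · exact (der_baseE dC _).trans (by rw [dC.sq_zero, map_zero])
      · exact der_gen _ _ (dEgen_mem dC) (.inr z)
      · exact map_zero _)

lemma dE_base (x : FreeCGA K degC) : dE (degZ := degZ) dC (baseE x) = baseE (dC x) := der_baseE dC x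

@[simp] lemma dE_fibre (z : ζ) : dE dC (gen K (degE degC degZ) (.inl (.inr z))) =
    gen K (degE degC degZ) (.inr z) := der_gen _ _ (dEgen_mem dC) _

@[simp] lemma dE_new (z : ζ) : dE dC (gen K (degE degC degZ) (.inr z)) = 0 :=
  der_gen _ _ (dEgen_mem dC) _

variable (K degC degZ) in
/-- The contraction of the cylinder, a derivation. -/
def hE : FreeCGA K (degE degC degZ) →ₗ[K] FreeCGA K (degE degC degZ) :=
  der (-1) (Sum.elim (fun _ => 0) (fun z => gen K (degE degC degZ) (.inl (.inr z)))) (by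
    rintro (i | z)
    · exact zero_mem _
    · simpa using gen_mem_part (K := K) (degE degC degZ) (.inl (.inr z)))

lemma hE_isDer : IsDer (AlgHom.id K _) (-1) (hE K degC degZ) := der_isDer _ _ _
@[simp] lemma hE_inl (i) : hE K degC degZ (gen K (degE degC degZ) (.inl i)) = 0 := der_gen _ _ _ _
@[simp] lemma hE_new (z) : hE K degC degZ (gen K (degE degC degZ) (.inr z)) =
    gen K (degE degC degZ) (.inl (.inr z)) := der_gen _ _ _ _

lemma hE_mem (i) : hE K degC degZ (gen K (degE degC degZ) i) ∈
    part K (degE degC degZ) (degE degC degZ i + -1) := by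
  rcases i with i | z
  · rw [hE_inl]; exact zero_mem _
  · rw [hE_new]; simpa using gen_mem_part (K := K) (degE degC degZ) (.inl (.inr z))

/-- The commutator is a derivation of degree 0. It is the identity on each fibre generator and on
its differential, and zero on the base, so it counts fibre generators. -/
lemma dE_hE (x : FreeCGA K (degE degC degZ)) :
    dE dC (hE K degC degZ x) + hE K degC degZ (dE dC x) = euler K (degE degC degZ) wtE x := by
  have h := (dE (degZ := degZ) dC).isDer.commutator hE_isDer
    (fun i => (dE dC).map_part _ _ (gen_mem_part _ i)) hE_mem
  rw [add_neg_cancel, sgn_odd K (n := 1 * -1) (by decide)] at h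
  have h2 := h.ext (euler_isDer wtE) (fun i => ?_) x
  · simpa using h2
  · rw [euler_of_mem (gen_mem_wpart wtE i)]
    rcases i with (c | z) | z
    · simp only [LinearMap.sub_apply, LinearMap.comp_apply, LinearMap.smul_apply, hE_inl, map_zero,
        zero_sub, neg_smul, one_smul, neg_neg, wtE, Sum.elim_inl, Int.cast_zero, zero_smul]
      have := dE_base (degZ := degZ) dC (gen K degC c)
      rw [baseE_gen] at this
      rw [this]
      exact (hE_isDer.comp_algHom baseE baseE_mem_part).eq_zero (fun c => by simp) _
    · simp [wtE]
    · simp [wtE]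

variable (K degC degZ) in
/-- Division by the weight, on the components of nonzero weight. -/
def invE : FreeCGA K (degE degC degZ) →ₗ[K] FreeCGA K (degE degC degZ) :=
  wsum wtE fun k => (if k = 0 then 0 else (k : K)⁻¹) • LinearMap.id

lemma invE_of_mem {k : ℤ} {x : FreeCGA K (degE degC degZ)} (hx : x ∈ wpart K _ wtE k) :
    invE K degC degZ x = (if k = 0 then 0 else (k : K)⁻¹) • x := wsum_of_mem _ hx

lemma invE_lspan {S : Set (List ((κ ⊕ ζ) ⊕ ζ))} {x : FreeCGA K (degE degC degZ)}
    (hx : x ∈ lspan K (degE degC degZ) S) : invE K degC degZ x ∈ lspan K (degE degC degZ) S :=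
  map_mem_of_lspan (fun l hl => by
    rw [invE_of_mem (mon_mem_wpart wtE l)]; exact Submodule.smul_mem _ _ (mon_mem_lspan hl)) hx

lemma dE_wpart {k : ℤ} {x : FreeCGA K (degE degC degZ)} (hx : x ∈ wpart K _ wtE k) :
    dE dC x ∈ wpart K (degE degC degZ) wtE k := by
  have := (dE (degZ := degZ) dC).isDer.map_wpart (w := wtE) (r := 0) (fun i => ?_) hx
  · rwa [add_zero] at this
  · rw [add_zero]
    rcases i with (c | z) | z
    · have := dE_base (degZ := degZ) dC (gen K degC c)
      rw [baseE_gen] at this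
      exact this ▸ baseE_wpart _
    · exact (dE_fibre dC z).symm ▸ gen_mem_wpart wtE (Sum.inr z)
    · exact (dE_new dC z).symm ▸ zero_mem _

lemma dE_invE (x : FreeCGA K (degE degC degZ)) :
    dE dC (invE K degC degZ x) = invE K degC degZ (dE dC x) :=
  eq_of_mon (f := (dE dC).toLin ∘ₗ invE K degC degZ) (g := invE K degC degZ ∘ₗ (dE dC).toLin)
    (fun l => by
      rw [LinearMap.comp_apply, LinearMap.comp_apply, invE_of_mem (mon_mem_wpart wtE l),
        invE_of_mem (dE_wpart dC (mon_mem_wpart wtE l)), map_smul]) x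

variable (K degC degZ) in
/-- The normalized contraction. -/
def contrE : FreeCGA K (degE degC degZ) →ₗ[K] FreeCGA K (degE degC degZ) :=
  hE K degC degZ ∘ₗ invE K degC degZ

lemma contrE_mem {n : ℤ} {x : FreeCGA K (degE degC degZ)} (hx : x ∈ part K _ n) :
    contrE K degC degZ x ∈ part K (degE degC degZ) (n - 1) := by
  rw [mem_part_lspan] at hx
  exact hE_isDer.map_part hE_mem (mem_part_lspan.2 (invE_lspan hx))

lemma contrE_wge {n : ℤ} {x : FreeCGA K (degE degC degZ)} (hx : x ∈ wge K _ (fun _ => 1) n) :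
    contrE K degC degZ x ∈ wge K (degE degC degZ) (fun _ => 1) n := by
  have := hE_isDer.map_wge (w := fun _ => 1) (r := 0) (fun i => ?_) (invE_lspan hx)
  · rwa [add_zero] at this
  · rcases i with i | z
    · rw [hE_inl]; exact zero_mem _
    · rw [hE_new]; exact gen_mem_wge (fun _ => 1) _

/-- After division by the weight the Euler derivation becomes the identity, except in weight 0,
which is the base. -/
lemma contrE_homotopy [CharZero K] (x : FreeCGA K (degE degC degZ)) :
    dE dC (contrE K degC degZ x) + contrE K degC degZ (dE dC x) = x - wproj wtE 0 x := by
  rw [contrE, LinearMap.comp_apply, LinearMap.comp_apply, ← dE_invE, dE_hE]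
  refine eq_of_mon (f := euler K _ wtE ∘ₗ invE K degC degZ) (g := LinearMap.id - wproj wtE 0)
    (fun l => ?_) x
  rw [LinearMap.comp_apply, invE_of_mem (mon_mem_wpart wtE l), map_smul, euler_mon,
    LinearMap.sub_apply, wproj_mon, LinearMap.id_apply, smul_smul]
  split_ifs with h
  · simp
  · rw [inv_mul_cancel₀ (by exact_mod_cast h), one_smul, sub_zero]

lemma exists_base {x : FreeCGA K (degE degC degZ)} (hx : x ∈ wpart K (degE degC degZ) wtE 0) :
    ∃ c : FreeCGA K degC, x = baseE c := by
  suffices x ∈ LinearMap.range (baseE (K := K) (degC := degC) (degZ := degZ)).toLinearMap by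
    obtain ⟨c, hc⟩ := this; exact ⟨c, hc.symm⟩
  refine lspan_le (fun l hl => ?_) hx
  replace hl : wt wtE l = 0 := hl
  induction l with
  | nil => exact ⟨1, map_one (baseE (K := K) (degC := degC) (degZ := degZ))⟩
  | cons i l ih =>
    have h0 : ∀ i, 0 ≤ wtE (κ := κ) (ζ := ζ) i := by rintro ((c | z) | z) <;> simp [wtE]
    have h1 := wt_nonneg h0 l
    rw [wt_cons] at hl
    have h2 := h0 i
    obtain ⟨c, hc⟩ := ih (by omega)
    rcases i with (a | z) | z
    · exact ⟨gen K degC a * c, by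
        rw [AlgHom.toLinearMap_apply, map_mul, baseE_gen, mon_cons, ← hc]; rfl⟩
    · exfalso; change 1 + _ = 0 at hl; omega
    · exfalso; change 1 + _ = 0 at hl; omega

/-! #### The projection of the cylinder -/

variable (D : Differential K (Sum.elim degC degZ))

/-- The projection of the cylinder. -/
def piE : FreeCGA K (degE degC degZ) →ₐ[K] FreeCGA K (Sum.elim degC degZ) :=
  ofGens (Sum.elim (gen K _) (fun z => D (gen K _ (.inr z)))) (by
    rintro (i | z)
    · exact gen_mem_part (Sum.elim degC degZ) i
    · exact D.map_part _ _ (gen_mem_part (Sum.elim degC degZ) (.inr z)))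

@[simp] lemma piE_inl (i) : piE D (gen K (degE degC degZ) (.inl i)) = gen K _ i := ofGens_gen _ _ _
@[simp] lemma piE_new (z) : piE D (gen K (degE degC degZ) (.inr z)) = D (gen K _ (.inr z)) :=
  ofGens_gen _ _ _

lemma piE_mem (i) : piE D (gen K (degE degC degZ) i) ∈ part K (Sum.elim degC degZ) (degE degC degZ i) := by
  rcases i with i | z
  · rw [piE_inl]; exact gen_mem_part (Sum.elim degC degZ) i
  · rw [piE_new]; exact D.map_part _ _ (gen_mem_part (Sum.elim degC degZ) (.inr z))

lemma piE_base (x : FreeCGA K degC) : piE D (baseE x) = inl degC degZ x :=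
  algHom_ext (φ := (piE D).comp baseE) (fun c => by simp) x

variable {dC D} (hD : ∀ b, D (inl degC degZ b) = inl degC degZ (dC b))

include hD

lemma piE_comm (x) : piE D (dE dC x) = D (piE D x) := by
  refine algHom_comm (piE_mem D) (fun i => ?_) x
  rcases i with (c | z) | z
  · have := dE_base (degZ := degZ) dC (gen K degC c)
    rw [baseE_gen] at this
    rw [this, piE_base, piE_inl, ← hD, inl_gen]
  · rw [dE_fibre, piE_new, piE_inl]
  · rw [dE_new, piE_new, D.sq_zero, map_zero]

variable {m : FreeCGA K (Sum.elim degC degZ) →ₐ[K] FreeCGA K degC}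
  (hm : ∀ i, m (gen K _ i) ∈ part K degC (Sum.elim degC degZ i))
  (hm1 : ∀ c, m (inl degC degZ c) = c) (hmD : ∀ x, m (D x) = dC (m x))
  (hex : ∀ k, ∀ z ∈ part K (Sum.elim degC degZ) k, D z = 0 → m z = 0 →
    ∃ w ∈ part K (Sum.elim degC degZ) (k - 1), D w = z)

include hm hm1 hmD hex

/-- The kernel of the projection of the cylinder is acyclic. -/
lemma exists_primitive [CharZero K] {n : ℤ} {t : FreeCGA K (degE degC degZ)}
    (ht : t ∈ part K (degE degC degZ) (n + 1)) (h1 : piE D t = 0) (h2 : dE dC t = 0) :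
    ∃ r ∈ part K (degE degC degZ) n, piE D r = 0 ∧ dE dC r = t := by
  have h3 := contrE_homotopy dC t
  rw [h2, map_zero, add_zero] at h3
  obtain ⟨c, hc⟩ := exists_base (wproj_mem_wpart wtE 0 t)
  have hy := contrE_mem ht
  rw [add_sub_cancel_right] at hy
  set y := contrE K degC degZ t
  rw [hc] at h3
  have h4 : c + dC (m (piE D y)) = 0 := by
    have := congrArg (fun u => m (piE D u)) h3
    simp only [map_sub, h1, piE_base, hm1, piE_comm hD, hmD] at this
    rw [this]; simp
  have hmy : m (piE D y) ∈ part K degC n := algHom_map_part hm (algHom_map_part (piE_mem D) hy)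
  -- The contraction gives dE y = t - c with c in the base, and applying m ∘ piE identifies c as
  -- -dC(m(piE y)). This correction makes y' a primitive of t and makes its projection vanish under
  -- m.
  set y' := y - baseE (m (piE D y))
  have hy' : y' ∈ part K (degE degC degZ) n := sub_mem hy (algHom_map_part baseE_mem_part hmy)
  have e1 : dE dC y' = t := by
    simp only [y']
    rw [map_sub, h3, dE_base, eq_neg_of_add_eq_zero_left h4, map_neg]
    abel
  have e2 : D (piE D y') = 0 := by rw [← piE_comm hD, e1, h1]
  have e3 : m (piE D y') = 0 := by
    simp only [y']
    rw [map_sub, map_sub, piE_base, hm1, sub_self]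
  -- The projection of y' is a boundary D w. Subtracting dE of w, placed in the cylinder, moves y'
  -- into the kernel of the projection without changing its differential.
  obtain ⟨w, hw, e4⟩ := hex n _ (algHom_map_part (piE_mem D) hy') e2 e3
  refine ⟨y' - dE dC (inl _ _ w), sub_mem hy' ?_, ?_, ?_⟩
  · have := (dE (degZ := degZ) dC).map_part _ _ (inl_mem_part (degU := fun z => degZ z + 1) hw)
    rwa [sub_add_cancel] at this
  · have : piE D (inl _ _ w) = w :=
      algHom_ext (φ := (piE D).comp (inl _ _)) (ψ := AlgHom.id K _) (fun i => by simp) w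
    rw [map_sub, piE_comm hD, this, e4, sub_self]
  · rw [map_sub, (dE dC).sq_zero, e1, sub_zero]

/-- A linear choice of primitives. -/
lemma exists_primitive_map [CharZero K] (n : ℤ) :
    ∃ s : FreeCGA K (degE degC degZ) →ₗ[K] FreeCGA K (degE degC degZ),
      (∀ u, s u ∈ part K (degE degC degZ) n) ∧ (∀ u, piE D (s u) = 0) ∧
      ∀ u ∈ part K (degE degC degZ) (n + 1), piE D u = 0 → dE dC u = 0 → dE dC (s u) = u := by
  let X : Submodule K (FreeCGA K (degE degC degZ)) :=
    part K (degE degC degZ) n ⊓ LinearMap.ker (piE D).toLinearMap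
  obtain ⟨g, hg⟩ := exists_section ((dE dC).toLin ∘ₗ X.subtype)
  refine ⟨X.subtype ∘ₗ g, fun u => (g u).2.1, fun u => (g u).2.2, fun u h1 h2 h3 => ?_⟩
  obtain ⟨r, hr1, hr2, hr3⟩ := exists_primitive hD hm hm1 hmD hex h1 h2 h3
  have := hg ⟨r, hr1, hr2⟩
  simp only [LinearMap.comp_apply, Submodule.subtype_apply] at this ⊢
  rwa [hr3] at this

/-- The lifting property of relative Sullivan algebras. -/
lemma exists_section_of_tower [CharZero K] {G} (hG : Tower D G) :
    ∃ σ : FreeCGA K (Sum.elim degC degZ) →ₐ[K] FreeCGA K (degE degC degZ),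
      (∀ i, σ (gen K _ i) ∈ part K (degE degC degZ) (Sum.elim degC degZ i)) ∧
      (∀ c, σ (gen K _ (.inl c)) = gen K _ (.inl (.inl c))) ∧ (∀ x, piE D (σ x) = x) ∧
      ∀ v ∈ G, dE dC (σ v) = σ (D v) := by
  induction hG with
  | bot =>
    refine ⟨inl _ _, fun i => ?_, fun c => by rw [inl_gen], fun x => ?_, fun v hv => ?_⟩
    · rw [inl_gen]; exact gen_mem_part (degE degC degZ) (.inl i)
    · exact algHom_ext (φ := (piE D).comp (inl _ _)) (ψ := AlgHom.id K _) (fun i => by simp) x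
    · rw [(Submodule.mem_bot K).1 hv]; simp
  | @step G G' hG hgr hle hgens h ih =>
    obtain ⟨σ, s1, s2, s3, s4⟩ := ih
    have sb : ∀ c, σ (inl degC degZ c) = baseE c :=
      algHom_ext (φ := σ.comp (inl degC degZ)) fun c => by simp [s2]
    choose s hs1 hs2 hs3 using exists_primitive_map (degZ := degZ) hD hm hm1 hmD hex
    -- The defect of σ as a chain map. Its values lie in the kernel of the projection; where they
    -- are cocycles they have primitives there, and adding these to σ on generators repairs the
    -- defect.
    let τ : FreeCGA K (Sum.elim degC degZ) →ₗ[K] FreeCGA K (degE degC degZ) :=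
      σ.toLinearMap ∘ₗ D.toLin - (dE dC).toLin ∘ₗ σ.toLinearMap
    have hτ : ∀ x, τ x = σ (D x) - dE dC (σ x) := fun x => rfl
    let cor : FreeCGA K (Sum.elim degC degZ) →ₗ[K] FreeCGA K (degE degC degZ) :=
      wsum (Sum.elim degC degZ) fun n => s n ∘ₗ τ
    have hcor : ∀ n, ∀ x ∈ part K (Sum.elim degC degZ) n, cor x = s n (τ x) := fun n x hx => by
      rw [part_eq_wpart] at hx
      exact wsum_of_mem _ hx
    let σ' : FreeCGA K (Sum.elim degC degZ) →ₐ[K] FreeCGA K (degE degC degZ) :=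
      ofGens (fun i => σ (gen K _ i) + cor (gen K _ i)) fun i => by
        rw [hcor _ _ (gen_mem_part _ i)]; exact add_mem (s1 i) (hs1 _ _)
    have hσ' : ∀ v ∈ gens K (Sum.elim degC degZ), σ' v = σ v + cor v := fun v hv => by
      have : gens K (Sum.elim degC degZ) ≤
          LinearMap.eqLocus σ'.toLinearMap (σ.toLinearMap + cor) := by
        refine Submodule.span_le.2 ?_
        rintro _ ⟨i, rfl⟩
        exact ofGens_gen _ _ i
      exact this hv
    have hb : ∀ c, σ' (gen K _ (.inl c)) = gen K _ (.inl (.inl c)) := fun c => by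
      have : τ (gen K _ (.inl c)) = 0 := by
        have e := hD (gen K degC c)
        rw [inl_gen] at e
        rw [hτ, e, sb, s2, ← baseE_gen, dE_base, sub_self]
      rw [hσ' _ (Submodule.subset_span ⟨_, rfl⟩), hcor _ _ (gen_mem_part _ _), this, map_zero,
        add_zero, s2]
    have hσ'm : ∀ i, σ' (gen K _ i) ∈ part K (degE degC degZ) (Sum.elim degC degZ i) := fun i => by
      rw [hσ' _ (Submodule.subset_span ⟨i, rfl⟩), hcor _ _ (gen_mem_part _ i)]
      exact add_mem (s1 i) (hs1 _ _)
    -- On `G` there is no defect and hence no correction: σ and σ' agree on the subalgebra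
    -- containing D v for every v in `G'`.
    have hG0 : ∀ v ∈ G, σ' v = σ v := fun v hv => by
      rw [hσ' v (hgens (hle hv))]
      refine add_eq_left.2 ?_
      refine hG.isGraded.induction (P := fun v => cor v = 0) (map_zero _) (fun n x hx hn => ?_)
        (fun x y hx hy => by rw [map_add, hx, hy, add_zero]) hv
      rw [hcor n x hn, hτ, s4 x hx, sub_self, map_zero]
    have hsb' : ∀ c, σ' (inl degC degZ c) = baseE c :=
      algHom_ext (φ := σ'.comp (inl degC degZ)) fun c => by simp [hb]
    have hA : ∀ x ∈ Algebra.adjoin K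
        (Set.range (inl degC degZ) ∪ (G : Set (FreeCGA K (Sum.elim degC degZ)))),
        σ' x = σ x ∧ dE dC (σ x) = σ (D x) := fun x hx => by
      induction hx using Algebra.adjoin_induction with
      | mem x hx =>
        rcases hx with ⟨c, rfl⟩ | hx
        · exact ⟨by rw [hsb', sb], by rw [hD, sb, sb, dE_base]⟩
        · exact ⟨hG0 x hx, s4 x hx⟩
      | algebraMap r =>
        refine ⟨by rw [AlgHom.commutes, AlgHom.commutes], ?_⟩
        rw [AlgHom.commutes, Algebra.algebraMap_eq_smul_one, Algebra.algebraMap_eq_smul_one,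
          map_smul, map_smul, D.map_one, (dE dC).map_one, smul_zero, smul_zero, map_zero]
      | add x y _ _ hx hy =>
        exact ⟨by rw [map_add, map_add, hx.1, hy.1], by simp only [map_add, hx.2, hy.2]⟩
      | mul x y _ _ hx hy =>
        refine ⟨by rw [map_mul, map_mul, hx.1, hy.1], ?_⟩
        rw [map_mul, (dE dC).mul, hx.2, hy.2, D.mul, map_add, map_mul, map_mul, algHom_signAut s1]
    refine ⟨σ', hσ'm, hb, fun x => ?_, fun v hv => ?_⟩
    · refine algHom_ext (φ := (piE D).comp σ') (ψ := AlgHom.id K _) (fun i => ?_) x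
      rw [AlgHom.comp_apply, hσ' _ (Submodule.subset_span ⟨i, rfl⟩), map_add, s3,
        hcor _ _ (gen_mem_part _ i), hs2, add_zero, AlgHom.id_apply]
    -- The defect at v is a cocycle: D v lies in the subalgebra on which σ commutes with the
    -- differentials, and D² = 0.
    · have hv2 : dE dC (cor v) = τ v := by
        refine hgr.induction (P := fun v => dE dC (cor v) = τ v) (by simp) (fun n x hx hn => ?_)
          (fun x y hx hy => by rw [map_add, map_add, map_add, hx, hy]) hv
        rw [hcor n x hn]
        refine hs3 n _ ?_ ?_ ?_
        · exact sub_mem (algHom_map_part s1 (D.map_part _ _ hn))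
            ((dE dC).map_part _ _ (algHom_map_part s1 hn))
        · rw [hτ, map_sub, s3, piE_comm hD, s3, sub_self]
        · rw [hτ, map_sub, (dE dC).sq_zero, sub_zero, (hA _ (h x hx)).2, D.sq_zero, map_zero]
      rw [hσ' v (hgens hv), map_add, hv2, hτ, add_sub_cancel, (hA _ (h v hv)).1]

end Cyl


/-! ### Contractibility of the linear part of the fibre. -/

open FreeCGA

namespace Cyl

variable {K : Type*} [Field K] {κ ζ : Type*} {degC : κ → ℤ} {degZ : ζ → ℤ}

lemma gen_mem_wge_one {ι κ : Type*} {deg : ι → ℤ} {deg' : κ → ℤ} (hdeg : ∀ i, 1 ≤ deg i)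
    {φ : FreeCGA K deg →ₐ[K] FreeCGA K deg'} (hφ : ∀ i, φ (gen K deg i) ∈ part K deg' (deg i))
    {n : ℤ} {x : FreeCGA K deg} (hx : x ∈ wge K deg (fun _ => 1) n) :
    φ x ∈ wge K deg' (fun _ => 1) n :=
  algHom_map_wge (fun i => part_le_wge (by have := hdeg i; omega) (hφ i)) hx

/-- The linear part of the fibre of a relative Sullivan algebra that is quasi-isomorphic to its base
is contractible. -/
theorem exists_linear_contraction [CharZero K] [Fintype κ] [Fintype ζ] [DecidableEq ζ]
    (hC : ∀ c, 1 ≤ degC c) (hZ : ∀ z, 1 ≤ degZ z)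
    {dC : Differential K degC} {D : Differential K (Sum.elim degC degZ)}
    (hD : ∀ b, D (inl degC degZ b) = inl degC degZ (dC b))
    {m : FreeCGA K (Sum.elim degC degZ) →ₐ[K] FreeCGA K degC}
    (hm : ∀ i, m (gen K _ i) ∈ part K degC (Sum.elim degC degZ i))
    (hm1 : ∀ c, m (inl degC degZ c) = c) (hmD : ∀ x, m (D x) = dC (m x))
    (hex : ∀ k, ∀ z ∈ part K (Sum.elim degC degZ) k, D z = 0 → m z = 0 →
      ∃ w ∈ part K (Sum.elim degC degZ) (k - 1), D w = z)
    {G} (hG : Tower D G) (hG' : ∀ z, gen K _ (.inr z) ∈ G) :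
    ∃ H : ζ → ζ → K, (∀ z w, H z w ≠ 0 → degZ w = degZ z - 1) ∧ ∀ z z',
      ∑ w, H z w * lin K _ (.inr z') (D (gen K _ (.inr w))) +
        ∑ w, lin K _ (.inr w) (D (gen K _ (.inr z))) * H w z' = if z = z' then 1 else 0 := by
  classical
  obtain ⟨σ, s1, s2, s3, s4⟩ := exists_section_of_tower hD hm hm1 hmD hex hG
  have hT : ∀ i : κ ⊕ ζ, 1 ≤ Sum.elim degC degZ i := by
    rintro (c | z)
    · exact hC c
    · exact hZ z
  have hE : ∀ i : (κ ⊕ ζ) ⊕ ζ, 1 ≤ degE degC degZ i := by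
    rintro (i | z)
    · exact hT i
    · have := hZ z; simp; omega
  have sb : ∀ c, σ (inl degC degZ c) = baseE c :=
    algHom_ext (φ := σ.comp (inl degC degZ)) fun c => by simp [s2]
  have s5 : ∀ x, σ (D x) = dE dC (σ x) := by
    refine algHom_comm s1 fun i => ?_
    rcases i with c | z
    · have h1 := hD (gen K degC c)
      rw [inl_gen] at h1
      rw [h1, sb, s2, ← baseE_gen, dE_base]
    · exact (s4 _ (hG' z)).symm
  -- The contraction of the cylinder, transported by the section σ and the projection. Thus D η + η
  -- D is the identity up to terms in the base, which have no linear part along the fibre. Both maps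
  -- preserve word length filtrations, so linear parts may be compared.
  let η : FreeCGA K (Sum.elim degC degZ) →ₗ[K] FreeCGA K (Sum.elim degC degZ) :=
    (piE D).toLinearMap ∘ₗ contrE K degC degZ ∘ₗ σ.toLinearMap
  have hη : ∀ x, η x = piE D (contrE K degC degZ (σ x)) := fun _ => rfl
  have η1 : ∀ n, ∀ x ∈ part K _ n, η x ∈ part K _ (n - 1) := fun n x hx =>
    algHom_map_part (piE_mem D) (contrE_mem (algHom_map_part s1 hx))
  have η2 : ∀ n, ∀ x ∈ wge K _ (fun _ => 1) n, η x ∈ wge K (Sum.elim degC degZ) (fun _ => 1) n :=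
    fun n x hx => gen_mem_wge_one hE (piE_mem D) (contrE_wge (gen_mem_wge_one hT s1 hx))
  have D2 : ∀ n, ∀ x ∈ wge K _ (fun _ => 1) n, D x ∈ wge K (Sum.elim degC degZ) (fun _ => 1) n :=
    fun n x hx => by
      have := D.isDer.map_wge (w := fun _ => 1) (r := 0) (fun i => ?_) hx
      · rwa [add_zero] at this
      · exact part_le_wge (by have := hT i; omega) (D.map_part _ _ (gen_mem_part _ i))
  have lb : ∀ (z : ζ) (c : FreeCGA K degC), lin K (Sum.elim degC degZ) (.inr z) (inl _ _ c) = 0 := by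
    intro z c
    refine eq_of_mon (f := lin K _ _ ∘ₗ (inl degC degZ).toLinearMap) (g := 0) (fun l => ?_) c
    rw [LinearMap.comp_apply, AlgHom.toLinearMap_apply, LinearMap.zero_apply]
    induction l with
    | nil => rw [mon_nil, map_one, lin_one]
    | cons a l ih =>
      rw [mon_cons, map_mul, lin_mul, ih, inl_gen, lin_gen, if_neg (by simp)]
      simp
  refine ⟨fun z w => lin K _ (.inr w) (η (gen K _ (.inr z))), fun z w h => ?_, fun z z' => ?_⟩
  · have e := η1 (degZ z) _ (gen_mem_part (Sum.elim degC degZ) (.inr z))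
    have := lin_of_part (deg := Sum.elim degC degZ) (i := Sum.inr w) e h
    exact this
  · have key := contrE_homotopy dC (σ (gen K _ (.inr z)))
    obtain ⟨c, hc⟩ := exists_base (wproj_mem_wpart wtE 0 (σ (gen K _ (.inr z))))
    have h1 := congrArg (fun u => lin K _ (.inr z') (piE D u)) key
    simp only [map_add, map_sub, hc, piE_base, lb, piE_comm hD, s3, ← s5, sub_zero, ← hη, lin_gen] at h1
    have g1 : ∀ n, n ≠ 0 → ∀ x ∈ part K (Sum.elim degC degZ) n, x ∈ wge K _ (fun _ => 1) 1 :=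
      fun n hn x hx => part_le_wge hn hx
    have gz : gen K (Sum.elim degC degZ) (.inr z) ∈ wge K _ (fun _ => 1) 1 :=
      g1 _ (by have := hT (.inr z); omega) _ (gen_mem_part _ _)
    rw [lin_map (f := D.toLin) _ (D2 2) (η2 1 _ gz), lin_map (f := η) _ (η2 2) (D2 1 _ gz),
      Fintype.sum_sum_type, Fintype.sum_sum_type] at h1
    have z1 : ∀ c, lin K (Sum.elim degC degZ) (.inr z') (D (gen K _ (.inl c))) = 0 := fun c => by
      have h1 := hD (gen K degC c)
      rw [inl_gen] at h1
      rw [h1, lb]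
    -- The division by the weight takes the value 0 in weight 0, so the contraction kills the base.
    have z2 : ∀ c : κ, η (gen K _ (.inl c)) = 0 := fun c => by
      have e : baseE (degZ := degZ) (gen K degC c) ∈ wpart K _ wtE 0 := baseE_wpart _
      rw [hη, s2, ← baseE_gen, contrE, LinearMap.comp_apply, invE_of_mem e, if_pos rfl, zero_smul,
        map_zero, map_zero]
    simp only [z1, z2, map_zero, mul_zero, Finset.sum_const_zero, zero_add, Sum.inr.injEq] at h1
    exact h1

end Cyl


/-! ### Quotients by generators, homogeneous primitives, graded subspaces. -/

open FreeCGA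

section Quotients

variable {K : Type*} [Field K] {ι κ : Type*} {deg : ι → ℤ} {deg' : κ → ℤ}

/-- The differential induced on a quotient algebra with a section. -/
def FreeCGA.Differential.quot (D : Differential K deg) (φ : FreeCGA K deg →ₐ[K] FreeCGA K deg')
    (ψ : FreeCGA K deg' →ₐ[K] FreeCGA K deg) (hφ : ∀ i, φ (gen K deg i) ∈ part K deg' (deg i))
    (hψ : ∀ j, ψ (gen K deg' j) ∈ part K deg (deg' j)) (hφψ : ∀ j, φ (ψ (gen K deg' j)) = gen K deg' j)
    (h : ∀ i, φ (D (gen K deg i)) = φ (D (ψ (φ (gen K deg i))))) : Differential K deg' :=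
  have e : φ.comp ψ = AlgHom.id K _ := AlgHom.ext fun x =>
    algHom_ext (φ := φ.comp ψ) (ψ := AlgHom.id K _) hφψ x
  have h1 : IsDer (AlgHom.id K _) 1 (φ.toLinearMap ∘ₗ D.toLin ∘ₗ ψ.toLinearMap) := by
    have := (D.isDer.comp_algHom ψ hψ).algHom_comp φ
    rwa [show φ.comp ((AlgHom.id K _).comp ψ) = AlgHom.id K _ from e] at this
  Differential.ofGens (φ.toLinearMap ∘ₗ D.toLin ∘ₗ ψ.toLinearMap) h1
    (fun j => algHom_map_part hφ (D.map_part _ _ (hψ j))) (fun j => by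
      have h2 : ∀ x, φ (D x) = φ (D (ψ (φ x))) := by
        have h3 := D.isDer.algHom_comp φ
        have h4 := h1.comp_algHom φ hφ
        exact h3.ext h4 h
      simp only [LinearMap.comp_apply, AlgHom.toLinearMap_apply]
      rw [← h2, D.sq_zero, map_zero])

lemma FreeCGA.Differential.quot_comm (D : Differential K deg) {φ : FreeCGA K deg →ₐ[K] FreeCGA K deg'}
    {ψ : FreeCGA K deg' →ₐ[K] FreeCGA K deg} (hφ : ∀ i, φ (gen K deg i) ∈ part K deg' (deg i))
    (hψ : ∀ j, ψ (gen K deg' j) ∈ part K deg (deg' j)) (hφψ : ∀ j, φ (ψ (gen K deg' j)) = gen K deg' j)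
    (h : ∀ i, φ (D (gen K deg i)) = φ (D (ψ (φ (gen K deg i))))) (x) :
    D.quot φ ψ hφ hψ hφψ h (φ x) = φ (D x) :=
  (algHom_comm (d' := D.quot φ ψ hφ hψ hφψ h) hφ h x).symm

/-- The left ideal generated by a set of generators is spanned by the monomials that contain one
of them. -/
lemma mem_span_gen {X : Set ι} {S : Set (FreeCGA K deg)} (hS : S = gen K deg '' X)
    {x : FreeCGA K deg} : x ∈ Ideal.span S ↔ x ∈ lspan K deg {l | ∃ i ∈ X, i ∈ l} := by
  subst hS
  constructor
  · intro hx
    induction hx using Submodule.span_induction with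
    | mem x hx =>
      obtain ⟨i, hi, rfl⟩ := hx
      simpa using mon_mem_lspan (K := K) (deg := deg) (l := [i])
        (S := {l | ∃ i ∈ X, i ∈ l}) ⟨i, hi, by simp⟩
    | zero => exact zero_mem _
    | add x y _ _ hx hy => exact add_mem hx hy
    | smul a x _ hx =>
      have ha : a ∈ lspan K deg Set.univ := by rw [lspan_univ]; trivial
      refine mul_mem_lspan (U := {l | ∃ i ∈ X, i ∈ l}) ?_ ha hx
      rintro l - l' ⟨i, hi, h⟩
      exact ⟨i, hi, List.mem_append_right _ h⟩
  · intro hx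
    refine lspan_le (T := (Ideal.span (gen K deg '' X)).restrictScalars K) ?_ hx
    rintro l ⟨i, hi, hl⟩
    classical
    obtain ⟨s, -, e⟩ := mon_perm (K := K) (deg := deg)
      ((List.perm_cons_erase hl).trans (List.perm_append_singleton i (l.erase i)).symm)
    rw [e, mon_append, mon_cons, mon_nil, mul_one]
    exact Submodule.smul_mem _ _ (Ideal.mul_mem_left _ _ (Ideal.subset_span ⟨i, hi, rfl⟩))

lemma algHom_lspan_eq_zero {φ : FreeCGA K deg →ₐ[K] FreeCGA K deg'} {X : Set ι}
    (h : ∀ i ∈ X, φ (gen K deg i) = 0) {x : FreeCGA K deg}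
    (hx : x ∈ lspan K deg {l | ∃ i ∈ X, i ∈ l}) : φ x = 0 := by
  refine lspan_le (T := LinearMap.ker φ.toLinearMap) ?_ hx
  rintro l ⟨i, hi, hl⟩
  obtain ⟨l1, l2, rfl⟩ := List.append_of_mem hl
  rw [LinearMap.mem_ker, AlgHom.toLinearMap_apply, mon_append, mon_cons]
  simp [h i hi]

/-- The kernel of a homomorphism killing some generators. -/
lemma sub_section_mem {φ : FreeCGA K deg →ₐ[K] FreeCGA K deg'} {ψ : FreeCGA K deg' →ₐ[K] FreeCGA K deg}
    {X : Set ι} (h : ∀ i ∈ X, φ (gen K deg i) = 0) (h' : ∀ i ∉ X, ψ (φ (gen K deg i)) = gen K deg i)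
    (x : FreeCGA K deg) : x - ψ (φ x) ∈ lspan K deg {l | ∃ i ∈ X, i ∈ l} := by
  refine mem_of_mon (T := (lspan K deg {l | ∃ i ∈ X, i ∈ l}).comap
    (LinearMap.id - ψ.toLinearMap ∘ₗ φ.toLinearMap)) (fun l => ?_) x
  rw [Submodule.mem_comap]
  change mon K deg l - ψ (φ (mon K deg l)) ∈ _
  by_cases hl : ∃ i ∈ X, i ∈ l
  · have h1 : mon K deg l ∈ lspan K deg {l | ∃ i ∈ X, i ∈ l} := mon_mem_lspan hl
    rw [algHom_lspan_eq_zero h h1, map_zero, sub_zero]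
    exact h1
  · have : ψ (φ (mon K deg l)) = mon K deg l := by
      push Not at hl
      induction l with
      | nil => simp
      | cons i l ih =>
        rw [mon_cons, map_mul, map_mul, h' i fun hi => hl i hi (by simp),
          ih fun j hj h => hl j hj (by simp [h])]
    rw [this, sub_self]
    exact zero_mem _

lemma IsQuasiIso.exists_primitive {A A' : Type*} [AddCommGroup A] [Module K A] [AddCommGroup A']
    [Module K A'] {d : A →ₗ[K] A} {d' : A' →ₗ[K] A'} {φ : A →ₗ[K] A'} (h : IsQuasiIso d d' φ)
    {z : A} (hz : d z = 0) (hφ : φ z = 0) : ∃ w, d w = z := by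
  obtain ⟨hc, hi, -⟩ := h
  have h1 : cohomologyMap φ hc (Submodule.Quotient.mk ⟨z, hz⟩) = 0 := by
    change Submodule.Quotient.mk _ = _
    rw [Submodule.Quotient.mk_eq_zero]
    refine ⟨0, ?_⟩
    rw [map_zero]
    exact hφ.symm
  have h2 := hi (h1.trans (map_zero _).symm)
  rw [Submodule.Quotient.mk_eq_zero] at h2
  obtain ⟨w, hw⟩ := h2
  exact ⟨w, hw⟩

/-- A primitive of a homogeneous element can be chosen homogeneous. -/
lemma exists_homogeneous_primitive (D : Differential K deg) {k : ℤ} {z w : FreeCGA K deg}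
    (hz : z ∈ part K deg k) (h : D w = z) : ∃ w ∈ part K deg (k - 1), D w = z := by
  refine ⟨wproj deg (k - 1) w, by rw [part_eq_wpart]; exact wproj_mem_wpart _ _ _, ?_⟩
  have h1 : ∀ w, D (wproj deg (k - 1) w) = wproj deg k (D w) :=
    eq_of_mon (f := D.toLin ∘ₗ wproj deg (k - 1)) (g := wproj deg k ∘ₗ D.toLin) fun l => by
      have h2 := D.map_part _ _ (mon_mem_part (K := K) (deg := deg) l)
      rw [part_eq_wpart] at h2
      rw [LinearMap.comp_apply, LinearMap.comp_apply, wproj_mon]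
      split_ifs with h3
      · rw [show wt deg l + 1 = k by omega] at h2
        rw [wproj_of_mem h2]
      · rw [wproj_of_mem_ne h2 (by omega), map_zero]
  rw [part_eq_wpart] at hz
  rw [h1, h, wproj_of_mem hz]

lemma aug_of_gens {φ : FreeCGA K deg →ₐ[K] FreeCGA K deg'} (h : ∀ i, aug K deg' (φ (gen K deg i)) = 0)
    (x) : aug K deg' (φ x) = aug K deg x :=
  algHom_ext (φ := (aug K deg').comp φ) (fun i => by
    rw [AlgHom.comp_apply, h, aug, lift_gen]) x

lemma lin_comp {φ : FreeCGA K deg →ₐ[K] FreeCGA K deg'} (h : ∀ i, aug K deg' (φ (gen K deg i)) = 0)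
    {i : ι} {i' : κ} (h' : ∀ j, lin K deg' i' (φ (gen K deg j)) = lin K deg i (gen K deg j)) (x) :
    lin K deg' i' (φ x) = lin K deg i x := by
  refine eq_of_mon (f := lin K deg' i' ∘ₗ φ.toLinearMap) (fun l => ?_) x
  rw [LinearMap.comp_apply, AlgHom.toLinearMap_apply]
  induction l with
  | nil => rw [mon_nil, map_one, lin_one, lin_one]
  | cons a l ih => rw [mon_cons, map_mul, lin_mul, lin_mul, ih, h', aug_of_gens h, aug_of_gens h]

lemma aug_of_part {n : ℤ} (hn : n ≠ 0) {x : FreeCGA K deg} (hx : x ∈ part K deg n) :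
    aug K deg x = 0 := by
  rw [mem_part_lspan] at hx
  refine lspan_le (T := LinearMap.ker (aug K deg).toLinearMap) (fun l hl => ?_) hx
  have hl : wt deg l = n := hl
  rcases l with _ | ⟨a, l⟩
  · exact absurd hl.symm hn
  · exact aug_mon_cons a l

end Quotients

section Graded

variable {K : Type*} [Field K] {ι κ : Type*} {deg : ι → ℤ} {deg' : κ → ℤ}

lemma IsGradedSubspace.map {F : Submodule K (FreeCGA K deg)} (hF : IsGradedSubspace F)
    {φ : FreeCGA K deg →ₐ[K] FreeCGA K deg'} (hφ : ∀ i, φ (gen K deg i) ∈ part K deg' (deg i)) :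
    IsGradedSubspace (F.map φ.toLinearMap) := by
  refine le_antisymm ?_ (iSup_le fun n => inf_le_left)
  nth_rewrite 1 [hF]
  rw [Submodule.map_iSup]
  refine iSup_mono fun n => ?_
  rintro _ ⟨x, ⟨h1, h2⟩, rfl⟩
  exact ⟨⟨x, h1, rfl⟩, algHom_map_part hφ h2⟩

lemma IsGradedSubspace.sup {F G : Submodule K (FreeCGA K deg)} (hF : IsGradedSubspace F)
    (hG : IsGradedSubspace G) : IsGradedSubspace (F ⊔ G) := by
  refine le_antisymm (sup_le ?_ ?_) (iSup_le fun n => inf_le_left)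
  · nth_rewrite 1 [hF]
    exact iSup_mono fun n => inf_le_inf_right _ le_sup_left
  · nth_rewrite 1 [hG]
    exact iSup_mono fun n => inf_le_inf_right _ le_sup_right

lemma exists_le_of_iSup_eq {M : Type*} [AddCommGroup M] [Module K M] [Finite ι] {F : ℕ → Submodule K M}
    (hF : Monotone F) (g : ι → M) (h : ∀ i, g i ∈ ⨆ k, F k) : ∃ k, ∀ i, g i ∈ F k := by
  have h1 : ∀ i, ∃ k, g i ∈ F k := fun i =>
    (Submodule.mem_iSup_of_directed _ hF.directed_le).1 (h i)
  choose k hk using h1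
  obtain ⟨M, hM⟩ := (Set.finite_range k).bddAbove
  exact ⟨M, fun i => hF (hM ⟨i, rfl⟩) (hk i)⟩

end Graded

/-! ### The model as a relative Sullivan algebra over its first factor. -/

section TowerOfModel

variable {K : Type*} [Field K] {p q : ℕ} {deg : Fin p ⊕ Fin q → ℤ} {d : Differential K deg}
  {D : Differential K (deg3 deg)}

/-- The inclusion of the second factor. -/
def sndHom (deg : Fin p ⊕ Fin q → ℤ) : FreeCGA K deg →ₐ[K] FreeCGA K (deg3 deg) :=
  (inl (deg2 deg) (barDeg deg)).comp (inr deg deg)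

/-- The inclusion of the first factor. -/
def fstHom (deg : Fin p ⊕ Fin q → ℤ) : FreeCGA K deg →ₐ[K] FreeCGA K (deg3 deg) :=
  (inl (deg2 deg) (barDeg deg)).comp (inl deg deg)

@[simp] lemma sndHom_gen (v) : sndHom (K := K) deg (gen K deg v) = gen K (deg3 deg) (.inl (.inr v)) := by
  rw [sndHom, AlgHom.comp_apply, inr_gen, inl_gen]

@[simp] lemma fstHom_gen (v) : fstHom (K := K) deg (gen K deg v) = gen K (deg3 deg) (.inl (.inl v)) := by
  rw [fstHom, AlgHom.comp_apply, inl_gen, inl_gen]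

lemma D_sndHom (hD : ∀ b, D (inl _ _ b) = inl _ _ (d.tensor d b)) (x) :
    D (sndHom deg x) = sndHom deg (d x) := by
  rw [sndHom, AlgHom.comp_apply, hD]
  exact congrArg _ (tensor_inr d d x)

lemma D_fstHom (hD : ∀ b, D (inl _ _ b) = inl _ _ (d.tensor d b)) (x) :
    D (fstHom deg x) = fstHom deg (d x) := by
  rw [fstHom, AlgHom.comp_apply, hD]
  exact congrArg _ (tensor_inl d d x)

lemma adjoin_map_mem {A A' : Type*} [Ring A] [Algebra K A] [Ring A'] [Algebra K A'] (φ : A →ₐ[K] A')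
    {S : Set A} {T : Subalgebra K A'} (h : ∀ s ∈ S, φ s ∈ T) {x : A} (hx : x ∈ Algebra.adjoin K S) :
    φ x ∈ T :=
  (Algebra.adjoin_le (S := T.comap φ) h) hx

/-- The Sullivan filtrations give a tower in a quotient of the model. -/
lemma exists_tower {κ ζ : Type*} {degC : κ → ℤ} {degZ : ζ → ℤ} {D' : Differential K (Sum.elim degC degZ)}
    (hd : IsSullivan d) (hD : IsRelSullivan (d.tensor d) D)
    {φ : FreeCGA K (deg3 deg) →ₐ[K] FreeCGA K (Sum.elim degC degZ)}
    (hφ : ∀ i, φ (gen K _ i) ∈ part K (Sum.elim degC degZ) (deg3 deg i))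
    (hφD : ∀ x, φ (D x) = D' (φ x)) (hφg : ∀ i, φ (gen K _ i) ∈ gens K (Sum.elim degC degZ))
    (hφb : ∀ v, φ (gen K _ (.inl (.inl v))) ∈ Set.range (inl degC degZ)) :
    ∃ G, Tower D' G ∧ (∀ v, φ (gen K _ (.inl (.inr v))) ∈ G) ∧ ∀ v, φ (gen K _ (.inr v)) ∈ G := by
  obtain ⟨-, F, F1, F2, F3, F4, F5⟩ := hd
  obtain ⟨-, -, hDl, U, U1, U2, U3, U4, U5⟩ := hD
  obtain ⟨ψ, hψe⟩ : ∃ ψ : FreeCGA K deg →ₐ[K] FreeCGA K (Sum.elim degC degZ),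
      ∀ x, ψ x = φ (sndHom deg x) := ⟨φ.comp (sndHom deg), fun _ => rfl⟩
  have hψ : ∀ v, ψ (gen K deg v) ∈ part K _ (deg v) := fun v => by
    rw [hψe, sndHom_gen]; exact hφ (.inl (.inr v))
  have hψg : ∀ k, (F k).map ψ.toLinearMap ≤ gens K (Sum.elim degC degZ) := fun k => by
    refine Submodule.map_le_iff_le_comap.2 ((le_iSup F k).trans ?_)
    rw [F4]
    refine Submodule.span_le.2 ?_
    rintro _ ⟨v, rfl⟩
    rw [SetLike.mem_coe, Submodule.mem_comap, AlgHom.toLinearMap_apply, hψe, sndHom_gen]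
    exact hφg _
  -- Over the first factor alone, 1 ⊗ V belongs to the fibre. Its Sullivan filtration comes first,
  -- and the filtration of V̄ is then stacked on top.
  have t1 : ∀ k, Tower D' ((F k).map ψ.toLinearMap) := by
    intro k
    induction k with
    | zero => rw [F2, Submodule.map_bot]; exact Tower.bot
    | succ k ih =>
      refine ih.step ((F1 _).map hψ) (Submodule.map_mono (F3 (Nat.le_succ k))) (hψg _) ?_
      rintro _ ⟨v, hv, rfl⟩
      have e : D' (ψ v) = ψ (d v) := by
        rw [hψe, hψe, ← hφD, D_sndHom hDl]
      rw [AlgHom.toLinearMap_apply, e]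
      exact adjoin_map_mem ψ (fun s hs => Algebra.subset_adjoin (Or.inr ⟨s, hs, rfl⟩)) (F5 k v hv)
  obtain ⟨k0, hk0⟩ := exists_le_of_iSup_eq F3 (gen K deg)
    (fun i => by rw [F4]; exact Submodule.subset_span ⟨i, rfl⟩)
  obtain ⟨k1, hk1⟩ := exists_le_of_iSup_eq U3 (fun v => gen K (deg3 deg) (.inr v))
    (fun i => by
      rw [U4]
      exact ⟨gen K _ i, Submodule.subset_span ⟨i, rfl⟩, inr_gen _⟩)
  have hUg : ∀ k, (U k).map φ.toLinearMap ≤ gens K (Sum.elim degC degZ) := fun k => by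
    refine Submodule.map_le_iff_le_comap.2 ((le_iSup U k).trans ?_)
    rw [U4, Submodule.map_le_iff_le_comap]
    refine Submodule.span_le.2 ?_
    rintro _ ⟨v, rfl⟩
    simp only [SetLike.mem_coe, Submodule.mem_comap, AlgHom.toLinearMap_apply, inr_gen]
    exact hφg _
  have hψ0 : ∀ v, φ (gen K _ (.inl (.inr v))) ∈ (F k0).map ψ.toLinearMap := fun v =>
    ⟨gen K deg v, hk0 v, by rw [AlgHom.toLinearMap_apply, hψe, sndHom_gen]⟩
  have t2 : ∀ k, Tower D' ((F k0).map ψ.toLinearMap ⊔ (U k).map φ.toLinearMap) := by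
    intro k
    induction k with
    | zero => rw [U2, Submodule.map_bot, sup_bot_eq]; exact t1 k0
    | succ k ih =>
      refine ih.step (((F1 _).map hψ).sup ((U1 _).map hφ))
        (sup_le_sup_left (Submodule.map_mono (U3 (Nat.le_succ k))) _) (sup_le (hψg _) (hUg _)) ?_
      intro x hx
      obtain ⟨y, ⟨v, hv, rfl⟩, z, ⟨u, hu, rfl⟩, rfl⟩ := Submodule.mem_sup.1 hx
      rw [map_add]
      refine add_mem ?_ ?_
      · have e : D' (ψ v) = ψ (d v) := by
          rw [hψe, hψe, ← hφD, D_sndHom hDl]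
        rw [AlgHom.toLinearMap_apply, e]
        refine adjoin_map_mem ψ (S := Set.univ) (fun s hs => ?_) (Algebra.subset_adjoin trivial)
        clear hs
        induction s using FreeCGA.induction with
        | h0 c => rw [AlgHom.commutes]; exact Subalgebra.algebraMap_mem _ c
        | h1 i =>
          refine Algebra.subset_adjoin (Or.inr (Submodule.mem_sup_left ?_))
          rw [hψe, sndHom_gen]; exact hψ0 i
        | hm x y hx hy => rw [map_mul]; exact mul_mem hx hy
        | ha x y hx hy => rw [map_add]; exact add_mem hx hy
      · rw [AlgHom.toLinearMap_apply, ← hφD]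
        refine adjoin_map_mem φ ?_ (U5 k u hu)
        rintro _ (⟨s, rfl⟩ | hs)
        · induction s using FreeCGA.induction with
          | h0 c => rw [AlgHom.commutes, AlgHom.commutes]; exact Subalgebra.algebraMap_mem _ c
          | h1 i =>
            rw [inl_gen]
            rcases i with v | v
            · exact Algebra.subset_adjoin (Or.inl (hφb v))
            · exact Algebra.subset_adjoin (Or.inr (Submodule.mem_sup_left (hψ0 v)))
          | hm x y hx hy => rw [map_mul, map_mul]; exact mul_mem hx hy
          | ha x y hx hy => rw [map_add, map_add]; exact add_mem hx hy
        · exact Algebra.subset_adjoin (Or.inr (Submodule.mem_sup_right ⟨_, hs, rfl⟩))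
  exact ⟨_, t2 k1, fun v => Submodule.mem_sup_left (hψ0 v),
    fun v => Submodule.mem_sup_right ⟨_, hk1 v, rfl⟩⟩

end TowerOfModel


/-! ### Nice models: ideals, linear parts and the odd quotient. -/

open FreeCGA

namespace NiceModel

variable {K : Type*} [Field K] {p q : ℕ} {deg : Fin p ⊕ Fin q → ℤ}

variable (p q) in
/-- The even generators of `∧V`. -/
def XV : Set (Fin p ⊕ Fin q) := Set.range Sum.inl

variable (p q) in
/-- The generators `x ⊗ 1`, `1 ⊗ x` and `x̄` of the model. -/
def X3 : Set (((Fin p ⊕ Fin q) ⊕ (Fin p ⊕ Fin q)) ⊕ (Fin p ⊕ Fin q)) :=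
  {i | Sum.elim (Sum.elim id id) id i ∈ XV p q}

@[simp] lemma inl_mem_XV (i : Fin p) : (.inl i : Fin p ⊕ Fin q) ∈ XV p q := ⟨i, rfl⟩
@[simp] lemma inr_notMem_XV (j : Fin q) : (.inr j : Fin p ⊕ Fin q) ∉ XV p q := by simp [XV]

lemma mem_evenIdeal {x : FreeCGA K deg} :
    x ∈ evenIdeal K deg ↔ x ∈ lspan K deg {l | ∃ i ∈ XV p q, i ∈ l} := by
  refine mem_span_gen ?_
  rw [XV, ← Set.range_comp]; rfl

lemma mem_evenIdealBar {x : FreeCGA K (deg3 deg)} :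
    x ∈ evenIdealBar K deg ↔ x ∈ lspan K (deg3 deg) {l | ∃ i ∈ X3 p q, i ∈ l} := by
  refine mem_span_gen ?_
  ext z
  constructor
  · rintro ⟨i, rfl | rfl | rfl⟩
    · exact ⟨.inl (.inl (.inl i)), by simp [X3], rfl⟩
    · exact ⟨.inl (.inr (.inl i)), by simp [X3], rfl⟩
    · exact ⟨.inr (.inl i), by simp [X3], rfl⟩
  · rintro ⟨(v | v) | v, ⟨i, hi⟩, rfl⟩
    · exact ⟨i, Or.inl (by rw [show v = .inl i from hi.symm]; rfl)⟩
    · exact ⟨i, Or.inr (Or.inl (by rw [show v = .inl i from hi.symm]; rfl))⟩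
    · exact ⟨i, Or.inr (Or.inr (by rw [show v = .inl i from hi.symm]; rfl))⟩

lemma mem_evenIdealBarExcept {i : Fin p} {x : FreeCGA K (deg3 deg)} :
    x ∈ evenIdealBarExcept K deg i ↔ x ∈ lspan K (deg3 deg) {l | ∃ a ∈ X3 p q \ {.inr (.inl i)}, a ∈ l} := by
  refine mem_span_gen ?_
  ext z
  constructor
  · rintro ⟨k, rfl | rfl | ⟨hk, rfl⟩⟩
    · exact ⟨.inl (.inl (.inl k)), by simp [X3], rfl⟩
    · exact ⟨.inl (.inr (.inl k)), by simp [X3], rfl⟩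
    · exact ⟨.inr (.inl k), by simp [X3, hk], rfl⟩
  · rintro ⟨(v | v) | v, ⟨⟨k, hk⟩, h⟩, rfl⟩
    · exact ⟨k, Or.inl (by rw [show v = .inl k from hk.symm]; rfl)⟩
    · exact ⟨k, Or.inr (Or.inl (by rw [show v = .inl k from hk.symm]; rfl))⟩
    · obtain rfl : v = .inl k := hk.symm
      exact ⟨k, Or.inr (Or.inr ⟨fun e => h (by rw [e]; rfl), rfl⟩)⟩

lemma lin_of_ideal {ι : Type*} {deg : ι → ℤ} {X : Set ι} {i : ι} (hi : i ∉ X) {x : FreeCGA K deg}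
    (hx : x ∈ lspan K deg {l | ∃ i ∈ X, i ∈ l}) : lin K deg i x = 0 := by
  classical
  refine lspan_le (T := LinearMap.ker (lin K deg i)) ?_ hx
  rintro l ⟨a, ha, hl⟩
  rcases l with _ | ⟨b, _ | ⟨c, l⟩⟩
  · exact lin_one i
  · rw [LinearMap.mem_ker, mon_cons, mon_nil, mul_one, lin_gen, if_neg]
    rintro rfl
    rw [List.mem_singleton] at hl
    exact hi (hl ▸ ha)
  · refine lin_of_wge (mon_mem_wge ?_)
    have := wt_nonneg (w := fun _ : ι => (1 : ℤ)) (fun _ => by norm_num) l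
    rw [wt_cons, wt_cons]; omega

variable {d : Differential K deg} {hd : IsSemiPure d} {D : Differential K (deg3 deg)}
  {m : FreeCGA K (deg3 deg) →ₐ[K] FreeCGA K deg}

variable (D) in
/-- The coefficients of the leading term of `D v̄`. -/
def coefA (v k : Fin p ⊕ Fin q) : K := lin K (deg3 deg) (.inl (.inr k)) (D (gen K _ (.inr v)))

lemma lin_D_deg (i j) (h : lin K (deg3 deg) i (D (gen K _ j)) ≠ 0) : deg3 deg i = deg3 deg j + 1 :=
  lin_of_part (D.map_part _ _ (gen_mem_part _ j)) h

lemma coefA_deg {v k : Fin p ⊕ Fin q} (h : coefA D v k ≠ 0) : deg v = deg k := by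
  have := lin_D_deg _ _ h
  simp at this
  omega

lemma mult_inl (x : FreeCGA K deg) : mult K deg (inl deg deg x) = x :=
  algHom_ext (φ := (mult K deg).comp (inl deg deg)) (ψ := AlgHom.id K _) (fun i => by
    rw [AlgHom.comp_apply, inl_gen, mult, map_gen]; rfl) x

lemma mult_inr (x : FreeCGA K deg) : mult K deg (inr deg deg x) = x :=
  algHom_ext (φ := (mult K deg).comp (inr deg deg)) (ψ := AlgHom.id K _) (fun i => by
    rw [AlgHom.comp_apply, inr_gen, mult, map_gen]; rfl) x

lemma lin_sndHom (v) (x : FreeCGA K deg) : lin K (deg3 deg) (.inr v) (sndHom deg x) = 0 := by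
  classical
  refine eq_of_mon (f := lin K (deg3 deg) (.inr v) ∘ₗ (sndHom deg).toLinearMap) (g := 0) (fun l => ?_) x
  rw [LinearMap.comp_apply, AlgHom.toLinearMap_apply, LinearMap.zero_apply]
  induction l with
  | nil => rw [mon_nil, map_one, lin_one]
  | cons a l ih =>
    rw [mon_cons, map_mul, lin_mul, ih, sndHom_gen, lin_gen, if_neg (by simp)]
    simp

lemma d_gen_mem (hd : IsSemiPure d) (i : Fin p) : d (gen K deg (.inl i)) ∈ lspan K deg {l | ∃ i ∈ XV p q, i ∈ l} :=
  mem_evenIdeal.1 (hd.map_evenIdeal _ (Ideal.subset_span ⟨i, rfl⟩))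

section Nice

variable (hm : IsNice hd D m)
include hm

lemma D_inl (b) : D (inl _ _ b) = inl _ _ (d.tensor d b) := hm.isModel.isRelSullivan.2.2.1 b

lemma m_fst (x) : m (fstHom deg x) = x := by
  rw [fstHom, AlgHom.comp_apply, ← AlgHom.comp_apply, hm.isModel.restrict, mult_inl]

lemma m_snd (x) : m (sndHom deg x) = x := by
  rw [sndHom, AlgHom.comp_apply, ← AlgHom.comp_apply, hm.isModel.restrict, mult_inr]

lemma m_D (x) : m (D x) = d (m x) := hm.isModel.quasiIso.1 x

lemma m_mem (i) : m (gen K _ i) ∈ part K deg (deg3 deg i) := hm.isModel.map_part _ _ (gen_mem_part _ i)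

lemma D_gen_mem {i} (hi : i ∈ X3 p q) : D (gen K _ i) ∈ lspan K (deg3 deg) {l | ∃ i ∈ X3 p q, i ∈ l} :=
  mem_evenIdealBar.1 (hm.map_evenIdealBar _ (mem_evenIdealBar.2 (by
    simpa using mon_mem_lspan (K := K) (deg := deg3 deg) (l := [i])
      (S := {l | ∃ i ∈ X3 p q, i ∈ l}) ⟨i, hi, by simp⟩)))

end Nice

/-! ### The quotient by the even generators -/

section Odd

/-- The projection to the quotient by the even generators. -/
def phiY : FreeCGA K deg →ₐ[K] FreeCGA K (degY deg) :=
  ofGens (Sum.elim (fun _ => 0) (gen K _)) (by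
    rintro (i | j)
    · exact zero_mem _
    · exact gen_mem_part (degY deg) j)

/-- The section of the projection to the quotient by the even generators. -/
def psiY : FreeCGA K (degY deg) →ₐ[K] FreeCGA K deg :=
  ofGens (fun j => gen K deg (.inr j)) (fun j => gen_mem_part deg (.inr j))

lemma phiY_X (i) : phiY (K := K) (deg := deg) (gen K deg (.inl i)) = 0 := ofGens_gen _ _ _
lemma phiY_Y (j) : phiY (K := K) (deg := deg) (gen K deg (.inr j)) = gen K _ j := ofGens_gen _ _ _
lemma psiY_gen (j) : psiY (K := K) (deg := deg) (gen K _ j) = gen K deg (.inr j) := ofGens_gen _ _ _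

lemma phiY_mem (i) : phiY (K := K) (gen K deg i) ∈ part K (degY deg) (deg i) := by
  rcases i with i | j
  · rw [phiY_X]; exact zero_mem _
  · rw [phiY_Y]; exact gen_mem_part (degY deg) j

lemma psiY_mem (j) : psiY (K := K) (gen K (degY deg) j) ∈ part K deg (degY deg j) := by
  rw [psiY_gen]; exact gen_mem_part deg (.inr j)

lemma phiY_ideal {x : FreeCGA K deg} (hx : x ∈ evenIdeal K deg) : phiY x = 0 :=
  algHom_lspan_eq_zero (by rintro _ ⟨i, rfl⟩; exact phiY_X i) (mem_evenIdeal.1 hx)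

lemma ideal_of_phiY {x : FreeCGA K deg} (hx : phiY x = 0) : x ∈ evenIdeal K deg := by
  have := sub_section_mem (φ := phiY) (ψ := psiY) (X := XV p q) (deg := deg)
    (by rintro _ ⟨i, rfl⟩; exact phiY_X i) (by
      rintro (i | j) h
      · exact absurd (inl_mem_XV i) h
      · rw [phiY_Y, psiY_gen]) x
  rw [hx, map_zero, sub_zero] at this
  exact mem_evenIdeal.2 this

/-- The differential of the quotient by the even generators. -/
def dY (hd : IsSemiPure d) : Differential K (degY deg) :=
  d.quot phiY psiY phiY_mem psiY_mem (fun j => by rw [psiY_gen, phiY_Y]) (by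
    rintro (i | j)
    · rw [phiY_X, map_zero, map_zero, map_zero]
      exact phiY_ideal (hd.map_evenIdeal _ (Ideal.subset_span ⟨i, rfl⟩))
    · rw [phiY_Y, psiY_gen])

lemma dY_phiY (hd : IsSemiPure d) (x) : dY hd (phiY x) = phiY (d x) := d.quot_comm _ _ _ _ x

variable (deg) in
/-- The degrees of the generators of the quotient of the model by the even generators. -/
abbrev deg3Y : Fin q ⊕ (Fin q ⊕ Fin q) → ℤ :=
  Sum.elim (degY deg) (Sum.elim (degY deg) (fun j => barDeg deg (.inr j)))

/-- The projection of the model to its quotient by the even generators. -/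
def phi3 : FreeCGA K (deg3 deg) →ₐ[K] FreeCGA K (deg3Y deg) :=
  ofGens (Sum.elim (Sum.elim (Sum.elim (fun _ => 0) (fun j => gen K (deg3Y deg) (.inl j)))
    (Sum.elim (fun _ => 0) (fun j => gen K (deg3Y deg) (.inr (.inl j)))))
    (Sum.elim (fun _ => 0) (fun j => gen K (deg3Y deg) (.inr (.inr j))))) (by
    rintro (((i | j) | (i | j)) | (i | j))
    · exact zero_mem _
    · exact gen_mem_part (deg3Y deg) (.inl j)
    · exact zero_mem _
    · exact gen_mem_part (deg3Y deg) (.inr (.inl j))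
    · exact zero_mem _
    · exact gen_mem_part (deg3Y deg) (.inr (.inr j)))

/-- The section of the projection of the model to its quotient by the even generators. -/
def psi3 : FreeCGA K (deg3Y deg) →ₐ[K] FreeCGA K (deg3 deg) :=
  ofGens (Sum.elim (fun j => gen K (deg3 deg) (.inl (.inl (.inr j))))
    (Sum.elim (fun j => gen K (deg3 deg) (.inl (.inr (.inr j))))
      (fun j => gen K (deg3 deg) (.inr (.inr j))))) (by
    rintro (j | (j | j))
    · exact gen_mem_part (deg3 deg) (.inl (.inl (.inr j)))
    · exact gen_mem_part (deg3 deg) (.inl (.inr (.inr j)))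
    · exact gen_mem_part (deg3 deg) (.inr (.inr j)))

lemma phi3_X {i} (hi : i ∈ X3 p q) : phi3 (K := K) (gen K (deg3 deg) i) = 0 := by
  rw [phi3, ofGens_gen]
  rcases i with ((i | j) | (i | j)) | (i | j)
  all_goals first | rfl | exact absurd hi (inr_notMem_XV j)

lemma phi3_fst (j) : phi3 (K := K) (gen K (deg3 deg) (.inl (.inl (.inr j)))) = gen K _ (.inl j) :=
  ofGens_gen _ _ _
lemma phi3_snd (j) : phi3 (K := K) (gen K (deg3 deg) (.inl (.inr (.inr j)))) = gen K _ (.inr (.inl j)) :=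
  ofGens_gen _ _ _
lemma phi3_bar (j) : phi3 (K := K) (gen K (deg3 deg) (.inr (.inr j))) = gen K _ (.inr (.inr j)) :=
  ofGens_gen _ _ _
lemma psi3_fst (j) : psi3 (K := K) (gen K (deg3Y deg) (.inl j)) = gen K _ (.inl (.inl (.inr j))) :=
  ofGens_gen _ _ _
lemma psi3_snd (j) : psi3 (K := K) (gen K (deg3Y deg) (.inr (.inl j))) = gen K _ (.inl (.inr (.inr j))) :=
  ofGens_gen _ _ _
lemma psi3_bar (j) : psi3 (K := K) (gen K (deg3Y deg) (.inr (.inr j))) = gen K _ (.inr (.inr j)) :=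
  ofGens_gen _ _ _

lemma phi3_psi3_gen (j) : phi3 (K := K) (psi3 (gen K (deg3Y deg) j)) = gen K _ j := by
  rcases j with j | (j | j)
  · rw [psi3_fst, phi3_fst]
  · rw [psi3_snd, phi3_snd]
  · rw [psi3_bar, phi3_bar]

lemma phi3_psi3 (x) : phi3 (K := K) (deg := deg) (psi3 x) = x :=
  algHom_ext (φ := phi3.comp psi3) (ψ := AlgHom.id K _) phi3_psi3_gen x

lemma psi3_phi3 {i} (hi : i ∉ X3 p q) : psi3 (phi3 (K := K) (gen K (deg3 deg) i)) = gen K _ i := by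
  rcases i with ((i | j) | (i | j)) | (i | j)
  · exact absurd (inl_mem_XV i) hi
  · rw [phi3_fst, psi3_fst]
  · exact absurd (inl_mem_XV i) hi
  · rw [phi3_snd, psi3_snd]
  · exact absurd (inl_mem_XV i) hi
  · rw [phi3_bar, psi3_bar]

lemma phi3_mem (i) : phi3 (K := K) (gen K (deg3 deg) i) ∈ part K (deg3Y deg) (deg3 deg i) := by
  by_cases hi : i ∈ X3 p q
  · rw [phi3_X hi]; exact zero_mem _
  · rcases i with ((i | j) | (i | j)) | (i | j)
    · exact absurd (inl_mem_XV i) hi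
    · rw [phi3_fst]; exact gen_mem_part (deg3Y deg) (.inl j)
    · exact absurd (inl_mem_XV i) hi
    · rw [phi3_snd]; exact gen_mem_part (deg3Y deg) (.inr (.inl j))
    · exact absurd (inl_mem_XV i) hi
    · rw [phi3_bar]; exact gen_mem_part (deg3Y deg) (.inr (.inr j))

lemma psi3_mem (i) : psi3 (K := K) (gen K (deg3Y deg) i) ∈ part K (deg3 deg) (deg3Y deg i) := by
  rcases i with j | (j | j)
  · rw [psi3_fst]; exact gen_mem_part (deg3 deg) (.inl (.inl (.inr j)))
  · rw [psi3_snd]; exact gen_mem_part (deg3 deg) (.inl (.inr (.inr j)))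
  · rw [psi3_bar]; exact gen_mem_part (deg3 deg) (.inr (.inr j))

lemma phi3_ideal {x : FreeCGA K (deg3 deg)} (hx : x ∈ evenIdealBar K deg) : phi3 x = 0 :=
  algHom_lspan_eq_zero (fun _ => phi3_X) (mem_evenIdealBar.1 hx)

lemma ideal_of_phi3 {x : FreeCGA K (deg3 deg)} (hx : phi3 x = 0) : x ∈ evenIdealBar K deg := by
  have := sub_section_mem (φ := phi3) (ψ := psi3) (X := X3 p q) (deg := deg3 deg) (fun _ => phi3_X)
    (fun _ => psi3_phi3) x
  rw [hx, map_zero, sub_zero] at this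
  exact mem_evenIdealBar.2 this

variable (hm : IsNice hd D m)

/-- The differential of the quotient of the model by the even generators. -/
def DY : Differential K (deg3Y deg) :=
  D.quot phi3 psi3 phi3_mem psi3_mem phi3_psi3_gen (fun i => by
    by_cases hi : i ∈ X3 p q
    · rw [phi3_X hi, map_zero, map_zero, map_zero]
      exact phi3_ideal (mem_evenIdealBar.2 (D_gen_mem hm hi))
    · rw [psi3_phi3 hi])

lemma DY_phi3 (x) : DY hm (phi3 x) = phi3 (D x) := D.quot_comm _ _ _ _ x

variable (m) in
/-- The map induced by the model on the quotients by the even generators. -/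
def mY : FreeCGA K (deg3Y deg) →ₐ[K] FreeCGA K (degY deg) := (phiY.comp m).comp psi3

include hm in
lemma mY_phi3 (x) : mY m (phi3 x) = phiY (m x) := by
  have := sub_section_mem (φ := phi3) (ψ := psi3) (X := X3 p q) (deg := deg3 deg) (fun _ => phi3_X)
    (fun _ => psi3_phi3) x
  have := phiY_ideal (hm.map_ideal _ (mem_evenIdealBar.2 this))
  rw [AlgHom.toLinearMap_apply, map_sub, map_sub, sub_eq_zero] at this
  exact this.symm

/-- The kernels of the two projections are exactly Ī_V and I_V, so this is injectivity in cohomology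
of the quotient map in condition (c). -/
lemma exists_primitive_Y (k : ℤ) (z) (hz : z ∈ part K (deg3Y deg) k) (h1 : DY hm z = 0)
    (h2 : mY m z = 0) : ∃ w ∈ part K (deg3Y deg) (k - 1), DY hm w = z := by
  have e1 : D (psi3 z) ∈ evenIdealBar K deg := ideal_of_phi3 (by
    rw [← DY_phi3 hm, phi3_psi3, h1])
  have e2 : m (psi3 z) ∈ evenIdeal K deg := ideal_of_phiY h2
  obtain ⟨w, hw⟩ := hm.quasiIso_quotient.exists_primitive
    (z := Submodule.Quotient.mk (psi3 z)) ((Submodule.Quotient.mk_eq_zero _).2 e1)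
    ((Submodule.Quotient.mk_eq_zero _).2 e2)
  obtain ⟨w, rfl⟩ := Submodule.Quotient.mk_surjective _ w
  have e3 : D.toLin w - psi3 z ∈ (evenIdealBar K deg).restrictScalars K :=
    (Submodule.Quotient.eq _).1 hw
  have e4 := phi3_ideal e3
  rw [map_sub, phi3_psi3, sub_eq_zero] at e4
  exact exists_homogeneous_primitive (DY hm) hz (w := phi3 w) ((DY_phi3 hm w).trans e4)

variable [CharZero K]

include hm in
-- Modulo even generators, the differential of 1 ⊗ y has no linear part along the fibre: parity
-- excludes the 1 ⊗ y_k, and the second factor is a subcomplex. The (y, y) entries of the linear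
-- contraction then say that its component from y to ȳ is a left inverse of the odd block.
lemma exists_left_inverse_odd (hdeg : ∀ v, 2 ≤ deg v) (hodd : ∀ j, Odd (deg (.inr j))) :
    ∃ B : Matrix (Fin q) (Fin q) K, B * Matrix.of (fun j k => coefA D (.inr j) (.inr k)) = 1 := by
  have hinl : ∀ b : FreeCGA K deg, phi3 (fstHom deg b) = inl (degY deg) (Sum.elim (degY deg) fun j => barDeg deg (.inr j))
      (phiY b) := algHom_ext (φ := phi3.comp (fstHom deg)) (ψ := (inl _ _).comp phiY) (by
    rintro (i | j)
    · rw [AlgHom.comp_apply, AlgHom.comp_apply, fstHom_gen, phi3_X (by simp [X3]), phiY_X, map_zero]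
    · rw [AlgHom.comp_apply, AlgHom.comp_apply, fstHom_gen, phi3_fst, phiY_Y, inl_gen])
  have hpsi : ∀ b, phiY (K := K) (deg := deg) (psiY b) = b :=
    algHom_ext (φ := phiY.comp psiY) (ψ := AlgHom.id K _) fun j => by
      rw [AlgHom.comp_apply, psiY_gen, phiY_Y]; rfl
  obtain ⟨G, hG, g1, g2⟩ := exists_tower (D' := DY hm) hd.isSullivan hm.isModel.isRelSullivan
    phi3_mem (fun x => (DY_phi3 hm x).symm) (fun i => by
      by_cases hi : i ∈ X3 p q
      · rw [phi3_X hi]; exact zero_mem _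
      · rw [phi3, ofGens_gen]
        rcases i with ((i | j) | (i | j)) | (i | j)
        all_goals first | exact Submodule.subset_span ⟨_, rfl⟩ | exact zero_mem _) (fun v => by
      rw [← fstHom_gen, hinl]; exact ⟨_, rfl⟩)
  obtain ⟨H, -, hH⟩ := Cyl.exists_linear_contraction (dC := dY hd) (D := DY hm) (m := mY m)
    (fun j => by have := hdeg (.inr j); rw [degY]; omega)
    (by
      rintro (j | j) <;> have := hdeg (.inr j)
      · change 1 ≤ deg (.inr j); omega
      · change 1 ≤ deg (.inr j) - 1; omega)
    (fun b => by
      obtain ⟨b, rfl⟩ : ∃ c, phiY c = b := ⟨_, hpsi b⟩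
      rw [← hinl, DY_phi3, D_fstHom (D_inl hm), hinl, dY_phiY])
    (fun i => algHom_map_part phiY_mem (hm.isModel.map_part _ _ (psi3_mem i)))
    (fun c => by
      obtain ⟨b, rfl⟩ : ∃ b, phiY b = c := ⟨_, hpsi c⟩
      rw [← hinl, mY_phi3 hm, m_fst hm])
    (fun x => by
      rw [← phi3_psi3 x, DY_phi3, mY_phi3 hm, mY_phi3 hm, m_D hm, dY_phiY])
    (exists_primitive_Y hm) hG (by
      rintro (j | j)
      · rw [← phi3_snd]; exact g1 _
      · rw [← phi3_bar]; exact g2 _)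
  refine ⟨Matrix.of fun j k => H (.inl j) (.inr k), ?_⟩
  have haug : ∀ i, aug K _ (phi3 (K := K) (gen K (deg3 deg) i)) = 0 := fun i =>
    aug_of_part (by
      rcases i with (v | v) | v <;> have := hdeg v
      · change deg v ≠ 0; omega
      · change deg v ≠ 0; omega
      · change deg v - 1 ≠ 0; omega) (phi3_mem i)
  have l1 : ∀ k x, lin K (deg3Y deg) (.inr (.inl k)) (phi3 x) = lin K (deg3 deg) (.inl (.inr (.inr k))) x :=
    fun k => lin_comp haug (by
      rintro (((i | j) | (i | j)) | (i | j)) <;> simp [phi3, lin_gen])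
  have l2 : ∀ k x, lin K (deg3Y deg) (.inr (.inr k)) (phi3 x) = lin K (deg3 deg) (.inr (.inr k)) x :=
    fun k => lin_comp haug (by
      rintro (((i | j) | (i | j)) | (i | j)) <;> simp [phi3, lin_gen])
  ext j k
  have h := hH (.inl j) (.inl k)
  rw [Fintype.sum_sum_type, Fintype.sum_sum_type] at h
  simp only [← phi3_snd, ← phi3_bar, DY_phi3, l1, l2] at h
  have z1 : ∀ j k : Fin q, lin K (deg3 deg) (.inl (.inr (.inr k))) (D (gen K _ (.inl (.inr (.inr j))))) = 0 := by
    intro j k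
    by_contra hne
    have := lin_D_deg _ _ hne
    simp at this
    have h1 := hodd j
    have h2 := hodd k
    rw [this] at h2
    exact (Int.not_even_iff_odd.2 h2) (h1.add_odd odd_one)
  have z2 : ∀ j k : Fin q, lin K (deg3 deg) (.inr (.inr k)) (D (gen K _ (.inl (.inr (.inr j))))) = 0 := by
    intro j k
    rw [← sndHom_gen, D_sndHom (D_inl hm), lin_sndHom]
  simp only [z1, z2, mul_zero, zero_mul, Finset.sum_const_zero, zero_add, add_zero,
    Sum.inl.injEq] at h
  rw [Matrix.mul_apply, Matrix.one_apply, ← h]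
  rfl

end Odd

end NiceModel


/-! ### Inverting the matrix of leading coefficients. -/

open FreeCGA

namespace NiceModel

variable {K : Type*} [Field K] {p q : ℕ} {deg : Fin p ⊕ Fin q → ℤ}
variable {d : Differential K deg} {hd : IsSemiPure d} {D : Differential K (deg3 deg)}
  {m : FreeCGA K (deg3 deg) →ₐ[K] FreeCGA K deg}

/-! ### Invertibility of the leading coefficients -/

lemma lin_fstHom (v) (x : FreeCGA K deg) : lin K (deg3 deg) (.inl (.inr v)) (fstHom deg x) = 0 := by
  classical
  refine eq_of_mon (f := lin K (deg3 deg) (.inl (.inr v)) ∘ₗ (fstHom deg).toLinearMap) (g := 0)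
    (fun l => ?_) x
  rw [LinearMap.comp_apply, AlgHom.toLinearMap_apply, LinearMap.zero_apply]
  induction l with
  | nil => rw [mon_nil, map_one, lin_one]
  | cons a l ih =>
    rw [mon_cons, map_mul, lin_mul, ih, fstHom_gen, lin_gen, if_neg (by simp)]
    simp

variable (p q) in
/-- The inclusion of the fibre generators. -/
def fib : (Fin p ⊕ Fin q) ⊕ (Fin p ⊕ Fin q) → ((Fin p ⊕ Fin q) ⊕ (Fin p ⊕ Fin q)) ⊕ (Fin p ⊕ Fin q) :=
  Sum.elim (fun v => .inl (.inr v)) .inr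

/-- After reassociating the generators, the first factor is the base and 1 ⊗ V, V̄ form the fibre;
the model map is a retraction onto that base and a quasi-isomorphism. -/
lemma exists_contraction [CharZero K] (hm : IsNice hd D m) (hdeg : ∀ v, 2 ≤ deg v) :
    ∃ H : (Fin p ⊕ Fin q) ⊕ (Fin p ⊕ Fin q) → (Fin p ⊕ Fin q) ⊕ (Fin p ⊕ Fin q) → K, ∀ z z',
      ∑ w, H z w * lin K (deg3 deg) (fib p q z') (D (gen K _ (fib p q w))) +
        ∑ w, lin K (deg3 deg) (fib p q w) (D (gen K _ (fib p q z))) * H w z' =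
          if z = z' then 1 else 0 := by
  let e := Equiv.sumAssoc (Fin p ⊕ Fin q) (Fin p ⊕ Fin q) (Fin p ⊕ Fin q)
  let dg : (Fin p ⊕ Fin q) ⊕ ((Fin p ⊕ Fin q) ⊕ (Fin p ⊕ Fin q)) → ℤ :=
    Sum.elim deg (Sum.elim deg (barDeg deg))
  have he : ∀ i, dg (e i) = deg3 deg i := by rintro ((v | v) | v) <;> rfl
  have he' : ∀ i, deg3 deg (e.symm i) = dg i := fun i => by
    conv_rhs => rw [← e.apply_symm_apply i]
    exact (he _).symm
  obtain ⟨φ, hφ⟩ : ∃ φ : FreeCGA K (deg3 deg) →ₐ[K] FreeCGA K dg, ∀ i, φ (gen K _ i) = gen K dg (e i) :=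
    ⟨FreeCGA.map e he, map_gen e he⟩
  obtain ⟨ψ, hψ⟩ : ∃ ψ : FreeCGA K dg →ₐ[K] FreeCGA K (deg3 deg), ∀ i, ψ (gen K _ i) = gen K _ (e.symm i) :=
    ⟨FreeCGA.map e.symm he', map_gen e.symm he'⟩
  have φψ : ∀ x, φ (ψ x) = x := algHom_ext (φ := φ.comp ψ) (ψ := AlgHom.id K _) fun i => by
    rw [AlgHom.comp_apply, hψ, hφ, e.apply_symm_apply]; rfl
  have ψφ : ∀ x, ψ (φ x) = x := algHom_ext (φ := ψ.comp φ) (ψ := AlgHom.id K _) fun i => by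
    rw [AlgHom.comp_apply, hφ, hψ, e.symm_apply_apply]; rfl
  have hφm : ∀ i, φ (gen K _ i) ∈ part K dg (deg3 deg i) := fun i => by
    rw [hφ, ← he]; exact gen_mem_part _ _
  have hψm : ∀ i, ψ (gen K dg i) ∈ part K (deg3 deg) (dg i) := fun i => by
    rw [hψ, ← he']; exact gen_mem_part _ _
  obtain ⟨D', hD'⟩ : ∃ D' : Differential K dg, ∀ x, D' (φ x) = φ (D x) :=
    ⟨D.quot φ ψ hφm hψm (fun j => φψ _) (fun i => by rw [ψφ]), D.quot_comm _ _ _ _⟩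
  have hinl : ∀ b : FreeCGA K deg, φ (fstHom deg b) = inl deg (Sum.elim deg (barDeg deg)) b :=
    algHom_ext (φ := φ.comp (fstHom deg)) (ψ := inl _ _) fun v => by
      rw [AlgHom.comp_apply, fstHom_gen, hφ, inl_gen]; rfl
  obtain ⟨G, hG, g1, g2⟩ := exists_tower (D' := D') hd.isSullivan hm.isModel.isRelSullivan
    hφm (fun x => (hD' x).symm) (fun i => by rw [hφ]; exact Submodule.subset_span ⟨_, rfl⟩) (fun v => by
      rw [← fstHom_gen, hinl]; exact ⟨_, rfl⟩)
  obtain ⟨H, -, hH⟩ := Cyl.exists_linear_contraction (dC := d) (D := D') (m := m.comp ψ)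
    (fun v => by have := hdeg v; omega)
    (by
      rintro (j | j) <;> have := hdeg j
      · change 1 ≤ deg j; omega
      · change 1 ≤ deg j - 1; omega)
    (fun b => by rw [← hinl, hD', D_fstHom (D_inl hm), hinl])
    (fun i => hm.isModel.map_part _ _ (hψm i))
    (fun c => by rw [← hinl, AlgHom.comp_apply, ψφ, m_fst hm])
    (fun x => by
      rw [← φψ x, hD', AlgHom.comp_apply, AlgHom.comp_apply, ψφ, ψφ, m_D hm])
    (fun k z _ h1 h2 => by
      obtain ⟨w, hw⟩ := hm.isModel.quasiIso.exists_primitive (z := ψ z) (by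
        have h3 := hD' (ψ z)
        rw [φψ, h1] at h3
        rw [← map_zero ψ, h3, ψφ]) h2
      exact exists_homogeneous_primitive D' ‹_› (w := φ w) (by
        rw [hD']; exact (congrArg φ hw).trans (φψ z))) hG (by
      rintro (j | j)
      · have := g1 j; rwa [hφ] at this
      · have := g2 j; rwa [hφ] at this)
  refine ⟨H, fun z z' => ?_⟩
  rw [← hH z z']
  have haug : ∀ i, aug K _ (φ (gen K (deg3 deg) i)) = 0 := fun i => by rw [hφ, aug, lift_gen]
  have hfib : ∀ z, φ (gen K _ (fib p q z)) = gen K dg (.inr z) := by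
    rintro (z | z) <;> rw [hφ] <;> rfl
  have l1 : ∀ z x, lin K dg (.inr z) (φ x) = lin K (deg3 deg) (fib p q z) x := by
    classical
    intro z x
    refine lin_comp haug (fun j => ?_) x
    rw [hφ, lin_gen, lin_gen]
    have : (.inr z : (Fin p ⊕ Fin q) ⊕ ((Fin p ⊕ Fin q) ⊕ (Fin p ⊕ Fin q))) = e (fib p q z) := by
      rcases z with z | z <;> rfl
    simp only [this, e.injective.eq_iff]
  have l2 : ∀ z w, lin K dg (.inr z) (D' (gen K dg (.inr w))) =
      lin K (deg3 deg) (fib p q z) (D (gen K _ (fib p q w))) := fun z w => by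
    rw [← hfib, hD', l1]
  exact (congrArg₂ (· + ·) (Finset.sum_congr rfl fun w _ => congrArg _ (l2 _ _))
    (Finset.sum_congr rfl fun w _ => congrArg (· * _) (l2 _ _))).symm

lemma not_deg_eq_add_one {a b : ℤ} (h : (Even a ∧ Even b) ∨ (Odd a ∧ Odd b)) : a ≠ b + 1 := by
  rintro rfl
  rcases h with ⟨⟨a, ha⟩, b, hb⟩ | ⟨⟨a, ha⟩, b, hb⟩ <;> omega

/-- No minimality is assumed, so d y may have a linear part d0 in the x, and the (x, x) entries of
the contraction only give HY d0 + HX AX = 1. The linear part of D² ȳ = 0 gives AY d0 + W AX = 0.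
Since AY has a left inverse, d0 is a left multiple of AX and can be eliminated. -/
lemma exists_left_inverse_even [CharZero K] (hm : IsNice hd D m) (hdeg : ∀ v, 2 ≤ deg v)
    (heven : ∀ i, Even (deg (.inl i))) (hodd : ∀ j, Odd (deg (.inr j))) :
    ∃ B : Matrix (Fin p) (Fin p) K, B * Matrix.of (fun i k => coefA D (.inl i) (.inl k)) = 1 := by
  obtain ⟨H, hH⟩ := exists_contraction hm hdeg
  obtain ⟨BY, hBY⟩ := exists_left_inverse_odd hm hdeg hodd
  set AX : Matrix (Fin p) (Fin p) K := Matrix.of (fun i k => coefA D (.inl i) (.inl k)) with hAX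
  set AY : Matrix (Fin q) (Fin q) K := Matrix.of (fun i k => coefA D (.inr i) (.inr k)) with hAY
  let d0 : Matrix (Fin q) (Fin p) K := Matrix.of fun j k =>
    lin K (deg3 deg) (.inl (.inr (.inl k))) (D (gen K _ (.inl (.inr (.inr j)))))
  let W : Matrix (Fin q) (Fin p) K := Matrix.of fun j k =>
    lin K (deg3 deg) (.inr (.inl k)) (D (gen K _ (.inr (.inr j))))
  let HX : Matrix (Fin p) (Fin p) K := Matrix.of fun i k => H (.inl (.inl i)) (.inr (.inl k))
  let HY : Matrix (Fin p) (Fin q) K := Matrix.of fun i k => H (.inl (.inl i)) (.inl (.inr k))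
  have zd : ∀ i j, deg3 deg i ≠ deg3 deg j + 1 → lin K (deg3 deg) i (D (gen K _ j)) = 0 :=
    fun i j h => by_contra fun hne => h (lin_D_deg _ _ hne)
  have zX : ∀ i k, lin K (deg3 deg) (.inl (.inr (.inl k))) (D (gen K _ (.inl (.inr (.inl i))))) = 0 :=
    fun i k => zd _ _ (not_deg_eq_add_one (Or.inl ⟨heven k, heven i⟩))
  have zY : ∀ i k, lin K (deg3 deg) (.inl (.inr (.inl k))) (D (gen K _ (.inr (.inr i)))) = 0 :=
    fun i k => zd _ _ (not_deg_eq_add_one (Or.inl ⟨heven k, (hodd i).sub_odd odd_one⟩))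
  have zXs : ∀ v i, lin K (deg3 deg) (.inr v) (D (gen K _ (.inl (.inr i)))) = 0 := fun v i => by
    rw [← sndHom_gen, D_sndHom (D_inl hm), lin_sndHom]
  have zXY : ∀ i k, lin K (deg3 deg) (.inl (.inr (.inr k))) (D (gen K _ (.inl (.inr (.inl i))))) = 0 :=
    fun i k => lin_of_ideal (X := X3 p q) (by simp [X3]) (D_gen_mem hm (by simp [X3]))
  have e1 : HY * d0 + HX * AX = 1 := by
    ext i k
    have h := hH (.inl (.inl i)) (.inl (.inl k))
    simp only [Fintype.sum_sum_type, fib, Sum.elim_inl, Sum.elim_inr, zX, zY, zXs, zXY, mul_zero,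
      zero_mul, Finset.sum_const_zero, zero_add, add_zero, Sum.inl.injEq] at h
    rw [Matrix.one_apply, ← h]
    rfl
  have e2 : AY * d0 + W * AX = 0 := by
    ext j k
    have h := lin_map (f := D.toLin) (.inl (.inr (.inl k)))
      (fun x hx => by
        have := D.isDer.map_wge (w := fun _ => (1 : ℤ)) (r := 0) (fun i => by
          rw [add_zero]
          refine part_le_wge ?_ (D.map_part _ _ (gen_mem_part _ i))
          rcases i with (v | v) | v <;> have := hdeg v
          · change deg v + 1 ≠ 0; omega
          · change deg v + 1 ≠ 0; omega
          · change deg v - 1 + 1 ≠ 0; omega) hx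
        rwa [add_zero] at this)
      (x := D (gen K (deg3 deg) (.inr (.inr j)))) (part_le_wge (by
        have := hdeg (.inr j)
        change deg (.inr j) - 1 + 1 ≠ 0; omega) (D.map_part _ _ (gen_mem_part _ _)))
    have z1 : ∀ v, lin K (deg3 deg) (.inl (.inr (.inl k))) (D.toLin (gen K _ (.inl (.inl v)))) = 0 :=
      fun v => by
        rw [← fstHom_gen]
        exact (congrArg _ (D_fstHom (D_inl hm) _)).trans (lin_fstHom _ _)
    have z2 : ∀ l, lin K (deg3 deg) (.inr (.inr l)) (D (gen K _ (.inr (.inr j)))) = 0 := fun l =>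
      zd _ _ (not_deg_eq_add_one (Or.inl ⟨(hodd l).sub_odd odd_one, (hodd j).sub_odd odd_one⟩))
    have z3 := fun l => zX l k
    have e0 : D.toLin (D (gen K (deg3 deg) (.inr (.inr j)))) = 0 := D.sq_zero _
    rw [e0, map_zero] at h
    simp only [Fintype.sum_sum_type, z1, z2, mul_zero, zero_mul, Finset.sum_const_zero, zero_add,
      add_zero] at h
    have z4 : ∑ l, lin K (deg3 deg) (.inl (.inr (.inl l))) (D (gen K _ (.inr (.inr j)))) *
        lin K (deg3 deg) (.inl (.inr (.inl k))) (D.toLin (gen K _ (.inl (.inr (.inl l))))) = 0 :=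
      Finset.sum_eq_zero fun l _ => by rw [show D.toLin _ = _ from rfl]; exact mul_eq_zero_of_right _ (zX l k)
    rw [z4, zero_add] at h
    exact h.symm
  refine ⟨HX - HY * BY * W, ?_⟩
  have e3 : d0 = -(BY * W * AX) := by
    calc d0 = BY * (AY * d0) := by rw [← Matrix.mul_assoc, hBY, Matrix.one_mul]
      _ = _ := by rw [eq_neg_of_add_eq_zero_left e2, Matrix.mul_neg, Matrix.mul_assoc]
  rw [← e1, Matrix.sub_mul, e3, Matrix.mul_neg]
  simp only [Matrix.mul_assoc]
  abel

/-- The matrix of the leading coefficients has a graded inverse. -/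
theorem exists_inverse [CharZero K] (hm : IsNice hd D m) (hdeg : ∀ v, 2 ≤ deg v)
    (heven : ∀ i, Even (deg (.inl i))) (hodd : ∀ j, Odd (deg (.inr j))) :
    ∃ A' : Fin p ⊕ Fin q → Fin p ⊕ Fin q → K, (∀ k v, A' k v ≠ 0 → deg k = deg v) ∧
      (∀ k l, ∑ v, A' k v * coefA D v l = if k = l then 1 else 0) ∧
      ∀ v u, ∑ k, coefA D v k * A' k u = if v = u then 1 else 0 := by
  obtain ⟨BX, hBX⟩ := exists_left_inverse_even hm hdeg heven hodd
  obtain ⟨BY, hBY⟩ := exists_left_inverse_odd hm hdeg hodd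
  let A : Matrix (Fin p ⊕ Fin q) (Fin p ⊕ Fin q) K := Matrix.of (coefA D)
  let B : Matrix (Fin p ⊕ Fin q) (Fin p ⊕ Fin q) K := Matrix.fromBlocks BX 0 0 BY
  have hne : ∀ i j, deg (.inl i) ≠ deg (.inr j) := fun i j h => by
    have := heven i
    rw [h] at this
    exact (Int.not_even_iff_odd.2 (hodd j)) this
  have hA : A = Matrix.fromBlocks (Matrix.of fun i k => coefA D (.inl i) (.inl k)) 0 0
      (Matrix.of fun i k => coefA D (.inr i) (.inr k)) := by
    ext (i | i) (k | k)
    · rfl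
    · exact by_contra fun h => hne _ _ (coefA_deg h)
    · exact by_contra fun h => hne _ _ (coefA_deg h).symm
    · rfl
  have hBA : B * A = 1 := by
    rw [hA, Matrix.fromBlocks_multiply, hBX, hBY]
    simp
  -- Since `A` preserves degrees, deleting the entries of `B` between different degrees keeps it a
  -- left inverse.
  let A' : Matrix (Fin p ⊕ Fin q) (Fin p ⊕ Fin q) K :=
    Matrix.of fun k v => if deg k = deg v then B k v else 0
  have hA'A : A' * A = 1 := by
    ext k l
    rw [Matrix.mul_apply, Matrix.one_apply]
    have h0 := congrFun (congrFun hBA k) l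
    rw [Matrix.mul_apply, Matrix.one_apply] at h0
    by_cases h : deg k = deg l
    · rw [← h0]
      refine Finset.sum_congr rfl fun v _ => ?_
      by_cases hv : A v l = 0
      · rw [hv, mul_zero, mul_zero]
      · have : deg k = deg v := by rw [h, coefA_deg hv]
        simp [A', this]
    · rw [if_neg fun e => h (by rw [e])]
      refine Finset.sum_eq_zero fun v _ => ?_
      by_cases hv : A v l = 0
      · rw [hv, mul_zero]
      · have : deg k ≠ deg v := fun e => h (by rw [e]; exact coefA_deg hv)
        simp [A', this]
  have hAA' := mul_eq_one_comm.1 hA'A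
  refine ⟨A', fun k v h => ?_, fun k l => ?_, fun v u => ?_⟩
  · by_contra hne
    exact h (by simp [A', hne])
  · have := congrFun (congrFun hA'A k) l
    rwa [Matrix.mul_apply, Matrix.one_apply] at this
  · have := congrFun (congrFun hAA' v) u
    rwa [Matrix.mul_apply, Matrix.one_apply] at this

end NiceModel


/-! ### The differentials raise the filtration beyond their leading terms. -/

open FreeCGA

section Lists

variable {ι : Type*} {w : ι → ℤ}

lemma length_le_wt (hw : ∀ i, 1 ≤ w i) (l : List ι) : (l.length : ℤ) ≤ wt w l := by
  induction l with
  | nil => simp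
  | cons a l ih => have := hw a; rw [wt_cons, List.length_cons]; push_cast; omega

lemma wt_one (l : List ι) : wt (fun _ => (1 : ℤ)) l = l.length := by
  induction l with
  | nil => simp
  | cons a l ih => rw [wt_cons, ih, List.length_cons]; push_cast; ring

lemma add_one_le_wt (hw : ∀ i, 1 ≤ w i) {l : List ι} {a : ι} (ha : a ∈ l) (hl : 2 ≤ l.length) :
    w a + 1 ≤ wt w l := by
  obtain ⟨l1, l2, rfl⟩ := List.append_of_mem ha
  have h1 := length_le_wt hw l1
  have h2 := length_le_wt hw l2
  rw [wt_append, wt_cons]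
  simp only [List.length_append, List.length_cons] at hl
  omega

/-- The weight with the value `Λ` on the generators of even degree and `1` on the others. -/
def omOf (Lam : ℤ) (deg : ι → ℤ) (b : ι) : ℤ := if Even (deg b) then Lam else 1

lemma omOf_even {Lam : ℤ} {deg : ι → ℤ} {b : ι} (h : Even (deg b)) : omOf Lam deg b = Lam := if_pos h

lemma omOf_odd {Lam : ℤ} {deg : ι → ℤ} {b : ι} (h : Odd (deg b)) : omOf Lam deg b = 1 :=
  if_neg (Int.not_even_iff_odd.2 h)

lemma one_le_omOf {Lam : ℤ} (h : 1 ≤ Lam) (deg : ι → ℤ) (b : ι) : 1 ≤ omOf Lam deg b := by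
  unfold omOf; split_ifs <;> omega

end Lists

namespace NiceModel

variable {K : Type*} [Field K] {p q : ℕ} {deg : Fin p ⊕ Fin q → ℤ}
variable {d : Differential K deg} {hd : IsSemiPure d} {D : Differential K (deg3 deg)}
  {m : FreeCGA K (deg3 deg) →ₐ[K] FreeCGA K deg}

variable (p q) in
/-- The weight with the value `Λ` on the `x̄` and `1` on the `ȳ`. -/
def omBar (Lam : ℤ) : Fin p ⊕ Fin q → ℤ := Sum.elim (fun _ => Lam) (fun _ => 1)

/-- The differential of a semi-pure algebra raises the weight. -/
lemma d_raise (hd : IsSemiPure d) (hdeg : ∀ v, 2 ≤ deg v) (heven : ∀ i, Even (deg (.inl i)))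
    (hodd : ∀ j, Odd (deg (.inr j))) {Lam : ℤ} (hL : 2 ≤ Lam) (v) :
    d (gen K deg v) ∈ wge K deg (omOf Lam deg) (omOf Lam deg v + 1) := by
  have h1 : ∀ v, 1 ≤ omOf Lam deg v := one_le_omOf (by omega) deg
  have hp := d.map_part _ _ (gen_mem_part deg v)
  rcases v with i | j
  · refine lspan_mono ?_ (mem_lspan_part (d_gen_mem hd i) hp)
    rintro l ⟨⟨_, ⟨k, rfl⟩, hl⟩, hw⟩
    have hw : wt deg l = deg (.inl i) + 1 := hw
    change _ ≤ wt _ l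
    rw [omOf_even (heven i)]
    -- Semi-purity provides a factor of weight Λ. A second factor must be present, since a single
    -- even generator has the wrong parity for d x.
    suffices 2 ≤ l.length by
      have h2 := add_one_le_wt h1 hl this
      rwa [omOf_even (heven k)] at h2
    rcases l with _ | ⟨a, _ | ⟨b, l⟩⟩
    · simp at hl
    · simp only [List.mem_singleton] at hl
      subst hl
      simp at hw
      exact absurd hw (not_deg_eq_add_one (Or.inl ⟨heven k, heven i⟩))
    · simp
  · rw [mem_part_lspan] at hp
    refine lspan_mono (fun l hl => ?_) hp
    have hw : wt deg l = deg (.inr j) + 1 := hl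
    change _ ≤ wt _ l
    rw [omOf_odd (hodd j)]
    have h2 := length_le_wt h1 l
    rcases l with _ | ⟨a, _ | ⟨b, l⟩⟩
    · have := hdeg (.inr j)
      rw [wt_nil] at hw
      omega
    · simp at hw ⊢
      rw [omOf_even]
      · omega
      · rw [hw]; exact (hodd j).add_odd odd_one
    · simp only [List.length_cons] at h2
      push_cast at h2
      have := Int.natCast_nonneg l.length
      omega

lemma tensor_raise (hd : IsSemiPure d) (hdeg : ∀ v, 2 ≤ deg v) (heven : ∀ i, Even (deg (.inl i)))
    (hodd : ∀ j, Odd (deg (.inr j))) {Lam : ℤ} (hL : 2 ≤ Lam) (v) :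
    d.tensor d (gen K (deg2 deg) v) ∈
      wge K (deg2 deg) (omOf Lam (deg2 deg)) (omOf Lam (deg2 deg) v + 1) := by
  rcases v with v | v
  · rw [← inl_gen]
    rw [show d.tensor d (inl deg deg (gen K deg v)) = _ from tensor_inl d d _]
    refine algHom_map_wge (w := omOf Lam deg) (fun i => ?_) (d_raise hd hdeg heven hodd hL v)
    rw [inl_gen]
    exact gen_mem_wge (omOf Lam (deg2 deg)) (.inl i)
  · rw [← inr_gen]
    rw [show d.tensor d (inr deg deg (gen K deg v)) = _ from tensor_inr d d _]
    refine algHom_map_wge (w := omOf Lam deg) (fun i => ?_) (d_raise hd hdeg heven hodd hL v)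
    rw [inr_gen]
    exact gen_mem_wge (omOf Lam (deg2 deg)) (.inr i)

lemma lin_m_bar (hm : IsNice hd D m) (i : Fin p) (j : Fin q) :
    lin K deg (.inr j) (m (gen K _ (.inr (.inl i)))) = 0 :=
  lin_of_ideal (X := XV p q) (by simp) (mem_evenIdeal.1 (hm.map_ideal _ (mem_evenIdealBar.2 (by
    simpa using mon_mem_lspan (K := K) (deg := deg3 deg) (l := [.inr (.inl i)])
      (S := {l | ∃ i ∈ X3 p q, i ∈ l}) ⟨_, by simp [X3], List.mem_singleton_self _⟩))))

lemma deg3_pos (hdeg : ∀ v, 2 ≤ deg v) (i) : 1 ≤ deg3 deg i := by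
  rcases i with (v | v) | v <;> have := hdeg v
  · change 1 ≤ deg v; omega
  · change 1 ≤ deg v; omega
  · change 1 ≤ deg v - 1; omega

/-- The linear part of `D v̄` in the first factor is the opposite of the one in the second factor. -/
lemma lin_fst_D_bar (hm : IsNice hd D m) (hdeg : ∀ v, 2 ≤ deg v) (heven : ∀ i, Even (deg (.inl i)))
    (hodd : ∀ j, Odd (deg (.inr j))) (v k : Fin p ⊕ Fin q) :
    lin K (deg3 deg) (.inl (.inl k)) (D (gen K _ (.inr v))) = - coefA D v k := by
  classical
  have hb : 1 ≤ barDeg deg v := deg3_pos hdeg (.inr v)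
  have hL := lin_map (f := m.toLinearMap) k
    (fun x hx => algHom_map_wge (w := fun _ => (1 : ℤ)) (w' := fun _ => (1 : ℤ)) (fun i =>
      part_le_wge (by have := deg3_pos hdeg i; omega) (m_mem hm i)) hx)
    (x := D (gen K (deg3 deg) (.inr v))) (part_le_wge (by
      change barDeg deg v + 1 ≠ 0; omega) (D.map_part _ _ (gen_mem_part _ _)))
  have hR := lin_map (f := d.toLin) k
    (fun x hx => by
      have := d.isDer.map_wge (w := fun _ => (1 : ℤ)) (r := 0) (fun i => by
        rw [add_zero]
        exact part_le_wge (by have := hdeg i; omega) (d.map_part _ _ (gen_mem_part _ i))) hx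
      rwa [add_zero] at this)
    (x := m (gen K (deg3 deg) (.inr v))) (part_le_wge (by
      change barDeg deg v ≠ 0; omega) (m_mem hm _))
  -- A nonzero term is a path v̄ → j → k of linear parts. Parity and the invariance of the even
  -- ideals, (c) for m and semi-purity for d, rule out every case. The next sum is treated in the
  -- same way.
  have zR : ∑ j, lin K deg j (m (gen K (deg3 deg) (.inr v))) * lin K deg k (d (gen K deg j)) = 0 := by
    refine Finset.sum_eq_zero fun j _ => ?_
    by_contra hne
    have h1 := left_ne_zero_of_mul hne
    have h2 := right_ne_zero_of_mul hne
    have e1 : deg j = deg v - 1 := lin_of_part (m_mem hm (.inr v)) h1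
    have e2 : deg k = deg j + 1 := lin_of_part (d.map_part _ _ (gen_mem_part _ j)) h2
    rcases j with i | j
    · rcases k with k | k
      · exact not_deg_eq_add_one (Or.inl ⟨heven k, heven i⟩) e2
      · exact h2 (lin_of_ideal (X := XV p q) (by simp) (d_gen_mem hd i))
    · rcases v with v | v
      · exact h1 (lin_m_bar hm v j)
      · exact not_deg_eq_add_one (Or.inr ⟨hodd v, hodd j⟩) (by omega)
  have zL : ∑ w, lin K (deg3 deg) (.inr w) (D (gen K _ (.inr v))) *
      lin K deg k (m (gen K _ (.inr w))) = 0 := by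
    refine Finset.sum_eq_zero fun w _ => ?_
    by_contra hne
    have h1 := left_ne_zero_of_mul hne
    have h2 := right_ne_zero_of_mul hne
    have e1 : deg w - 1 = deg v - 1 + 1 := lin_D_deg _ _ h1
    have e2 : deg k = deg w - 1 := lin_of_part (m_mem hm (.inr w)) h2
    rcases w with w | w
    · rcases k with k | k
      · exact not_deg_eq_add_one (Or.inl ⟨heven w, heven k⟩) (by omega)
      · exact h2 (lin_m_bar hm w k)
    · rcases v with v | v
      · exact h1 (lin_of_ideal (X := X3 p q) (by simp [X3]) (D_gen_mem hm (by simp [X3])))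
      · exact not_deg_eq_add_one (Or.inr ⟨hodd w, hodd v⟩) (by omega)
  have e : m.toLinearMap (D (gen K (deg3 deg) (.inr v))) = d.toLin (m (gen K (deg3 deg) (.inr v))) :=
    m_D hm _
  have hmf : ∀ u, m (gen K (deg3 deg) (.inl (.inl u))) = gen K deg u := fun u => by
    rw [← fstHom_gen, m_fst hm]
  have hms : ∀ u, m (gen K (deg3 deg) (.inl (.inr u))) = gen K deg u := fun u => by
    rw [← sndHom_gen, m_snd hm]
  -- Comparing linear parts in m ∘ D = d ∘ m: m identifies v ⊗ 1 with 1 ⊗ v, so the coefficients of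
  -- the two copies of k add up to zero.
  rw [e, hR, zR] at hL
  simp only [Fintype.sum_sum_type (α₁ := (Fin p ⊕ Fin q) ⊕ (Fin p ⊕ Fin q)),
    Fintype.sum_sum_type (α₁ := Fin p ⊕ Fin q), AlgHom.toLinearMap_apply, hmf, hms, lin_gen] at hL
  rw [zL, add_zero] at hL
  simp only [mul_ite, mul_one, mul_zero, Finset.sum_ite_eq', Finset.mem_univ, if_true] at hL
  exact eq_neg_of_add_eq_zero_left hL.symm

/-- The leading term of the differential of the model. -/
theorem D_bar_raise (hm : IsNice hd D m) (hdeg : ∀ v, 2 ≤ deg v) (heven : ∀ i, Even (deg (.inl i)))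
    (hodd : ∀ j, Odd (deg (.inr j))) {Lam : ℤ} (hL : 2 ≤ Lam) (v) :
    D (gen K _ (.inr v)) - ∑ k, coefA D v k • (gen K (deg3 deg) (.inl (.inr k)) - gen K _ (.inl (.inl k))) ∈
      wge K (deg3 deg) (Sum.elim (omOf Lam (deg2 deg)) (omBar p q Lam)) (omBar p q Lam v + 1) := by
  set w : ((Fin p ⊕ Fin q) ⊕ (Fin p ⊕ Fin q)) ⊕ (Fin p ⊕ Fin q) → ℤ :=
    Sum.elim (omOf Lam (deg2 deg)) (omBar p q Lam)
  have hw : ∀ i, 1 ≤ w i := by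
    rintro (i | (i | i))
    · exact one_le_omOf (by omega) _ _
    · change 1 ≤ Lam; omega
    · exact le_rfl
  have hX : ∀ i ∈ X3 p q, w i = Lam := by
    rintro ((v | v) | v) ⟨i, hi⟩ <;> obtain rfl : .inl i = v := hi
    · exact omOf_even (heven i)
    · exact omOf_even (heven i)
    · rfl
  have h0 := part_le_wge (by
    have := deg3_pos hdeg (.inr v)
    omega) (D.map_part _ _ (gen_mem_part (deg3 deg) (.inr v)))
  have h1 := sub_lin_mem h0
  have h2 : ∑ i, lin K (deg3 deg) i (D (gen K _ (.inr v))) • gen K (deg3 deg) i =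
      ∑ k, coefA D v k • (gen K (deg3 deg) (.inl (.inr k)) - gen K _ (.inl (.inl k))) +
        ∑ k, lin K (deg3 deg) (.inr k) (D (gen K _ (.inr v))) • gen K (deg3 deg) (.inr k) := by
    rw [Fintype.sum_sum_type, Fintype.sum_sum_type]
    congr 1
    rw [← Finset.sum_add_distrib]
    refine Finset.sum_congr rfl fun k _ => ?_
    rw [lin_fst_D_bar hm hdeg heven hodd, smul_sub, neg_smul]
    change _ + coefA D v k • _ = _
    abel
  -- By parity and D(Ī_V) ⊆ Ī_V, a linear term in V̄ can only lead from ȳ to x̄, which raises the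
  -- weight from 1 to Λ.
  have h3 : ∑ k, lin K (deg3 deg) (.inr k) (D (gen K _ (.inr v))) • gen K (deg3 deg) (.inr k) ∈
      wge K (deg3 deg) w (omBar p q Lam v + 1) := by
    refine Submodule.sum_mem _ fun k _ => ?_
    by_cases hk : lin K (deg3 deg) (.inr k) (D (gen K _ (.inr v))) = 0
    · rw [hk, zero_smul]; exact zero_mem _
    refine Submodule.smul_mem _ _ (wge_anti w ?_ (gen_mem_wge w (.inr k)))
    change omBar p q Lam v + 1 ≤ omBar p q Lam k
    have e1 : deg k - 1 = deg v - 1 + 1 := lin_D_deg _ _ hk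
    rcases v with v | v <;> rcases k with k | k
    · exact absurd (show deg (.inl k) = _ by omega) (not_deg_eq_add_one (Or.inl ⟨heven k, heven v⟩))
    · exact absurd (lin_of_ideal (X := X3 p q) (by simp [X3]) (D_gen_mem hm (by simp [X3]))) hk
    · simp only [omBar, Sum.elim_inl, Sum.elim_inr]; omega
    · exact absurd (show deg (.inr k) = _ by omega) (not_deg_eq_add_one (Or.inr ⟨hodd k, hodd v⟩))
  -- The nonlinear terms have at least two factors, which suffices for v odd. For v even one of the
  -- factors lies in Ī_V and has weight Λ.
  have h4 : D (gen K _ (.inr v)) - ∑ i, lin K (deg3 deg) i (D (gen K _ (.inr v))) • gen K (deg3 deg) i ∈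
      wge K (deg3 deg) w (omBar p q Lam v + 1) := by
    rcases v with v | v
    · have h5 : D (gen K _ (.inr (.inl v))) - ∑ i, lin K (deg3 deg) i (D (gen K _ (.inr (.inl v)))) •
          gen K (deg3 deg) i ∈ lspan K (deg3 deg) {l | ∃ i ∈ X3 p q, i ∈ l} := by
        have hI := D_gen_mem hm (i := .inr (.inl v)) (by simp [X3])
        refine sub_mem hI (Submodule.sum_mem _ fun i _ => ?_)
        by_cases hi : i ∈ X3 p q
        · exact Submodule.smul_mem _ _ (by
            simpa using mon_mem_lspan (K := K) (deg := deg3 deg) (l := [i])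
              (S := {l | ∃ i ∈ X3 p q, i ∈ l}) ⟨i, hi, by simp⟩)
        · rw [lin_of_ideal hi hI, zero_smul]; exact zero_mem _
      refine lspan_mono ?_ (mem_lspan_inter (Q := fun n => 2 ≤ n) h5 h1)
      rintro l ⟨⟨i, hi, hl⟩, h6⟩
      have h6 : 2 ≤ wt (fun _ => (1 : ℤ)) l := h6
      rw [wt_one] at h6
      have := add_one_le_wt hw hl (by exact_mod_cast h6)
      rw [hX i hi] at this
      exact this
    · refine lspan_mono (fun l hl => ?_) h1
      have hl : 2 ≤ wt (fun _ => (1 : ℤ)) l := hl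
      have h6 := length_le_wt hw l
      rw [wt_one] at hl
      change 1 + 1 ≤ wt w l
      omega
  have := add_mem h4 h3
  rw [h2] at this
  convert this using 1
  abel

end NiceModel


/-! ### Acyclicity of the Koszul data with all generators in the leading term. -/

open FreeCGA

lemma wt_neg {ι : Type*} (w : ι → ℤ) (l : List ι) : wt (fun i => -w i) l = -wt w l := by
  induction l with
  | nil => simp
  | cons a l ih => rw [wt_cons, wt_cons, ih]; ring

lemma exists_mem_wge {K : Type*} [Field K] {ι : Type*} {deg : ι → ℤ} (w : ι → ℤ) (x : FreeCGA K deg) :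
    ∃ n, x ∈ wge K deg w n := by
  have : x ∈ ⨆ n : ℕ, wge K deg w (-n) := mem_of_mon (T := ⨆ n : ℕ, wge K deg w (-n)) (fun l =>
    Submodule.mem_iSup_of_mem (wt w l).natAbs (mon_mem_wge (by omega))) x
  rw [Submodule.mem_iSup_of_directed] at this
  · obtain ⟨n, hn⟩ := this
    exact ⟨_, hn⟩
  · refine Monotone.directed_le fun a b h => wge_anti w ?_
    simpa using h

lemma sub_aug_mem {K : Type*} [Field K] {ι : Type*} {deg : ι → ℤ} (x : FreeCGA K deg) :
    x - aug K deg x • 1 ∈ wge K deg (fun _ => 1) 1 := by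
  refine mem_of_mon (T := (wge K deg (fun _ => 1) 1).comap
    (LinearMap.id - (aug K deg).toLinearMap.smulRight 1)) (fun l => ?_) x
  rw [Submodule.mem_comap]
  change mon K deg l - aug K deg (mon K deg l) • 1 ∈ _
  rcases l with _ | ⟨a, l⟩
  · simp
  · rw [aug_mon_cons, zero_smul, sub_zero]
    refine mon_mem_wge ?_
    rw [wt_one, List.length_cons]; push_cast; omega

namespace KoszulData

variable {K : Type*} [Field K] {p q : ℕ} {β : Type*} (S : KoszulData K p q β)

/-- The contraction of the Koszul complex. -/
def kh : S.P →ₗ[K] S.P := ∑ v, LinearMap.mulLeft K (S.bar v) ∘ₗ S.parP v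

lemma kh_isDer : IsDer (AlgHom.id K _) (-1) S.kh :=
  IsDer.sum _ fun v _ => by
    have := (S.parP_isDer v).mulLeft (gen_mem_part S.degP (.inr v))
    rwa [show S.degP (.inr v) + -S.deg v = -1 by simp [barDeg]; ring] at this

lemma kh_base (b) : S.kh (S.base b) = ∑ v, S.coef b v • S.bar v := by
  rw [kh, LinearMap.sum_apply]
  refine Finset.sum_congr rfl fun v _ => ?_
  rw [LinearMap.comp_apply, parP_base, LinearMap.mulLeft_apply, mul_smul_comm, mul_one]

lemma kh_bar (v) : S.kh (S.bar v) = 0 := by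
  rw [kh, LinearMap.sum_apply]
  refine Finset.sum_eq_zero fun v _ => ?_
  rw [LinearMap.comp_apply, parP_bar, map_zero]

lemma kh_w (v) : S.kh (inl _ _ (S.w v)) = S.bar v := by
  rw [kh, LinearMap.sum_apply, Finset.sum_eq_single v]
  · rw [LinearMap.comp_apply, parP_w, if_pos rfl, LinearMap.mulLeft_apply, mul_one]
  · intro u _ hu
    rw [LinearMap.comp_apply, parP_w, if_neg fun h => hu h.symm, map_zero]
  · simp

lemma kh_gen_mem (i) : S.kh (gen K S.degP i) ∈ part K S.degP (S.degP i + -1) := by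
  rcases i with b | v
  · rw [kh_base]
    refine Submodule.sum_mem _ fun v _ => ?_
    by_cases h : S.coef b v = 0
    · rw [h, zero_smul]; exact zero_mem _
    · refine Submodule.smul_mem _ _ ?_
      have := gen_mem_part (K := K) S.degP (.inr v)
      rwa [show S.degP (.inl b) + -1 = S.degP (.inr v) by
        simp [barDeg, S.coef_ne h]; ring]
  · rw [kh_bar]; exact zero_mem _

lemma kh_wge {w : β ⊕ (Fin p ⊕ Fin q) → ℤ} {r : ℤ}
    (h : ∀ b v, S.coef b v ≠ 0 → w (.inl b) + r ≤ w (.inr v)) {n : ℤ} {x : S.P}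
    (hx : x ∈ wge K S.degP w n) : S.kh x ∈ wge K S.degP w (n + r) := by
  refine S.kh_isDer.map_wge (fun i => ?_) hx
  rcases i with b | v
  · rw [kh_base]
    refine Submodule.sum_mem _ fun v _ => ?_
    by_cases h0 : S.coef b v = 0
    · rw [h0, zero_smul]; exact zero_mem _
    · exact Submodule.smul_mem _ _ (wge_anti w (h b v h0) (gen_mem_wge w (.inr v)))
  · rw [kh_bar]; exact zero_mem _

/-- The derivation `kh` sends w_v back to v̄, so the commutator is the identity on generators,
provided that every base generator is one of the `e k`. -/
lemma kos_kh (he : Function.Surjective S.e) (x : S.P) :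
    S.kos (S.kh x) + S.kh (S.kos x) = euler K S.degP (fun _ => 1) x := by
  have h := S.kos_isDer.commutator S.kh_isDer S.kos_mem S.kh_gen_mem
  have h3 := h.ext (euler_isDer fun _ => 1) (fun i => ?_) x
  · simp only [LinearMap.sub_apply, LinearMap.comp_apply, LinearMap.smul_apply] at h3
    rw [← h3, sgn_odd K (by decide)]
    simp
  · rw [euler_of_mem (gen_mem_wpart _ i)]
    simp only [LinearMap.sub_apply, LinearMap.comp_apply, LinearMap.smul_apply]
    rw [sgn_odd K (by decide)]
    rcases i with b | v
    · obtain ⟨k, rfl⟩ := he b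
      rw [kos_base, map_zero, kh_base, map_sum]
      simp only [map_smul, kos_bar, coef_e, w, map_sum, inl_gen, Finset.smul_sum, smul_smul]
      rw [Finset.sum_comm]
      simp only [← Finset.sum_smul, S.A'_mul]
      simp
    · rw [kh_bar, map_zero, kos_bar, kh_w]
      simp

/-- The division by the word length. -/
def wdiv : S.P →ₗ[K] S.P := wsum (fun _ => 1) fun k => ((k : K)⁻¹) • LinearMap.id

lemma wdiv_mon (l) : S.wdiv (mon K S.degP l) = ((wt (fun _ => 1) l : ℤ) : K)⁻¹ • mon K S.degP l := by
  simp [wdiv, wsum_mon]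

lemma wdiv_wge {w : β ⊕ (Fin p ⊕ Fin q) → ℤ} {n : ℤ} {x : S.P} (hx : x ∈ wge K S.degP w n) :
    S.wdiv x ∈ wge K S.degP w n :=
  map_mem_of_lspan (fun l hl => by
    rw [wdiv_mon]; exact Submodule.smul_mem _ _ (mon_mem_lspan hl)) hx

lemma kos_wdiv (x : S.P) : S.kos (S.wdiv x) = S.wdiv (S.kos x) := by
  refine eq_of_mon (f := S.kos ∘ₗ S.wdiv) (g := S.wdiv ∘ₗ S.kos) (fun l => ?_) x
  have h : S.kos (mon K S.degP l) ∈ wpart K S.degP (fun _ => 1) (wt (fun _ => 1) l + 0) := by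
    refine S.kos_isDer.map_wpart (fun i => ?_) (mon_mem_wpart _ l)
    rcases i with b | v
    · rw [kos_base]; exact zero_mem _
    · rw [kos_bar, w, map_sum]
      refine Submodule.sum_mem _ fun k _ => ?_
      rw [map_smul, inl_gen]
      exact Submodule.smul_mem _ _ (gen_mem_wpart _ _)
  rw [add_zero] at h
  rw [LinearMap.comp_apply, LinearMap.comp_apply, wdiv_mon, map_smul]
  conv_rhs => rw [wdiv, wsum_of_mem _ h]
  rfl

lemma euler_wdiv [CharZero K] {x : S.P} (hx : x ∈ wge K S.degP (fun _ => 1) 1) :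
    euler K S.degP (fun _ => 1) (S.wdiv x) = x := by
  refine eq_of_lspan (f := euler K S.degP (fun _ => 1) ∘ₗ S.wdiv) (g := LinearMap.id) (fun l hl => ?_) hx
  have hl : 1 ≤ wt (fun _ => (1 : ℤ)) l := hl
  rw [LinearMap.comp_apply, wdiv_mon, map_smul, euler_mon, smul_smul, inv_mul_cancel₀, one_smul]
  · rfl
  · exact_mod_cast (by omega : wt (fun _ => (1 : ℤ)) l ≠ 0)

lemma D_sub_kos {a : ℤ} {x : S.P} (hx : x ∈ wge K S.degP S.omP a) :
    S.D x - S.kos x ∈ wge K S.degP S.omP (a + 1) := by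
  have hder : IsDer (AlgHom.id K _) 1 (S.D.toLin - S.kos) := by
    rw [sub_eq_add_neg, ← neg_one_smul K S.kos]
    exact S.D.isDer.add (S.kos_isDer.smul _)
  refine hder.map_wge (fun i => ?_) hx
  rcases i with b | v
  · rw [LinearMap.sub_apply, kos_base, sub_zero]
    have h2 := S.D_inl (gen K S.degB b)
    rw [inl_gen] at h2
    rw [h2]
    refine algHom_map_wge (fun b => ?_) (S.dB_raise b)
    rw [inl_gen]
    exact gen_mem_wge S.omP (.inl b)
  · rw [LinearMap.sub_apply, kos_bar]
    have h2 := S.D_raise v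
    rw [w, map_sum]
    simp only [map_smul, inl_gen]
    exact h2

/-- The algebra `B ⊗ ∧V̄` is acyclic if `B = ∧V`. -/
theorem exists_primitive [CharZero K] (he : Function.Surjective S.e) {z : S.P} (hz : S.D z = 0)
    (h1 : z ∈ wge K S.degP (fun _ => 1) 1) : ∃ w, S.D w = z := by
  have hdP : ∀ i, 1 ≤ S.degP i := by
    rintro (b | v)
    · have := S.two_le_B b; change 1 ≤ S.degB b; omega
    · have := S.two_le v; change 1 ≤ S.deg v - 1; omega
  obtain ⟨n, hn⟩ := exists_mem_wge (fun i => -S.degP i) z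
  -- Here n bounds the negative of the degree from below, so the degrees in z are at most -n and
  -- filtration above Λ(-n) forces z = 0. The induction replaces z by z - D(kh(wdiv z)), which
  -- cancels the leading part and gains one step.
  have key : ∀ k : ℕ, ∀ z : S.P, S.D z = 0 → z ∈ wge K S.degP (fun _ => 1) 1 →
      z ∈ wge K S.degP (fun i => -S.degP i) n → z ∈ wge K S.degP S.omP (S.Lam * -n + 1 - k) →
      ∃ w, S.D w = z := by
    intro k
    induction k with
    | zero =>
      intro z _ _ h2 h3
      refine ⟨0, ?_⟩
      rw [map_zero, eq_comm]
      refine lspan_le (T := ⊥) (fun l hl => ?_)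
        (mem_lspan_inter (w := S.omP) (Q := fun k => S.Lam * -n + 1 - (0 : ℕ) ≤ k) h2 h3)
      have e1 : n ≤ wt (fun i => -S.degP i) l := hl.1
      have e2 : S.Lam * -n + 1 - (0 : ℕ) ≤ wt S.omP l := hl.2
      have e3 := wt_neg S.degP l
      have e4 : wt S.omP l ≤ S.Lam * wt S.degP l := by
        clear hl e1 e2 e3
        induction l with
        | nil => simp
        | cons a l ih =>
          have h4 : S.omP a ≤ S.Lam := by
            have := S.one_le_Lam
            rcases a with b | (i | j)
            · simp only [omP, Sum.elim_inl, omB]; split_ifs <;> omega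
            · exact le_rfl
            · simpa [omU] using this
          have h5 := hdP a
          have := S.one_le_Lam
          rw [wt_cons, wt_cons]
          nlinarith
      have := S.one_le_Lam
      push_cast at e2
      exfalso
      nlinarith
    | succ k ih =>
      intro z h0 h1 h2 h3
      set y := S.kh (S.wdiv z) with hy
      have y1 : y ∈ wge K S.degP (fun _ => 1) 1 := by
        have := S.kh_wge (r := 0) (w := fun _ => 1) (fun _ _ _ => le_rfl) (S.wdiv_wge h1)
        rwa [add_zero] at this
      have y2 : y ∈ wge K S.degP (fun i => -S.degP i) (n + 1) :=
        S.kh_wge (r := 1) (w := fun i => -S.degP i) (fun b v h => by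
          simp [barDeg, S.coef_ne h]) (S.wdiv_wge h2)
      have y3 : ∀ {a : ℤ} {z : S.P}, z ∈ wge K S.degP S.omP a → S.kh (S.wdiv z) ∈ wge K S.degP S.omP a := by
        intro a z hz
        have := S.kh_wge (r := 0) (w := S.omP) (fun b v h => (S.coef_omB h).le) (S.wdiv_wge hz)
        rwa [add_zero] at this
      obtain ⟨w, hw⟩ := ih (z - S.D y) (by
          rw [map_sub, h0, sub_eq_zero]; exact (S.D.sq_zero _).symm) (sub_mem h1 (by
          have := S.D.isDer.map_wge (w := fun _ => (1 : ℤ)) (r := 0) (fun i => by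
            rw [add_zero]
            exact part_le_wge (by have := hdP i; change S.degP i + 1 ≠ 0; omega) (S.D.map_part _ _ (gen_mem_part _ i))) y1
          rwa [add_zero] at this)) (sub_mem h2 (by
          have := S.D.isDer.map_wge (w := fun i => -S.degP i) (r := -1) (fun i => by
            have h5 := S.D.map_part _ _ (gen_mem_part S.degP i)
            rw [mem_part_lspan] at h5
            refine lspan_mono (fun l hl => ?_) h5
            have hl : wt S.degP l = S.degP i + 1 := hl
            change _ ≤ wt _ l
            rw [wt_neg, hl]
            omega) y2
          rwa [add_neg_cancel_right] at this)) (by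
          have e1 := S.kos_kh he (S.wdiv z)
          rw [S.euler_wdiv h1, kos_wdiv] at e1
          have e2 : z - S.D y = S.kh (S.wdiv (-(S.D z - S.kos z))) - (S.D y - S.kos y) := by
            rw [h0, zero_sub, neg_neg, hy]
            nth_rewrite 1 [← e1]
            abel
          rw [e2, show S.Lam * -n + 1 - (k : ℤ) = S.Lam * -n + 1 - ((k + 1 : ℕ) : ℤ) + 1 by push_cast; ring]
          exact sub_mem (y3 (neg_mem (S.D_sub_kos h3))) (S.D_sub_kos (y3 h3)))
      refine ⟨w + y, ?_⟩
      rw [map_add, hw, sub_add_cancel]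
  obtain ⟨s, hs⟩ := exists_mem_wge S.omP z
  exact key (S.Lam * -n + 1 - s).toNat z hz h1 hn (wge_anti _ (by omega) hs)

end KoszulData


open FreeCGA

/-! ### The dimension of `Ext` -/

section Rank

variable {K : Type*} [Field K] {κ υ : Type*} {degB : κ → ℤ} {degU : υ → ℤ} {dB : Differential K degB}
  {D : Differential K (Sum.elim degB degU)} {n : ℤ}

lemma extClass_eq_zero_iff (f : cocycles dB D n) : extClass dB D n f = 0 ↔ f.1 ∈ coboundaries dB D n :=
  Submodule.Quotient.mk_eq_zero _

lemma rank_ext_eq_zero (h : cocycles dB D n ≤ coboundaries dB D n) : Module.rank K (Ext dB D n) = 0 := by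
  have : Subsingleton (Ext dB D n) := by
    refine subsingleton_of_forall_eq 0 fun x => ?_
    obtain ⟨f, rfl⟩ := Submodule.Quotient.mk_surjective _ x
    exact (extClass_eq_zero_iff f).2 (h f.2)
  exact rank_subsingleton' K _

lemma exists_smul_extClass {f : cocycles dB D n}
    (h : ∀ F ∈ cocycles dB D n, ∃ c : K, F - c • f.1 ∈ coboundaries dB D n) (x : Ext dB D n) :
    ∃ c : K, c • extClass dB D n f = x := by
  obtain ⟨F, rfl⟩ := Submodule.Quotient.mk_surjective _ x
  obtain ⟨c, hc⟩ := h F.1 F.2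
  refine ⟨c, ?_⟩
  have h1 : extClass dB D n (F - c • f) = 0 := (extClass_eq_zero_iff _).2 hc
  have h2 := (SubQuotient.mk (cocycles dB D n) (coboundaries dB D n)).map_sub F (c • f)
  rw [LinearMap.map_smul] at h2
  exact (sub_eq_zero.1 (h2.symm.trans h1)).symm

lemma rank_ext_eq_one {f : cocycles dB D n} (hf : extClass dB D n f ≠ 0)
    (h : ∀ F ∈ cocycles dB D n, ∃ c : K, F - c • f.1 ∈ coboundaries dB D n) :
    Module.rank K (Ext dB D n) = 1 ∧ Submodule.span K {extClass dB D n f} = ⊤ :=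
  ⟨rank_eq_one _ hf (exists_smul_extClass h), by
    rw [eq_top_iff]
    rintro x -
    exact Submodule.mem_span_singleton.2 (exists_smul_extClass h x)⟩

/-- Modulo coboundaries f is a multiple of f₀, with nonzero factor because its class is nonzero;
divide by that factor. -/
lemma spanning_of_ne_zero {f f₀ : cocycles dB D n} (hf : extClass dB D n f ≠ 0)
    (h : ∀ F ∈ cocycles dB D n, ∃ c : K, F - c • f₀.1 ∈ coboundaries dB D n) :
    ∀ F ∈ cocycles dB D n, ∃ c : K, F - c • f.1 ∈ coboundaries dB D n := by
  intro F hF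
  obtain ⟨a, ha⟩ := h f.1 f.2
  obtain ⟨b, hb⟩ := h F hF
  have ha0 : a ≠ 0 := by
    rintro rfl
    rw [zero_smul, sub_zero] at ha
    exact hf ((extClass_eq_zero_iff f).2 ha)
  refine ⟨b / a, ?_⟩
  have e : F - (b / a) • f.1 = F - b • f₀.1 - (b / a) • (f.1 - a • f₀.1) := by
    rw [smul_sub, smul_smul, div_mul_cancel₀ b ha0]
    abel
  rw [e]
  exact Submodule.sub_mem _ hb (Submodule.smul_mem _ _ ha)

end Rank

namespace KoszulData

variable {K : Type*} [Field K] [CharZero K] {p q : ℕ} {β : Type*} [Fintype β] (S : KoszulData K p q β)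

lemma exists_spanning {f : S.P →ₗ[K] S.B} (hf : f ∈ S.hom S.N) (hD : S.hD S.N f = 0)
    (hf0 : f - S.f0 ∈ S.shift S.omP S.omB (S.s0 + 1)) {F : S.P →ₗ[K] S.B}
    (hF : F ∈ cocycles S.dB S.D S.N) : ∃ c : K, F - c • f ∈ coboundaries S.dB S.D S.N := by
  obtain ⟨c, G, hG, e⟩ := S.cocycle_eq hf hD hf0 hF.1 hF.2
  exact ⟨c, G, hG, by rw [e]; exact (add_sub_cancel_left _ _).symm⟩

omit [CharZero K] [Fintype β] in
-- All that is known about the error at x̄_1 ⋯ x̄_p: strictly larger filtration than ∏ t_y, at least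
-- q odd factors in each term, and the degree of ∏ t_y.
lemma barx_sub_mem {f : S.P →ₗ[K] S.B} (hf : f ∈ S.hom S.N)
    (hf0 : f - S.f0 ∈ S.shift S.omP S.omB (S.s0 + 1)) (hl : f ∈ S.shift S.lowP S.lowB (q - p)) :
    f S.barx - S.ty ∈ wge K S.degB S.omB (q + 1) ∧ f S.barx - S.ty ∈ wge K S.degB S.lowB q ∧
      f S.barx - S.ty ∈ part K S.degB (wt S.deg (ys p q)) := by
  have h0 : S.f0 S.barx = S.ty := S.f0_barx
  have e : f S.barx - S.ty = (f - S.f0) S.barx := by rw [LinearMap.sub_apply, h0]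
  have hw : ∀ w : β ⊕ (Fin p ⊕ Fin q) → ℤ, S.barx ∈ wge K S.degP w (wt (w ∘ Sum.inr) (xs p q)) := fun w => by
    rw [← wt_map]; exact mon_mem_wge le_rfl
  rw [e]
  refine ⟨?_, ?_, ?_⟩
  · have := hf0 _ _ (hw S.omP)
    rw [wt_xs (c := S.Lam) (fun _ => rfl), s0] at this
    convert this using 2
    ring
  · have := sub_mem hl S.f0_low _ _ (hw S.lowP)
    rw [wt_xs (c := 1) (fun _ => rfl)] at this
    convert this using 2
    ring
  · have := (sub_mem hf S.f0_mem).1 _ _ S.barx_mem_part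
    rwa [N, add_sub_cancel] at this

end KoszulData

/-! ### The quotient by the first factor and the Gorenstein property. -/

namespace NiceModel

variable {K : Type*} [Field K] {p q : ℕ} {deg : Fin p ⊕ Fin q → ℤ}
variable {d : Differential K deg} {hd : IsSemiPure d} {D : Differential K (deg3 deg)}
  {m : FreeCGA K (deg3 deg) →ₐ[K] FreeCGA K deg}

open KoszulData

/-! ### The quotient by the first factor -/

/-- The degrees of the generators of the quotient of the model by the first factor. -/
abbrev degR (deg : Fin p ⊕ Fin q → ℤ) : (Fin p ⊕ Fin q) ⊕ (Fin p ⊕ Fin q) → ℤ := Sum.elim deg (barDeg deg)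

/-- The projection of the model to its quotient by the first factor. -/
def phiR : FreeCGA K (deg3 deg) →ₐ[K] FreeCGA K (degR deg) :=
  ofGens (Sum.elim (Sum.elim (fun _ => 0) (fun v => gen K (degR deg) (.inl v)))
    (fun v => gen K (degR deg) (.inr v))) (by
    rintro ((v | v) | v)
    · exact zero_mem _
    · exact gen_mem_part (degR deg) (.inl v)
    · exact gen_mem_part (degR deg) (.inr v))

/-- The section of the projection to the quotient by the first factor. -/
def psiR : FreeCGA K (degR deg) →ₐ[K] FreeCGA K (deg3 deg) :=
  ofGens (Sum.elim (fun v => gen K (deg3 deg) (.inl (.inr v))) (fun v => gen K (deg3 deg) (.inr v))) (by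
    rintro (v | v)
    · exact gen_mem_part (deg3 deg) (.inl (.inr v))
    · exact gen_mem_part (deg3 deg) (.inr v))

lemma phiR_fst (v) : phiR (K := K) (gen K (deg3 deg) (.inl (.inl v))) = 0 := ofGens_gen _ _ _
lemma phiR_snd (v) : phiR (K := K) (gen K (deg3 deg) (.inl (.inr v))) = gen K _ (.inl v) := ofGens_gen _ _ _
lemma phiR_bar (v) : phiR (K := K) (gen K (deg3 deg) (.inr v)) = gen K _ (.inr v) := ofGens_gen _ _ _
lemma psiR_inl (v) : psiR (K := K) (gen K (degR deg) (.inl v)) = gen K _ (.inl (.inr v)) := ofGens_gen _ _ _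
lemma psiR_inr (v) : psiR (K := K) (gen K (degR deg) (.inr v)) = gen K _ (.inr v) := ofGens_gen _ _ _

lemma phiR_mem (i) : phiR (K := K) (gen K (deg3 deg) i) ∈ part K (degR deg) (deg3 deg i) := by
  rcases i with (v | v) | v
  · rw [phiR_fst]; exact zero_mem _
  · rw [phiR_snd]; exact gen_mem_part (degR deg) (.inl v)
  · rw [phiR_bar]; exact gen_mem_part (degR deg) (.inr v)

lemma psiR_mem (i) : psiR (K := K) (gen K (degR deg) i) ∈ part K (deg3 deg) (degR deg i) := by
  rcases i with v | v
  · rw [psiR_inl]; exact gen_mem_part (deg3 deg) (.inl (.inr v))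
  · rw [psiR_inr]; exact gen_mem_part (deg3 deg) (.inr v)

lemma phiR_sndHom (x : FreeCGA K deg) : phiR (sndHom deg x) = inl deg (barDeg deg) x :=
  algHom_ext (φ := phiR.comp (sndHom deg)) (ψ := inl _ _) (fun v => by
    rw [AlgHom.comp_apply, sndHom_gen, phiR_snd, inl_gen]) x

lemma phiR_fstHom (x : FreeCGA K deg) : phiR (fstHom deg x) = algebraMap K (FreeCGA K (degR deg)) (aug K deg x) :=
  algHom_ext (φ := phiR.comp (fstHom deg)) (ψ := (Algebra.ofId K _).comp (aug K deg)) (fun v => by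
    rw [AlgHom.comp_apply, fstHom_gen, phiR_fst, AlgHom.comp_apply, aug, lift_gen, map_zero]) x

/-- The differential of the quotient by the first factor. -/
def DR (hm : IsNice hd D m) (hdeg : ∀ v, 2 ≤ deg v) : Differential K (degR deg) :=
  D.quot phiR psiR phiR_mem psiR_mem (by
    rintro (v | v)
    · rw [psiR_inl, phiR_snd]
    · rw [psiR_inr, phiR_bar]) (by
    rintro ((v | v) | v)
    · rw [phiR_fst, map_zero, map_zero, map_zero, ← fstHom_gen, D_fstHom (D_inl hm), phiR_fstHom,
        aug_of_part (by have := hdeg v; omega) (d.map_part _ _ (gen_mem_part _ v)), map_zero]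
    · rw [phiR_snd, psiR_inl]
    · rw [phiR_bar, psiR_inr])

variable (hm : IsNice hd D m) (hdeg : ∀ v, 2 ≤ deg v)

lemma DR_phiR (x) : DR hm hdeg (phiR x) = phiR (D x) := D.quot_comm _ _ _ _ x

lemma DR_inl (x) : DR hm hdeg (inl deg (barDeg deg) x) = inl deg (barDeg deg) (d x) := by
  rw [← phiR_sndHom, DR_phiR, D_sndHom (D_inl hm), phiR_sndHom]

variable (deg) in
/-- A bound for the degrees. -/
def bigDeg : ℤ := 2 + ∑ v, deg v

include hdeg in
lemma le_bigDeg (v) : deg v ≤ bigDeg deg := by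
  have := Finset.single_le_sum (f := deg) (fun v _ => by have := hdeg v; omega) (Finset.mem_univ v)
  unfold bigDeg; omega

include hdeg in
lemma two_le_bigDeg : 2 ≤ bigDeg deg := by
  have := Finset.sum_nonneg (f := deg) (s := Finset.univ) (fun v _ => by have := hdeg v; omega)
  unfold bigDeg; omega

variable [CharZero K] (heven : ∀ i, Even (deg (.inl i))) (hodd : ∀ j, Odd (deg (.inr j)))

/-- The Koszul data of the quotient by the first factor. -/
def dataR : KoszulData K p q (Fin p ⊕ Fin q) where
  deg := deg
  two_le := hdeg
  even := heven
  odd := hodd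
  degB := deg
  two_le_B := hdeg
  -- Every base generator occurs in the leading term here, which yields vanishing in all degrees but
  -- one.
  e := id
  inj := Function.injective_id
  deg_e _ := rfl
  dB := d
  D := DR hm hdeg
  D_inl := DR_inl hm hdeg
  A := coefA D
  A' := (exists_inverse hm hdeg heven hodd).choose
  A_deg _ _ h := coefA_deg h
  A'_deg := (exists_inverse hm hdeg heven hodd).choose_spec.1
  A_mul := (exists_inverse hm hdeg heven hodd).choose_spec.2.2
  A'_mul := (exists_inverse hm hdeg heven hodd).choose_spec.2.1
  Lam := bigDeg deg
  le_Lam := le_bigDeg hdeg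
  one_le_Lam := by have := two_le_bigDeg hdeg; omega
  dB_raise := d_raise hd hdeg heven hodd (two_le_bigDeg hdeg)
  D_raise v := by
    have h := D_bar_raise hm hdeg heven hodd (two_le_bigDeg hdeg) v
    have h2 := algHom_map_wge (φ := phiR) (w' := Sum.elim (omOf (bigDeg deg) deg) (omBar p q (bigDeg deg)))
      (by
        rintro ((v | v) | v)
        · rw [phiR_fst]; exact zero_mem _
        · rw [phiR_snd]; exact gen_mem_wge (Sum.elim (omOf (bigDeg deg) deg) (omBar p q (bigDeg deg))) (.inl v)
        · rw [phiR_bar]; exact gen_mem_wge (Sum.elim (omOf (bigDeg deg) deg) (omBar p q (bigDeg deg))) (.inr v)) h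
    simp only [map_sub, map_sum, map_smul, phiR_fst, phiR_snd, sub_zero] at h2
    rw [← DR_phiR hm hdeg, phiR_bar] at h2
    exact h2

/-! ### The Gorenstein property -/

include hdeg in
omit [CharZero K] in
lemma degR_pos (i) : 1 ≤ degR deg i := by
  rcases i with v | v <;> have := hdeg v
  · change 1 ≤ deg v; omega
  · change 1 ≤ deg v - 1; omega

omit [CharZero K] in
lemma isRelSullivan_DR : IsRelSullivan d (DR hm hdeg) := by
  obtain ⟨-, -, -, U, U1, U2, U3, U4, U5⟩ := hm.isModel.isRelSullivan
  refine ⟨fun v => degR_pos hdeg (.inl v), fun v => degR_pos hdeg (.inr v), DR_inl hm hdeg,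
    fun k => (U k).map phiR.toLinearMap, fun k => (U1 k).map phiR_mem, (congrArg _ U2).trans (Submodule.map_bot _),
    fun a b h => Submodule.map_mono (U3 h), ?_, ?_⟩
  · rw [← Submodule.map_iSup, U4, ← Submodule.map_comp]
    congr 1
    exact LinearMap.ext (algHom_ext (φ := phiR.comp (inr (deg2 deg) (barDeg deg))) (ψ := inr _ _) fun v => by
      rw [AlgHom.comp_apply, inr_gen, phiR_bar, inr_gen])
  · rintro k _ ⟨u, hu, rfl⟩
    rw [AlgHom.toLinearMap_apply, DR_phiR]
    refine adjoin_map_mem phiR ?_ (U5 k u hu)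
    rintro _ (⟨s, rfl⟩ | hs)
    · refine Algebra.subset_adjoin (Or.inl ?_)
      induction s using FreeCGA.induction with
      | h0 c => exact ⟨algebraMap K _ c, by rw [AlgHom.commutes, AlgHom.commutes, AlgHom.commutes]⟩
      | h1 i =>
        rw [inl_gen]
        rcases i with v | v
        · exact ⟨0, by rw [phiR_fst, map_zero]⟩
        · exact ⟨gen K deg v, by rw [phiR_snd, inl_gen]⟩
      | hm x y hx hy =>
        obtain ⟨a, ha⟩ := hx
        obtain ⟨b, hb⟩ := hy
        exact ⟨a * b, by rw [map_mul, map_mul, map_mul, ha, hb]⟩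
      | ha x y hx hy =>
        obtain ⟨a, ha⟩ := hx
        obtain ⟨b, hb⟩ := hy
        exact ⟨a + b, by rw [map_add, map_add, map_add, ha, hb]⟩
    · exact Algebra.subset_adjoin (Or.inr ⟨_, hs, rfl⟩)

include heven hodd in
-- All generators have positive degree, so the augmentation kills the image of the differential. A
-- cocycle without constant term is a boundary by the perturbed Koszul contraction.
lemma isModel_DR : IsRelSullivanModel d (DR hm hdeg) (fun l => if l = 0 then ⊤ else ⊥) 0 (aug K deg)
    (aug K (degR deg)) where
  isRelSullivan := isRelSullivan_DR hm hdeg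
  map_part n x hx := by
    split_ifs with h
    · trivial
    · exact aug_of_part h hx
  restrict := AlgHom.ext fun x => algHom_ext (φ := (aug K (degR deg)).comp (inl _ _)) (ψ := aug K deg)
    (fun v => by rw [AlgHom.comp_apply, inl_gen, aug, lift_gen, aug, lift_gen]) x
  quasiIso := by
    have h : ∀ x, aug K (degR deg) (DR hm hdeg x) = 0 :=
      eq_of_mon (f := (aug K (degR deg)).toLinearMap ∘ₗ (DR hm hdeg).toLin) (g := 0) fun l =>
        aug_of_part (by
          have := wt_nonneg (fun i => (degR_pos hdeg i).trans' zero_le_one) l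
          omega) ((DR hm hdeg).map_part _ _ (mon_mem_part l))
    refine ⟨h, ?_, ?_⟩
    · rw [injective_iff_map_eq_zero]
      intro x hx
      obtain ⟨⟨z, hz⟩, rfl⟩ := Submodule.Quotient.mk_surjective _ x
      obtain ⟨c, hc⟩ := (Submodule.Quotient.mk_eq_zero _).1 hx
      have hz0 : aug K (degR deg) z = 0 := hc.symm
      obtain ⟨w, hw⟩ := (dataR hm hdeg heven hodd).exists_primitive Function.surjective_id (z := z) hz (by
        have := sub_aug_mem z
        rwa [hz0, zero_smul, sub_zero] at this)
      exact (Submodule.Quotient.mk_eq_zero _).2 ⟨w, hw⟩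
    · intro x
      obtain ⟨⟨c, hc⟩, rfl⟩ := Submodule.Quotient.mk_surjective _ x
      refine ⟨Submodule.Quotient.mk ⟨c • 1, ?_⟩, ?_⟩
      · rw [LinearMap.mem_ker, map_smul, (DR hm hdeg).map_one, smul_zero]
      · refine congrArg Submodule.Quotient.mk (Subtype.ext ?_)
        change aug K (degR deg) (c • 1) = c
        rw [map_smul, map_one, smul_eq_mul, mul_one]

omit [CharZero K] in
lemma phiY_mon (l : List (Fin q)) : phiY (K := K) (mon K deg (l.map Sum.inr)) = mon K (degY deg) l := by
  induction l with
  | nil => simp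
  | cons a l ih => rw [List.map_cons, mon_cons, map_mul, ih, phiY_Y, mon_cons]

include hodd in
-- A product of more than q factors repeats one of the q odd generators.
lemma wge_degY_eq_zero {x : FreeCGA K (degY deg)} (hx : x ∈ wge K (degY deg) (fun _ => 1) (q + 1)) :
    x = 0 := by
  refine lspan_le (T := ⊥) (fun l hl => ?_) hx
  have hl : (q : ℤ) + 1 ≤ wt (fun _ => 1) l := hl
  by_contra hne
  have := wt_le_sum (c := fun _ => 1) (fun _ => zero_le_one) (fun j _ => hodd j) hne
  simp at this
  omega

omit [CharZero K] in
include hodd in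
lemma phiY_wge {Lam n : ℤ} {x : FreeCGA K deg} (hx : x ∈ wge K deg (omOf Lam deg) n) :
    phiY x ∈ wge K (degY deg) (fun _ => 1) n := by
  refine algHom_map_wge (fun v => ?_) hx
  rcases v with i | j
  · rw [phiY_X]; exact zero_mem _
  · rw [phiY_Y, omOf_odd (hodd j)]; exact gen_mem_wge _ j

omit [CharZero K] in
/-- The image of the ideal generated by some generators. -/
lemma algHom_map_lspan {ι κ : Type*} {deg : ι → ℤ} {deg' : κ → ℤ}
    {φ : FreeCGA K deg →ₐ[K] FreeCGA K deg'} {X : Set ι} {Y : Set κ}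
    (h : ∀ i ∈ X, φ (gen K deg i) ∈ lspan K deg' {l | ∃ i ∈ Y, i ∈ l}) {x : FreeCGA K deg}
    (hx : x ∈ lspan K deg {l | ∃ i ∈ X, i ∈ l}) : φ x ∈ lspan K deg' {l | ∃ i ∈ Y, i ∈ l} := by
  refine map_mem_of_lspan (f := φ.toLinearMap) ?_ hx
  rintro l ⟨i, hi, hl⟩
  obtain ⟨l1, l2, rfl⟩ := List.append_of_mem hl
  have ht : ∀ y : FreeCGA K deg', y ∈ lspan K deg' Set.univ := fun y => by rw [lspan_univ]; trivial
  rw [AlgHom.toLinearMap_apply, mon_append, mon_cons, map_mul, map_mul]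
  refine mul_mem_lspan (S := Set.univ) (fun a _ b hb => ?_) (ht _)
    (mul_mem_lspan (T := Set.univ) (U := {l | ∃ i ∈ Y, i ∈ l}) (fun a ha b _ => ?_) (h i hi) (ht _))
  · obtain ⟨j, hj, hb⟩ := hb
    exact ⟨j, hj, List.mem_append_right _ hb⟩
  · obtain ⟨j, hj, ha⟩ := ha
    exact ⟨j, hj, List.mem_append_left _ ha⟩

omit [CharZero K] in
lemma DR_bar_mem (i : Fin p) : DR hm hdeg (gen K _ (.inr (.inl i))) ∈ lspan K (degR deg)
    {l | (∃ b ∈ XV p q, .inl b ∈ l) ∨ ∃ k ≠ i, .inr (.inl k) ∈ l} := by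
  rw [← phiR_bar, DR_phiR]
  have h := algHom_map_lspan (φ := phiR) (Y := {a | (∃ b ∈ XV p q, a = .inl b) ∨
    ∃ k ≠ i, a = .inr (.inl k)}) (fun a ha => ?_) (mem_evenIdealBarExcept.1 (hm.map_bar i))
  · refine lspan_mono ?_ h
    rintro l ⟨a, ⟨b, hb, rfl⟩ | ⟨k, hk, rfl⟩, hl⟩
    · exact Or.inl ⟨b, hb, hl⟩
    · exact Or.inr ⟨k, hk, hl⟩
  · have hg : ∀ a, a ∈ {a | (∃ b ∈ XV p q, a = .inl b) ∨ ∃ k ≠ i, a = .inr (.inl k)} →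
        gen K (degR deg) a ∈ lspan K (degR deg) {l | ∃ a ∈ {a | (∃ b ∈ XV p q, a = .inl b) ∨
          ∃ k ≠ i, a = .inr (.inl k)}, a ∈ l} := fun a ha => by
      simpa using mon_mem_lspan (K := K) (deg := degR deg) (l := [a])
        (S := {l | ∃ a ∈ {a | (∃ b ∈ XV p q, a = .inl b) ∨ ∃ k ≠ i, a = .inr (.inl k)}, a ∈ l})
        ⟨a, ha, by simp⟩
    obtain ⟨h1, h2⟩ := ha
    rcases a with (v | v) | v
    · rw [phiR_fst]; exact zero_mem _
    · rw [phiR_snd]; exact hg _ (Or.inl ⟨v, h1, rfl⟩)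
    · rw [phiR_bar]
      obtain ⟨k, hk⟩ := h1
      obtain rfl : .inl k = v := hk
      exact hg _ (Or.inr ⟨k, fun e => h2 (by rw [e]; rfl), rfl⟩)

variable (deg) in
/-- The dimension of the Gorenstein algebra. -/
def dimG : ℤ := wt deg (ys p q) - wt (barDeg deg) (xs p q)

include hm hdeg heven hodd in
/-- The algebra `(∧V, d)` is Gorenstein. -/
theorem isGorenstein : IsGorenstein d (dimG deg) := by
  let S := dataR hm hdeg heven hodd
  refine ⟨Fin p ⊕ Fin q, barDeg deg, DR hm hdeg, _, isModel_DR hm hdeg heven hodd, fun l => ?_⟩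
  split_ifs with hl
  · subst hl
    obtain ⟨f, f1, f2, f3, f4⟩ := S.exists_cocycle
    refine (rank_ext_eq_one (f := ⟨f, f1, f2⟩) (fun h0 => ?_) fun F hF => S.exists_spanning f1 f2 f3 hF).1
    obtain ⟨g, hg, e⟩ := (extClass_eq_zero_iff _).1 h0
    have h1 := map_homD_barx hdeg heven hodd (dB := d) (D := DR hm hdeg) (π := phiY) phiY_mem
      (θ := (dY hd).toLin) (fun b => (dY_phiY hd b).symm) (X := XV p q) (by
        rintro _ ⟨i, rfl⟩; exact phiY_X i) (DR_bar_mem hm hdeg) (n := dimG deg) (by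
        unfold dimG; ring) hg
    -- Modulo the x_i the error has word length above q and vanishes. So f(x̄_1 ⋯ x̄_p) projects to
    -- ∏ y_j, whereas a coboundary projects to zero.
    obtain ⟨h2, -, -⟩ := S.barx_sub_mem f1 f3 f4
    have h3 : phiY (f S.barx - S.ty) = 0 := wge_degY_eq_zero hodd (phiY_wge hodd h2)
    have h4 : phiY (K := K) (deg := deg) S.ty = mon K (degY deg) (List.finRange q) := by
      have : S.ty = mon K deg ((List.finRange q).map Sum.inr) := by
        rw [← ys_eq]
        exact congrArg (mon K deg) (List.map_id _)
      rw [this, phiY_mon]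
    have h5 : phiY (f S.barx) = 0 := by
      rw [show f = homD d (DR hm hdeg) (dimG deg - 1) g from e.symm]; exact h1
    rw [map_sub, h5, zero_sub, neg_eq_zero] at h3
    exact mon_ne_zero (List.nodup_finRange q) (h4.symm.trans h3)
  · exact rank_ext_eq_zero fun F hF => S.coboundary_of_ne Function.surjective_id hl hF.1 hF.2

end NiceModel


open FreeCGA

/-! ### Transport of `Hom` complexes along automorphisms -/

section Conj

variable {K : Type*} [Field K] {κ κ' υ : Type*} {degB : κ → ℤ} {degB' : κ' → ℤ} {degU : υ → ℤ}
  (ψ : FreeCGA K degB' →ₐ[K] FreeCGA K degB)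
  (Φ : FreeCGA K (Sum.elim degB degU) →ₐ[K] FreeCGA K (Sum.elim degB' degU))

/-- The map `f ↦ ψ ∘ f ∘ Φ`. -/
def conj : (FreeCGA K (Sum.elim degB' degU) →ₗ[K] FreeCGA K degB') →ₗ[K]
    (FreeCGA K (Sum.elim degB degU) →ₗ[K] FreeCGA K degB) where
  toFun f := ψ.toLinearMap ∘ₗ f ∘ₗ Φ.toLinearMap
  map_add' f g := by ext; simp
  map_smul' c f := by ext; simp

lemma conj_apply (f : FreeCGA K (Sum.elim degB' degU) →ₗ[K] FreeCGA K degB') (x) :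
    conj ψ Φ f x = ψ (f (Φ x)) := rfl

variable {ψ Φ}

lemma conj_mem {φ : FreeCGA K degB →ₐ[K] FreeCGA K degB'} (hΦ : ∀ b, Φ (inl _ _ b) = inl _ _ (φ b))
    (hψφ : ∀ b, ψ (φ b) = b) (hφm : ∀ i, φ (gen K degB i) ∈ part K degB' (degB i))
    (hψm : ∀ i, ψ (gen K degB' i) ∈ part K degB (degB' i))
    (hΦm : ∀ i, Φ (gen K _ i) ∈ part K (Sum.elim degB' degU) (Sum.elim degB degU i)) {n : ℤ}
    {f : FreeCGA K (Sum.elim degB' degU) →ₗ[K] FreeCGA K degB'} (hf : f ∈ homDeg degB' degU n) :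
    conj ψ Φ f ∈ homDeg degB degU n := by
  refine ⟨fun k x hx => algHom_map_part hψm (hf.1 _ _ (algHom_map_part hΦm hx)), fun k b hb x => ?_⟩
  rw [conj_apply, map_mul, hΦ, hf.2 _ _ (algHom_map_part hφm hb), map_smul, map_mul, hψφ, conj_apply]

lemma homD_conj {dB : Differential K degB} {dB' : Differential K degB'}
    {D : Differential K (Sum.elim degB degU)} {D' : Differential K (Sum.elim degB' degU)}
    (hψd : ∀ y, ψ (dB' y) = dB (ψ y)) (hΦD : ∀ x, Φ (D x) = D' (Φ x)) (n : ℤ)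
    (f : FreeCGA K (Sum.elim degB' degU) →ₗ[K] FreeCGA K degB') :
    homD dB D n (conj ψ Φ f) = conj ψ Φ (homD dB' D' n f) := by
  refine LinearMap.ext fun x => ?_
  change dB (ψ (f (Φ x))) - sgn K n • ψ (f (Φ (D x))) = ψ (dB' (f (Φ x)) - sgn K n • f (D' (Φ x)))
  rw [map_sub, map_smul, hψd, hΦD]

end Conj

namespace NiceModel

variable {K : Type*} [Field K] {p q : ℕ} {deg : Fin p ⊕ Fin q → ℤ}
variable {d : Differential K deg} {hd : IsSemiPure d} {D : Differential K (deg3 deg)}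
  {m : FreeCGA K (deg3 deg) →ₐ[K] FreeCGA K deg}

open KoszulData

/-! ### The coordinates `1 ⊗ v - v ⊗ 1` -/

variable (K deg) in
/-- The automorphism `1 ⊗ v ↦ 1 ⊗ v + c (v ⊗ 1)` of `∧V ⊗ ∧V`. -/
def chi2 (c : K) : FreeCGA K (deg2 deg) →ₐ[K] FreeCGA K (deg2 deg) :=
  ofGens (Sum.elim (fun v => gen K _ (.inl v)) (fun v => gen K _ (.inr v) + c • gen K _ (.inl v))) (by
    rintro (v | v)
    · exact gen_mem_part (deg2 deg) (.inl v)
    · exact add_mem (gen_mem_part (deg2 deg) (.inr v)) (Submodule.smul_mem _ _ (gen_mem_part (deg2 deg) (.inl v))))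

lemma chi2_fst (c : K) (v) : chi2 K deg c (gen K _ (.inl v)) = gen K _ (.inl v) := ofGens_gen _ _ _
lemma chi2_snd (c : K) (v) : chi2 K deg c (gen K _ (.inr v)) = gen K _ (.inr v) + c • gen K _ (.inl v) :=
  ofGens_gen _ _ _

lemma chi2_mem (c : K) (i) : chi2 K deg c (gen K _ i) ∈ part K (deg2 deg) (deg2 deg i) := by
  rcases i with v | v
  · rw [chi2_fst]; exact gen_mem_part (deg2 deg) (.inl v)
  · rw [chi2_snd]
    exact add_mem (gen_mem_part (deg2 deg) (.inr v)) (Submodule.smul_mem _ _ (gen_mem_part (deg2 deg) (.inl v)))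

lemma chi2_chi2 {c c' : K} (h : c + c' = 0) (x) : chi2 K deg c (chi2 K deg c' x) = x :=
  algHom_ext (φ := (chi2 K deg c).comp (chi2 K deg c')) (ψ := AlgHom.id K _) (by
    rintro (v | v)
    · rw [AlgHom.comp_apply, chi2_fst, chi2_fst]; rfl
    · rw [AlgHom.comp_apply, chi2_snd, map_add, map_smul, chi2_snd, chi2_fst, add_assoc, ← add_smul, h,
        zero_smul, add_zero]; rfl) x

lemma chi2_wge (c : K) {w : (Fin p ⊕ Fin q) ⊕ (Fin p ⊕ Fin q) → ℤ} (hw : ∀ v, w (.inl v) = w (.inr v))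
    {n : ℤ} {x} (hx : x ∈ wge K (deg2 deg) w n) : chi2 K deg c x ∈ wge K (deg2 deg) w n := by
  refine algHom_map_wge (fun i => ?_) hx
  rcases i with v | v
  · rw [chi2_fst]; exact gen_mem_wge _ _
  · rw [chi2_snd]
    refine add_mem (gen_mem_wge _ _) (Submodule.smul_mem _ _ ?_)
    rw [← hw]; exact gen_mem_wge _ _

variable (K deg) in
/-- The automorphism `1 ⊗ v ↦ 1 ⊗ v + c (v ⊗ 1)` of the model. -/
def chi3 (c : K) : FreeCGA K (deg3 deg) →ₐ[K] FreeCGA K (deg3 deg) :=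
  ofGens (Sum.elim (fun i => inl _ _ (chi2 K deg c (gen K _ i))) (fun v => gen K _ (.inr v))) (by
    rintro (i | v)
    · exact inl_mem_part (chi2_mem c i)
    · exact gen_mem_part (deg3 deg) (.inr v))

lemma chi3_bar (c : K) (v) : chi3 K deg c (gen K _ (.inr v)) = gen K _ (.inr v) := ofGens_gen _ _ _

lemma chi3_inl (c : K) (x) : chi3 K deg c (inl _ _ x) = inl _ _ (chi2 K deg c x) :=
  algHom_ext (φ := (chi3 K deg c).comp (inl _ _)) (ψ := (inl _ _).comp (chi2 K deg c)) (fun i => by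
    rw [AlgHom.comp_apply, inl_gen, AlgHom.comp_apply]
    exact ofGens_gen _ _ _) x

lemma chi3_fst (c : K) (v) : chi3 K deg c (gen K _ (.inl (.inl v))) = gen K _ (.inl (.inl v)) := by
  rw [← inl_gen, chi3_inl, chi2_fst]

lemma chi3_snd (c : K) (v) : chi3 K deg c (gen K _ (.inl (.inr v))) =
    gen K _ (.inl (.inr v)) + c • gen K _ (.inl (.inl v)) := by
  rw [← inl_gen, chi3_inl, chi2_snd, map_add, map_smul, inl_gen, inl_gen]

lemma chi3_mem (c : K) (i) : chi3 K deg c (gen K _ i) ∈ part K (deg3 deg) (deg3 deg i) := by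
  rcases i with i | v
  · rw [← inl_gen, chi3_inl]; exact inl_mem_part (chi2_mem c i)
  · rw [chi3_bar]; exact gen_mem_part (deg3 deg) (.inr v)

lemma chi3_chi3 {c c' : K} (h : c + c' = 0) (x) : chi3 K deg c (chi3 K deg c' x) = x :=
  algHom_ext (φ := (chi3 K deg c).comp (chi3 K deg c')) (ψ := AlgHom.id K _) (by
    rintro (i | v)
    · rw [AlgHom.comp_apply, ← inl_gen, chi3_inl, chi3_inl, chi2_chi2 h]; rfl
    · rw [AlgHom.comp_apply, chi3_bar, chi3_bar]; rfl) x

lemma chi3_barx (c : K) (l : List (Fin p ⊕ Fin q)) :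
    chi3 K deg c (mon K (deg3 deg) (l.map Sum.inr)) = mon K (deg3 deg) (l.map Sum.inr) := by
  induction l with
  | nil => simp
  | cons a l ih => rw [List.map_cons, mon_cons, map_mul, ih, chi3_bar]

variable (d) in
/-- The differential of `∧V ⊗ ∧V` in the new coordinates. -/
def dT : Differential K (deg2 deg) :=
  (d.tensor d).quot (chi2 K deg 1) (chi2 K deg (-1)) (chi2_mem 1) (chi2_mem (-1))
    (fun _ => chi2_chi2 (by ring) _) (fun i => by rw [chi2_chi2 (by ring)])

lemma dT_chi2 (x) : dT d (chi2 K deg 1 x) = chi2 K deg 1 (d.tensor d x) :=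
  (d.tensor d).quot_comm _ _ _ _ x

variable (D) in
/-- The differential of the model in the new coordinates. -/
def DT : Differential K (deg3 deg) :=
  D.quot (chi3 K deg 1) (chi3 K deg (-1)) (chi3_mem 1) (chi3_mem (-1))
    (fun _ => chi3_chi3 (by ring) _) (fun i => by rw [chi3_chi3 (by ring)])

lemma DT_chi3 (x) : DT D (chi3 K deg 1 x) = chi3 K deg 1 (D x) := D.quot_comm _ _ _ _ x

lemma chi2_dT (y) : chi2 K deg (-1) (dT d y) = d.tensor d (chi2 K deg (-1) y) := by
  have h := dT_chi2 (d := d) (chi2 K deg (-1) y)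
  rw [chi2_chi2 (by ring)] at h
  rw [h, chi2_chi2 (by ring)]

lemma chi3_DT (y) : chi3 K deg (-1) (DT D y) = D (chi3 K deg (-1) y) := by
  have h := DT_chi3 (D := D) (chi3 K deg (-1) y)
  rw [chi3_chi3 (by ring)] at h
  rw [h, chi3_chi3 (by ring)]

lemma omOf_deg2 (Lam : ℤ) (v) : omOf Lam (deg2 deg) (.inl v) = omOf Lam (deg2 deg) (.inr v) := rfl

variable [CharZero K] (hm : IsNice hd D m) (hdeg : ∀ v, 2 ≤ deg v) (heven : ∀ i, Even (deg (.inl i)))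
  (hodd : ∀ j, Odd (deg (.inr j)))

/-- The Koszul data of the model in the new coordinates. -/
def dataB : KoszulData K p q ((Fin p ⊕ Fin q) ⊕ (Fin p ⊕ Fin q)) where
  deg := deg
  two_le := hdeg
  even := heven
  odd := hodd
  degB := deg2 deg
  two_le_B := by rintro (v | v) <;> exact hdeg v
  -- In the new coordinates 1 ⊗ v stands for the former 1 ⊗ v - v ⊗ 1. The v ⊗ 1 stay outside the
  -- leading terms.
  e := Sum.inr
  inj := Sum.inr_injective
  deg_e _ := rfl
  dB := dT d
  D := DT D
  D_inl b := by
    have h := DT_chi3 (D := D) (inl _ _ (chi2 K deg (-1) b))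
    rw [chi3_inl, chi2_chi2 (by ring), D_inl hm, chi3_inl, ← dT_chi2, chi2_chi2 (by ring)] at h
    exact h
  A := coefA D
  A' := (exists_inverse hm hdeg heven hodd).choose
  A_deg _ _ h := coefA_deg h
  A'_deg := (exists_inverse hm hdeg heven hodd).choose_spec.1
  A_mul := (exists_inverse hm hdeg heven hodd).choose_spec.2.2
  A'_mul := (exists_inverse hm hdeg heven hodd).choose_spec.2.1
  Lam := bigDeg deg
  le_Lam := by rintro (v | v) <;> exact le_bigDeg hdeg v
  one_le_Lam := by have := two_le_bigDeg hdeg; omega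
  dB_raise b := by
    have h := dT_chi2 (d := d) (chi2 K deg (-1) (gen K _ b))
    rw [chi2_chi2 (by ring)] at h
    have h1 := chi2_wge 1 (omOf_deg2 (bigDeg deg)) ((d.tensor d).isDer.map_wge
      (tensor_raise hd hdeg heven hodd (two_le_bigDeg hdeg))
      (chi2_wge (-1) (omOf_deg2 (bigDeg deg)) (gen_mem_wge (K := K) (omOf (bigDeg deg) (deg2 deg)) b)))
    rw [h]
    exact h1
  D_raise v := by
    have h := D_bar_raise hm hdeg heven hodd (two_le_bigDeg hdeg) v
    have h2 := algHom_map_wge (φ := chi3 K deg 1)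
      (w' := Sum.elim (omOf (bigDeg deg) (deg2 deg)) (omBar p q (bigDeg deg)))
      (by
        set w := Sum.elim (omOf (bigDeg deg) (deg2 deg)) (omBar p q (bigDeg deg))
        rintro ((v | v) | v)
        · rw [chi3_fst]; exact gen_mem_wge w (.inl (.inl v))
        · rw [chi3_snd]
          exact add_mem (gen_mem_wge w (.inl (.inr v))) (Submodule.smul_mem _ _ (gen_mem_wge w (.inl (.inl v))))
        · rw [chi3_bar]; exact gen_mem_wge w (.inr v)) h
    simp only [map_sub, map_sum, map_smul, chi3_fst, chi3_snd, one_smul, add_sub_cancel_right] at h2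
    rw [← DT_chi3, chi3_bar] at h2
    exact h2

/-! ### Detecting the class -/

variable (K deg) in
/-- The projection `∧V ⊗ ∧V → ∧V` that kills the second factor. -/
def eps1 : FreeCGA K (deg2 deg) →ₐ[K] FreeCGA K deg :=
  ofGens (Sum.elim (gen K deg) (fun _ => 0)) (by
    rintro (v | v)
    · exact gen_mem_part deg v
    · exact zero_mem _)

omit [CharZero K] in
lemma eps1_fst (v) : eps1 K deg (gen K _ (.inl v)) = gen K deg v := ofGens_gen _ _ _
omit [CharZero K] in
lemma eps1_snd (v) : eps1 K deg (gen K _ (.inr v)) = 0 := ofGens_gen _ _ _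

omit [CharZero K] in
lemma eps1_mem (i) : eps1 K deg (gen K _ i) ∈ part K deg (deg2 deg i) := by
  rcases i with v | v
  · rw [eps1_fst]; exact gen_mem_part deg v
  · rw [eps1_snd]; exact zero_mem _

omit [CharZero K] in
include hdeg in
lemma eps1_tensor (x) : eps1 K deg (d.tensor d x) = d (eps1 K deg x) := by
  refine algHom_comm eps1_mem (fun i => ?_) x
  rcases i with v | v
  · rw [← inl_gen, show d.tensor d (inl deg deg (gen K deg v)) = _ from tensor_inl d d _]
    have h : ∀ x : FreeCGA K deg, eps1 K deg (inl _ _ x) = x :=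
      algHom_ext (φ := (eps1 K deg).comp (inl _ _)) (ψ := AlgHom.id K _) fun v => by
        rw [AlgHom.comp_apply, inl_gen, eps1_fst]; rfl
    rw [h, h]
  · rw [← inr_gen, show d.tensor d (inr deg deg (gen K deg v)) = _ from tensor_inr d d _]
    have h : ∀ x : FreeCGA K deg, eps1 K deg (inr _ _ x) = algebraMap K _ (aug K deg x) :=
      algHom_ext (φ := (eps1 K deg).comp (inr _ _)) (ψ := (Algebra.ofId K _).comp (aug K deg)) fun v => by
        rw [AlgHom.comp_apply, inr_gen, eps1_snd, AlgHom.comp_apply, aug, lift_gen, map_zero]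
    rw [h, aug_of_part (by have := hdeg v; omega) (d.map_part _ _ (gen_mem_part _ v)), map_zero, inr_gen,
      eps1_snd, map_zero]

variable (K deg) in
/-- The projection `∧V ⊗ ∧V → ∧V / I_V` that kills the second factor. -/
def pi1 : FreeCGA K (deg2 deg) →ₐ[K] FreeCGA K (degY deg) := phiY.comp (eps1 K deg)

omit [CharZero K] in
lemma pi1_mem (i) : pi1 K deg (gen K _ i) ∈ part K (degY deg) (deg2 deg i) :=
  algHom_map_part phiY_mem (eps1_mem i)

omit [CharZero K] in
lemma pi1_diagIdeal {u} (hu : u ∈ diagIdeal K deg) : pi1 K deg u = 0 := by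
  have : diagIdeal K deg ≤ RingHom.ker (pi1 K deg : FreeCGA K (deg2 deg) →+* FreeCGA K (degY deg)) := by
    refine Ideal.span_le.2 ?_
    rintro _ ⟨j, rfl⟩
    change pi1 K deg _ = 0
    rw [map_mul, pi1, AlgHom.comp_apply, AlgHom.comp_apply, eps1_snd, map_zero, mul_zero]
  exact this hu

omit [CharZero K] in
lemma prod_neg_gen (l : List (Fin q)) : (l.map fun j => -gen K (degY deg) j).prod =
    (-1 : K) ^ l.length • mon K (degY deg) l := by
  induction l with
  | nil => simp
  | cons a l ih =>
    rw [List.map_cons, List.prod_cons, ih, mon_cons, List.length_cons, pow_succ, mul_smul_comm,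
      mul_neg_one, neg_smul, neg_mul, smul_neg]

omit [CharZero K] in
lemma ofFn_bar : (List.ofFn fun i : Fin p => bar K deg (.inl i)).prod =
    mon K (deg3 deg) ((xs p q).map Sum.inr) := by
  rw [mon, xs, List.map_ofFn, List.map_ofFn]; rfl

omit [CharZero K] in
/-- The value of a map satisfying the condition is detected by the projection. -/
lemma pi1_ne_zero {f : FreeCGA K (deg3 deg) →ₗ[K] FreeCGA K (deg2 deg)} (hf : HasGoodValue f) :
    pi1 K deg (f (mon K (deg3 deg) ((xs p q).map Sum.inr))) ≠ 0 ∧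
      pi1 K deg (f (mon K (deg3 deg) ((xs p q).map Sum.inr))) ∈ part K (degY deg) (wt deg (ys p q)) := by
  obtain ⟨s, hs, u, hu, e⟩ := hf
  rw [ofFn_bar] at e
  have h : pi1 K deg (List.ofFn fun j : Fin q =>
        gen K (deg2 deg) (.inr (.inr j)) - gen K (deg2 deg) (.inl (.inr j))).prod =
      (-1 : K) ^ q • mon K (degY deg) (List.finRange q) := by
    have h1 : ∀ j : Fin q, pi1 K deg (gen K (deg2 deg) (.inr (.inr j)) - gen K (deg2 deg) (.inl (.inr j))) =
        -gen K (degY deg) j := fun j => by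
      rw [map_sub, pi1, AlgHom.comp_apply, AlgHom.comp_apply, eps1_snd, eps1_fst, map_zero, phiY_Y, zero_sub]
    have h2 := prod_neg_gen (K := K) (deg := deg) (List.finRange q)
    rw [List.length_finRange] at h2
    rw [← h2, map_list_prod, List.ofFn_eq_map, List.map_map]
    congr 1
    exact List.map_congr_left fun j _ => h1 j
  rw [e, map_add, pi1_diagIdeal hu, add_zero, map_smul, h, smul_smul]
  have hs0 : s * (-1) ^ q ≠ 0 := by
    refine mul_ne_zero ?_ (pow_ne_zero _ (by norm_num))
    rcases hs with rfl | rfl <;> norm_num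
  refine ⟨smul_ne_zero hs0 (mon_ne_zero (List.nodup_finRange q)), Submodule.smul_mem _ _ ?_⟩
  rw [← wt_degY]; exact mon_mem_part _

omit [CharZero K] in
/-- The condition determines the degree. -/
lemma degree_eq {n : ℤ} {f : FreeCGA K (deg3 deg) →ₗ[K] FreeCGA K (deg2 deg)}
    (hn : f ∈ homDeg (deg2 deg) (barDeg deg) n) (hf : HasGoodValue f) : n = dimG deg := by
  obtain ⟨h1, h2⟩ := pi1_ne_zero hf
  have h3 := algHom_map_part pi1_mem (hn.1 _ _ (mon_mem_part ((xs p q).map Sum.inr)))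
  rw [part_eq_wpart] at h2 h3
  by_contra hne
  refine h1 (eq_zero_of_mem_wpart h2 h3 fun e => hne ?_)
  have e1 : wt (Sum.elim (deg2 deg) (barDeg deg)) ((xs p q).map Sum.inr) = wt (barDeg deg) (xs p q) := by
    rw [wt_map]; rfl
  rw [e1] at e
  unfold dimG
  omega

omit [CharZero K] in
include hm in
lemma D_bar_mem (i : Fin p) : D (gen K _ (.inr (.inl i))) ∈ lspan K (deg3 deg)
    {l | (∃ b ∈ {b : (Fin p ⊕ Fin q) ⊕ (Fin p ⊕ Fin q) | Sum.elim id id b ∈ XV p q}, .inl b ∈ l) ∨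
      ∃ k ≠ i, .inr (.inl k) ∈ l} := by
  refine lspan_mono ?_ (mem_evenIdealBarExcept.1 (hm.map_bar i))
  rintro l ⟨a, ⟨h1, h2⟩, hl⟩
  rcases a with b | v
  · exact Or.inl ⟨b, h1, hl⟩
  · obtain ⟨k, hk⟩ := h1
    obtain rfl : .inl k = v := hk
    exact Or.inr ⟨k, fun e => h2 (by rw [e]; rfl), hl⟩

include hm hdeg heven hodd in
/-- The class of a cocycle satisfying the condition is not zero. -/
theorem extClass_ne_zero {n : ℤ} {f : cocycles (d.tensor d) D n} (hf : HasGoodValue f.1) :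
    extClass (d.tensor d) D n f ≠ 0 := by
  obtain rfl := degree_eq f.2.1 hf
  intro h0
  obtain ⟨g, hg, e⟩ := (extClass_eq_zero_iff _).1 h0
  refine (pi1_ne_zero hf).1 ?_
  rw [← e]
  refine map_homD_barx hdeg heven hodd (π := pi1 K deg) pi1_mem (θ := (dY hd).toLin) (fun b => ?_)
    (X := {b | Sum.elim id id b ∈ XV p q}) ?_ (D_bar_mem hm) (by unfold dimG; ring) hg
  · rw [pi1, AlgHom.comp_apply, AlgHom.comp_apply, eps1_tensor hdeg]
    exact (dY_phiY hd _).symm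
  · rintro (v | v) ⟨i, hi⟩ <;> obtain rfl : .inl i = v := hi
    · rw [pi1, AlgHom.comp_apply, eps1_fst, phiY_X]
    · rw [pi1, AlgHom.comp_apply, eps1_snd, map_zero]

/-! ### The value on `x̄₁ ⋯ x̄ₚ` -/

include hdeg heven hodd in
-- Take a nonzero monomial without any product y_j ⊗ y_j. Each j contributes at most one odd factor,
-- and `h2`, whose weight counts odd factors, asks for at least q of them, hence exactly one for
-- each j. These exhaust the degree in `h3`, so there are no even factors and the weight is q,
-- against `h1`.
lemma mem_diagIdeal {Lam : ℤ} {x : FreeCGA K (deg2 deg)}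
    (h1 : x ∈ wge K (deg2 deg) (omOf Lam (deg2 deg)) (q + 1))
    (h2 : x ∈ wge K (deg2 deg) (omOf 0 (deg2 deg)) q) (h3 : x ∈ part K (deg2 deg) (wt deg (ys p q))) :
    x ∈ diagIdeal K deg := by
  let _ : BEq ((Fin p ⊕ Fin q) ⊕ (Fin p ⊕ Fin q)) := instBEqOfDecidableEq
  have h4 := mem_lspan_part (mem_lspan_inter (w := omOf 0 (deg2 deg)) (Q := fun k => q ≤ k) h1 h2) h3
  refine lspan_le (T := (diagIdeal K deg).restrictScalars K) (fun l hl => ?_) h4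
  have e1 : (q : ℤ) + 1 ≤ wt (omOf Lam (deg2 deg)) l := hl.1.1
  have e2 : (q : ℤ) ≤ wt (omOf 0 (deg2 deg)) l := hl.1.2
  have e3 : wt (deg2 deg) l = wt deg (ys p q) := hl.2
  by_cases hne : mon K (deg2 deg) l = 0
  · rw [hne]; exact zero_mem _
  by_cases hj : ∃ j : Fin q, .inl (.inr j) ∈ l ∧ .inr (.inr j) ∈ l
  · obtain ⟨j, ha, hb⟩ := hj
    have hb' : (.inr (.inr j) : (Fin p ⊕ Fin q) ⊕ (Fin p ⊕ Fin q)) ∈ l.erase (.inl (.inr j)) :=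
      (List.mem_erase_of_ne (by simp)).2 hb
    have hp := (List.perm_cons_erase ha).trans ((List.perm_cons_erase hb').cons _)
    obtain ⟨s, -, e⟩ := mon_perm (K := K) (deg := deg2 deg) (hp.trans (List.perm_append_comm
      (l₁ := [Sum.inl (Sum.inr j), Sum.inr (Sum.inr j)])))
    rw [e, mon_append]
    refine Submodule.smul_mem _ _ (Ideal.mul_mem_left _ _ (Ideal.subset_span ⟨j, ?_⟩))
    rw [mon_cons, mon_cons, mon_nil, mul_one]
  exfalso
  push Not at hj
  set c : (Fin p ⊕ Fin q) ⊕ (Fin p ⊕ Fin q) → ℤ := fun b => (l.count b : ℤ) with hc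
  have hc0 : ∀ b, 0 ≤ c b := fun b => Int.natCast_nonneg _
  have hc1 : ∀ j : Fin q, c (.inl (.inr j)) + c (.inr (.inr j)) ≤ 1 := fun j => by
    have h5 : c (.inl (.inr j)) ≤ 1 := 
      Int.ofNat_le.2 (count_le_one (deg := deg2 deg) (i := .inl (.inr j)) (hodd j) hne)
    have h6 : c (.inr (.inr j)) ≤ 1 := 
      Int.ofNat_le.2 (count_le_one (deg := deg2 deg) (i := .inr (.inr j)) (hodd j) hne)
    by_cases h7 : .inl (.inr j) ∈ l
    · have : c (.inr (.inr j)) = 0 := by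
        simpa [hc] using List.count_eq_zero_of_not_mem (hj j h7)
      omega
    · have : c (.inl (.inr j)) = 0 := by
        simpa [hc] using List.count_eq_zero_of_not_mem h7
      omega
  have hexp : ∀ w : (Fin p ⊕ Fin q) → ℤ, wt (Sum.elim w w) l =
      ∑ i, w (.inl i) * (c (.inl (.inl i)) + c (.inr (.inl i))) +
        ∑ j, w (.inr j) * (c (.inl (.inr j)) + c (.inr (.inr j))) := fun w => by
    rw [wt_eq_sum_count]
    simp only [Fintype.sum_sum_type, Sum.elim_inl, Sum.elim_inr, mul_add, Finset.sum_add_distrib, hc]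
    ring
  have hom : ∀ Lam, omOf Lam (deg2 deg) = Sum.elim (Sum.elim (fun _ => Lam) (fun _ => 1))
      (Sum.elim (fun _ => Lam) (fun _ => 1)) := fun Lam => by
    funext b
    rcases b with (i | j) | (i | j)
    · exact omOf_even (heven i)
    · exact omOf_odd (hodd j)
    · exact omOf_even (heven i)
    · exact omOf_odd (hodd j)
  rw [hom, hexp] at e1 e2
  rw [hexp deg] at e3
  simp only [Sum.elim_inl, Sum.elim_inr, zero_mul, Finset.sum_const_zero, zero_add, one_mul] at e1 e2
  have e4 : ∑ j, (c (.inl (.inr j)) + c (.inr (.inr j))) = Fintype.card (Fin q) := by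
    have := Finset.sum_le_sum fun j (_ : j ∈ Finset.univ) => hc1 j
    simp only [Finset.sum_const, Finset.card_univ, Fintype.card_fin, nsmul_eq_mul, mul_one] at this
    rw [Fintype.card_fin]
    omega
  have e5 := sum_eq_card hc1 e4
  have e6 : wt deg (ys p q) = ∑ j : Fin q, deg (.inr j) := by
    simp [wt, ys, List.map_ofFn, List.sum_ofFn]
  simp only [e5, mul_one, e6, add_eq_right] at e3
  have e7 : ∀ i : Fin p, c (.inl (.inl i)) + c (.inr (.inl i)) = 0 := fun i => by
    have h8 := (Finset.sum_eq_zero_iff_of_nonneg (fun i _ => mul_nonneg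
      (by have := hdeg (.inl i); omega) (add_nonneg (hc0 _) (hc0 _)))).1 e3 i (Finset.mem_univ i)
    exact (mul_eq_zero.1 h8).resolve_left (by have := hdeg (.inl i); omega)
  rw [e4, Fintype.card_fin] at e1
  simp only [e7, mul_zero, Finset.sum_const_zero] at e1
  omega

include hm hdeg heven hodd in
/-- There is a cocycle satisfying the condition whose class spans. -/
theorem exists_cocycle_goodValue : ∃ f : cocycles (d.tensor d) D (dimG deg), HasGoodValue f.1 ∧
    ∀ F ∈ cocycles (d.tensor d) D (dimG deg), ∃ c : K, F - c • f.1 ∈ coboundaries (d.tensor d) D (dimG deg) := by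
  let S := dataB hm hdeg heven hodd
  obtain ⟨f, f1, f2, f3, f4⟩ := S.exists_cocycle
  -- Conjugation by the coordinate change is an isomorphism between the two Hom complexes. It fixes
  -- x̄_1 ⋯ x̄_p and turns the product of the new generators 1 ⊗ y_j into ∏ (1 ⊗ y_j - y_j ⊗ 1).
  have hmem : ∀ {n : ℤ} {g : S.P →ₗ[K] S.B}, g ∈ S.hom n →
      conj (chi2 K deg (-1)) (chi3 K deg 1) g ∈ homDeg (deg2 deg) (barDeg deg) n :=
    conj_mem (φ := chi2 K deg 1) (chi3_inl 1) (chi2_chi2 (by ring)) (chi2_mem 1) (chi2_mem (-1)) (chi3_mem 1)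
  have hmem' : ∀ {n : ℤ} {g : FreeCGA K (deg3 deg) →ₗ[K] FreeCGA K (deg2 deg)},
      g ∈ homDeg (deg2 deg) (barDeg deg) n → conj (chi2 K deg 1) (chi3 K deg (-1)) g ∈ S.hom n :=
    conj_mem (φ := chi2 K deg (-1)) (chi3_inl (-1)) (chi2_chi2 (by ring)) (chi2_mem (-1)) (chi2_mem 1)
      (chi3_mem (-1))
  have hD : ∀ (n : ℤ) (g : S.P →ₗ[K] S.B), homD (d.tensor d) D n (conj (chi2 K deg (-1)) (chi3 K deg 1) g) =
      conj (chi2 K deg (-1)) (chi3 K deg 1) (S.hD n g) :=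
    homD_conj chi2_dT (fun x => (DT_chi3 x).symm)
  have hD' : ∀ (n : ℤ) (g : FreeCGA K (deg3 deg) →ₗ[K] FreeCGA K (deg2 deg)),
      S.hD n (conj (chi2 K deg 1) (chi3 K deg (-1)) g) =
      conj (chi2 K deg 1) (chi3 K deg (-1)) (homD (d.tensor d) D n g) :=
    homD_conj (fun y => (dT_chi2 y).symm) chi3_DT
  refine ⟨⟨conj (chi2 K deg (-1)) (chi3 K deg 1) f, hmem f1, ?_⟩, ?_, fun F hF => ?_⟩
  · have := hD S.N f
    rw [f2] at this
    exact this.trans (map_zero _)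
  · obtain ⟨u1, u2, u3⟩ := S.barx_sub_mem f1 f3 f4
    refine ⟨1, Or.inl rfl, chi2 K deg (-1) (f S.barx - S.ty), ?_, ?_⟩
    -- Both weights and the degree agree on v ⊗ 1 and 1 ⊗ v, so the three bounds on the error
    -- survive the return to the old coordinates.
    · exact mem_diagIdeal hdeg heven hodd (chi2_wge (-1) (omOf_deg2 (bigDeg deg)) u1)
        (chi2_wge (-1) (omOf_deg2 0) u2) (algHom_map_part (chi2_mem (-1)) u3)
    · have e1 : chi2 K deg (-1) S.ty = (List.ofFn fun j : Fin q =>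
          gen K (deg2 deg) (.inr (.inr j)) - gen K (deg2 deg) (.inl (.inr j))).prod := by
        change chi2 K deg (-1) (mon K (deg2 deg) ((ys p q).map Sum.inr)) = _
        rw [mon, map_list_prod, ys, List.map_ofFn, List.map_ofFn, List.map_ofFn]
        congr 2
        funext j
        change chi2 K deg (-1) (gen K _ (.inr (.inr j))) = _
        rw [chi2_snd, neg_one_smul, sub_eq_add_neg]
      rw [ofFn_bar, one_smul, ← e1]
      refine (congrArg (fun z => chi2 K deg (-1) (f z)) (chi3_barx 1 _)).trans ?_
      exact (congrArg _ (add_sub_cancel S.ty (f S.barx)).symm).trans (map_add _ _ _)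
  · obtain ⟨c, G, hG, e⟩ := S.exists_spanning f1 f2 f3
      (F := conj (chi2 K deg 1) (chi3 K deg (-1)) F) ⟨hmem' hF.1, by
        refine (hD' _ F).trans ?_
        rw [show homD (d.tensor d) D S.N F = 0 from hF.2]
        exact map_zero _⟩
    refine ⟨c, conj (chi2 K deg (-1)) (chi3 K deg 1) G, hmem hG, ?_⟩
    refine (hD _ G).trans ((congrArg _ e).trans ?_)
    refine (map_sub _ _ _).trans (congrArg₂ _ (LinearMap.ext fun x => ?_) (map_smul _ c f))
    rw [conj_apply, conj_apply, chi2_chi2 (by ring), chi3_chi3 (by ring)]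

end NiceModel

end ShriekMap

end

/-! ### Conclusion: existence, non-vanishing and generation. -/

theorem mainTheorem3 {K : Type*} [Field K] [CharZero K] {p q : ℕ}
    (deg : Fin p ⊕ Fin q → ℤ)
    (hdeg : ∀ v, 2 ≤ deg v)
    (heven : ∀ i : Fin p, Even (deg (Sum.inl i)))
    (hodd : ∀ j : Fin q, Odd (deg (Sum.inr j)))
    (d : ShriekMap.FreeCGA.Differential K deg)
    (hd : ShriekMap.IsSemiPure d)
    (D : ShriekMap.FreeCGA.Differential K (ShriekMap.deg3 deg))
    (m : ShriekMap.FreeCGA K (ShriekMap.deg3 deg) →ₐ[K] ShriekMap.FreeCGA K deg)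
    (hm : ShriekMap.IsNice hd D m) :
    (∃ (n : ℤ) (f : ShriekMap.cocycles (d.tensor d) D n), ShriekMap.HasGoodValue f.1) ∧
    ∀ (n : ℤ) (f : ShriekMap.cocycles (d.tensor d) D n), ShriekMap.HasGoodValue f.1 →
      ShriekMap.extClass (d.tensor d) D n f ≠ 0 ∧ ShriekMap.RepresentsShriek d D n f := by
  obtain ⟨f₀, h₀, hs₀⟩ := ShriekMap.NiceModel.exists_cocycle_goodValue hm hdeg heven hodd
  refine ⟨⟨_, f₀, h₀⟩, fun n f hf => ?_⟩
  -- The value on x̄_1 ⋯ x̄_p has a nonzero projection of degree ∑|y_j|, so (∗) leaves only one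
  -- possible degree.
  obtain rfl := ShriekMap.NiceModel.degree_eq f.2.1 hf
  have hne := ShriekMap.NiceModel.extClass_ne_zero hm hdeg heven hodd hf
  have hs := ShriekMap.spanning_of_ne_zero hne hs₀
  exact ⟨hne, ShriekMap.NiceModel.isGorenstein hm hdeg heven hodd, ShriekMap.rank_ext_eq_one hne hs⟩
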